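/- **Theorem 2.6 (Rates of convergence).** *The process.* Let $V_I(h)$ denote the total variation of a function $h$ on an interval $I$. For some $\kappa>0$ let $\ell(j)=1$ for $|j|\le 1$ and $\ell(j)=|j|\log^{1+\kappa}|j|$ for $|j|>1$. Let $X_{t,n}$, $1\le t\le n$, be a Gaussian locally stationary process. That is, for each $n$ the vector $(X_{1,n},\dots,X_{n,n})$ is Gaussian and $X_{t,n}=\sum_{j\in\mathbb Z}a_{t,n}(j)\varepsilon_{t-j}$ (a.s. convergence), where the $\varepsilon_t$ are identically distributed with $E\varepsilon_t=0$, $E\varepsilon_s\varepsilon_t=0$ for $s\ne t$ and $E\varepsilon_t^2=1$. Moreover, there are a constant $K$ and functions $a(\cdot,j):(0,1]\to\mathbb R$ such that for all $n,t,j$ $$|a_{t,n}(j)|\le \tfrac{K}{\ell(j)},\quad \sup_u|a(u,j)|\le \tfrac{K}{\ell(j)},\quad \sum_{t=1}^n\bigl|a_{t,n}(j)-a(\tfrac tn,j)\bigr|\le K,\quad V_{(0,1]}(a(\cdot,j))\le \tfrac{K}{\ell(j)}.$$ Let $f(u,\lambda)=\frac1{2\pi}\bigl|\sum_j a(u,j)e^{-i\lambda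 j}\bigr|^2$ be its time-varying spectral density. *Contrasts.* For measurable $g:[0,1]\times[-\pi,\pi]\to(0,\infty)$ let $$\mathcal L(g)=\frac1{4\pi}\int_0^1\!\int_{-\pi}^{\pi}\Bigl\{\log g+\frac fg\Bigr\}d\lambda\,du,\qquad \mathcal L_n(g)=\frac1n\sum_{t=1}^n\frac1{4\pi}\int_{-\pi}^{\pi}\Bigl\{\log g(\tfrac tn,\lambda)+\frac{J_n(\frac tn,\lambda)}{g(\frac tn,\lambda)}\Bigr\}d\lambda,$$ where $J_n(\frac tn,\lambda)=\frac1{2\pi}\sum_k X_{[t+1/2+k/2],n}X_{[t+1/2-k/2],n}e^{-i\lambda k}$, the sum being over all $k\in\mathbb Z$ with $1\le[t+\frac12\pm\frac k2]\le n$; $\mathcal L(g)=+\infty$ if the integral does not converge. *Norms and entropy.* Let $\rho_2(\phi,\psi)$ be the $L_2$-distance on $[0,1]\times[-\pi,\pi]$ with respect to Lebesgue measure. Let $\hat\phi(u,j)=\int_{-\pi}^{\pi}\phi(u,\lambda)e^{i\lambda j}d\lambda$, $\rho_\infty(\phi)=\sum_j\sup_{u}|\hat\phi(u,j)|$, $\tilde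 v(\phi)=\sup_jV_{[0,1]}(\hat\phi(\cdot,j))$ and $v_\Sigma(\phi)=\sum_jV_{[0,1]}(\hat\phi(\cdot,j))$. Let $N(\eta,\Phi,\rho_2)$ be the smallest number of open $\rho_2$-balls of radius $\eta$ with centres in $\Phi$ that cover $\Phi$ ($\infty$ if there is no finite cover). *Model classes.* Let $\mathcal F_n$ ($n\ge1$) and $\mathcal F$ be classes of measurable functions $g:[0,1]\times[-\pi,\pi]\to(0,\infty)$, and put $\mathcal F_n^*=\{1/g:g\in\mathcal F_n\}$, $\mathcal F^*=\{1/g:g\in\mathcal F\}$. Assume: (a) $\hat f_n\in\mathcal F_n$ almost surely minimises $\mathcal L_n$ over $\mathcal F_n$, and $f_{\mathcal F}\in\mathcal F$ minimises $\mathcal L$ over $\mathcal F$ and is the unique such minimiser up to null sets; (b) for every $\phi\in\mathcal F^*$ there are $\pi_n\in\mathcal F_n^*$ with $\rho_2(\phi,\pi_n)\to0$; (c) there are constants $0<M_*\le1\le M^*<\infty$ and $\rho_\infty,\tilde v,v_\Sigma<\infty$, all of which may depend on $n$, such that $M_*\le|\phi(u,\lambda)|<M^*$ for all $u,\lambda$,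 $\rho_\infty(\phi)\le\rho_\infty$, $\tilde v(\phi)\le\tilde v$ and $v_\Sigma(\phi)\le v_\Sigma$ for all $\phi\in\mathcal F_n^*$. "$f\in\mathcal F$" means that $f$ agrees almost everywhere with an element of $\mathcal F$. $Y_n=O_P(\delta_n)$ means that for every $\varepsilon>0$ there is $C<\infty$ with $P(Y_n>C\delta_n)\le\varepsilon$ for all sufficiently large $n$. **Part I (sieve estimation).** Suppose that there are constants $A>0$ (not depending on $n$) and $k_n\ge1$ with $\log N(\eta,\mathcal F_n^*,\rho_2)\le A\,k_n\log(n/\eta)$ for all $n\ge 1$ and $0<\eta\le1$. Let $c_n=\max\{\rho_\infty,v_\Sigma,(M^*)^2\}$. If $f\in\mathcal F$ then, with $a_n=\inf_{g\in\mathcal F_n}\rho_2\bigl(\frac1{f_{\mathcal F}},\frac1g\bigr)$, $$\rho_2\Bigl(\frac1{\hat f_n},\frac1{f_{\mathcal F}}\Bigr)=O_P(\delta_n),\qquad \delta_n=\frac{M^*}{M_*}\max\Bigl(\sqrt{\frac{c_nk_n\log n}{n}},\,a_n\Bigr).$$ Whether or not $f\in\mathcal F$, the same result holds with $a_n$ replaced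 by $b_n=\rho_2\bigl(\frac1{f_{\mathcal F}},\frac1{f_{\mathcal F_n}}\bigr)$, provided that all $\mathcal F_n^*$ are convex, where $f_{\mathcal F_n}\in\mathcal F_n$ is a minimiser of $\mathcal L$ over $\mathcal F_n$ (assumed to exist). **Part II (global estimation).** Let $\mathcal F_n=\mathcal F$ for all $n$. Assume that $f\in\mathcal F$ or that $\mathcal F^*$ is convex. Assume further that there are $0<\gamma<2$ and $0<A<\infty$ with $\log N(\eta,\mathcal F^*,\rho_2)\le A\eta^{-\gamma}$ for all $\eta>0$. Then $$\rho_2\Bigl(\frac1{\hat f_n},\frac1{f_{\mathcal F}}\Bigr)=O_P(\delta_n),\qquad \delta_n=\begin{cases}n^{-\frac1{2(\gamma+1)}}&\text{for }0<\gamma<1,\\[2pt] n^{-\frac{2-\gamma}{4\gamma}}(\log n)^{\frac{\gamma-1}{2\gamma}}&\text{for }1\le\gamma<2.\end{cases}$$ -/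

import Mathlib

open Set Filter Topology MeasureTheory ProbabilityTheory
open scoped ENNReal NNReal

noncomputable section

namespace LocStat

/-- The weights `ℓ(j)`: `1` for `|j| ≤ 1`, and `|j| log^{1+κ} |j|` for `|j| > 1`. -/
def ell (κ : ℝ) (j : ℤ) : ℝ :=
  if |j| ≤ 1 then 1 else |(j : ℝ)| * Real.log |(j : ℝ)| ^ (1 + κ)

/-- The triangular array `X n t`, `1 ≤ t ≤ n`, is a locally stationary process with limiting
coefficient functions `a(·, j) : (0, 1] → ℝ` (values of `a` outside `(0, 1]` are irrelevant).
The series is required to converge (unconditionally) almost surely, which is automatic from the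
bound on the coefficients. -/
def IsLocallyStationary {Ω : Type*} [MeasurableSpace Ω] (P : Measure Ω)
    (X : ℕ → ℤ → Ω → ℝ) (a : ℝ → ℤ → ℝ) : Prop :=
  ∃ (κ K : ℝ) (α : ℕ → ℤ → ℤ → ℝ) (ε : ℤ → Ω → ℝ),
    0 < κ ∧
    (∀ t, MemLp (ε t) 2 P) ∧
    (∀ s t, IdentDistrib (ε s) (ε t) P P) ∧
    (∀ t, ∫ ω, ε t ω ∂P = 0) ∧
    (∀ s t, s ≠ t → ∫ ω, ε s ω * ε t ω ∂P = 0) ∧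
    (∀ t, ∫ ω, ε t ω ^ 2 ∂P = 1) ∧
    (∀ n : ℕ, ∀ t ∈ Icc (1 : ℤ) n, ∀ᵐ ω ∂P,
      HasSum (fun j : ℤ => α n t j * ε (t - j) ω) (X n t ω)) ∧
    (∀ n : ℕ, ∀ t ∈ Icc (1 : ℤ) n, ∀ j, |α n t j| ≤ K / ell κ j) ∧
    (∀ u ∈ Ioc (0 : ℝ) 1, ∀ j, |a u j| ≤ K / ell κ j) ∧
    (∀ n : ℕ, ∀ j, ∑ t ∈ Finset.Icc (1 : ℤ) n, |α n t j - a ((t : ℝ) / n) j| ≤ K) ∧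
    (∀ j, eVariationOn (fun u => a u j) (Ioc 0 1) ≤ ENNReal.ofReal (K / ell κ j))

/-- A locally stationary process all of whose rows `X n 1, …, X n n` are jointly Gaussian. -/
def IsGaussianLocallyStationary {Ω : Type*} [MeasurableSpace Ω] (P : Measure Ω)
    (X : ℕ → ℤ → Ω → ℝ) (a : ℝ → ℤ → ℝ) : Prop :=
  IsLocallyStationary P X a ∧
    ∀ n : ℕ, IsGaussianProcess (fun (t : Icc (1 : ℤ) (n : ℤ)) (ω : Ω) => X n t ω) P

/-- The time-varying transfer function `A(u, x) = ∑ⱼ a(u, j) exp(-i x j)`. -/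
def transferFun (a : ℝ → ℤ → ℝ) (u x : ℝ) : ℂ :=
  ∑' j : ℤ, (a u j : ℂ) * Complex.exp (-Complex.I * x * j)

/-- The time-varying spectral density `f(u, x) = |A(u, x)|² / (2π)`. -/
def specDensity (a : ℝ → ℤ → ℝ) (u x : ℝ) : ℝ :=
  1 / (2 * Real.pi) * ‖transferFun a u x‖ ^ 2

/-- Lebesgue measure on the time-frequency rectangle `[0, 1] × [-π, π]`. Functions of
`(u, x)` are represented as functions `ℝ → ℝ → ℝ`; only their values on the rectangle matter. -/
def rect : Measure (ℝ × ℝ) :=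
  (volume.restrict (Icc (0 : ℝ) 1)).prod (volume.restrict (Icc (-Real.pi) Real.pi))

/-- The pre-periodogram `J_n(t/n, x)`: the sum over all `k ∈ ℤ` for which both indices
`⌊t + 1/2 ± k/2⌋` lie in `{1, …, n}` (then `|k| < n`). Integer division by `2` is the floor.
The terms for `k` and `-k` are complex conjugates, so the sum is real. -/
def prePeriodogram {Ω : Type*} (X : ℕ → ℤ → Ω → ℝ) (n : ℕ) (t : ℤ) (x : ℝ) (ω : Ω) : ℝ :=
  (1 / (2 * Real.pi) *
    ∑ k ∈ (Finset.Icc (-(n : ℤ)) n).filter (fun k : ℤ =>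
        (2 * t + 1 + k) / 2 ∈ Icc (1 : ℤ) n ∧ (2 * t + 1 - k) / 2 ∈ Icc (1 : ℤ) n),
      ((X n ((2 * t + 1 + k) / 2) ω : ℂ) * (X n ((2 * t + 1 - k) / 2) ω : ℂ) *
        Complex.exp (-Complex.I * x * k)) : ℂ).re

/-- The empirical contrast (Whittle-type likelihood) `ℒ_n(g)`. -/
def empContrast {Ω : Type*} (X : ℕ → ℤ → Ω → ℝ) (n : ℕ) (g : ℝ → ℝ → ℝ) (ω : Ω) : ℝ :=
  1 / (n : ℝ) * ∑ t ∈ Finset.Icc (1 : ℤ) n, 1 / (4 * Real.pi) *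
    ∫ x in (-Real.pi)..Real.pi,
      (Real.log (g ((t : ℝ) / n) x) + prePeriodogram X n t x ω / g ((t : ℝ) / n) x)

open Classical in
/-- The asymptotic contrast `ℒ(g)`, with value `+∞` when the integral does not converge (for the
functions considered, the negative part of the integrand is integrable). -/
def contrast (f g : ℝ → ℝ → ℝ) : EReal :=
  if Integrable (fun p : ℝ × ℝ => Real.log (g p.1 p.2) + f p.1 p.2 / g p.1 p.2) rect then
    ((1 / (4 * Real.pi) *
      ∫ p, (Real.log (g p.1 p.2) + f p.1 p.2 / g p.1 p.2) ∂rect : ℝ) : EReal)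
  else ⊤

/-- `g₀` is a minimiser of `ℒ` over the class `F`. -/
def IsContrastMin (f : ℝ → ℝ → ℝ) (F : Set (ℝ → ℝ → ℝ)) (g₀ : ℝ → ℝ → ℝ) : Prop :=
  g₀ ∈ F ∧ ∀ g ∈ F, contrast f g₀ ≤ contrast f g

/-- `f ∈ F`, functions on the rectangle being identified when they agree almost everywhere. -/
def BelongsTo (f : ℝ → ℝ → ℝ) (F : Set (ℝ → ℝ → ℝ)) : Prop :=
  ∃ g ∈ F, ∀ᵐ p ∂rect, f p.1 p.2 = g p.1 p.2

/-- The reciprocal function `1/g`. -/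
def recip (g : ℝ → ℝ → ℝ) : ℝ → ℝ → ℝ := fun u x => 1 / g u x

/-- The class `F* = {1/g : g ∈ F}`. -/
def recipClass (F : Set (ℝ → ℝ → ℝ)) : Set (ℝ → ℝ → ℝ) := {φ | ∃ g ∈ F, φ = recip g}

/-- The `L₂`-distance `ρ₂(φ, ψ)` on the rectangle, possibly infinite. -/
def rho2 (φ ψ : ℝ → ℝ → ℝ) : ℝ≥0∞ :=
  (∫⁻ p, ENNReal.ofReal (|φ p.1 p.2 - ψ p.1 p.2| ^ 2) ∂rect) ^ (1 / 2 : ℝ)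

/-- The Fourier coefficient `φ̂(u, j) = ∫ φ(u, x) exp(i x j) dx`. -/
def fourierCoef (φ : ℝ → ℝ → ℝ) (u : ℝ) (j : ℤ) : ℂ :=
  ∫ x in (-Real.pi)..Real.pi, (φ u x : ℂ) * Complex.exp (Complex.I * x * j)

/-- `ρ_∞(φ) = ∑ⱼ sup_u |φ̂(u, j)|`. -/
def rhoInfty (φ : ℝ → ℝ → ℝ) : ℝ≥0∞ :=
  ∑' j : ℤ, ⨆ u ∈ Icc (0 : ℝ) 1, ‖fourierCoef φ u j‖ₑ

/-- `ṽ(φ) = supⱼ V(φ̂(·, j))`. -/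
def vTilde (φ : ℝ → ℝ → ℝ) : ℝ≥0∞ :=
  ⨆ j : ℤ, eVariationOn (fun u => fourierCoef φ u j) (Icc 0 1)

/-- `v_Σ(φ) = ∑ⱼ V(φ̂(·, j))`. -/
def vSigma (φ : ℝ → ℝ → ℝ) : ℝ≥0∞ :=
  ∑' j : ℤ, eVariationOn (fun u => fourierCoef φ u j) (Icc 0 1)

/-- The covering number `N(ε, Φ, ρ₂)` (centres in `Φ`, strict inequality), `⊤` if there is no
finite cover. -/
def coveringNumber (ε : ℝ) (Φ : Set (ℝ → ℝ → ℝ)) : ℕ∞ :=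
  ⨅ (m : ℕ) (_ : 1 ≤ m ∧ ∃ c : Fin m → ℝ → ℝ → ℝ, (∀ i, c i ∈ Φ) ∧
    ∀ φ ∈ Φ, ∃ i, rho2 φ (c i) < ENNReal.ofReal ε), (m : ℕ∞)

/-- The metric entropy `H(ε, Φ, ρ₂) = log N(ε, Φ, ρ₂)`. -/
def metricEntropy (ε : ℝ) (Φ : Set (ℝ → ℝ → ℝ)) : EReal :=
  ENNReal.log ((coveringNumber ε Φ : ℕ∞) : ℝ≥0∞)

/-- A class of candidate spectral densities: measurable functions, positive on the rectangle. -/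
def IsCandidateClass (F : Set (ℝ → ℝ → ℝ)) : Prop :=
  ∀ g ∈ F, Measurable (fun p : ℝ × ℝ => g p.1 p.2) ∧
    ∀ u ∈ Icc (0 : ℝ) 1, ∀ x ∈ Icc (-Real.pi) Real.pi, 0 < g u x

/-- The assumptions on the model classes `Fn n` (the sieve, `n ≥ 1`) and `F`, on the estimators
`fhat n`, on the best approximation `fF` of the spectral density `f` in `F`, and on the
constants `Mlo n = M_*`, `Mhi n = M^*`, `rInf n = ρ_∞`, `vT n = ṽ`, `vS n = v_Σ`, all of which
may depend on `n`. -/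
structure ModelAssumption {Ω : Type*} [MeasurableSpace Ω] (P : Measure Ω)
    (X : ℕ → ℤ → Ω → ℝ) (f : ℝ → ℝ → ℝ)
    (Fn : ℕ → Set (ℝ → ℝ → ℝ)) (F : Set (ℝ → ℝ → ℝ))
    (fhat : ℕ → Ω → ℝ → ℝ → ℝ) (fF : ℝ → ℝ → ℝ)
    (Mlo Mhi rInf vT vS : ℕ → ℝ) : Prop where
  candidate : IsCandidateClass F
  candidate_sieve : ∀ n, 1 ≤ n → IsCandidateClass (Fn n)
  /-- `fhat n` minimises `ℒ_n` over the `n`-th sieve -/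
  estimator : ∀ n, 1 ≤ n → ∀ᵐ ω ∂P, fhat n ω ∈ Fn n ∧
    ∀ g ∈ Fn n, empContrast X n (fhat n ω) ω ≤ empContrast X n g ω
  /-- `fF` minimises `ℒ` over `F` -/
  target : IsContrastMin f F fF
  /-- the minimiser of `ℒ` over `F` is unique (up to null sets) -/
  target_unique : ∀ g, IsContrastMin f F g → ∀ᵐ p ∂rect, g p.1 p.2 = fF p.1 p.2
  /-- the sieves approximate `F*` -/
  approx : ∀ φ ∈ recipClass F, ∃ ψ : ℕ → ℝ → ℝ → ℝ, (∀ n, 1 ≤ n → ψ n ∈ recipClass (Fn n)) ∧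
    Tendsto (fun n => rho2 φ (ψ n)) atTop (𝓝 0)
  const : ∀ n, 1 ≤ n → 0 < Mlo n ∧ Mlo n ≤ 1 ∧ 1 ≤ Mhi n
  bounds : ∀ n, 1 ≤ n → ∀ φ ∈ recipClass (Fn n), ∀ u ∈ Icc (0 : ℝ) 1,
    ∀ x ∈ Icc (-Real.pi) Real.pi, Mlo n ≤ |φ u x| ∧ |φ u x| < Mhi n
  bound_rhoInfty : ∀ n, 1 ≤ n → ∀ φ ∈ recipClass (Fn n), rhoInfty φ ≤ ENNReal.ofReal (rInf n)
  bound_vTilde : ∀ n, 1 ≤ n → ∀ φ ∈ recipClass (Fn n), vTilde φ ≤ ENNReal.ofReal (vT n)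
  bound_vSigma : ∀ n, 1 ≤ n → ∀ φ ∈ recipClass (Fn n), vSigma φ ≤ ENNReal.ofReal (vS n)

/-- `Y_n = O_P(δ_n)`: for every `ε > 0` there is a finite `C` with
`P(Y_n > C δ_n) ≤ ε` for all sufficiently large `n` (outer probability if `Y_n` is not
measurable). -/
def IsBigOP {Ω : Type*} [MeasurableSpace Ω] (P : Measure Ω)
    (Y : ℕ → Ω → ℝ≥0∞) (δ : ℕ → ℝ≥0∞) : Prop :=
  ∀ ε : ℝ≥0∞, 0 < ε → ∃ C : ℝ≥0, ∀ᶠ n in atTop, P {ω | (C : ℝ≥0∞) * δ n < Y n ω} ≤ ε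

/-- `δ_n = (M^* / M_*) max(√(c_n k_n log n / n), e_n)` with `c_n = max{ρ_∞, v_Σ, (M^*)²}`,
where `e_n` is an approximation error. -/
def sieveRate (Mlo Mhi rInf vS k : ℕ → ℝ) (e : ℕ → ℝ≥0∞) (n : ℕ) : ℝ≥0∞ :=
  ENNReal.ofReal (Mhi n / Mlo n) *
    max (ENNReal.ofReal
      (Real.sqrt (max (rInf n) (max (vS n) (Mhi n ^ 2)) * k n * Real.log n / n))) (e n)

/-- The rate of the global estimator under polynomial entropy with exponent `γ`. -/
def globalRate (γ : ℝ) (n : ℕ) : ℝ :=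
  if γ < 1 then (n : ℝ) ^ (-(1 / (2 * (γ + 1))))
  else (n : ℝ) ^ (-((2 - γ) / (4 * γ))) * Real.log n ^ ((γ - 1) / (2 * γ))

end LocStat

end

/-! ### Exponential inequalities for Gaussian quadratic forms -/

section

open scoped MatrixOrder

namespace LocStat

/-! In terms of the inverse density `φ = 1/g` the contrast is, up to the factor `1/(4π)`, the convex
functional `Λ(φ) = ∫ (-log φ + f φ)`. The empirical contrast is `Λ(φ)` plus a quadratic form in the
observations, linear in `φ` and centred at its mean, plus three small errors: a Riemann sum error of
the logarithmic term, the replacement of point values of the Fourier coefficients by cell averages,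
and the bias of the local covariances (`LinearRows.abs_empContrast_sub_le`). The first two are
governed by the variations of the Fourier coefficients, the third by `ρ_∞`; all are of order `1/n`
or `log n / n` on the event that the squared observations are at most of order `log n`.

Comparing the estimator with a reference element `ψ` of the class (`LinearRows.invContrast_sub_le`)
bounds `Λ(φ̂) - Λ(ψ)` by the centred form `E(φ̂ - ψ)` plus these errors. Conversely `Λ(φ) - Λ(ψ)`
controls the squared distance `ρ = ρ₂(φ, ψ)` up to the factor `4 M^*²`. In the correctly specified
case this comes from the divergence `x/z - 1 - log(x/z)` between `φ` and `1/f`, at the price of the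
approximation error of `ψ` (`LinearRows.sq_rho2_le_of_specified`); in the convex case it comes from
the uniform convexity of `-log` on `(0, M^*]`, applied at the midpoint of `φ` and the minimiser
(`LinearRows.sq_rho2_le_of_midpoint`). What remains is to bound `E(φ - ψ)` uniformly over the class
in terms of `ρ`.

The covariance matrices of the rows have bounded operator norms, by absolute summability of the
coefficients. Parseval's identity makes the Hilbert–Schmidt norm of the matrix of the form at most
of order `ρ/√n`, and its operator norm is at most of order `ρ_∞/n`. Diagonalising a Gaussian
quadratic form gives a Bernstein inequality: outside an event of probability `2 e^{-L}` the form is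
at most of order `ρ √(L/n) + ρ_∞ L/n`. Using the Hilbert–Schmidt norm also as operator norm gives
the alternative `ρ L/√n`.

For sieves, the Bernstein inequality is applied to a net of mesh `n⁻²`, whose entropy is of order
`k_n log n`; the distance to the net is negligible by a crude bound. The resulting quadratic
inequality in `ρ` is solved by absorbing the cross term (`sieve_arith`), and the triangle inequality
transfers the result from `ψ` to the target.

For the global estimator one shows that `E(φ - ψ)` is of order `ρ τ + τ²` with `τ` the claimed rate.
If `γ < 1`, the Bernstein inequality is used on a net of mesh `τ`, and below this scale chaining
with the bound `ρ L/√n` converges, since `ε^{-γ}` is integrable at zero; the contribution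
`τ^{1-γ}/√n` is `τ²` for `τ = n^{-1/(2(γ+1))}`. If `γ ≥ 1`, that integral diverges, and the Fourier
coefficients are expanded over dyadic cells in `u` instead (`LinearRows.exists_uniform_bound`). The
coefficients of the expansion have bounded `ℓ¹` norm at every level because of `v_Σ`, while the
forms of the individual atoms are uniformly small with few exceptions, which are handled in `ℓ²`.
This gives a uniform bound of order `(log n + ρ)/√n`, enough for `γ > 1`; for `γ = 1` the logarithm
is removed by applying the expansion only below a net of mesh `n^{-1/2}`. -/

lemma integrable_exp_sq_gaussianReal {s : ℝ} (hs : |s| ≤ 1 / 4) :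
    Integrable (fun x : ℝ => Real.exp (s * (x ^ 2 - 1))) (gaussianReal 0 1) ∧
    ∫ x, Real.exp (s * (x ^ 2 - 1)) ∂gaussianReal 0 1 ≤ Real.exp (4 * s ^ 2) := by
  have hs2 := abs_le.1 hs
  have hpos : 0 < 1 / 2 - s := by linarith
  have key : ∀ x : ℝ, gaussianPDFReal 0 1 x * Real.exp (s * (x ^ 2 - 1)) =
      (Real.sqrt (2 * Real.pi))⁻¹ * Real.exp (-s) * Real.exp (-(1 / 2 - s) * x ^ 2) := by
    intro x
    simp only [gaussianPDFReal, NNReal.coe_one, mul_one, sub_zero]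
    rw [mul_assoc, mul_assoc, ← Real.exp_add, ← Real.exp_add]
    congr 2; ring
  constructor
  · rw [gaussianReal_of_var_ne_zero _ one_ne_zero,
      integrable_withDensity_iff_integrable_smul' (by fun_prop) (by simp [gaussianPDF])]
    simp only [toReal_gaussianPDF, smul_eq_mul, key]
    exact (integrable_exp_neg_mul_sq hpos).const_mul _
  · rw [integral_gaussianReal_eq_integral_smul one_ne_zero]
    simp only [smul_eq_mul, key]
    rw [integral_const_mul, integral_gaussian]
    have h2 : Real.sqrt (2 * Real.pi) ≠ 0 := by positivity
    have h1 : (Real.sqrt (2 * Real.pi))⁻¹ * Real.exp (-s) * Real.sqrt (Real.pi / (1 / 2 - s)) =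
        Real.exp (-s) * Real.sqrt ((1 - 2 * s)⁻¹) := by
      have h3 : Real.pi / (1 / 2 - s) = (2 * Real.pi) * (1 - 2 * s)⁻¹ := by
        have h4 : 1 - 2 * s ≠ 0 := by linarith
        rw [show 1 / 2 - s = (1 - 2 * s) / 2 by ring]
        field_simp
      rw [h3, Real.sqrt_mul (show (0 : ℝ) ≤ 2 * Real.pi by positivity) ((1 - 2 * s)⁻¹)]
      field_simp
    rw [h1]
    have h3 : (1 - 2 * s)⁻¹ ≤ Real.exp (2 * s + 8 * s ^ 2) := by
      rw [inv_le_comm₀ (by linarith) (Real.exp_pos _), ← Real.exp_neg]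
      -- The first-order expansion of `log (1 - x)` at `x = 2s` has remainder at most `x² / (1 -
      -- |x|)`, and `|x| ≤ 1/2`.
      have h4 : -(2 * s + 8 * s ^ 2) ≤ Real.log (1 - 2 * s) := by
        have h7 := Real.abs_log_sub_add_sum_range_le (x := 2 * s)
          (by rw [abs_mul]; norm_num; linarith) 1
        simp only [Finset.range_one, Finset.sum_singleton, zero_add, pow_one, Nat.cast_zero,
          div_one, Nat.reduceAdd, sq_abs] at h7
        have h5 := (abs_le.1 h7).1
        have h6 : (2 * s) ^ (2:ℕ) / (1 - |2 * s|) ≤ 8 * s ^ 2 := by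
          rw [abs_mul, abs_two, div_le_iff₀ (by linarith)]
          nlinarith [sq_nonneg s]
        linarith
      calc _ ≤ Real.exp (Real.log (1 - 2 * s)) := Real.exp_le_exp.2 h4
        _ = _ := Real.exp_log (by linarith)
    calc Real.exp (-s) * Real.sqrt ((1 - 2 * s)⁻¹)
        ≤ Real.exp (-s) * Real.sqrt (Real.exp (2 * s + 8 * s ^ 2)) := by gcongr
      _ = Real.exp (-s) * Real.exp (s + 4 * s ^ 2) := by
        congr 1
        rw [show Real.exp (2 * s + 8 * s ^ 2) = Real.exp (s + 4 * s ^ 2) ^ 2 by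
          rw [← Real.exp_nat_mul]; congr 1; push_cast; ring]
        exact Real.sqrt_sq (Real.exp_pos _).le
      _ = Real.exp (4 * s ^ 2) := by rw [← Real.exp_add]; congr 1; ring

/-- The squared Hilbert–Schmidt norm does not depend on the basis: expand each norm in the other
basis and exchange the sums. -/
lemma sum_norm_sq_symmetric {E ι κ : Type*} [NormedAddCommGroup E] [InnerProductSpace ℝ E]
    [Fintype ι] [Fintype κ] {M : E →ₗ[ℝ] E}
    (hM : M.IsSymmetric) (b : OrthonormalBasis ι ℝ E) (e : OrthonormalBasis κ ℝ E) :
    ∑ i, ‖M (b i)‖ ^ 2 = ∑ j, ‖M (e j)‖ ^ 2 := by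
  simp_rw [fun i => (e.sum_sq_inner_right (M (b i))).symm,
    fun j => (b.sum_sq_inner_right (M (e j))).symm]
  rw [Finset.sum_comm]
  refine Finset.sum_congr rfl fun j _ => Finset.sum_congr rfl fun i _ => ?_
  rw [← hM, real_inner_comm]

section stdGaussian

variable {E : Type*} [NormedAddCommGroup E] [InnerProductSpace ℝ E] [FiniteDimensional ℝ E]
  [MeasurableSpace E] [BorelSpace E]

/-- In an eigenbasis the centred form is `∑ lᵢ (zᵢ² - 1)` with independent standard normal `zᵢ`, so
its exponential moment factorises. The bound `a` keeps each `θ lᵢ` in the range of the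
one-dimensional estimate, and `∑ lᵢ²` is the squared Hilbert–Schmidt norm. -/
lemma stdGaussian_quadForm_mgf {κ : Type*} [Fintype κ] {M : E →ₗ[ℝ] E}
    (hM : M.IsSymmetric) (e : OrthonormalBasis κ ℝ E) {a G θ : ℝ}
    (ha : ∀ x, |inner ℝ x (M x)| ≤ a * ‖x‖ ^ 2) (hG : ∑ j, ‖M (e j)‖ ^ 2 ≤ G)
    (hθ : |θ| * a ≤ 1 / 4) :
    Integrable (fun z : E => Real.exp (θ * (inner ℝ z (M z) -
        ∫ y, inner ℝ y (M y) ∂stdGaussian E))) (stdGaussian E) ∧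
    ∫ z, Real.exp (θ * (inner ℝ z (M z) - ∫ y, inner ℝ y (M y) ∂stdGaussian E)) ∂stdGaussian E
      ≤ Real.exp (4 * θ ^ 2 * G) := by
  set n := Module.finrank ℝ E
  set b := hM.eigenvectorBasis (n := n) rfl with hb
  set l := hM.eigenvalues (n := n) rfl with hl
  have hMb : ∀ i, M (b i) = l i • b i := fun i => hM.apply_eigenvectorBasis rfl i
  have hquad : ∀ x : Fin n → ℝ, inner ℝ (∑ i, x i • b i) (M (∑ i, x i • b i)) =
      ∑ i, l i * x i ^ 2 := by
    intro x
    simp only [map_sum, map_smul, hMb]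
    rw [sum_inner]
    refine Finset.sum_congr rfl fun i _ => ?_
    rw [inner_sum, Finset.sum_eq_single i]
    · simp [inner_smul_left, inner_smul_right]; ring
    · intro j _ hj
      simp [inner_smul_left, inner_smul_right, b.orthonormal.2 hj.symm]
    · simp
  have hli : ∀ i, |l i| ≤ a := by
    intro i
    have := ha (b i)
    rw [hMb, inner_smul_right] at this
    simpa using this
  have hlsum : ∑ i, l i ^ 2 ≤ G := by
    rw [← sum_norm_sq_symmetric hM b e] at hG
    refine le_trans (le_of_eq ?_) hG
    refine Finset.sum_congr rfl fun i _ => ?_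
    rw [hMb, norm_smul]; simp
  have hmeas : Measurable (fun x : Fin n → ℝ => ∑ i, x i • b i) := by fun_prop
  have hMc : Continuous M := M.continuous_of_finiteDimensional
  have hstd := stdGaussian_eq_map_pi_orthonormalBasis b
  have hint1 : Integrable (fun x : ℝ => x ^ 2) (gaussianReal 0 1) :=
    (memLp_id_gaussianReal 2).integrable_sq
  have hvar : ∫ x, x ^ 2 ∂gaussianReal 0 1 = 1 := by
    have h1 : Var[id; gaussianReal 0 1] = 1 := by simp [variance_id_gaussianReal]
    rw [variance_of_integral_eq_zero aemeasurable_id (by simp [integral_id_gaussianReal])] at h1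
    simpa using h1
  have hmean : ∫ y, inner ℝ y (M y) ∂stdGaussian E = ∑ i, l i := by
    rw [hstd, integral_map hmeas.aemeasurable (by fun_prop)]
    simp only [hquad]
    rw [integral_finsetSum]
    · refine Finset.sum_congr rfl fun i _ => ?_
      rw [integral_const_mul]
      have := integral_comp_eval (μ := fun _ : Fin n => gaussianReal 0 1) (i := i)
        (f := fun x : ℝ => x ^ 2) hint1.aestronglyMeasurable
      rw [this, hvar, mul_one]
    · intro i _
      exact (integrable_comp_eval (μ := fun _ : Fin n => gaussianReal 0 1) (i := i)
        hint1).const_mul _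
  have hexp : ∀ x : Fin n → ℝ, Real.exp (θ * (∑ i, l i * x i ^ 2 - ∑ i, l i)) =
      ∏ i, Real.exp ((θ * l i) * (x i ^ 2 - 1)) := by
    intro x
    rw [← Real.exp_sum, ← Finset.sum_sub_distrib, Finset.mul_sum]
    congr 1
    refine Finset.sum_congr rfl fun i _ => by ring
  have hsmall : ∀ i, |θ * l i| ≤ 1 / 4 := by
    intro i
    rw [abs_mul]
    exact (mul_le_mul_of_nonneg_left (hli i) (abs_nonneg _)).trans hθ
  rw [hmean]
  rw [hstd]
  have hcont : Continuous (fun z : E => Real.exp (θ * (inner ℝ z (M z) - ∑ i, l i))) := by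
    fun_prop
  constructor
  · rw [integrable_map_measure hcont.aestronglyMeasurable hmeas.aemeasurable]
    simp only [Function.comp_def, hquad, hexp]
    exact Integrable.fintype_prod (f := fun i x => Real.exp ((θ * l i) * (x ^ 2 - 1)))
      fun i => (integrable_exp_sq_gaussianReal (hsmall i)).1
  · rw [integral_map hmeas.aemeasurable hcont.aestronglyMeasurable]
    simp only [hquad, hexp]
    rw [integral_fintype_prod_eq_prod (fun i x => Real.exp ((θ * l i) * (x ^ 2 - 1)))]
    calc ∏ i, ∫ x, Real.exp ((θ * l i) * (x ^ 2 - 1)) ∂gaussianReal 0 1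
        ≤ ∏ i, Real.exp (4 * (θ * l i) ^ 2) :=
          Finset.prod_le_prod (fun i _ => integral_nonneg fun x => (Real.exp_pos _).le)
            fun i _ => (integrable_exp_sq_gaussianReal (hsmall i)).2
      _ = Real.exp (4 * θ ^ 2 * ∑ i, l i ^ 2) := by
          rw [← Real.exp_sum, Finset.mul_sum]
          congr 1
          refine Finset.sum_congr rfl fun i _ => by ring
      _ ≤ _ := Real.exp_le_exp.2 (by gcongr)

end stdGaussian

section gaussianVector

variable {Ω : Type*} [MeasurableSpace Ω] {P : Measure Ω} {ι : Type*} [Fintype ι]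

/-- With `S` the covariance matrix, `X` has the law of `S^{1/2} Z` for a standard normal `Z`, so the
form has the matrix `S^{1/2} B S^{1/2}`. Its operator and squared Hilbert–Schmidt norms exceed those
of `B` by at most the factors `C` and `C²`. -/
lemma symm_quadForm_mgf {X : ι → Ω → ℝ} (hX : HasGaussianLaw (fun ω i => X i ω) P)
    (h0 : ∀ i, ∫ ω, X i ω ∂P = 0) {C : ℝ} (hC : 0 ≤ C)
    (hcov : ∀ c : ι → ℝ, ∫ ω, (∑ i, c i * X i ω) ^ 2 ∂P ≤ C * ∑ i, c i ^ 2)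
    {B : Matrix ι ι ℝ} (hB : B.IsSymm) {G b θ : ℝ} (hG : ∑ i, ∑ j, B i j ^ 2 ≤ G)
    (hb : ∀ x : ι → ℝ, |∑ i, ∑ j, B i j * (x i * x j)| ≤ b * ∑ i, x i ^ 2)
    (hb0 : 0 ≤ b) (hθ : |θ| * (C * b) ≤ 1 / 4) :
    Integrable (fun ω => Real.exp (θ * (∑ i, ∑ j, B i j * (X i ω * X j ω) -
        ∫ ω, ∑ i, ∑ j, B i j * (X i ω * X j ω) ∂P))) P ∧
    ∫ ω, Real.exp (θ * (∑ i, ∑ j, B i j * (X i ω * X j ω) -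
        ∫ ω, ∑ i, ∑ j, B i j * (X i ω * X j ω) ∂P)) ∂P ≤ Real.exp (4 * θ ^ 2 * (C ^ 2 * G)) := by
  classical
  have hPP : IsProbabilityMeasure P := hX.isProbabilityMeasure
  set Y : Ω → EuclideanSpace ℝ ι := fun ω => WithLp.toLp 2 fun i => X i ω with hY
  have hYg : HasGaussianLaw Y P := hX.toLp_pi 2
  have hXm : ∀ i, AEMeasurable (X i) P := fun i => (hX.eval i).aemeasurable
  have hX2 : ∀ i, MemLp (X i) 2 P := fun i => (hX.eval i).memLp_two
  have hXX : ∀ i j, Integrable (fun ω => X i ω * X j ω) P := fun i j =>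
    (hX2 i).integrable_mul (hX2 j)
  set S : Matrix ι ι ℝ := fun i j => ∫ ω, X i ω * X j ω ∂P with hS
  have hquadS : ∀ x : ι → ℝ, x ⬝ᵥ (S.mulVec x) = ∫ ω, (∑ i, x i * X i ω) ^ 2 ∂P := by
    intro x
    simp only [dotProduct, Matrix.mulVec, hS, Finset.mul_sum]
    have h1 : ∀ ω, (∑ i, x i * X i ω) ^ 2 = ∑ i, ∑ j, x i * ((X i ω * X j ω) * x j) := by
      intro ω
      rw [sq, Finset.sum_mul_sum]
      exact Finset.sum_congr rfl fun i _ => Finset.sum_congr rfl fun j _ => by ring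
    simp_rw [h1]
    rw [integral_finsetSum]
    · refine Finset.sum_congr rfl fun i _ => ?_
      rw [integral_finsetSum]
      · refine Finset.sum_congr rfl fun j _ => ?_
        rw [integral_const_mul, integral_mul_const]
      · exact fun j _ => ((hXX i j).mul_const _).const_mul _
    · exact fun i _ => integrable_finsetSum _ fun j _ => ((hXX i j).mul_const _).const_mul _
  have hSpos : S.PosSemidef := by
    refine Matrix.PosSemidef.of_dotProduct_mulVec_nonneg ?_ fun x => ?_
    · ext i j
      simp only [hS]
      exact integral_congr_ae (ae_of_all _ fun ω => mul_comm _ _)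
    · simp only [star_trivial]
      rw [hquadS]
      exact integral_nonneg fun ω => sq_nonneg _
  have hYm : AEMeasurable Y P := hYg.aemeasurable
  have : IsGaussian (P.map Y) := hYg.isGaussian_map
  have hlaw : P.map Y = multivariateGaussian 0 S := by
    have hmean0 : ∫ x, x ∂P.map Y = 0 := by
      rw [integral_map hYm (by fun_prop)]
      ext i
      have h1 := (EuclideanSpace.proj (𝕜 := ℝ) i).integral_comp_comm hYg.integrable
      simp only [EuclideanSpace.coe_proj] at h1
      rw [← h1]
      simpa [hY] using h0 i
    apply IsGaussian.ext
    · simp only [id_eq, integral_id_multivariateGaussian, hmean0]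
    · ext x y
      rw [covarianceBilin_multivariateGaussian hSpos, covarianceBilin_apply IsGaussian.memLp_two_id]
      simp only [id_eq, hmean0, sub_zero]
      rw [integral_map hYm (by fun_prop)]
      simp only [dotProduct, Matrix.mulVec, hS, Finset.mul_sum]
      have h1 : ∀ ω, inner ℝ x (Y ω) * inner ℝ y (Y ω) =
          ∑ i, ∑ j, x i * ((X i ω * X j ω) * y j) := by
        intro ω
        simp only [PiLp.inner_apply, hY, RCLike.inner_apply, conj_trivial]
        rw [Finset.sum_mul_sum]
        exact Finset.sum_congr rfl fun i _ => Finset.sum_congr rfl fun j _ => by ring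
      simp_rw [h1]
      rw [integral_finsetSum]
      · refine Finset.sum_congr rfl fun i _ => ?_
        rw [integral_finsetSum]
        · refine Finset.sum_congr rfl fun j _ => ?_
          rw [integral_const_mul, integral_mul_const]
        · exact fun j _ => ((hXX i j).mul_const _).const_mul _
      · exact fun i _ => integrable_finsetSum _ fun j _ => ((hXX i j).mul_const _).const_mul _
  set T := Matrix.toEuclideanCLM (𝕜 := ℝ) (CFC.sqrt S) with hT
  set A := Matrix.toEuclideanCLM (𝕜 := ℝ) B with hA
  have hTsa : ∀ x y, inner ℝ (T x) y = inner ℝ x (T y) := by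
    have h1 : IsSelfAdjoint T := (CFC.sqrt_nonneg S).isSelfAdjoint.map _
    intro x y
    rw [← ContinuousLinearMap.adjoint_inner_right, h1.adjoint_eq]
  have hTT : ∀ x, T (T x) = Matrix.toEuclideanCLM (𝕜 := ℝ) S x := by
    intro x
    rw [← ContinuousLinearMap.comp_apply, ← ContinuousLinearMap.mul_def, ← map_mul,
      CFC.sqrt_mul_sqrt_self S hSpos.nonneg]
  have hTn : ∀ x, ‖T x‖ ^ 2 ≤ C * ‖x‖ ^ 2 := by
    intro x
    rw [← real_inner_self_eq_norm_sq, hTsa, hTT, Matrix.inner_toEuclideanCLM, hquadS,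
      EuclideanSpace.real_norm_sq_eq]
    exact hcov _
  have hAquad : ∀ x : EuclideanSpace ℝ ι, inner ℝ x (A x) = ∑ i, ∑ j, B i j * (x i * x j) := by
    intro x
    rw [Matrix.inner_toEuclideanCLM]
    simp only [dotProduct, Matrix.mulVec, Finset.mul_sum]
    exact Finset.sum_congr rfl fun i _ => Finset.sum_congr rfl fun j _ => by ring
  have hAsa : ∀ x y, inner ℝ (A x) y = inner ℝ x (A y) := by
    intro x y
    rw [real_inner_comm, Matrix.inner_toEuclideanCLM, Matrix.inner_toEuclideanCLM,
      Matrix.dotProduct_mulVec, ← Matrix.mulVec_transpose, hB.eq, dotProduct_comm]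
  set M : EuclideanSpace ℝ ι →ₗ[ℝ] EuclideanSpace ℝ ι := (T ∘L A ∘L T).toLinearMap with hM
  have hMa : ∀ x, M x = T (A (T x)) := fun x => rfl
  have hMs : M.IsSymmetric := by
    intro x y
    rw [hMa, hMa, hTsa, hAsa, hTsa]
  have hTsum : ∀ {N : EuclideanSpace ℝ ι →L[ℝ] EuclideanSpace ℝ ι},
      ∑ j, ‖T (N (EuclideanSpace.basisFun ι ℝ j))‖ ^ 2 ≤
        C * ∑ j, ‖N (EuclideanSpace.basisFun ι ℝ j)‖ ^ 2 := by
    intro N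
    rw [Finset.mul_sum]
    exact Finset.sum_le_sum fun j _ => hTn _
  have hAsum : ∑ j, ‖A (EuclideanSpace.basisFun ι ℝ j)‖ ^ 2 ≤ G := by
    refine le_trans (le_of_eq ?_) hG
    rw [Finset.sum_comm]
    refine Finset.sum_congr rfl fun j _ => ?_
    rw [EuclideanSpace.real_norm_sq_eq]
    refine Finset.sum_congr rfl fun i _ => ?_
    congr 1
    rw [EuclideanSpace.basisFun_apply, hA, Matrix.ofLp_toEuclideanCLM]
    simp
  -- `AT` and `TA` are adjoint to each other and so have the same Hilbert–Schmidt norm. This moves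
  -- the remaining factor `T` to the left, where its operator norm can be pulled out.
  have hATsum : ∑ j, ‖A (T (EuclideanSpace.basisFun ι ℝ j))‖ ^ 2 =
      ∑ j, ‖T (A (EuclideanSpace.basisFun ι ℝ j))‖ ^ 2 := by
    set e := EuclideanSpace.basisFun ι ℝ
    simp_rw [fun i => (e.sum_sq_inner_right (A (T (e i)))).symm,
      fun j => (e.sum_sq_inner_right (T (A (e j)))).symm]
    rw [Finset.sum_comm]
    refine Finset.sum_congr rfl fun j _ => Finset.sum_congr rfl fun i _ => ?_
    rw [← hAsa, ← hTsa, real_inner_comm]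
  have hMsum : ∑ j, ‖M (EuclideanSpace.basisFun ι ℝ j)‖ ^ 2 ≤ C ^ 2 * G := by
    calc _ ≤ C * ∑ j, ‖A (T (EuclideanSpace.basisFun ι ℝ j))‖ ^ 2 := hTsum (N := A ∘L T)
      _ ≤ C * (C * ∑ j, ‖A (EuclideanSpace.basisFun ι ℝ j)‖ ^ 2) := by
        rw [hATsum]; exact mul_le_mul_of_nonneg_left hTsum hC
      _ ≤ C * (C * G) := by gcongr
      _ = _ := by ring
  have hMb : ∀ x, |inner ℝ x (M x)| ≤ (C * b) * ‖x‖ ^ 2 := by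
    intro x
    rw [hMa, ← hTsa, hAquad]
    calc _ ≤ b * ∑ i, (T x) i ^ 2 := hb _
      _ = b * ‖T x‖ ^ 2 := by rw [EuclideanSpace.real_norm_sq_eq]
      _ ≤ b * (C * ‖x‖ ^ 2) := mul_le_mul_of_nonneg_left (hTn x) hb0
      _ = _ := by ring
  have hmain := stdGaussian_quadForm_mgf hMs (EuclideanSpace.basisFun ι ℝ) hMb hMsum hθ
  set q : EuclideanSpace ℝ ι → ℝ := fun x => ∑ i, ∑ j, B i j * (x i * x j) with hq
  have hqc : Continuous q := by fun_prop
  have hqT : ∀ x, inner ℝ x (M x) = q (T x) := fun x => by rw [hMa, ← hTsa, hAquad]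
  have hqY : ∀ ω, ∑ i, ∑ j, B i j * (X i ω * X j ω) = q (Y ω) := fun ω => rfl
  have htrans : ∀ {g : EuclideanSpace ℝ ι → ℝ}, Continuous g →
      ∫ ω, g (Y ω) ∂P = ∫ z, g (T z) ∂stdGaussian (EuclideanSpace ℝ ι) := by
    intro g hg
    rw [← integral_map hYm hg.aestronglyMeasurable, hlaw, multivariateGaussian,
      integral_map (by fun_prop) hg.aestronglyMeasurable]
    simp [hT]
  simp only [hqT] at hmain
  simp only [hqY]
  rw [htrans hqc]
  have hexpc : Continuous fun x => Real.exp (θ * (q x -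
      ∫ z, q (T z) ∂stdGaussian (EuclideanSpace ℝ ι))) := by fun_prop
  refine ⟨?_, ?_⟩
  · have h1 := (integrable_map_measure (μ := P) (f := Y) hexpc.aestronglyMeasurable hYm).1
    apply h1
    rw [hlaw, multivariateGaussian, integrable_map_measure hexpc.aestronglyMeasurable (by fun_prop)]
    simpa [Function.comp_def] using hmain.1
  · rw [htrans hexpc]
    exact hmain.2

/-- Symmetrising the matrix leaves the form unchanged and does not increase the Hilbert–Schmidt
norm. -/
lemma quadForm_mgf {X : ι → Ω → ℝ} (hX : HasGaussianLaw (fun ω i => X i ω) P)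
    (h0 : ∀ i, ∫ ω, X i ω ∂P = 0) {C : ℝ} (hC : 0 ≤ C)
    (hcov : ∀ c : ι → ℝ, ∫ ω, (∑ i, c i * X i ω) ^ 2 ∂P ≤ C * ∑ i, c i ^ 2)
    (B : ι → ι → ℝ) {G b θ : ℝ} (hG : ∑ i, ∑ j, B i j ^ 2 ≤ G)
    (hb : ∀ x : ι → ℝ, |∑ i, ∑ j, B i j * (x i * x j)| ≤ b * ∑ i, x i ^ 2)
    (hb0 : 0 ≤ b) (hθ : |θ| * (C * b) ≤ 1 / 4) :
    Integrable (fun ω => Real.exp (θ * (∑ i, ∑ j, B i j * (X i ω * X j ω) -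
        ∫ ω, ∑ i, ∑ j, B i j * (X i ω * X j ω) ∂P))) P ∧
    ∫ ω, Real.exp (θ * (∑ i, ∑ j, B i j * (X i ω * X j ω) -
        ∫ ω, ∑ i, ∑ j, B i j * (X i ω * X j ω) ∂P)) ∂P ≤ Real.exp (4 * θ ^ 2 * (C ^ 2 * G)) := by
  set B' : Matrix ι ι ℝ := fun i j => (B i j + B j i) / 2 with hB'
  have hsymm : B'.IsSymm := by
    ext i j
    change (B j i + B i j) / 2 = (B i j + B j i) / 2
    rw [add_comm]
  have hquad : ∀ x : ι → ℝ, ∑ i, ∑ j, B i j * (x i * x j) = ∑ i, ∑ j, B' i j * (x i * x j) := by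
    intro x
    have h1 : ∑ i, ∑ j, B j i * (x i * x j) = ∑ i, ∑ j, B i j * (x i * x j) := by
      rw [Finset.sum_comm]
      exact Finset.sum_congr rfl fun i _ => Finset.sum_congr rfl fun j _ => by ring
    have h2 : ∑ i, ∑ j, B' i j * (x i * x j) =
        (∑ i, ∑ j, B i j * (x i * x j) + ∑ i, ∑ j, B j i * (x i * x j)) / 2 := by
      simp only [← Finset.sum_add_distrib, Finset.sum_div, hB']
      exact Finset.sum_congr rfl fun i _ => Finset.sum_congr rfl fun j _ => by ring
    rw [h2, h1]; ring
  have hG' : ∑ i, ∑ j, B' i j ^ 2 ≤ G := by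
    have h1 : ∑ i, ∑ j, B j i ^ 2 = ∑ i, ∑ j, B i j ^ 2 := Finset.sum_comm
    have h2 : ∑ i, ∑ j, B' i j ^ 2 ≤ (∑ i, ∑ j, B i j ^ 2 + ∑ i, ∑ j, B j i ^ 2) / 2 := by
      simp only [← Finset.sum_add_distrib, Finset.sum_div, hB']
      exact Finset.sum_le_sum fun i _ => Finset.sum_le_sum fun j _ => by
        nlinarith [sq_nonneg (B i j - B j i)]
    linarith
  have hX' : ∀ ω, ∑ i, ∑ j, B i j * (X i ω * X j ω) = ∑ i, ∑ j, B' i j * (X i ω * X j ω) :=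
    fun ω => hquad fun i => X i ω
  simp only [hX']
  exact symm_quadForm_mgf hX h0 hC hcov hsymm hG' (fun x => by rw [← hquad]; exact hb x) hb0 hθ

end gaussianVector

/-! ### Tails and truncated moments from exponential moments -/

section subexponential

variable {Ω : Type*} [MeasurableSpace Ω] {P : Measure Ω}
  {Y : Ω → ℝ} {v β : ℝ}

/-- Chernoff's method for both signs. A parameter with `4 θ² v ≤ L` and `θ x ≥ 2 L` turns the bound
`exp(-θx + 4θ²v)` into `exp(-L)`. -/
lemma measure_tail_of_mgf [IsProbabilityMeasure P] (hv : 0 ≤ v) (hβ : 0 < β)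
    (h : ∀ θ, |θ| * β ≤ 1 / 4 → Integrable (fun ω => Real.exp (θ * Y ω)) P ∧
      ∫ ω, Real.exp (θ * Y ω) ∂P ≤ Real.exp (4 * θ ^ 2 * v)) {L : ℝ} (hL : 0 ≤ L) :
    P {ω | 4 * Real.sqrt (v * L) + 8 * β * L < |Y ω|} ≤ ENNReal.ofReal (2 * Real.exp (-L)) := by
  set x := 4 * Real.sqrt (v * L) + 8 * β * L with hx
  -- The Gaussian choice `θ = √(L/(4v))` makes `4θ²v = L`. When the largest admissible value
  -- `1/(4β)` already satisfies `4θ²v ≤ L`, it is used instead, and the linear part of `x` suffices.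
  obtain ⟨θ, hθ0, hθβ, hθv, hθx⟩ : ∃ θ : ℝ, 0 ≤ θ ∧ θ * β ≤ 1 / 4 ∧ 4 * θ ^ 2 * v ≤ L ∧
      2 * L ≤ θ * x := by
    have hs := Real.sqrt_nonneg (v * L)
    by_cases hc : 4 * (1 / (4 * β)) ^ 2 * v ≤ L
    · refine ⟨1 / (4 * β), by positivity, le_of_eq (by field_simp), hc, ?_⟩
      have : 1 / (4 * β) * (8 * β * L) = 2 * L := by field_simp; ring
      rw [hx, mul_add, this]
      have : 0 ≤ 1 / (4 * β) * (4 * Real.sqrt (v * L)) := by positivity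
      linarith
    · push Not at hc
      have hvpos : 0 < v := by
        rcases hv.eq_or_lt with h0 | h0
        · rw [← h0] at hc; simp at hc; linarith
        · exact h0
      refine ⟨Real.sqrt (L / (4 * v)), Real.sqrt_nonneg _, ?_, ?_, ?_⟩
      · have : Real.sqrt (L / (4 * v)) ≤ 1 / (4 * β) := by
          rw [Real.sqrt_le_left (by positivity), div_le_iff₀ (by positivity)]
          linarith
        calc _ ≤ 1 / (4 * β) * β := by gcongr
          _ = 1 / 4 := by field_simp
      · rw [Real.sq_sqrt (by positivity)]
        exact le_of_eq (by field_simp)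
      · have h1 : Real.sqrt (L / (4 * v)) * Real.sqrt (v * L) = L / 2 := by
          rw [← Real.sqrt_mul (by positivity)]
          rw [show L / (4 * v) * (v * L) = (L / 2) ^ 2 by field_simp; norm_num]
          exact Real.sqrt_sq (by positivity)
        rw [hx, mul_add]
        have : 0 ≤ Real.sqrt (L / (4 * v)) * (8 * β * L) := by positivity
        nlinarith
  have hside : ∀ σ : ℝ, |σ| = 1 → P {ω | x ≤ σ * Y ω} ≤ ENNReal.ofReal (Real.exp (-L)) := by
    intro σ hσ
    have hh := h (θ * σ) (by rw [abs_mul, hσ, mul_one, abs_of_nonneg hθ0]; exact hθβ)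
    have hm := measure_ge_le_exp_mul_mgf (μ := P) (X := fun ω => σ * Y ω) (t := θ) x hθ0
      (by simpa only [mul_assoc] using hh.1)
    rw [← ofReal_measureReal]
    refine ENNReal.ofReal_le_ofReal (hm.trans ?_)
    have h2 : mgf (fun ω => σ * Y ω) P θ ≤ Real.exp L := by
      refine le_trans (le_of_eq ?_) (hh.2.trans (Real.exp_le_exp.2 ?_))
      · simp only [mgf, mul_assoc]
      · have : σ ^ 2 = 1 := by rw [← sq_abs, hσ, one_pow]
        rw [mul_pow, this, mul_one]
        exact hθv
    calc Real.exp (-θ * x) * mgf (fun ω => σ * Y ω) P θ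
        ≤ Real.exp (-(2 * L)) * Real.exp L := by
          gcongr
          · exact mgf_nonneg
          · linarith
      _ = _ := by rw [← Real.exp_add]; congr 1; ring
  calc P {ω | x < |Y ω|} ≤ P ({ω | x ≤ 1 * Y ω} ∪ {ω | x ≤ -1 * Y ω}) := by
        refine measure_mono fun ω hω => ?_
        rcases lt_abs.1 (show x < |Y ω| from hω) with h1 | h1
        · left; simpa using h1.le
        · right; simpa using h1.le
    _ ≤ _ := measure_union_le _ _
    _ ≤ ENNReal.ofReal (Real.exp (-L)) + ENNReal.ofReal (Real.exp (-L)) :=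
        add_le_add (hside 1 (by simp)) (hside (-1) (by simp))
    _ = _ := by rw [← ENNReal.ofReal_add (by positivity) (by positivity), two_mul]

/-- Half of the exponent `c|Y|` pays for the square, through `y² ≤ 8 c⁻² exp(c|y|/2)`; the other
half pays for the truncation, since `exp(c|y|/2) ≤ exp(-cM/2) exp(c|y|)` once `|y| > M`. -/
lemma lintegral_sq_indicator_of_mgf (h : ∀ θ, |θ| * β ≤ 1 / 4 →
      Integrable (fun ω => Real.exp (θ * Y ω)) P ∧
      ∫ ω, Real.exp (θ * Y ω) ∂P ≤ Real.exp (4 * θ ^ 2 * v))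
    {c : ℝ} (hc : 0 < c) (hcβ : c * β ≤ 1 / 4) (M : ℝ) :
    ∫⁻ ω, ENNReal.ofReal (if M < |Y ω| then Y ω ^ 2 else 0) ∂P ≤
      ENNReal.ofReal (16 / c ^ 2 * Real.exp (4 * c ^ 2 * v) * Real.exp (-(c * M / 2))) := by
  have h1 := h c (by rwa [abs_of_pos hc])
  have h2 := h (-c) (by rwa [abs_neg, abs_of_pos hc])
  set D := 8 / c ^ 2 * Real.exp (-(c * M / 2)) with hD
  have hD0 : 0 ≤ D := by positivity
  have hpt : ∀ ω, (if M < |Y ω| then Y ω ^ 2 else 0) ≤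
      D * (Real.exp (c * Y ω) + Real.exp (-c * Y ω)) := by
    intro ω
    split_ifs with hM
    · have e1 : Real.exp (c * |Y ω|) ≤ Real.exp (c * Y ω) + Real.exp (-c * Y ω) := by
        rcases abs_choice (Y ω) with h | h <;> rw [h]
        · linarith [Real.exp_pos (-c * Y ω)]
        · rw [mul_neg, ← neg_mul]; linarith [Real.exp_pos (c * Y ω)]
      have e2 : (c * |Y ω| / 2) ^ 2 / 2 ≤ Real.exp (c * |Y ω| / 2) := by
        have := Real.quadratic_le_exp_of_nonneg (x := c * |Y ω| / 2) (by positivity)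
        have : 0 ≤ c * |Y ω| / 2 := by positivity
        linarith
      have e3 : Y ω ^ 2 ≤ 8 / c ^ 2 * Real.exp (c * |Y ω| / 2) := by
        rw [div_mul_eq_mul_div, le_div_iff₀ (by positivity), ← sq_abs]
        nlinarith
      have e4 : Real.exp (c * |Y ω| / 2) ≤ Real.exp (-(c * M / 2)) * Real.exp (c * |Y ω|) := by
        rw [← Real.exp_add]
        refine Real.exp_le_exp.2 ?_
        nlinarith
      calc Y ω ^ 2 ≤ 8 / c ^ 2 * Real.exp (c * |Y ω| / 2) := e3
        _ ≤ 8 / c ^ 2 * (Real.exp (-(c * M / 2)) * Real.exp (c * |Y ω|)) := by gcongr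
        _ = D * Real.exp (c * |Y ω|) := by rw [hD]; ring
        _ ≤ _ := by gcongr
    · positivity
  calc _ ≤ ∫⁻ ω, ENNReal.ofReal (D * (Real.exp (c * Y ω) + Real.exp (-c * Y ω))) ∂P :=
        lintegral_mono fun ω => ENNReal.ofReal_le_ofReal (hpt ω)
    _ = ENNReal.ofReal (∫ ω, D * (Real.exp (c * Y ω) + Real.exp (-c * Y ω)) ∂P) := by
        refine (ofReal_integral_eq_lintegral_ofReal ((h1.1.add h2.1).const_mul D) ?_).symm
        exact ae_of_all _ fun ω => by simp only [Pi.add_apply, Pi.zero_apply]; positivity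
    _ ≤ _ := by
        refine ENNReal.ofReal_le_ofReal ?_
        rw [integral_const_mul, integral_add h1.1 h2.1]
        have h3 := h2.2
        rw [neg_sq] at h3
        calc _ ≤ D * (Real.exp (4 * c ^ 2 * v) + Real.exp (4 * c ^ 2 * v)) := by
              gcongr
              exact h1.2
          _ = _ := by rw [hD]; ring

end subexponential


end LocStat

end

/-! ### Locally stationary rows: weights and covariances -/

namespace LocStat

lemma ell_pos (κ : ℝ) (j : ℤ) : 0 < ell κ j := by
  unfold ell
  split_ifs with h
  · norm_num
  · push Not at h
    have h2 : (1 : ℝ) < |(j : ℝ)| := by exact_mod_cast h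
    exact mul_pos (by linarith) (Real.rpow_pos_of_pos (Real.log_pos h2) _)

lemma ell_neg (κ : ℝ) (j : ℤ) : ell κ (-j) = ell κ j := by simp [ell]

/-- By Cauchy condensation the series compares with `∑ (k log 2)^{-(1+κ)}`. -/
lemma summable_inv_ell {κ : ℝ} (hκ : 0 < κ) : Summable fun j : ℤ => 1 / ell κ j := by
  have hnat : Summable fun n : ℕ => 1 / ell κ (n : ℤ) := by
    rw [← summable_condensed_iff_of_eventually_nonneg]
    · have h1 : Summable fun k : ℕ => (Real.log 2 ^ (1 + κ))⁻¹ * (1 / (k : ℝ) ^ (1 + κ)) :=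
        (Real.summable_one_div_nat_rpow.2 (by linarith)).mul_left _
      refine (summable_congr_cofinite ?_).1 h1
      rw [Nat.cofinite_eq_atTop]
      filter_upwards [eventually_ge_atTop 1] with k hk
      have h2 : ¬ |((2 ^ k : ℕ) : ℤ)| ≤ 1 := by
        rw [not_le, abs_of_nonneg (by positivity)]
        exact_mod_cast Nat.one_lt_two_pow (by omega)
      have h3 : (0:ℝ) < k := by exact_mod_cast hk
      unfold ell
      rw [if_neg h2]
      push_cast
      rw [abs_of_pos (by positivity), Real.log_pow, Real.mul_rpow h3.le (Real.log_nonneg one_le_two)]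
      field_simp
    · exact Eventually.of_forall fun n => (one_div_pos.2 (ell_pos κ _)).le
    · filter_upwards [eventually_ge_atTop 2] with n hn
      have h2 : (2 : ℝ) ≤ n := by exact_mod_cast hn
      have e : ∀ m : ℕ, 2 ≤ m → ell κ (m : ℤ) = m * Real.log m ^ (1 + κ) := by
        intro m hm
        rw [ell, if_neg (by rw [not_le, abs_of_nonneg (by positivity)]; exact_mod_cast hm)]
        simp
      rw [e n hn, e (n + 1) (by omega)]
      have h3 : 0 < Real.log n := Real.log_pos (by linarith)
      have h4 : Real.log n ≤ Real.log (n + 1 : ℕ) := Real.log_le_log (by linarith) (by simp)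
      have h5 : (n : ℝ) ≤ (n + 1 : ℕ) := by simp
      have h6 : (0 : ℝ) < n := by linarith
      gcongr
  refine Summable.of_nat_of_neg hnat ?_
  simpa only [ell_neg] using hnat

lemma abs_mul_inv_ell_le {κ : ℝ} (hκ : 0 < κ) (j : ℤ) :
    |(j : ℝ)| * (1 / ell κ j) ≤ 1 + 1 / Real.log 2 ^ (1 + κ) := by
  have hl := Real.log_pos one_lt_two
  have h0 : 0 < 1 / Real.log 2 ^ (1 + κ) := by positivity
  unfold ell
  split_ifs with h
  · have : |(j : ℝ)| ≤ 1 := by exact_mod_cast h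
    linarith
  · push Not at h
    have h2 : (2 : ℝ) ≤ |(j : ℝ)| := by exact_mod_cast h
    have h3 : Real.log 2 ≤ Real.log |(j : ℝ)| := Real.log_le_log (by norm_num) h2
    have h4 : 1 / Real.log |(j : ℝ)| ^ (1 + κ) ≤ 1 / Real.log 2 ^ (1 + κ) := by gcongr
    have h5 : |(j : ℝ)| * (1 / (|(j : ℝ)| * Real.log |(j : ℝ)| ^ (1 + κ))) =
        1 / Real.log |(j : ℝ)| ^ (1 + κ) := by
      field_simp
    rw [h5]; linarith

section L2

variable {Ω : Type*} [MeasurableSpace Ω] {P : Measure Ω} [IsProbabilityMeasure P]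

/-- Absolute summability gives an `L²` limit of the series. It agrees with the almost sure limit
because `L²` convergence yields almost sure convergence along a subsequence. -/
lemma hasSum_toLp {ε : ℤ → Ω → ℝ} (hε : ∀ t, MemLp (ε t) 2 P)
    (h1 : ∀ t, ∫ ω, ε t ω ^ 2 ∂P = 1) {a : ℤ → ℝ} (ha : Summable fun i => |a i|)
    {X : Ω → ℝ} (hX : ∀ᵐ ω ∂P, HasSum (fun i => a i * ε i ω) (X ω)) :
    ∃ hm : MemLp X 2 P, HasSum (fun i => a i • (hε i).toLp (ε i)) (hm.toLp X) := by
  have hnorm : ∀ i, ‖(hε i).toLp (ε i)‖ = 1 := by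
    intro i
    have h2 : ‖(hε i).toLp (ε i)‖ ^ 2 = 1 := by
      rw [← real_inner_self_eq_norm_sq, L2.inner_def, ← h1 i]
      refine integral_congr_ae ?_
      filter_upwards [(hε i).coeFn_toLp] with ω hω
      rw [hω]; simp [sq]
    nlinarith [norm_nonneg ((hε i).toLp (ε i))]
  have hsum : Summable fun i => a i • (hε i).toLp (ε i) := by
    refine Summable.of_norm ?_
    simpa only [norm_smul, hnorm, mul_one, Real.norm_eq_abs] using ha
  set Z := ∑' i, a i • (hε i).toLp (ε i) with hZ
  have hZs : HasSum (fun i => a i • (hε i).toLp (ε i)) Z := hsum.hasSum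
  -- Almost sure subsequences require sequences, so the net of finite partial sums is first
  -- restricted to a cofinal sequence of finite sets.
  obtain ⟨u, hu⟩ := exists_seq_tendsto (atTop : Filter (Finset ℤ))
  have hconv : Tendsto (fun N => ∑ i ∈ u N, a i • (hε i).toLp (ε i)) atTop (𝓝 Z) := hZs.comp hu
  obtain ⟨ns, hns, hae⟩ := (tendstoInMeasure_of_tendsto_Lp hconv).exists_seq_tendsto_ae
  have hcoe : ∀ᵐ ω ∂P, ∀ s : Finset ℤ,
      (∑ i ∈ s, a i • (hε i).toLp (ε i) : Lp ℝ 2 P) ω = ∑ i ∈ s, a i * ε i ω := by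
    rw [ae_all_iff]
    intro s
    induction s using Finset.induction_on with
    | empty => exact Eventually.of_forall fun ω => by simp
    | insert i s hi ih =>
      rw [Finset.sum_insert hi]
      filter_upwards [ih, Lp.coeFn_add (a i • (hε i).toLp (ε i)) (∑ i ∈ s, a i • (hε i).toLp (ε i)),
        Lp.coeFn_smul (a i) ((hε i).toLp (ε i)), (hε i).coeFn_toLp] with ω h1 h2 h3 h4
      rw [h2, Finset.sum_insert hi, Pi.add_apply, h1, h3, Pi.smul_apply, h4, smul_eq_mul]
  have hXZ : X =ᵐ[P] Z := by
    filter_upwards [hX, hae, hcoe] with ω h1 h2 h3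
    simp only [h3] at h2
    have h4 := (h1.comp hu).comp hns.tendsto_atTop
    exact tendsto_nhds_unique h4 h2
  have hm : MemLp X 2 P := (memLp_congr_ae hXZ).2 (Lp.memLp Z)
  refine ⟨hm, ?_⟩
  have : hm.toLp X = Z := by
    refine Lp.ext ?_
    exact hm.coeFn_toLp.trans hXZ
  rw [this]
  exact hZs

/-- The continuous linear functionals `⟨1, ·⟩` and `⟨Y, ·⟩` on `L²` are applied termwise to the
series; orthonormality of the noise identifies `⟨Y, εᵢ⟩` with the coefficient `bᵢ`. -/
lemma integral_mul_of_hasSum {ε : ℤ → Ω → ℝ} (hε : ∀ t, MemLp (ε t) 2 P)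
    (h0 : ∀ t, ∫ ω, ε t ω ∂P = 0) (horth : ∀ s t, s ≠ t → ∫ ω, ε s ω * ε t ω ∂P = 0)
    (h1 : ∀ t, ∫ ω, ε t ω ^ 2 ∂P = 1)
    {a b : ℤ → ℝ} (ha : Summable fun i => |a i|) (hb : Summable fun i => |b i|) {X Y : Ω → ℝ}
    (hX : ∀ᵐ ω ∂P, HasSum (fun i => a i * ε i ω) (X ω))
    (hY : ∀ᵐ ω ∂P, HasSum (fun i => b i * ε i ω) (Y ω)) :
    MemLp X 2 P ∧ ∫ ω, X ω ∂P = 0 ∧ HasSum (fun i => a i * b i) (∫ ω, X ω * Y ω ∂P) := by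
  obtain ⟨hXm, hXs⟩ := hasSum_toLp hε h1 ha hX
  obtain ⟨hYm, hYs⟩ := hasSum_toLp hε h1 hb hY
  have hin : ∀ {U V : Ω → ℝ} (hU : MemLp U 2 P) (hV : MemLp V 2 P),
      inner ℝ (hU.toLp U) (hV.toLp V) = ∫ ω, U ω * V ω ∂P := by
    intro U V hU hV
    rw [L2.inner_def]
    refine integral_congr_ae ?_
    filter_upwards [hU.coeFn_toLp, hV.coeFn_toLp] with ω h1 h2
    rw [h1, h2]; simp [mul_comm]
  refine ⟨hXm, ?_, ?_⟩
  · have hc : MemLp (fun _ : Ω => (1 : ℝ)) 2 P := memLp_const 1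
    have h2 := hXs.mapL (innerSL ℝ (hc.toLp _))
    simp only [innerSL_apply_apply, inner_smul_right, hin, one_mul, h0, mul_zero] at h2
    exact h2.unique hasSum_zero
  · have hY2 : ∀ i, ∫ ω, ε i ω * Y ω ∂P = b i := by
      intro i
      have h2 := hYs.mapL (innerSL ℝ ((hε i).toLp _))
      simp only [innerSL_apply_apply, inner_smul_right, hin] at h2
      refine h2.unique ?_
      have h3 := hasSum_single (f := fun j => b j * ∫ ω, ε i ω * ε j ω ∂P) i
        (fun j hj => by rw [horth i j hj.symm, mul_zero])
      simpa only [← sq, h1, mul_one] using h3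
    have h2 := hXs.mapL (innerSL ℝ (hYm.toLp _))
    simp only [innerSL_apply_apply, inner_smul_right, hin] at h2
    have h3 : ∀ i, ∫ ω, Y ω * ε i ω ∂P = b i := fun i => by
      rw [← hY2 i]; exact integral_congr_ae (ae_of_all _ fun ω => mul_comm _ _)
    simp only [h3] at h2
    rwa [show (∫ ω, X ω * Y ω ∂P) = ∫ ω, Y ω * X ω ∂P from
      integral_congr_ae (ae_of_all _ fun ω => mul_comm _ _)]

end L2

/-- The array `X` consists of linear combinations of an orthonormal noise sequence, with coefficient
bounds expressed through a summable weight `w`. -/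
structure LinearRows {Ω : Type*} [MeasurableSpace Ω] (P : Measure Ω) (X : ℕ → ℤ → Ω → ℝ)
    (a : ℝ → ℤ → ℝ) (w : ℤ → ℝ) (K : ℝ) (α : ℕ → ℤ → ℤ → ℝ) : Prop where
  K_pos : 0 < K
  w_nonneg : ∀ j, 0 ≤ w j
  summable : Summable w
  w_decay : ∀ j : ℤ, |(j : ℝ)| * w j ≤ K
  memLp : ∀ n : ℕ, ∀ t ∈ Icc (1 : ℤ) n, MemLp (X n t) 2 P
  mean : ∀ n : ℕ, ∀ t ∈ Icc (1 : ℤ) n, ∫ ω, X n t ω ∂P = 0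
  cov : ∀ n : ℕ, ∀ s ∈ Icc (1 : ℤ) n, ∀ r ∈ Icc (1 : ℤ) n,
    HasSum (fun i => α n s (s - i) * α n r (r - i)) (∫ ω, X n s ω * X n r ω ∂P)
  coef_le : ∀ n : ℕ, ∀ t ∈ Icc (1 : ℤ) n, ∀ j, |α n t j| ≤ w j
  limit_le : ∀ u ∈ Ioc (0 : ℝ) 1, ∀ j, |a u j| ≤ w j
  coef_sub_le : ∀ n : ℕ, ∀ j, ∑ t ∈ Finset.Icc (1 : ℤ) n, |α n t j - a ((t : ℝ) / n) j| ≤ K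
  variation_le : ∀ j, eVariationOn (fun u => a u j) (Ioc 0 1) ≤ ENNReal.ofReal (w j)

lemma IsLocallyStationary.linearRows {Ω : Type*} [MeasurableSpace Ω] {P : Measure Ω}
    [IsProbabilityMeasure P] {X : ℕ → ℤ → Ω → ℝ} {a : ℝ → ℤ → ℝ}
    (h : IsLocallyStationary P X a) : ∃ w K α, LinearRows P X a w K α := by
  obtain ⟨κ, K, α, ε, hκ, hε, -, h0, horth, h1, hX, hα, ha, hαa, hV⟩ := h
  have hK : 0 ≤ K := by
    have h2 := (abs_nonneg _).trans (ha 1 (by norm_num) 0)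
    have h3 : ell κ 0 = 1 := by simp [ell]
    simpa [h3] using h2
  have hl := Real.log_pos one_lt_two
  set D := 1 + 1 / Real.log 2 ^ (1 + κ) with hD
  have hD1 : 1 ≤ D := by
    have : 0 < 1 / Real.log 2 ^ (1 + κ) := by positivity
    linarith
  have hw0 : ∀ j, 0 ≤ K / ell κ j := fun j => div_nonneg hK (ell_pos κ j).le
  have hws : Summable fun j => K / ell κ j := by
    simpa only [mul_one_div] using (summable_inv_ell hκ).mul_left K
  have hαs : ∀ n : ℕ, ∀ t ∈ Icc (1 : ℤ) n, Summable fun i => |α n t (t - i)| := by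
    intro n t ht
    have h2 : Summable fun j => |α n t j| :=
      Summable.of_nonneg_of_le (fun j => abs_nonneg _) (hα n t ht) hws
    exact (Equiv.subLeft t).summable_iff.2 h2
  have hXs : ∀ n : ℕ, ∀ t ∈ Icc (1 : ℤ) n,
      ∀ᵐ ω ∂P, HasSum (fun i => α n t (t - i) * ε i ω) (X n t ω) := by
    intro n t ht
    filter_upwards [hX n t ht] with ω hω
    have h2 := (Equiv.subLeft t).hasSum_iff.2 hω
    simpa [Function.comp_def] using h2
  -- `D` bounds `|j| / ℓ(j)`. The enlarged constant serves at once for the decay of the weight and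
  -- for the coefficient differences, and the summand `1` makes it positive.
  refine ⟨fun j => K / ell κ j, K * D + 1, α, ⟨by positivity, hw0, hws, ?_, ?_, ?_, ?_, hα, ha, ?_,
    hV⟩⟩
  · intro j
    have h2 := mul_le_mul_of_nonneg_left (abs_mul_inv_ell_le hκ j) hK
    calc |(j : ℝ)| * (K / ell κ j) = K * (|(j : ℝ)| * (1 / ell κ j)) := by ring
      _ ≤ _ := by linarith
  · exact fun n t ht => (integral_mul_of_hasSum hε h0 horth h1 (hαs n t ht) (hαs n t ht)
      (hXs n t ht) (hXs n t ht)).1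
  · exact fun n t ht => (integral_mul_of_hasSum hε h0 horth h1 (hαs n t ht) (hαs n t ht)
      (hXs n t ht) (hXs n t ht)).2.1
  · exact fun n s hs r hr => (integral_mul_of_hasSum hε h0 horth h1 (hαs n s hs) (hαs n r hr)
      (hXs n s hs) (hXs n r hr)).2.2
  · intro n j
    exact (hαa n j).trans (by nlinarith)

namespace LinearRows

variable {Ω : Type*} [MeasurableSpace Ω] {P : Measure Ω} {X : ℕ → ℤ → Ω → ℝ} {a : ℝ → ℤ → ℝ}
  {w : ℤ → ℝ} {K : ℝ} {α : ℕ → ℤ → ℤ → ℝ}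

/-- Each covariance is dominated by a convolution of the weights, and summing a convolution over one
argument gives at most `(∑ w)²`. -/
lemma sum_abs_cov_le (h : LinearRows P X a w K α) {n : ℕ} {s : ℤ} (hs : s ∈ Icc (1 : ℤ) n) :
    ∑ r ∈ Finset.Icc (1 : ℤ) n, |∫ ω, X n s ω * X n r ω ∂P| ≤ (∑' j, w j) ^ 2 := by
  have hsw : Summable fun i => w (s - i) := (Equiv.subLeft s).summable_iff.2 h.summable
  have hterm : ∀ r ∈ Finset.Icc (1 : ℤ) n, Summable (fun i => w (s - i) * w (r - i)) ∧
      |∫ ω, X n s ω * X n r ω ∂P| ≤ ∑' i, w (s - i) * w (r - i) := by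
    intro r hr
    rw [Finset.mem_Icc] at hr
    have hsum : Summable (fun i => w (s - i) * w (r - i)) := by
      refine Summable.of_nonneg_of_le (fun i => mul_nonneg (h.w_nonneg _) (h.w_nonneg _))
        (fun i => ?_) (hsw.mul_right (∑' j, w j))
      exact mul_le_mul_of_nonneg_left (h.summable.le_tsum _ fun j _ => h.w_nonneg j) (h.w_nonneg _)
    refine ⟨hsum, ?_⟩
    rw [← (h.cov n s hs r hr).tsum_eq, ← Real.norm_eq_abs]
    refine tsum_of_norm_bounded hsum.hasSum fun i => ?_
    rw [Real.norm_eq_abs, abs_mul]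
    exact mul_le_mul (h.coef_le n s hs _) (h.coef_le n r hr _) (abs_nonneg _) (h.w_nonneg _)
  calc _ ≤ ∑ r ∈ Finset.Icc (1 : ℤ) n, ∑' i, w (s - i) * w (r - i) :=
        Finset.sum_le_sum fun r hr => (hterm r hr).2
    _ = ∑' i, ∑ r ∈ Finset.Icc (1 : ℤ) n, w (s - i) * w (r - i) :=
        (Summable.tsum_finsetSum fun r hr => (hterm r hr).1).symm
    _ ≤ ∑' i, w (s - i) * ∑' j, w j := by
        refine Summable.tsum_le_tsum (fun i => ?_) (summable_sum fun r hr => (hterm r hr).1)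
          (hsw.mul_right _)
        rw [← Finset.mul_sum]
        refine mul_le_mul_of_nonneg_left ?_ (h.w_nonneg _)
        have h2 := h.summable.sum_le_tsum
          ((Finset.Icc (1 : ℤ) n).map (Equiv.subRight i).toEmbedding) fun j _ => h.w_nonneg j
        simpa using h2
    _ = (∑' j, w j) ^ 2 := by
        rw [tsum_mul_right, sq]
        congr 1
        exact (Equiv.subLeft s).tsum_eq w

/-- Schur's test: the operator norm of the symmetric covariance matrix is at most its largest
absolute row sum. -/
lemma integral_sq_le (h : LinearRows P X a w K α) (n : ℕ) (c : ℤ → ℝ) :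
    ∫ ω, (∑ t ∈ Finset.Icc (1 : ℤ) n, c t * X n t ω) ^ 2 ∂P ≤
      (∑' j, w j) ^ 2 * ∑ t ∈ Finset.Icc (1 : ℤ) n, c t ^ 2 := by
  set I := Finset.Icc (1 : ℤ) n
  have hI : ∀ t ∈ I, t ∈ Icc (1 : ℤ) n := fun t ht => by simpa [I] using ht
  have hint : ∀ s ∈ I, ∀ r ∈ I, Integrable (fun ω => X n s ω * X n r ω) P := fun s hs r hr =>
    (h.memLp n s (hI s hs)).integrable_mul (h.memLp n r (hI r hr))
  have h1 : ∀ ω, (∑ t ∈ I, c t * X n t ω) ^ 2 =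
      ∑ s ∈ I, ∑ r ∈ I, (c s * c r) * (X n s ω * X n r ω) := by
    intro ω
    rw [sq, Finset.sum_mul_sum]
    exact Finset.sum_congr rfl fun i _ => Finset.sum_congr rfl fun j _ => by ring
  simp_rw [h1]
  rw [integral_finsetSum _ fun s hs => integrable_finsetSum _ fun r hr =>
    (hint s hs r hr).const_mul _]
  have h2 : ∀ s ∈ I, ∫ ω, ∑ r ∈ I, (c s * c r) * (X n s ω * X n r ω) ∂P =
      ∑ r ∈ I, (c s * c r) * ∫ ω, X n s ω * X n r ω ∂P := by
    intro s hs
    rw [integral_finsetSum _ fun r hr => (hint s hs r hr).const_mul _]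
    exact Finset.sum_congr rfl fun r _ => integral_const_mul _ _
  rw [Finset.sum_congr rfl h2]
  set γ : ℤ → ℤ → ℝ := fun s r => |∫ ω, X n s ω * X n r ω ∂P| with hγ
  have hγs : ∀ s r, γ s r = γ r s := fun s r => by
    simp only [hγ]; congr 1; exact integral_congr_ae (ae_of_all _ fun ω => mul_comm _ _)
  calc _ ≤ ∑ s ∈ I, ∑ r ∈ I, (c s ^ 2 / 2 * γ s r + c r ^ 2 / 2 * γ s r) := by
        refine Finset.sum_le_sum fun s _ => Finset.sum_le_sum fun r _ => ?_
        refine (le_abs_self _).trans ?_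
        rw [abs_mul, ← add_mul]
        refine mul_le_mul_of_nonneg_right ?_ (abs_nonneg _)
        rw [abs_mul]
        nlinarith [sq_nonneg (|c s| - |c r|), sq_abs (c s), sq_abs (c r)]
    _ = ∑ s ∈ I, c s ^ 2 * ∑ r ∈ I, γ s r := by
        simp only [Finset.sum_add_distrib]
        have h3 : ∑ s ∈ I, ∑ r ∈ I, c r ^ 2 / 2 * γ s r = ∑ s ∈ I, ∑ r ∈ I, c s ^ 2 / 2 * γ s r := by
          rw [Finset.sum_comm]
          exact Finset.sum_congr rfl fun s _ => Finset.sum_congr rfl fun r _ => by rw [hγs]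
        rw [h3, ← Finset.sum_add_distrib]
        refine Finset.sum_congr rfl fun s _ => ?_
        rw [← Finset.sum_add_distrib, Finset.mul_sum]
        exact Finset.sum_congr rfl fun r _ => by ring
    _ ≤ ∑ s ∈ I, c s ^ 2 * (∑' j, w j) ^ 2 :=
        Finset.sum_le_sum fun s hs =>
          mul_le_mul_of_nonneg_left (h.sum_abs_cov_le (hI s hs)) (sq_nonneg _)
    _ = _ := by rw [← Finset.sum_mul, mul_comm]

end LinearRows

end LocStat

/-! ### Quadratic forms with a symbol and the norms of their matrices -/

namespace LocStat

/-- The `t`-th of the `n` equal cells of `(0, 1]`. -/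
noncomputable def cell (n : ℕ) (t : ℤ) : Set ℝ := Ioc (((t : ℝ) - 1) / n) ((t : ℝ) / n)

/-- `∑ₖ sup_u |β(u, k)|` -/
noncomputable def symSup (β : ℝ → ℤ → ℝ) : ℝ≥0∞ := ∑' k : ℤ, ⨆ u ∈ Ioc (0 : ℝ) 1, ‖β u k‖ₑ

/-- `∑ₖ V(β(·, k))` -/
noncomputable def symVar (β : ℝ → ℤ → ℝ) : ℝ≥0∞ := ∑' k : ℤ, eVariationOn (fun u => β u k) (Ioc 0 1)

/-- `∑ₖ ∫ β(u, k)² du` -/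
noncomputable def symSq (β : ℝ → ℤ → ℝ) : ℝ≥0∞ := ∑' k : ℤ, ∫⁻ u in Ioc (0 : ℝ) 1, ‖β u k‖ₑ ^ 2

/-- The quadratic form `∑ c(s, r) X_s X_r`. -/
noncomputable def quadForm {Ω : Type*} (X : ℕ → ℤ → Ω → ℝ) (n : ℕ) (c : ℤ → ℤ → ℝ) (ω : Ω) : ℝ :=
  ∑ s ∈ Finset.Icc (1 : ℤ) n, ∑ r ∈ Finset.Icc (1 : ℤ) n, c s r * (X n s ω * X n r ω)

/-- The coefficients of the quadratic form with symbol `β`. -/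
noncomputable def quadCoef (n : ℕ) (β : ℝ → ℤ → ℝ) (s r : ℤ) : ℝ := ∫ u in cell n ((s + r) / 2), β u (s - r)

/-- The centred quadratic form with symbol `β`. -/
noncomputable def centredForm {Ω : Type*} [MeasurableSpace Ω] (P : Measure Ω) (X : ℕ → ℤ → Ω → ℝ) (n : ℕ)
    (β : ℝ → ℤ → ℝ) (ω : Ω) : ℝ :=
  quadForm X n (quadCoef n β) ω - ∫ ω', quadForm X n (quadCoef n β) ω' ∂P

section cells

variable {n : ℕ}

lemma measurableSet_cell (t : ℤ) : MeasurableSet (cell n t) := measurableSet_Ioc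

lemma volume_cell (t : ℤ) : volume (cell n t) = ENNReal.ofReal (1 / n) := by
  rw [cell, Real.volume_Ioc]; congr 1; ring

lemma mem_cell_iff (hn : 0 < n) {t : ℤ} {u : ℝ} : u ∈ cell n t ↔ ⌈(n : ℝ) * u⌉ = t := by
  have hn' : (0 : ℝ) < n := by exact_mod_cast hn
  rw [cell, mem_Ioc, Int.ceil_eq_iff, div_lt_iff₀ hn', le_div_iff₀ hn', mul_comm]

lemma iUnion_cell (hn : 0 < n) : ⋃ t ∈ Finset.Icc (1 : ℤ) n, cell n t = Ioc 0 1 := by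
  have hn' : (0 : ℝ) < n := by exact_mod_cast hn
  ext u
  simp only [mem_iUnion, exists_prop, mem_cell_iff hn, exists_eq_right', Finset.mem_Icc]
  rw [Int.one_le_ceil_iff, Int.ceil_le, mem_Ioc]
  constructor
  · rintro ⟨h1, h2⟩
    exact ⟨pos_of_mul_pos_right h1 hn'.le, by push_cast at h2; nlinarith⟩
  · rintro ⟨h1, h2⟩
    exact ⟨by positivity, by push_cast; nlinarith⟩

lemma cell_subset (hn : 0 < n) {t : ℤ} (ht : t ∈ Finset.Icc (1 : ℤ) n) : cell n t ⊆ Ioc 0 1 := by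
  rw [← iUnion_cell hn]
  exact subset_biUnion_of_mem (u := fun t => cell n t) ht

lemma pairwiseDisjoint_cell (hn : 0 < n) (S : Set ℤ) : S.PairwiseDisjoint (cell n) := by
  intro s _ t _ hst
  refine Set.disjoint_left.2 fun u hu hv => hst ?_
  rw [mem_cell_iff hn] at hu hv
  rw [← hu, ← hv]

lemma sum_lintegral_cell (hn : 0 < n) (f : ℝ → ℝ≥0∞) :
    ∑ t ∈ Finset.Icc (1 : ℤ) n, ∫⁻ u in cell n t, f u = ∫⁻ u in Ioc (0 : ℝ) 1, f u := by
  rw [← iUnion_cell hn, lintegral_biUnion_finset (pairwiseDisjoint_cell hn _)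
    fun t _ => measurableSet_cell t]

lemma sum_integral_cell (hn : 0 < n) {f : ℝ → ℝ} (hf : IntegrableOn f (Ioc 0 1)) :
    ∑ t ∈ Finset.Icc (1 : ℤ) n, ∫ u in cell n t, f u = ∫ u in Ioc (0 : ℝ) 1, f u := by
  rw [← iUnion_cell hn, integral_biUnion_finset _ (fun t _ => measurableSet_cell t)
    (pairwiseDisjoint_cell hn _)]
  exact fun t ht => hf.mono_set (cell_subset hn ht)

lemma div_mem_cell (hn : 0 < n) (t : ℤ) : (t : ℝ) / n ∈ cell n t := by
  have hn' : (n : ℝ) ≠ 0 := by exact_mod_cast hn.ne'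
  rw [mem_cell_iff hn, mul_div_cancel₀ _ hn', Int.ceil_intCast]

/-- The variations over the cells add up to at most the total variation. -/
lemma sum_eVariationOn_cell_le {E : Type*} [PseudoEMetricSpace E] (hn : 0 < n) (g : ℝ → E) :
    ∑ t ∈ Finset.Icc (1 : ℤ) n, eVariationOn g (cell n t) ≤ eVariationOn g (Ioc 0 1) := by
  have hn' : (0 : ℝ) < n := by exact_mod_cast hn
  have key : ∀ m : ℕ, ∑ t ∈ Finset.Icc (1 : ℤ) m, eVariationOn g (cell n t) ≤
      eVariationOn g (Ioc 0 ((m : ℝ) / n)) := by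
    intro m
    induction m with
    | zero => simp
    | succ m ih =>
      have h1 : Finset.Icc (1 : ℤ) (m + 1 : ℕ) = insert ((m : ℤ) + 1) (Finset.Icc (1 : ℤ) m) := by
        ext t; simp only [Finset.mem_Icc, Finset.mem_insert]; push_cast; omega
      rw [h1, Finset.sum_insert (by simp), add_comm]
      refine (add_le_add ih le_rfl).trans ?_
      refine (eVariationOn.add_le_union g ?_).trans (eVariationOn.mono g ?_)
      · intro x hx y hy
        refine hx.2.trans ?_
        simpa [cell] using hy.1.le
      · have h2 : (m : ℝ) / n ≤ ((m + 1 : ℕ) : ℝ) / n := by gcongr; simp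
        have h3 : (0 : ℝ) ≤ (m : ℝ) / n := by positivity
        rintro x (hx | hx)
        · exact ⟨hx.1, hx.2.trans h2⟩
        · simp only [cell, mem_Ioc] at hx
          push_cast at hx h2 ⊢
          rw [add_sub_cancel_right] at hx
          exact ⟨h3.trans_lt hx.1, hx.2⟩
  have h := key n
  rwa [div_self hn'.ne'] at h

/-- Pairs `(s, r)` are determined by `⌊(s + r) / 2⌋` and `s - r`. -/
lemma sum_pairs_le (n : ℕ) (g : ℤ → ℤ → ℝ≥0∞) :
    ∑ s ∈ Finset.Icc (1 : ℤ) n, ∑ r ∈ Finset.Icc (1 : ℤ) n, g ((s + r) / 2) (s - r) ≤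
      ∑ t ∈ Finset.Icc (1 : ℤ) n, ∑ k ∈ Finset.Icc (-(n : ℤ)) n, g t k := by
  rw [← Finset.sum_product', ← Finset.sum_product']
  -- `s + r` and `s - r` have the same parity, so the lag restores the bit lost by the floor.
  have hinj : Set.InjOn (fun p : ℤ × ℤ => ((p.1 + p.2) / 2, p.1 - p.2))
      (Finset.Icc (1 : ℤ) n ×ˢ Finset.Icc (1 : ℤ) n : Finset (ℤ × ℤ)) := by
    rintro ⟨s, r⟩ - ⟨s', r'⟩ - h
    simp only [Prod.mk.injEq] at h ⊢
    omega
  rw [← Finset.sum_image (f := fun q : ℤ × ℤ => g q.1 q.2) hinj]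
  refine Finset.sum_le_sum_of_subset ?_
  rintro ⟨t, k⟩ h
  simp only [Finset.mem_image, Finset.mem_product, Finset.mem_Icc, Prod.exists, Prod.mk.injEq] at h ⊢
  obtain ⟨s, r, h1, h2, h3⟩ := h
  omega

lemma half_sum_mem {s r : ℤ} (hs : s ∈ Finset.Icc (1 : ℤ) n) (hr : r ∈ Finset.Icc (1 : ℤ) n) :
    (s + r) / 2 ∈ Finset.Icc (1 : ℤ) n := by
  simp only [Finset.mem_Icc] at *; omega

end cells

section symbolBounds

variable {β : ℝ → ℤ → ℝ} {n : ℕ} {D R : ℝ}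

lemma enorm_setIntegral_sq_le (f : ℝ → ℝ) (hf : Measurable f) (t : ℤ) :
    ‖∫ u in cell n t, f u‖ₑ ^ 2 ≤ ENNReal.ofReal (1 / n) * ∫⁻ u in cell n t, ‖f u‖ₑ ^ 2 := by
  have h1 : ‖∫ u in cell n t, f u‖ₑ ≤ ∫⁻ u in cell n t, ‖f u‖ₑ := enorm_integral_le_lintegral_enorm _
  have h2 := ENNReal.lintegral_mul_le_Lp_mul_Lq (volume.restrict (cell n t))
    Real.HolderConjugate.two_two (f := fun _ => 1) (g := fun u => ‖f u‖ₑ) (by fun_prop)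
    (by fun_prop)
  simp only [Pi.mul_apply, one_mul, ENNReal.one_rpow, lintegral_one, Measure.restrict_apply_univ,
    volume_cell] at h2
  calc _ ≤ (ENNReal.ofReal (1 / n) ^ (1 / 2 : ℝ) *
        (∫⁻ u in cell n t, ‖f u‖ₑ ^ (2 : ℝ)) ^ (1 / 2 : ℝ)) ^ 2 := by
        gcongr; exact h1.trans h2
    _ = _ := by
        rw [mul_pow, ← ENNReal.rpow_natCast, ← ENNReal.rpow_natCast, ← ENNReal.rpow_mul,
          ← ENNReal.rpow_mul]
        norm_num

/-- This is the Hilbert–Schmidt norm of the form. Cauchy–Schwarz on a cell of length `1/n` supplies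
the factor `1/n`, and the cells at a fixed lag are disjoint. -/
lemma sum_quadCoef_sq_le (hn : 0 < n) (hβ : ∀ k, Measurable fun u => β u k)
    (hD : symSq β ≤ ENNReal.ofReal (D ^ 2)) :
    ∑ s ∈ Finset.Icc (1 : ℤ) n, ∑ r ∈ Finset.Icc (1 : ℤ) n, quadCoef n β s r ^ 2 ≤ D ^ 2 / n := by
  have hn' : (0 : ℝ) < n := by exact_mod_cast hn
  rw [← ENNReal.ofReal_le_ofReal_iff (by positivity),
    ENNReal.ofReal_sum_of_nonneg fun s _ => Finset.sum_nonneg fun r _ => sq_nonneg _]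
  simp_rw [fun s => ENNReal.ofReal_sum_of_nonneg (s := Finset.Icc (1 : ℤ) n)
    (f := fun r => quadCoef n β s r ^ 2) fun r _ => sq_nonneg _]
  have h1 : ∀ s r, ENNReal.ofReal (quadCoef n β s r ^ 2) ≤
      ENNReal.ofReal (1 / n) * ∫⁻ u in cell n ((s + r) / 2), ‖β u (s - r)‖ₑ ^ 2 := by
    intro s r
    refine le_trans (le_of_eq ?_) (enorm_setIntegral_sq_le (fun u => β u (s - r)) (hβ _) _)
    rw [← sq_abs, ENNReal.ofReal_pow (abs_nonneg _), ← Real.enorm_eq_ofReal_abs]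
    rfl
  calc _ ≤ ∑ s ∈ Finset.Icc (1 : ℤ) n, ∑ r ∈ Finset.Icc (1 : ℤ) n,
        ENNReal.ofReal (1 / n) * ∫⁻ u in cell n ((s + r) / 2), ‖β u (s - r)‖ₑ ^ 2 :=
        Finset.sum_le_sum fun s _ => Finset.sum_le_sum fun r _ => h1 s r
    _ ≤ ∑ t ∈ Finset.Icc (1 : ℤ) n, ∑ k ∈ Finset.Icc (-(n : ℤ)) n,
        ENNReal.ofReal (1 / n) * ∫⁻ u in cell n t, ‖β u k‖ₑ ^ 2 :=
        sum_pairs_le n fun t k => ENNReal.ofReal (1 / n) * ∫⁻ u in cell n t, ‖β u k‖ₑ ^ 2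
    _ = ENNReal.ofReal (1 / n) * ∑ k ∈ Finset.Icc (-(n : ℤ)) n, ∫⁻ u in Ioc (0 : ℝ) 1, ‖β u k‖ₑ ^ 2 := by
        rw [Finset.sum_comm, Finset.mul_sum]
        refine Finset.sum_congr rfl fun k _ => ?_
        rw [← Finset.mul_sum, sum_lintegral_cell hn]
    _ ≤ ENNReal.ofReal (1 / n) * ENNReal.ofReal (D ^ 2) := by
        gcongr
        exact (ENNReal.sum_le_tsum _).trans hD
    _ = _ := by
        rw [← ENNReal.ofReal_mul (by positivity)]; congr 1; ring

lemma ofReal_abs_quadCoef_le (hn : 0 < n) {s r : ℤ} (hs : s ∈ Finset.Icc (1 : ℤ) n)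
    (hr : r ∈ Finset.Icc (1 : ℤ) n) : ENNReal.ofReal |quadCoef n β s r| ≤
      ENNReal.ofReal (1 / n) * ⨆ u ∈ Ioc (0 : ℝ) 1, ‖β u (s - r)‖ₑ := by
  rw [← Real.enorm_eq_ofReal_abs]
  calc _ ≤ ∫⁻ u in cell n ((s + r) / 2), ‖β u (s - r)‖ₑ := enorm_integral_le_lintegral_enorm _
    _ ≤ ∫⁻ u in cell n ((s + r) / 2), ⨆ u ∈ Ioc (0 : ℝ) 1, ‖β u (s - r)‖ₑ := by
        refine setLIntegral_mono measurable_const fun u hu => ?_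
        exact le_biSup (fun u => ‖β u (s - r)‖ₑ) (cell_subset hn (half_sum_mem hs hr) hu)
    _ = _ := by rw [setLIntegral_const, volume_cell, mul_comm]

/-- Schur's test: along a row or a column every lag occurs at most once, and an entry is at most
`1/n` times the supremum of the symbol at its lag. -/
lemma abs_quadCoef_form_le (hn : 0 < n) (hR : symSup β ≤ ENNReal.ofReal R) (hR0 : 0 ≤ R)
    (x : ℤ → ℝ) :
    |∑ s ∈ Finset.Icc (1 : ℤ) n, ∑ r ∈ Finset.Icc (1 : ℤ) n, quadCoef n β s r * (x s * x r)| ≤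
      R / n * ∑ s ∈ Finset.Icc (1 : ℤ) n, x s ^ 2 := by
  set I := Finset.Icc (1 : ℤ) n
  have hn' : (0 : ℝ) < n := by exact_mod_cast hn
  have hsum : ∀ (J : Finset ℤ), ∑ k ∈ J, ENNReal.ofReal (1 / n) *
      (⨆ u ∈ Ioc (0 : ℝ) 1, ‖β u k‖ₑ) ≤ ENNReal.ofReal (R / n) := by
    intro J
    rw [← Finset.mul_sum]
    calc _ ≤ ENNReal.ofReal (1 / n) * ENNReal.ofReal R := by
          gcongr; exact (ENNReal.sum_le_tsum _).trans hR
      _ = _ := by rw [← ENNReal.ofReal_mul (by positivity)]; congr 1; ring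
  have hrow : ∀ s ∈ I, ∑ r ∈ I, |quadCoef n β s r| ≤ R / n := by
    intro s hs
    rw [← ENNReal.ofReal_le_ofReal_iff (by positivity),
      ENNReal.ofReal_sum_of_nonneg fun r _ => abs_nonneg _]
    refine (Finset.sum_le_sum fun r hr => ofReal_abs_quadCoef_le hn hs hr).trans ?_
    have := hsum (I.map (Equiv.subLeft s).toEmbedding)
    simpa using this
  have hcol : ∀ r ∈ I, ∑ s ∈ I, |quadCoef n β s r| ≤ R / n := by
    intro r hr
    rw [← ENNReal.ofReal_le_ofReal_iff (by positivity),
      ENNReal.ofReal_sum_of_nonneg fun r _ => abs_nonneg _]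
    refine (Finset.sum_le_sum fun s hs => ofReal_abs_quadCoef_le hn hs hr).trans ?_
    have := hsum (I.map (Equiv.subRight r).toEmbedding)
    simpa using this
  calc _ ≤ ∑ s ∈ I, ∑ r ∈ I, |quadCoef n β s r| * (x s ^ 2 / 2 + x r ^ 2 / 2) := by
        refine (Finset.abs_sum_le_sum_abs _ _).trans (Finset.sum_le_sum fun s _ => ?_)
        refine (Finset.abs_sum_le_sum_abs _ _).trans (Finset.sum_le_sum fun r _ => ?_)
        rw [abs_mul]
        refine mul_le_mul_of_nonneg_left ?_ (abs_nonneg _)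
        rw [abs_mul]
        nlinarith [sq_nonneg (|x s| - |x r|), sq_abs (x s), sq_abs (x r)]
    _ = ∑ s ∈ I, x s ^ 2 / 2 * ∑ r ∈ I, |quadCoef n β s r| +
        ∑ r ∈ I, x r ^ 2 / 2 * ∑ s ∈ I, |quadCoef n β s r| := by
        simp only [mul_add, Finset.sum_add_distrib, Finset.mul_sum]
        congr 1
        · exact Finset.sum_congr rfl fun s _ => Finset.sum_congr rfl fun r _ => by ring
        · rw [Finset.sum_comm]
          exact Finset.sum_congr rfl fun s _ => Finset.sum_congr rfl fun r _ => by ring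
    _ ≤ ∑ s ∈ I, x s ^ 2 / 2 * (R / n) + ∑ r ∈ I, x r ^ 2 / 2 * (R / n) := by
        gcongr with s hs r hr
        · exact hrow s hs
        · exact hcol r hr
    _ = _ := by rw [← Finset.sum_mul, ← Finset.sum_div]; ring

/-- By Cauchy–Schwarz the Hilbert–Schmidt norm bounds the operator norm. This serves where no good
bound for the supremum of the symbol is available. -/
lemma abs_form_le_of_sum_sq_le {I : Finset ℤ} {c : ℤ → ℤ → ℝ} {b : ℝ} (hb : 0 ≤ b)
    (hc : ∑ s ∈ I, ∑ r ∈ I, c s r ^ 2 ≤ b ^ 2) (x : ℤ → ℝ) :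
    |∑ s ∈ I, ∑ r ∈ I, c s r * (x s * x r)| ≤ b * ∑ s ∈ I, x s ^ 2 := by
  have h0 : 0 ≤ ∑ s ∈ I, x s ^ 2 := Finset.sum_nonneg fun s _ => sq_nonneg _
  refine abs_le_of_sq_le_sq ?_ (by positivity)
  rw [← Finset.sum_product', mul_pow]
  have h := Finset.sum_mul_sq_le_sq_mul_sq (I ×ˢ I) (fun p : ℤ × ℤ => c p.1 p.2)
    (fun p : ℤ × ℤ => x p.1 * x p.2)
  refine h.trans ?_
  have h2 : ∑ p ∈ I ×ˢ I, (x p.1 * x p.2) ^ 2 = (∑ s ∈ I, x s ^ 2) ^ 2 := by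
    rw [sq, Finset.sum_mul_sum, Finset.sum_product]
    simp only [mul_pow]
  rw [h2, Finset.sum_product]
  gcongr

end symbolBounds

end LocStat

/-! ### Deviation inequalities for the observed rows -/

namespace LocStat

variable {Ω : Type*} [MeasurableSpace Ω] {P : Measure Ω} {X : ℕ → ℤ → Ω → ℝ} {a : ℝ → ℤ → ℝ}
  {w : ℤ → ℝ} {K : ℝ} {α : ℕ → ℤ → ℤ → ℝ} {n : ℕ}

/-- A bound for the operator norms of the covariance matrices. -/
noncomputable def covBound (w : ℤ → ℝ) : ℝ := (∑' j, w j) ^ 2 + 1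

lemma one_le_covBound (w : ℤ → ℝ) : 1 ≤ covBound w := by
  unfold covBound; nlinarith [sq_nonneg (∑' j, w j)]

lemma sum_Icc_subtype {M : Type*} [AddCommMonoid M] (n : ℕ) (g : ℤ → M) :
    ∑ i : Icc (1 : ℤ) (n : ℤ), g i = ∑ t ∈ Finset.Icc (1 : ℤ) n, g t :=
  (Finset.sum_subtype (Finset.Icc (1 : ℤ) n) (p := fun t => t ∈ Icc (1 : ℤ) (n : ℤ))
    (fun t => by simp) g).symm

lemma hasGaussianLaw_row {T : Type*} [Fintype T] {Y : T → Ω → ℝ} (hY : IsGaussianProcess Y P) :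
    HasGaussianLaw (fun ω i => Y i ω) P := by
  have h := hY.hasGaussianLaw Finset.univ
  exact h.map_fun (ContinuousLinearMap.pi fun i : T =>
    ContinuousLinearMap.proj (R := ℝ) (φ := fun _ : (Finset.univ : Finset T) => ℝ)
      ⟨i, Finset.mem_univ i⟩)

section mgf

variable (h : LinearRows P X a w K α)
  (hG : IsGaussianProcess (fun (t : Icc (1 : ℤ) (n : ℤ)) (ω : Ω) => X n t ω) P)

include h hG

lemma LinearRows.quadForm_mgf (c : ℤ → ℤ → ℝ) {G b θ : ℝ}
    (hc : ∑ s ∈ Finset.Icc (1 : ℤ) n, ∑ r ∈ Finset.Icc (1 : ℤ) n, c s r ^ 2 ≤ G)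
    (hb : ∀ x : ℤ → ℝ, |∑ s ∈ Finset.Icc (1 : ℤ) n, ∑ r ∈ Finset.Icc (1 : ℤ) n,
      c s r * (x s * x r)| ≤ b * ∑ s ∈ Finset.Icc (1 : ℤ) n, x s ^ 2)
    (hb0 : 0 ≤ b) (hθ : |θ| * (covBound w * b) ≤ 1 / 4) :
    Integrable (fun ω => Real.exp (θ * (quadForm X n c ω - ∫ ω', quadForm X n c ω' ∂P))) P ∧
    ∫ ω, Real.exp (θ * (quadForm X n c ω - ∫ ω', quadForm X n c ω' ∂P)) ∂P ≤
      Real.exp (4 * θ ^ 2 * (covBound w ^ 2 * G)) := by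
  have hsum : ∀ f : ℤ → ℤ → ℝ, ∑ i : Icc (1 : ℤ) (n : ℤ), ∑ j : Icc (1 : ℤ) (n : ℤ), f i j =
      ∑ s ∈ Finset.Icc (1 : ℤ) n, ∑ r ∈ Finset.Icc (1 : ℤ) n, f s r := by
    intro f
    rw [← sum_Icc_subtype n]
    exact Finset.sum_congr rfl fun i _ => sum_Icc_subtype n (f i)
  have key := LocStat.quadForm_mgf (hasGaussianLaw_row hG) (fun i => h.mean n i i.2)
    (C := covBound w) (by linarith [one_le_covBound w]) ?_
    (fun i j : Icc (1 : ℤ) (n : ℤ) => c i j) (G := G) (b := b) (θ := θ)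
    (by rw [hsum fun s r => c s r ^ 2]; exact hc) ?_ hb0 hθ
  · have e : ∀ ω, ∑ i : Icc (1 : ℤ) (n : ℤ), ∑ j : Icc (1 : ℤ) (n : ℤ),
        c i j * (X n i ω * X n j ω) = quadForm X n c ω :=
      fun ω => hsum fun s r => c s r * (X n s ω * X n r ω)
    simp only [e] at key
    exact key
  · intro x
    classical
    set x' : ℤ → ℝ := fun t => if ht : t ∈ Icc (1 : ℤ) (n : ℤ) then x ⟨t, ht⟩ else 0 with hx'
    have hxx : ∀ i : Icc (1 : ℤ) (n : ℤ), x i = x' i := fun i => by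
      simp only [hx']; rw [dif_pos i.2]
    simp only [hxx]
    have h1 : ∀ ω, ∑ i : Icc (1 : ℤ) (n : ℤ), x' i * X n i ω =
        ∑ t ∈ Finset.Icc (1 : ℤ) n, x' t * X n t ω := fun ω =>
      sum_Icc_subtype n fun t => x' t * X n t ω
    simp only [h1]
    rw [sum_Icc_subtype n fun t => x' t ^ 2]
    refine (h.integral_sq_le n x').trans ?_
    refine mul_le_mul_of_nonneg_right ?_ (Finset.sum_nonneg fun t _ => sq_nonneg _)
    simp [covBound]
  · intro x
    classical
    set x' : ℤ → ℝ := fun t => if ht : t ∈ Icc (1 : ℤ) (n : ℤ) then x ⟨t, ht⟩ else 0 with hx'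
    have hxx : ∀ i : Icc (1 : ℤ) (n : ℤ), x i = x' i := fun i => by
      simp only [hx']; rw [dif_pos i.2]
    simp only [hxx]
    rw [hsum fun s r => c s r * (x' s * x' r), sum_Icc_subtype n fun t => x' t ^ 2]
    exact hb x'

variable [IsProbabilityMeasure P]

lemma LinearRows.quadForm_tail (c : ℤ → ℤ → ℝ) {G b L : ℝ}
    (hc : ∑ s ∈ Finset.Icc (1 : ℤ) n, ∑ r ∈ Finset.Icc (1 : ℤ) n, c s r ^ 2 ≤ G)
    (hb : ∀ x : ℤ → ℝ, |∑ s ∈ Finset.Icc (1 : ℤ) n, ∑ r ∈ Finset.Icc (1 : ℤ) n,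
      c s r * (x s * x r)| ≤ b * ∑ s ∈ Finset.Icc (1 : ℤ) n, x s ^ 2)
    (hG0 : 0 ≤ G) (hb0 : 0 < b) (hL : 0 ≤ L) :
    P {ω | 8 * covBound w * (Real.sqrt (G * L) + b * L) <
      |quadForm X n c ω - ∫ ω', quadForm X n c ω' ∂P|} ≤ ENNReal.ofReal (2 * Real.exp (-L)) := by
  have hC := one_le_covBound w
  have hC0 : 0 < covBound w := by linarith
  refine le_trans (measure_mono fun ω hω => ?_) (measure_tail_of_mgf (P := P)
    (Y := fun ω => quadForm X n c ω - ∫ ω', quadForm X n c ω' ∂P) (v := covBound w ^ 2 * G)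
    (β := covBound w * b) (by positivity) (by positivity)
    (fun θ hθ => h.quadForm_mgf hG c hc hb hb0.le hθ) hL)
  rw [mem_ofPred_eq] at hω ⊢
  refine lt_of_le_of_lt ?_ hω
  have h1 : Real.sqrt (covBound w ^ 2 * G * L) = covBound w * Real.sqrt (G * L) := by
    rw [mul_assoc, Real.sqrt_mul (sq_nonneg _), Real.sqrt_sq hC0.le]
  rw [h1]
  have h2 := Real.sqrt_nonneg (G * L)
  have h3 : 0 ≤ covBound w * Real.sqrt (G * L) := by positivity
  nlinarith

variable {β : ℝ → ℤ → ℝ} {D R L : ℝ}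

/-- Bernstein inequality for quadratic forms with symbol `β`. -/
lemma LinearRows.centredForm_tail (hn : 0 < n) (hβ : ∀ k, Measurable fun u => β u k)
    (hD : symSq β ≤ ENNReal.ofReal (D ^ 2)) (hD0 : 0 ≤ D)
    (hR : symSup β ≤ ENNReal.ofReal R) (hR0 : 0 < R) (hL : 0 ≤ L) :
    P {ω | 8 * covBound w * (D * Real.sqrt (L / n) + R * L / n) < |centredForm P X n β ω|} ≤
      ENNReal.ofReal (2 * Real.exp (-L)) := by
  have hn' : (0 : ℝ) < n := by exact_mod_cast hn
  have := h.quadForm_tail hG (quadCoef n β) (sum_quadCoef_sq_le hn hβ hD)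
    (abs_quadCoef_form_le hn hR hR0.le) (by positivity) (by positivity) hL
  have h1 : Real.sqrt (D ^ 2 / n * L) = D * Real.sqrt (L / n) := by
    rw [div_mul_eq_mul_div, mul_div_assoc, Real.sqrt_mul (sq_nonneg _), Real.sqrt_sq hD0]
  rw [h1, show R / n * L = R * L / n by ring] at this
  exact this

omit hG [IsProbabilityMeasure P] h in
lemma quadCoef_form_le_sq (hn : 0 < n) (hβ : ∀ k, Measurable fun u => β u k)
    (hD : symSq β ≤ ENNReal.ofReal (D ^ 2)) (hD0 : 0 ≤ D) (x : ℤ → ℝ) :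
    |∑ s ∈ Finset.Icc (1 : ℤ) n, ∑ r ∈ Finset.Icc (1 : ℤ) n, quadCoef n β s r * (x s * x r)| ≤
      D / Real.sqrt n * ∑ s ∈ Finset.Icc (1 : ℤ) n, x s ^ 2 := by
  refine abs_form_le_of_sum_sq_le (by positivity) ?_ x
  rw [div_pow, Real.sq_sqrt (by positivity)]
  exact sum_quadCoef_sq_le hn hβ hD

/-- Exponential inequality for quadratic forms in terms of the `L²`-norm of the symbol. -/
lemma LinearRows.centredForm_tail_sq (hn : 0 < n) (hβ : ∀ k, Measurable fun u => β u k)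
    (hD : symSq β ≤ ENNReal.ofReal (D ^ 2)) (hD0 : 0 < D) (hL : 1 ≤ L) :
    P {ω | 16 * covBound w * (D * L / Real.sqrt n) < |centredForm P X n β ω|} ≤
      ENNReal.ofReal (2 * Real.exp (-L)) := by
  have hn' : (0 : ℝ) < n := by exact_mod_cast hn
  have hs : 0 < Real.sqrt n := Real.sqrt_pos.2 hn'
  have hC := one_le_covBound w
  refine le_trans (measure_mono fun ω hω => ?_) (h.quadForm_tail hG (quadCoef n β)
    (sum_quadCoef_sq_le hn hβ hD) (quadCoef_form_le_sq hn hβ hD hD0.le) (by positivity)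
    (by positivity) (by linarith : 0 ≤ L))
  rw [mem_ofPred_eq] at hω ⊢
  refine lt_of_le_of_lt ?_ hω
  have h1 : Real.sqrt (D ^ 2 / n * L) ≤ D * L / Real.sqrt n := by
    refine Real.sqrt_le_iff.2 ⟨by positivity, ?_⟩
    rw [div_pow, Real.sq_sqrt hn'.le, mul_pow, div_mul_eq_mul_div]
    gcongr
    nlinarith
  have h2 : D / Real.sqrt n * L = D * L / Real.sqrt n := by ring
  rw [h2]
  have h3 : 8 * covBound w * (Real.sqrt (D ^ 2 / n * L) + D * L / Real.sqrt n) ≤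
      8 * covBound w * (D * L / Real.sqrt n + D * L / Real.sqrt n) := by gcongr
  linarith

-- Truncated second moment of a form whose operator norm is bounded only through its Hilbert–Schmidt
-- norm `D/√n`. It is applied to the atoms of the dyadic expansion.
omit [IsProbabilityMeasure P] in
lemma LinearRows.lintegral_centredForm_sq (hn : 0 < n) (hβ : ∀ k, Measurable fun u => β u k)
    (hD : symSq β ≤ ENNReal.ofReal (D ^ 2)) (hD0 : 0 < D) (M : ℝ) :
    ∫⁻ ω, ENNReal.ofReal (if M < |centredForm P X n β ω| then centredForm P X n β ω ^ 2 else 0) ∂P ≤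
      ENNReal.ofReal (1024 * (covBound w * D) ^ 2 / n *
        Real.exp (-(Real.sqrt n * M / (8 * (covBound w * D))))) := by
  have hn' : (0 : ℝ) < n := by exact_mod_cast hn
  have hs : 0 < Real.sqrt n := Real.sqrt_pos.2 hn'
  have hss : Real.sqrt n ^ 2 = n := Real.sq_sqrt hn'.le
  have hC := one_le_covBound w
  have hC0 : 0 < covBound w := by linarith
  refine (lintegral_sq_indicator_of_mgf (v := covBound w ^ 2 * (D ^ 2 / n))
    (β := covBound w * (D / Real.sqrt n))
    (fun θ hθ => h.quadForm_mgf hG (quadCoef n β) (sum_quadCoef_sq_le hn hβ hD)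
      (quadCoef_form_le_sq hn hβ hD hD0.le) (by positivity) hθ)
    -- The largest admissible exponent, for which `c β = 1/4`; the factor `exp(4c²v)` then equals
    -- `exp(1/4)`.
    (c := Real.sqrt n / (4 * (covBound w * D))) (by positivity) (le_of_eq ?_) M).trans ?_
  · field_simp
  · refine ENNReal.ofReal_le_ofReal ?_
    have e1 : 16 / (Real.sqrt n / (4 * (covBound w * D))) ^ 2 = 256 * (covBound w * D) ^ 2 / n := by
      rw [div_pow, hss]; field_simp; norm_num
    have e2 : 4 * (Real.sqrt n / (4 * (covBound w * D))) ^ 2 * (covBound w ^ 2 * (D ^ 2 / n)) =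
        1 / 4 := by
      rw [div_pow, hss]; field_simp
    have e3 : Real.sqrt n / (4 * (covBound w * D)) * M / 2 =
        Real.sqrt n * M / (8 * (covBound w * D)) := by ring
    rw [e1, e2, e3]
    have e4 : Real.exp (1 / 4) ≤ 4 := by
      have := Real.exp_one_lt_d9
      have : Real.exp (1 / 4) ≤ Real.exp 1 := Real.exp_le_exp.2 (by norm_num)
      linarith
    have : 256 * (covBound w * D) ^ 2 / n * Real.exp (1 / 4) ≤ 256 * (covBound w * D) ^ 2 / n * 4 := by
      gcongr
    calc _ ≤ 256 * (covBound w * D) ^ 2 / n * 4 *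
          Real.exp (-(Real.sqrt n * M / (8 * (covBound w * D)))) := by gcongr
      _ = _ := by ring

/-- With high probability, all observations are at most of order `√log n`. -/
lemma LinearRows.measure_max_sq (hn : 2 ≤ n) :
    P {ω | ∃ t ∈ Finset.Icc (1 : ℤ) n, 40 * covBound w * Real.log n < X n t ω ^ 2} ≤
      ENNReal.ofReal (2 / n) := by
  classical
  have hn' : (2 : ℝ) ≤ n := by exact_mod_cast hn
  have hC := one_le_covBound w
  have hlog : 1 / 2 ≤ Real.log n := by
    have := Real.log_two_gt_d9
    have := Real.log_le_log (by norm_num) hn'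
    linarith
  have hone : ∀ t ∈ Finset.Icc (1 : ℤ) n, P {ω | 40 * covBound w * Real.log n < X n t ω ^ 2} ≤
      ENNReal.ofReal (2 * Real.exp (-(2 * Real.log n))) := by
    intro t ht
    -- The square of one observation is the form of a matrix unit, with both norms equal to one. The
    -- choice `L = 2 log n` gives probability `2 n⁻²` for each `t`, and `2/n` after the union bound.
    set c : ℤ → ℤ → ℝ := fun s r => if s = t ∧ r = t then 1 else 0 with hc
    have hform : ∀ f : ℤ → ℤ → ℝ, ∑ s ∈ Finset.Icc (1 : ℤ) n, ∑ r ∈ Finset.Icc (1 : ℤ) n,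
        c s r * f s r = f t t := by
      intro f
      rw [Finset.sum_eq_single_of_mem t ht, Finset.sum_eq_single_of_mem t ht]
      · simp [hc]
      · intro r _ hr; simp [hc, hr]
      · intro s _ hs
        refine Finset.sum_eq_zero fun r _ => ?_
        simp [hc, hs]
    have hQ : ∀ ω, quadForm X n c ω = X n t ω ^ 2 := fun ω => by
      rw [quadForm, hform fun s r => X n s ω * X n r ω, sq]
    have htail := h.quadForm_tail hG c (G := 1) (b := 1) (L := 2 * Real.log n)
      (le_of_eq (by
        have h3 : ∀ s r, c s r ^ 2 = c s r * 1 := fun s r => by simp only [hc]; split_ifs <;> simp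
        simp only [h3]; exact hform fun _ _ => 1))
      (fun x => by
        rw [hform fun s r => x s * x r, one_mul, ← sq, abs_of_nonneg (sq_nonneg _)]
        exact Finset.single_le_sum (f := fun s => x s ^ 2) (fun s _ => sq_nonneg _) ht)
      zero_le_one one_pos (by linarith)
    refine le_trans (measure_mono fun ω hω => ?_) htail
    have hE : ∫ ω', quadForm X n c ω' ∂P ≤ covBound w := by
      simp only [hQ]
      have h4 := h.integral_sq_le n fun s => if s = t then 1 else 0
      have h5 : ∀ f : ℤ → ℝ, ∑ s ∈ Finset.Icc (1 : ℤ) n, (if s = t then (1 : ℝ) else 0) * f s =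
          f t := fun f => by
        rw [Finset.sum_eq_single_of_mem t ht]
        · simp
        · intro s _ hs; simp [hs]
      have h6 : ∑ s ∈ Finset.Icc (1 : ℤ) n, (if s = t then (1 : ℝ) else 0) ^ 2 = 1 := by
        rw [Finset.sum_eq_single_of_mem t ht]
        · simp
        · intro s _ hs; simp [hs]
      rw [h6] at h4
      simp only [h5] at h4
      unfold covBound
      linarith
    simp only [mem_ofPred_eq, hQ] at hω hE ⊢
    have h7 : Real.sqrt (1 * (2 * Real.log n)) ≤ 2 * Real.log n := by
      rw [one_mul]
      refine Real.sqrt_le_iff.2 ⟨by linarith, by nlinarith⟩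
    have h8 : 8 * covBound w * (Real.sqrt (1 * (2 * Real.log n)) + 1 * (2 * Real.log n)) ≤
        8 * covBound w * (2 * Real.log n + 1 * (2 * Real.log n)) := by gcongr
    have h9 : covBound w * (1 / 2) ≤ covBound w * Real.log n := by gcongr
    refine lt_of_lt_of_le ?_ (le_abs_self _)
    nlinarith
  calc _ ≤ P (⋃ t ∈ Finset.Icc (1 : ℤ) n, {ω | 40 * covBound w * Real.log n < X n t ω ^ 2}) := by
        refine measure_mono fun ω hω => ?_
        simpa using hω
    _ ≤ ∑ t ∈ Finset.Icc (1 : ℤ) n, P {ω | 40 * covBound w * Real.log n < X n t ω ^ 2} :=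
        measure_biUnion_finset_le _ _
    _ ≤ ∑ t ∈ Finset.Icc (1 : ℤ) n, ENNReal.ofReal (2 * Real.exp (-(2 * Real.log n))) :=
        Finset.sum_le_sum hone
    _ = ENNReal.ofReal (2 / n) := by
        rw [Finset.sum_const, Int.card_Icc, nsmul_eq_mul]
        have e : Real.exp (-(2 * Real.log n)) = ((n : ℝ) ^ 2)⁻¹ := by
          rw [Real.exp_neg, two_mul, Real.exp_add, Real.exp_log (by linarith), sq]
        rw [e, show ((n : ℤ) + 1 - 1).toNat = n by omega, ← ENNReal.ofReal_natCast,
          ← ENNReal.ofReal_mul (by positivity)]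
        congr 1
        field_simp

end mgf

end LocStat

/-! ### Crude bounds, linearity, and the passage from samples to cell averages -/

namespace LocStat

variable {Ω : Type*} [MeasurableSpace Ω] {P : Measure Ω} {X : ℕ → ℤ → Ω → ℝ} {a : ℝ → ℤ → ℝ}
  {w : ℤ → ℝ} {K : ℝ} {α : ℕ → ℤ → ℤ → ℝ} {n : ℕ}

section deterministic

omit [MeasurableSpace Ω] in
lemma abs_quadForm_le {c : ℤ → ℤ → ℝ} {m : ℝ} {ω : Ω}
    (hm : ∀ t ∈ Finset.Icc (1 : ℤ) n, X n t ω ^ 2 ≤ m) :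
    |quadForm X n c ω| ≤
      (∑ s ∈ Finset.Icc (1 : ℤ) n, ∑ r ∈ Finset.Icc (1 : ℤ) n, |c s r|) * m := by
  unfold quadForm
  rw [Finset.sum_mul]
  refine (Finset.abs_sum_le_sum_abs _ _).trans (Finset.sum_le_sum fun s hs => ?_)
  rw [Finset.sum_mul]
  refine (Finset.abs_sum_le_sum_abs _ _).trans (Finset.sum_le_sum fun r hr => ?_)
  rw [abs_mul]
  refine mul_le_mul_of_nonneg_left ?_ (abs_nonneg _)
  rw [abs_mul]
  nlinarith [sq_nonneg (|X n s ω| - |X n r ω|), sq_abs (X n s ω), sq_abs (X n r ω), hm s hs, hm r hr]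

variable (h : LinearRows P X a w K α)

include h

lemma LinearRows.integrable_mul {s r : ℤ} (hs : s ∈ Finset.Icc (1 : ℤ) n)
    (hr : r ∈ Finset.Icc (1 : ℤ) n) : Integrable (fun ω => X n s ω * X n r ω) P :=
  (h.memLp n s (by simpa using hs)).integrable_mul (h.memLp n r (by simpa using hr))

lemma LinearRows.integrable_quadForm (c : ℤ → ℤ → ℝ) : Integrable (quadForm X n c) P :=
  integrable_finsetSum _ fun _ hs => integrable_finsetSum _ fun _ hr =>
    (h.integrable_mul hs hr).const_mul _

lemma LinearRows.integral_quadForm (c : ℤ → ℤ → ℝ) :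
    ∫ ω, quadForm X n c ω ∂P = ∑ s ∈ Finset.Icc (1 : ℤ) n, ∑ r ∈ Finset.Icc (1 : ℤ) n,
      c s r * ∫ ω, X n s ω * X n r ω ∂P := by
  unfold quadForm
  rw [integral_finsetSum _ fun s hs => integrable_finsetSum _ fun r hr =>
    (h.integrable_mul hs hr).const_mul _]
  refine Finset.sum_congr rfl fun s hs => ?_
  rw [integral_finsetSum _ fun r hr => (h.integrable_mul hs hr).const_mul _]
  exact Finset.sum_congr rfl fun r _ => integral_const_mul _ _

lemma LinearRows.integral_sq_obs_le {t : ℤ} (ht : t ∈ Finset.Icc (1 : ℤ) n) :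
    ∫ ω, X n t ω ^ 2 ∂P ≤ covBound w := by
  have h1 := h.sum_abs_cov_le (n := n) (s := t) (by simpa using ht)
  have h2 := Finset.single_le_sum (f := fun r => |∫ ω, X n t ω * X n r ω ∂P|)
    (fun r _ => abs_nonneg _) ht
  have h3 := le_abs_self (∫ ω, X n t ω * X n t ω ∂P)
  simp only [sq]
  unfold covBound
  linarith

lemma LinearRows.abs_cov_le {s r : ℤ} (hs : s ∈ Finset.Icc (1 : ℤ) n)
    (hr : r ∈ Finset.Icc (1 : ℤ) n) : |∫ ω, X n s ω * X n r ω ∂P| ≤ covBound w := by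
  have h1 := h.sum_abs_cov_le (n := n) (s := s) (by simpa using hs)
  have h2 := Finset.single_le_sum (f := fun r => |∫ ω, X n s ω * X n r ω ∂P|)
    (fun r _ => abs_nonneg _) hr
  unfold covBound
  linarith

lemma LinearRows.abs_integral_quadForm_le (c : ℤ → ℤ → ℝ) :
    |∫ ω, quadForm X n c ω ∂P| ≤
      (∑ s ∈ Finset.Icc (1 : ℤ) n, ∑ r ∈ Finset.Icc (1 : ℤ) n, |c s r|) * covBound w := by
  rw [h.integral_quadForm, Finset.sum_mul]
  refine (Finset.abs_sum_le_sum_abs _ _).trans (Finset.sum_le_sum fun s hs => ?_)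
  rw [Finset.sum_mul]
  refine (Finset.abs_sum_le_sum_abs _ _).trans (Finset.sum_le_sum fun r hr => ?_)
  rw [abs_mul]
  exact mul_le_mul_of_nonneg_left (h.abs_cov_le hs hr) (abs_nonneg _)

/-- A crude bound of the centred form by the `L²`-norm of the symbol. -/
lemma LinearRows.abs_centredForm_le_sq {β : ℝ → ℤ → ℝ} {D m : ℝ} {ω : Ω} (hn : 0 < n)
    (hβ : ∀ k, Measurable fun u => β u k) (hD : symSq β ≤ ENNReal.ofReal (D ^ 2)) (hD0 : 0 ≤ D)
    (hm : ∀ t ∈ Finset.Icc (1 : ℤ) n, X n t ω ^ 2 ≤ m) :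
    |centredForm P X n β ω| ≤ D * Real.sqrt n * (m + covBound w) := by
  have hn' : (0 : ℝ) < n := by exact_mod_cast hn
  have hs := Real.sqrt_pos.2 hn'
  have hss : D / Real.sqrt n * n = D * Real.sqrt n := by
    rw [div_mul_eq_mul_div, div_eq_iff hs.ne', mul_assoc, Real.mul_self_sqrt hn'.le]
  have hcard : ∀ x : ℝ, ∑ _s ∈ Finset.Icc (1 : ℤ) n, x = n * x := fun x => by
    rw [Finset.sum_const, Int.card_Icc, nsmul_eq_mul]; simp
  have hpt : ∀ ω', |quadForm X n (quadCoef n β) ω'| ≤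
      D / Real.sqrt n * ∑ s ∈ Finset.Icc (1 : ℤ) n, X n s ω' ^ 2 := fun ω' =>
    quadCoef_form_le_sq hn hβ hD hD0 fun s => X n s ω'
  have hsq : ∀ s ∈ Finset.Icc (1 : ℤ) n, Integrable (fun ω' => X n s ω' ^ 2) P := fun s hs => by
    simpa only [sq] using h.integrable_mul hs hs
  have h1 : |quadForm X n (quadCoef n β) ω| ≤ D * Real.sqrt n * m := by
    refine (hpt ω).trans ?_
    rw [← hss, mul_assoc]
    refine mul_le_mul_of_nonneg_left ?_ (by positivity)
    rw [← hcard]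
    exact Finset.sum_le_sum hm
  have h2 : |∫ ω', quadForm X n (quadCoef n β) ω' ∂P| ≤ D * Real.sqrt n * covBound w := by
    calc _ ≤ ∫ ω', D / Real.sqrt n * ∑ s ∈ Finset.Icc (1 : ℤ) n, X n s ω' ^ 2 ∂P :=
          (abs_integral_le_integral_abs).trans (integral_mono_of_nonneg
            (ae_of_all _ fun _ => abs_nonneg _)
            ((integrable_finsetSum _ hsq).const_mul _) (ae_of_all _ hpt))
      _ = D / Real.sqrt n * ∑ s ∈ Finset.Icc (1 : ℤ) n, ∫ ω', X n s ω' ^ 2 ∂P := by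
          rw [integral_const_mul, integral_finsetSum _ hsq]
      _ ≤ D / Real.sqrt n * (n * covBound w) := by
          rw [← hcard]
          exact mul_le_mul_of_nonneg_left
            (Finset.sum_le_sum fun s hs => h.integral_sq_obs_le hs) (by positivity)
      _ = _ := by rw [← mul_assoc, hss]
  calc _ ≤ |quadForm X n (quadCoef n β) ω| + |∫ ω', quadForm X n (quadCoef n β) ω' ∂P| :=
        abs_sub _ _
    _ ≤ _ := by rw [mul_add]; exact add_le_add h1 h2

/-- A crude bound of the centred form by the `L¹`-norm of the symbol. -/
lemma LinearRows.abs_centredForm_le_abs {β : ℝ → ℤ → ℝ} {B m : ℝ} {ω : Ω} (hn : 0 < n) (hB : 0 ≤ B)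
    (hD : ∑' k, ∫⁻ u in Ioc (0 : ℝ) 1, ‖β u k‖ₑ ≤ ENNReal.ofReal B) (hm0 : 0 ≤ m)
    (hm : ∀ t ∈ Finset.Icc (1 : ℤ) n, X n t ω ^ 2 ≤ m) :
    |centredForm P X n β ω| ≤ B * (m + covBound w) := by
  have h0 : ∑ s ∈ Finset.Icc (1 : ℤ) n, ∑ r ∈ Finset.Icc (1 : ℤ) n, |quadCoef n β s r| ≤ B := by
    rw [← ENNReal.ofReal_le_ofReal_iff hB,
      ENNReal.ofReal_sum_of_nonneg fun s _ => Finset.sum_nonneg fun r _ => abs_nonneg _]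
    simp_rw [fun s => ENNReal.ofReal_sum_of_nonneg (s := Finset.Icc (1 : ℤ) n)
      (f := fun r => |quadCoef n β s r|) fun r _ => abs_nonneg _, ← Real.enorm_eq_ofReal_abs]
    calc _ ≤ ∑ s ∈ Finset.Icc (1 : ℤ) n, ∑ r ∈ Finset.Icc (1 : ℤ) n,
          ∫⁻ u in cell n ((s + r) / 2), ‖β u (s - r)‖ₑ :=
          Finset.sum_le_sum fun s _ => Finset.sum_le_sum fun r _ =>
            enorm_integral_le_lintegral_enorm _
      _ ≤ ∑ t ∈ Finset.Icc (1 : ℤ) n, ∑ k ∈ Finset.Icc (-(n : ℤ)) n,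
          ∫⁻ u in cell n t, ‖β u k‖ₑ := sum_pairs_le n fun t k => ∫⁻ u in cell n t, ‖β u k‖ₑ
      _ = ∑ k ∈ Finset.Icc (-(n : ℤ)) n, ∫⁻ u in Ioc (0 : ℝ) 1, ‖β u k‖ₑ := by
          rw [Finset.sum_comm]
          exact Finset.sum_congr rfl fun k _ => sum_lintegral_cell hn _
      _ ≤ _ := (ENNReal.sum_le_tsum _).trans hD
  have hC := one_le_covBound w
  calc _ ≤ |quadForm X n (quadCoef n β) ω| + |∫ ω', quadForm X n (quadCoef n β) ω' ∂P| :=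
        abs_sub _ _
    _ ≤ B * m + B * covBound w := by
        refine add_le_add ((abs_quadForm_le hm).trans ?_) ((h.abs_integral_quadForm_le _).trans ?_)
        · gcongr
        · gcongr
    _ = _ := by ring

end deterministic

section linearity

variable {β γ : ℝ → ℤ → ℝ}

omit [MeasurableSpace Ω] in
lemma quadForm_sub (c d : ℤ → ℤ → ℝ) (ω : Ω) :
    quadForm X n (fun s r => c s r - d s r) ω = quadForm X n c ω - quadForm X n d ω := by
  simp only [quadForm, sub_mul, Finset.sum_sub_distrib]

omit [MeasurableSpace Ω] in
lemma quadForm_congr {c d : ℤ → ℤ → ℝ} (hcd : ∀ s ∈ Finset.Icc (1 : ℤ) n,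
    ∀ r ∈ Finset.Icc (1 : ℤ) n, c s r = d s r) : quadForm X n c = quadForm X n d := by
  ext ω
  exact Finset.sum_congr rfl fun s hs => Finset.sum_congr rfl fun r hr => by rw [hcd s hs r hr]

lemma quadCoef_sub (hn : 0 < n) (hβ : ∀ k, IntegrableOn (fun u => β u k) (Ioc 0 1))
    (hγ : ∀ k, IntegrableOn (fun u => γ u k) (Ioc 0 1)) {s r : ℤ}
    (hs : s ∈ Finset.Icc (1 : ℤ) n) (hr : r ∈ Finset.Icc (1 : ℤ) n) :
    quadCoef n (fun u k => β u k - γ u k) s r = quadCoef n β s r - quadCoef n γ s r :=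
  integral_sub ((hβ _).mono_set (cell_subset hn (half_sum_mem hs hr)))
    ((hγ _).mono_set (cell_subset hn (half_sum_mem hs hr)))

lemma LinearRows.centredForm_sub (h : LinearRows P X a w K α) (hn : 0 < n)
    (hβ : ∀ k, IntegrableOn (fun u => β u k) (Ioc 0 1))
    (hγ : ∀ k, IntegrableOn (fun u => γ u k) (Ioc 0 1)) (ω : Ω) :
    centredForm P X n (fun u k => β u k - γ u k) ω =
      centredForm P X n β ω - centredForm P X n γ ω := by
  unfold centredForm
  have h1 : quadForm X n (quadCoef n fun u k => β u k - γ u k) =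
      fun ω => quadForm X n (quadCoef n β) ω - quadForm X n (quadCoef n γ) ω := by
    rw [quadForm_congr fun s hs r hr => quadCoef_sub hn hβ hγ hs hr]
    ext ω
    exact quadForm_sub _ _ ω
  rw [h1, integral_sub (h.integrable_quadForm _) (h.integrable_quadForm _)]
  ring

/-- A finite sum of suprema makes the symbol bounded on `(0, 1]` at every lag. -/
lemma integrableOn_of_symSup (hβ : ∀ k, Measurable fun u => β u k) (hS : symSup β ≠ ⊤) (k : ℤ) :
    IntegrableOn (fun u => β u k) (Ioc 0 1) := by
  refine ⟨(hβ k).aestronglyMeasurable, ?_⟩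
  have h1 : (⨆ u ∈ Ioc (0 : ℝ) 1, ‖β u k‖ₑ) < ⊤ :=
    lt_of_le_of_lt (ENNReal.le_tsum k) (lt_top_iff_ne_top.2 hS)
  calc ∫⁻ u in Ioc (0 : ℝ) 1, ‖β u k‖ₑ ≤ ∫⁻ u in Ioc (0 : ℝ) 1, ⨆ u ∈ Ioc (0 : ℝ) 1, ‖β u k‖ₑ :=
        setLIntegral_mono measurable_const fun u hu => le_biSup (fun u => ‖β u k‖ₑ) hu
    _ < ⊤ := by rw [setLIntegral_const]; simpa using h1

lemma symSup_sub_le (β γ : ℝ → ℤ → ℝ) :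
    symSup (fun u k => β u k - γ u k) ≤ symSup β + symSup γ := by
  unfold symSup
  rw [← ENNReal.tsum_add]
  refine ENNReal.tsum_le_tsum fun k => iSup₂_le fun u hu => ?_
  refine (enorm_sub_le).trans (add_le_add ?_ ?_)
  · exact le_biSup (fun u => ‖β u k‖ₑ) hu
  · exact le_biSup (fun u => ‖γ u k‖ₑ) hu

lemma eVariationOn_sub_le (f g : ℝ → ℝ) (s : Set ℝ) :
    eVariationOn (fun u => f u - g u) s ≤ eVariationOn f s + eVariationOn g s := by
  refine iSup_le fun p => ?_
  calc _ ≤ ∑ i ∈ Finset.range p.1, (edist (f (p.2.1 (i + 1))) (f (p.2.1 i)) +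
        edist (g (p.2.1 (i + 1))) (g (p.2.1 i))) := by
        refine Finset.sum_le_sum fun i _ => ?_
        simp only [edist_eq_enorm_sub]
        rw [show f (p.2.1 (i + 1)) - g (p.2.1 (i + 1)) - (f (p.2.1 i) - g (p.2.1 i)) =
          (f (p.2.1 (i + 1)) - f (p.2.1 i)) - (g (p.2.1 (i + 1)) - g (p.2.1 i)) by ring]
        exact enorm_sub_le
    _ ≤ _ := by
        rw [Finset.sum_add_distrib]
        exact add_le_add (eVariationOn.sum_le p.2.2.1 p.2.2.2) (eVariationOn.sum_le p.2.2.1 p.2.2.2)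

lemma symVar_sub_le (β γ : ℝ → ℤ → ℝ) :
    symVar (fun u k => β u k - γ u k) ≤ symVar β + symVar γ := by
  unfold symVar
  rw [← ENNReal.tsum_add]
  exact ENNReal.tsum_le_tsum fun k => eVariationOn_sub_le _ _ _

end linearity

section sampling

variable {β : ℝ → ℤ → ℝ}

lemma lintegral_cell_edist_le {E : Type*} [PseudoEMetricSpace E] (hn : 0 < n) (g : ℝ → E) (t : ℤ) :
    ∫⁻ u in cell n t, edist (g (t / n)) (g u) ≤ ENNReal.ofReal (1 / n) * eVariationOn g (cell n t) := by
  calc _ ≤ ∫⁻ _u in cell n t, eVariationOn g (cell n t) :=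
        setLIntegral_mono measurable_const fun u hu => eVariationOn.edist_le g (div_mem_cell hn t) hu
    _ = _ := by rw [setLIntegral_const, volume_cell, mul_comm]

/-- Error made by replacing cell averages of the symbol by its values at the right endpoints. -/
lemma sum_abs_sample_sub_quadCoef_le {V : ℝ} (hn : 0 < n) (hV0 : 0 ≤ V)
    (hβ : ∀ k, IntegrableOn (fun u => β u k) (Ioc 0 1)) (hV : symVar β ≤ ENNReal.ofReal V) :
    ∑ s ∈ Finset.Icc (1 : ℤ) n, ∑ r ∈ Finset.Icc (1 : ℤ) n,
      |1 / (n : ℝ) * β ((((s + r) / 2 : ℤ) : ℝ) / n) (s - r) - quadCoef n β s r| ≤ V / n := by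
  have hn' : (0 : ℝ) < n := by exact_mod_cast hn
  rw [← ENNReal.ofReal_le_ofReal_iff (by positivity),
    ENNReal.ofReal_sum_of_nonneg fun s _ => Finset.sum_nonneg fun r _ => abs_nonneg _]
  simp_rw [fun s => ENNReal.ofReal_sum_of_nonneg (s := Finset.Icc (1 : ℤ) n)
    (f := fun r => |1 / (n : ℝ) * β ((((s + r) / 2 : ℤ) : ℝ) / n) (s - r) - quadCoef n β s r|)
    fun r _ => abs_nonneg _, ← Real.enorm_eq_ofReal_abs]
  have h1 : ∀ s ∈ Finset.Icc (1 : ℤ) n, ∀ r ∈ Finset.Icc (1 : ℤ) n,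
      ‖1 / (n : ℝ) * β ((((s + r) / 2 : ℤ) : ℝ) / n) (s - r) - quadCoef n β s r‖ₑ ≤
      ENNReal.ofReal (1 / n) * eVariationOn (fun u => β u (s - r)) (cell n ((s + r) / 2)) := by
    intro s hs r hr
    refine le_trans ?_ (lintegral_cell_edist_le hn (fun u => β u (s - r)) ((s + r) / 2))
    -- The sampled value times `1/n` is the integral of a constant over the cell, so the error is at
    -- most `1/n` times the variation over the cell. These variations add up to at most `V`.
    have h2 : 1 / (n : ℝ) * β ((((s + r) / 2 : ℤ) : ℝ) / n) (s - r) - quadCoef n β s r =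
        ∫ u in cell n ((s + r) / 2), (β ((((s + r) / 2 : ℤ) : ℝ) / n) (s - r) - β u (s - r)) := by
      have h3 : IntegrableOn (fun _ : ℝ => β ((((s + r) / 2 : ℤ) : ℝ) / n) (s - r))
          (cell n ((s + r) / 2)) :=
        integrableOn_const (by rw [volume_cell]; exact ENNReal.ofReal_ne_top)
      rw [integral_sub h3
        ((hβ _).mono_set (cell_subset hn (half_sum_mem hs hr))), setIntegral_const,
        measureReal_def, volume_cell, ENNReal.toReal_ofReal (by positivity), smul_eq_mul]
      rfl
    rw [h2]
    simp only [edist_eq_enorm_sub]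
    exact enorm_integral_le_lintegral_enorm _
  calc _ ≤ ∑ s ∈ Finset.Icc (1 : ℤ) n, ∑ r ∈ Finset.Icc (1 : ℤ) n,
      ENNReal.ofReal (1 / n) * eVariationOn (fun u => β u (s - r)) (cell n ((s + r) / 2)) :=
        Finset.sum_le_sum fun s hs => Finset.sum_le_sum fun r hr => h1 s hs r hr
    _ ≤ ∑ t ∈ Finset.Icc (1 : ℤ) n, ∑ k ∈ Finset.Icc (-(n : ℤ)) n,
        ENNReal.ofReal (1 / n) * eVariationOn (fun u => β u k) (cell n t) :=
        sum_pairs_le n fun t k => ENNReal.ofReal (1 / n) * eVariationOn (fun u => β u k) (cell n t)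
    _ ≤ ENNReal.ofReal (1 / n) * ∑ k ∈ Finset.Icc (-(n : ℤ)) n,
        eVariationOn (fun u => β u k) (Ioc 0 1) := by
        rw [Finset.sum_comm, Finset.mul_sum]
        refine Finset.sum_le_sum fun k _ => ?_
        rw [← Finset.mul_sum]
        gcongr
        exact sum_eVariationOn_cell_le hn _
    _ ≤ ENNReal.ofReal (1 / n) * ENNReal.ofReal V := by
        gcongr
        exact (ENNReal.sum_le_tsum _).trans hV
    _ = _ := by rw [← ENNReal.ofReal_mul (by positivity)]; congr 1; ring

/-- The pairs `(s, r)` are parametrised by the midpoint `t` and the lag `k`. -/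
lemma sum_lag_eq_sum_pairs {M : Type*} [AddCommMonoid M] (n : ℕ) (F : ℤ → ℤ → M) :
    ∑ t ∈ Finset.Icc (1 : ℤ) n, ∑ k ∈ (Finset.Icc (-(n : ℤ)) n).filter (fun k : ℤ =>
        (2 * t + 1 + k) / 2 ∈ Icc (1 : ℤ) n ∧ (2 * t + 1 - k) / 2 ∈ Icc (1 : ℤ) n),
      F ((2 * t + 1 + k) / 2) ((2 * t + 1 - k) / 2) =
    ∑ s ∈ Finset.Icc (1 : ℤ) n, ∑ r ∈ Finset.Icc (1 : ℤ) n, F s r := by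
  rw [Finset.sum_sigma', Finset.sum_sigma']
  refine Finset.sum_nbij' (fun p => ⟨(2 * p.1 + 1 + p.2) / 2, (2 * p.1 + 1 - p.2) / 2⟩)
    (fun p => ⟨(p.1 + p.2) / 2, p.1 - p.2⟩) ?_ ?_ ?_ ?_ ?_
  · rintro ⟨t, k⟩ h
    simp only [Finset.mem_sigma, Finset.mem_Icc, Finset.mem_filter, mem_Icc] at h ⊢
    exact ⟨h.2.2.1, h.2.2.2⟩
  · rintro ⟨s, r⟩ h
    simp only [Finset.mem_sigma, Finset.mem_Icc, Finset.mem_filter, mem_Icc] at h ⊢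
    omega
  · rintro ⟨t, k⟩ h
    simp only [Sigma.mk.injEq, heq_eq_eq]
    omega
  · rintro ⟨s, r⟩ h
    simp only [Sigma.mk.injEq, heq_eq_eq]
    omega
  · rintro ⟨t, k⟩ h
    rfl

end sampling

end LocStat

/-! ### Bias of the local covariances -/

namespace LocStat

section oscillation

variable {E : Type*} [PseudoEMetricSpace E] {n : ℕ}

/-- The variation of `g` over the closure of the `i`-th cell (zero outside of `(0, 1]`). -/
noncomputable def cellOsc (n : ℕ) (g : ℝ → E) (i : ℤ) : ℝ≥0∞ :=
  if i ∈ Finset.Icc (1 : ℤ) n then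
    eVariationOn g (Icc (((i : ℝ) - 1) / n) ((i : ℝ) / n) ∩ Ioc 0 1) else 0

/-- Consecutive closed cells share only an endpoint, so variation is superadditive over them. Closed
cells are needed because neighbouring grid points must lie in a common cell. -/
lemma sum_cellOsc_le (hn : 0 < n) (g : ℝ → E) :
    ∑ t ∈ Finset.Icc (1 : ℤ) n, cellOsc n g t ≤ eVariationOn g (Ioc 0 1) := by
  have hn' : (0 : ℝ) < n := by exact_mod_cast hn
  have key : ∀ m : ℕ, m ≤ n → ∑ t ∈ Finset.Icc (1 : ℤ) m, cellOsc n g t ≤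
      eVariationOn g (Ioc 0 ((m : ℝ) / n)) := by
    intro m hm
    induction m with
    | zero => simp
    | succ m ih =>
      have h1 : Finset.Icc (1 : ℤ) (m + 1 : ℕ) = insert ((m : ℤ) + 1) (Finset.Icc (1 : ℤ) m) := by
        ext t; simp only [Finset.mem_Icc, Finset.mem_insert]; push_cast; omega
      rw [h1, Finset.sum_insert (by simp), add_comm, cellOsc,
        if_pos (by simp only [Finset.mem_Icc]; omega)]
      refine (add_le_add (ih (by omega)) le_rfl).trans ?_
      refine (eVariationOn.add_le_union g ?_).trans (eVariationOn.mono g ?_)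
      · intro x hx y hy
        refine hx.2.trans ?_
        simpa using hy.1.1
      · have h2 : (m : ℝ) / n ≤ ((m + 1 : ℕ) : ℝ) / n := by gcongr; simp
        rintro x (hx | hx)
        · exact ⟨hx.1, hx.2.trans h2⟩
        · exact ⟨hx.2.1, by simpa using hx.1.2⟩
  have h := key n le_rfl
  rwa [div_self hn'.ne'] at h

/-- Since the oscillation is zero outside the range `1, …, n`, injective reindexing may leave that
range without harm. -/
lemma sum_cellOsc_map_le (S : Finset ℤ) {f : ℤ → ℤ} (hf : Function.Injective f) (hn : 0 < n)
    (g : ℝ → E) : ∑ t ∈ S, cellOsc n g (f t) ≤ eVariationOn g (Ioc 0 1) := by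
  refine le_trans ?_ (sum_cellOsc_le hn g)
  rw [← Finset.sum_image (f := cellOsc n g) (g := f) hf.injOn]
  refine Finset.sum_le_sum_of_ne_zero fun i _ hi => ?_
  by_contra h
  exact hi (by rw [cellOsc, if_neg h])

lemma edist_le_cellOsc (g : ℝ → E) {i : ℤ} (hi : i ∈ Finset.Icc (1 : ℤ) n) {x y : ℝ}
    (hx : x ∈ Icc (((i : ℝ) - 1) / n) ((i : ℝ) / n)) (hx' : x ∈ Ioc (0 : ℝ) 1)
    (hy : y ∈ Icc (((i : ℝ) - 1) / n) ((i : ℝ) / n)) (hy' : y ∈ Ioc (0 : ℝ) 1) :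
    edist (g x) (g y) ≤ cellOsc n g i := by
  rw [cellOsc, if_pos hi]
  exact eVariationOn.edist_le g ⟨hx, hx'⟩ ⟨hy, hy'⟩

lemma div_mem_Ioc (hn : 0 < n) {i : ℤ} (hi : i ∈ Finset.Icc (1 : ℤ) n) :
    (i : ℝ) / n ∈ Ioc (0 : ℝ) 1 := cell_subset hn hi (div_mem_cell hn i)

lemma edist_grid_le (hn : 0 < n) (g : ℝ → E) {p q : ℤ} (hp : 1 ≤ p) (hpq : p ≤ q) :
    q ≤ n → edist (g ((p : ℝ) / n)) (g ((q : ℝ) / n)) ≤ ∑ i ∈ Finset.Ioc p q, cellOsc n g i := by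
  have hn' : (0 : ℝ) < n := by exact_mod_cast hn
  induction q, hpq using Int.leInduction with
  | base => simp
  | succ q hpq ih =>
    intro hq
    have h1 : Finset.Ioc p (q + 1) = insert (q + 1) (Finset.Ioc p q) := by
      ext t; simp only [Finset.mem_Ioc, Finset.mem_insert]; omega
    rw [h1, Finset.sum_insert (by simp), add_comm (cellOsc n g (q + 1))]
    refine (edist_triangle _ (g ((q : ℝ) / n)) _).trans (add_le_add (ih (by omega)) ?_)
    have hq1 : q + 1 ∈ Finset.Icc (1 : ℤ) n := by simp only [Finset.mem_Icc]; omega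
    have h2 : (q : ℝ) / n ≤ ((q + 1 : ℤ) : ℝ) / n := by gcongr; simp
    refine edist_le_cellOsc g hq1 ⟨by simp, h2⟩
      (div_mem_Ioc hn (by simp only [Finset.mem_Icc]; omega)) ⟨?_, le_rfl⟩ (div_mem_Ioc hn hq1)
    refine le_trans (by simp) h2

/-- The oscillation of `g` between the cell `t` and grid points at distance at most `m`. -/
noncomputable def rangeOsc (n : ℕ) (g : ℝ → E) (m : ℕ) (t : ℤ) : ℝ≥0∞ :=
  ∑ i ∈ Finset.Icc (-(m : ℤ)) m, cellOsc n g (t + i) + cellOsc n g t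

/-- One walks from `s/n` to `t/n` along the grid and then inside the cell of `t`; every step stays
in one closed cell. -/
lemma edist_le_rangeOsc (hn : 0 < n) (g : ℝ → E) {m : ℕ} {s t : ℤ} (hs : s ∈ Finset.Icc (1 : ℤ) n)
    (ht : t ∈ Finset.Icc (1 : ℤ) n) (hm : |s - t| ≤ m) {u : ℝ} (hu : u ∈ cell n t) :
    edist (g ((s : ℝ) / n)) (g u) ≤ rangeOsc n g m t := by
  have h1 : edist (g ((t : ℝ) / n)) (g u) ≤ cellOsc n g t :=
    edist_le_cellOsc g ht ⟨(div_mem_cell hn t).1.le, le_rfl⟩ (div_mem_Ioc hn ht)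
      ⟨hu.1.le, hu.2⟩ (cell_subset hn ht hu)
  have h2 : ∀ p q : ℤ, t - m ≤ p → q ≤ t + m → ∑ i ∈ Finset.Ioc p q, cellOsc n g i ≤
      ∑ i ∈ Finset.Icc (-(m : ℤ)) m, cellOsc n g (t + i) := by
    intro p q hp hq
    rw [← Finset.sum_image (f := cellOsc n g) (g := fun i => t + i) (by intro x _ y _; simp)]
    refine Finset.sum_le_sum_of_subset fun i hi => ?_
    simp only [Finset.mem_Ioc, Finset.mem_image, Finset.mem_Icc] at hi ⊢
    exact ⟨i - t, by omega, by omega⟩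
  rw [abs_le] at hm
  simp only [Finset.mem_Icc] at hs ht
  refine (edist_triangle _ (g ((t : ℝ) / n)) _).trans (add_le_add ?_ h1)
  rcases le_total s t with hst | hst
  · exact (edist_grid_le hn g hs.1 hst ht.2).trans (h2 _ _ (by omega) (by omega))
  · rw [edist_comm]
    exact (edist_grid_le hn g ht.1 hst hs.2).trans (h2 _ _ (by omega) (by omega))

/-- There are `2m + 1` translates of the cell oscillations and one extra copy, each summing to at
most the total variation. -/
lemma sum_rangeOsc_le (hn : 0 < n) (g : ℝ → E) (m : ℕ) (S : Finset ℤ) :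
    ∑ t ∈ S, rangeOsc n g m t ≤ (2 * m + 2 : ℕ) * eVariationOn g (Ioc 0 1) := by
  unfold rangeOsc
  rw [Finset.sum_add_distrib, Finset.sum_comm]
  have h1 : ∑ i ∈ Finset.Icc (-(m : ℤ)) m, ∑ t ∈ S, cellOsc n g (t + i) ≤
      ∑ _i ∈ Finset.Icc (-(m : ℤ)) m, eVariationOn g (Ioc 0 1) :=
    Finset.sum_le_sum fun i _ => sum_cellOsc_map_le S (add_left_injective i) hn g
  have h2 := sum_cellOsc_map_le S (f := fun t => t) (fun _ _ h => h) hn g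
  refine (add_le_add h1 h2).trans (le_of_eq ?_)
  rw [Finset.sum_const, Int.card_Icc, nsmul_eq_mul, show ((m : ℤ) + 1 - -m).toNat = 2 * m + 1 by omega]
  push_cast
  ring

end oscillation

lemma aemeasurable_of_eVariationOn_ne_top {f : ℝ → ℝ} {s : Set ℝ} (hs : MeasurableSet s)
    (h : eVariationOn f s ≠ ⊤) : AEMeasurable f (volume.restrict s) := by
  have hb : BoundedVariationOn f s := h
  obtain ⟨p, q, hp, hq, hpq⟩ := hb.locallyBoundedVariationOn.exists_monotoneOn_sub_monotoneOn
  have := (aemeasurable_restrict_of_monotoneOn (μ := volume) hs hp).sub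
    (aemeasurable_restrict_of_monotoneOn (μ := volume) hs hq)
  rwa [← hpq] at this

/-- The limiting local autocovariance at lag `k`. -/
noncomputable def limCov (a : ℝ → ℤ → ℝ) (u : ℝ) (k : ℤ) : ℝ := ∑' j : ℤ, a u (j + k) * a u j

variable {Ω : Type*} [MeasurableSpace Ω] {P : Measure Ω} {X : ℕ → ℤ → Ω → ℝ} {a : ℝ → ℤ → ℝ}
  {w : ℤ → ℝ} {K : ℝ} {α : ℕ → ℤ → ℤ → ℝ} {n : ℕ}

namespace LinearRows

variable (h : LinearRows P X a w K α)

include h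

lemma summable_shift (k : ℤ) : Summable fun j => w (j + k) :=
  (Equiv.addRight k).summable_iff.2 h.summable

lemma w_le_tsum (j : ℤ) : w j ≤ ∑' i, w i := h.summable.le_tsum j fun i _ => h.w_nonneg i

lemma tsum_nonneg : 0 ≤ ∑' i, w i := _root_.tsum_nonneg fun i => h.w_nonneg i

lemma summable_mul_shift (k : ℤ) : Summable fun j => w (j + k) * w j :=
  Summable.of_nonneg_of_le (fun _ => mul_nonneg (h.w_nonneg _) (h.w_nonneg _))
    (fun _ => mul_le_mul_of_nonneg_right (h.w_le_tsum _) (h.w_nonneg _)) (h.summable.mul_left _)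

lemma summable_limCov {u : ℝ} (hu : u ∈ Ioc (0 : ℝ) 1) (k : ℤ) :
    Summable fun j => a u (j + k) * a u j := by
  refine Summable.of_norm_bounded (h.summable_mul_shift k) fun j => ?_
  rw [Real.norm_eq_abs, abs_mul]
  exact mul_le_mul (h.limit_le u hu _) (h.limit_le u hu _) (abs_nonneg _) (h.w_nonneg _)

lemma abs_limCov_le {u : ℝ} (hu : u ∈ Ioc (0 : ℝ) 1) (k : ℤ) :
    |limCov a u k| ≤ (∑' j, w j) ^ 2 := by
  have h1 : |limCov a u k| ≤ ∑' j, w (j + k) * w j := by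
    rw [← Real.norm_eq_abs]
    refine tsum_of_norm_bounded (h.summable_mul_shift k).hasSum fun j => ?_
    rw [Real.norm_eq_abs, abs_mul]
    exact mul_le_mul (h.limit_le u hu _) (h.limit_le u hu _) (abs_nonneg _) (h.w_nonneg _)
  refine h1.trans ?_
  rw [sq, ← tsum_mul_left]
  exact Summable.tsum_le_tsum (fun j => mul_le_mul_of_nonneg_right (h.w_le_tsum _) (h.w_nonneg _))
    (h.summable_mul_shift k) (h.summable.mul_left _)

lemma aemeasurable_coef (j : ℤ) : AEMeasurable (fun u => a u j) (volume.restrict (Ioc 0 1)) :=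
  aemeasurable_of_eVariationOn_ne_top measurableSet_Ioc
    (ne_top_of_le_ne_top ENNReal.ofReal_ne_top (h.variation_le j))

lemma aemeasurable_limCov (k : ℤ) :
    AEMeasurable (fun u => limCov a u k) (volume.restrict (Ioc 0 1)) := by
  obtain ⟨v, hv⟩ := exists_seq_tendsto (atTop : Filter (Finset ℤ))
  refine aemeasurable_of_tendsto_metrizable_ae atTop
    (f := fun N u => ∑ j ∈ v N, a u (j + k) * a u j) (fun N => ?_) ?_
  · exact Finset.aemeasurable_fun_sum _ fun j _ => (h.aemeasurable_coef _).mul (h.aemeasurable_coef _)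
  · filter_upwards [ae_restrict_mem measurableSet_Ioc] with u hu
    exact (h.summable_limCov hu k).hasSum.comp hv

omit h in
/-- The coefficient products entering the covariance at midpoint `t`, lag `k`. -/
lemma card_bad_le (n : ℕ) (k : ℤ) :
    ((Finset.Icc (1 : ℤ) n).filter fun t => ¬ ((2 * t + 1 + k) / 2 ∈ Icc (1 : ℤ) n ∧
      (2 * t + 1 - k) / 2 ∈ Icc (1 : ℤ) n)).card ≤ 2 * k.natAbs := by
  calc _ ≤ (Finset.Icc (1 : ℤ) k.natAbs ∪ Finset.Ioc ((n : ℤ) - k.natAbs) n).card := by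
        refine Finset.card_le_card fun t ht => ?_
        simp only [Finset.mem_filter, Finset.mem_Icc, mem_Icc, Finset.mem_union,
          Finset.mem_Ioc] at ht ⊢
        omega
    _ ≤ _ := Finset.card_union_le _ _
    _ = 2 * k.natAbs := by
        rw [Int.card_Icc, Int.card_Ioc]; omega

/-- Bound for the `j`-th summand of the difference of the finite sample covariance and the limiting
covariance, at midpoint `t` and lag `k`. -/
noncomputable def covErr (a : ℝ → ℤ → ℝ) (w : ℤ → ℝ) (α : ℕ → ℤ → ℤ → ℝ) (n : ℕ) (k t j : ℤ) :
    ℝ≥0∞ :=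
  if (2 * t + 1 + k) / 2 ∈ Icc (1 : ℤ) n ∧ (2 * t + 1 - k) / 2 ∈ Icc (1 : ℤ) n then
    ENNReal.ofReal (w j) * (‖α n ((2 * t + 1 + k) / 2) (j + k) -
        a ((((2 * t + 1 + k) / 2 : ℤ) : ℝ) / n) (j + k)‖ₑ +
        rangeOsc n (fun u => a u (j + k)) k.natAbs t) +
    ENNReal.ofReal (w (j + k)) * (‖α n ((2 * t + 1 - k) / 2) j -
        a ((((2 * t + 1 - k) / 2 : ℤ) : ℝ) / n) j‖ₑ + rangeOsc n (fun u => a u j) k.natAbs t)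
  else ENNReal.ofReal (w (j + k)) * ENNReal.ofReal (w j)

/-- The covariance at midpoint `t` and lag `k`, if both indices are admissible. -/
noncomputable def lagCov (P : Measure Ω) (X : ℕ → ℤ → Ω → ℝ) (n : ℕ) (k t : ℤ) : ℝ :=
  if (2 * t + 1 + k) / 2 ∈ Icc (1 : ℤ) n ∧ (2 * t + 1 - k) / 2 ∈ Icc (1 : ℤ) n then
    ∫ ω, X n ((2 * t + 1 + k) / 2) ω * X n ((2 * t + 1 - k) / 2) ω ∂P else 0

lemma enorm_lagCov_sub_le (hn : 0 < n) {t : ℤ} (ht : t ∈ Finset.Icc (1 : ℤ) n) (k : ℤ) {u : ℝ}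
    (hu : u ∈ cell n t) : ‖lagCov P X n k t - limCov a u k‖ₑ ≤ ∑' j, covErr a w α n k t j := by
  have hu1 := cell_subset hn ht hu
  have hw : ∀ {x : ℝ} {j : ℤ}, |x| ≤ w j → ‖x‖ₑ ≤ ENNReal.ofReal (w j) := fun hx => by
    rw [Real.enorm_eq_ofReal_abs]; exact ENNReal.ofReal_le_ofReal hx
  by_cases hok : (2 * t + 1 + k) / 2 ∈ Icc (1 : ℤ) n ∧ (2 * t + 1 - k) / 2 ∈ Icc (1 : ℤ) n
  · set s := (2 * t + 1 + k) / 2 with hs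
    set r := (2 * t + 1 - k) / 2 with hr
    have hsr : s - r = k := by omega
    have hcov : HasSum (fun j => α n s (j + k) * α n r j) (∫ ω, X n s ω * X n r ω ∂P) := by
      have h1 := (Equiv.subLeft r).hasSum_iff.2 (h.cov n s hok.1 r hok.2)
      convert h1 using 2 with j
      simp only [Function.comp_apply, Equiv.subLeft_apply]
      congr 2 <;> omega
    have hlim := (h.summable_limCov hu1 k).hasSum
    have hdiff := (hcov.sub hlim).tsum_eq
    rw [lagCov, if_pos hok, limCov, ← hdiff]
    refine (enorm_tsum_le_tsum_enorm).trans (ENNReal.tsum_le_tsum fun j => ?_)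
    rw [covErr, if_pos hok]
    -- Telescoping the product leaves in each term one factor bounded by the weight and one
    -- difference of coefficients at a single lag index.
    have e1 : α n s (j + k) * α n r j - a u (j + k) * a u j =
        α n r j * (α n s (j + k) - a u (j + k)) + a u (j + k) * (α n r j - a u j) := by ring
    rw [e1]
    have e2 : ∀ {p i : ℤ}, p ∈ Icc (1 : ℤ) n → |p - t| ≤ (k.natAbs : ℤ) →
        ‖α n p i - a u i‖ₑ ≤ ‖α n p i - a ((p : ℝ) / n) i‖ₑ +
          rangeOsc n (fun u => a u i) k.natAbs t := by
      intro p i hp hpt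
      have e3 := edist_le_rangeOsc hn (fun u => a u i) (by simpa using hp) ht hpt hu
      rw [edist_eq_enorm_sub] at e3
      refine le_trans ?_ (add_le_add le_rfl e3)
      rw [show α n p i - a u i = (α n p i - a ((p : ℝ) / n) i) + (a ((p : ℝ) / n) i - a u i) by ring]
      exact enorm_add_le _ _
    refine (enorm_add_le _ _).trans ?_
    rw [enorm_mul, enorm_mul]
    gcongr
    · exact hw (h.coef_le n r hok.2 _)
    · exact e2 hok.1 (by rw [abs_le]; omega)
    · exact hw (h.limit_le u hu1 _)
    · exact e2 hok.2 (by rw [abs_le]; omega)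
  · rw [lagCov, if_neg hok, zero_sub, enorm_neg, limCov]
    refine (enorm_tsum_le_tsum_enorm).trans (ENNReal.tsum_le_tsum fun j => ?_)
    rw [covErr, if_neg hok, enorm_mul]
    gcongr
    · exact hw (h.limit_le u hu1 _)
    · exact hw (h.limit_le u hu1 _)

/-- The bound must be uniform in the lag `k`, although both the oscillation range and the number of
inadmissible midpoints grow like `|k|`. This growth is absorbed by the decay of the weights: `|k| ≤
|j + k| + |j|` and `|j| w j ≤ K`. The terms carrying `|k|` contribute `6K`, the coefficient
differences `K`, and the terms without `|k|` the multiple of `∑ w`. -/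
lemma sum_covErr_le (hn : 0 < n) (k j : ℤ) :
    ∑ t ∈ Finset.Icc (1 : ℤ) n, covErr a w α n k t j ≤
      ENNReal.ofReal ((7 * K + 4 * ∑' i, w i) * (w j + w (j + k))) := by
  set ok : ℤ → Prop := fun t =>
    (2 * t + 1 + k) / 2 ∈ Icc (1 : ℤ) n ∧ (2 * t + 1 - k) / 2 ∈ Icc (1 : ℤ) n with hok
  have hK := h.K_pos
  have hwj := h.w_nonneg j
  have hwk := h.w_nonneg (j + k)
  have hcoef : ∀ (i : ℤ) (f : ℤ → ℤ), Function.Injective f → (∀ t, ok t → f t ∈ Icc (1 : ℤ) n) →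
      ∑ t ∈ (Finset.Icc (1 : ℤ) n).filter ok, ‖α n (f t) i - a (((f t : ℤ) : ℝ) / n) i‖ₑ ≤
        ENNReal.ofReal K := by
    intro i f hf hfok
    rw [← Finset.sum_image (f := fun t : ℤ => ‖α n t i - a ((t : ℝ) / n) i‖ₑ) hf.injOn]
    calc _ ≤ ∑ t ∈ Finset.Icc (1 : ℤ) n, ‖α n t i - a ((t : ℝ) / n) i‖ₑ := by
          refine Finset.sum_le_sum_of_subset fun t ht => ?_
          simp only [Finset.mem_image, Finset.mem_filter] at ht
          obtain ⟨t', ht', rfl⟩ := ht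
          simpa using hfok t' ht'.2
      _ = ENNReal.ofReal (∑ t ∈ Finset.Icc (1 : ℤ) n, |α n t i - a ((t : ℝ) / n) i|) := by
          rw [ENNReal.ofReal_sum_of_nonneg fun t _ => abs_nonneg _]
          simp only [Real.enorm_eq_ofReal_abs]
      _ ≤ _ := ENNReal.ofReal_le_ofReal (h.coef_sub_le n i)
  have hosc : ∀ i : ℤ, ∑ t ∈ (Finset.Icc (1 : ℤ) n).filter ok,
      rangeOsc n (fun u => a u i) k.natAbs t ≤ ENNReal.ofReal ((2 * |(k : ℝ)| + 2) * w i) := by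
    intro i
    refine (sum_rangeOsc_le hn _ _ _).trans ?_
    rw [ENNReal.ofReal_mul (by positivity)]
    refine mul_le_mul' (le_of_eq ?_) (h.variation_le i)
    rw [← ENNReal.ofReal_natCast]
    congr 1
    push_cast
    rw [Nat.cast_natAbs, Int.cast_abs]
  have hinj1 : Function.Injective fun t : ℤ => (2 * t + 1 + k) / 2 := fun x y hxy => by
    simp only at hxy; omega
  have hinj2 : Function.Injective fun t : ℤ => (2 * t + 1 - k) / 2 := fun x y hxy => by
    simp only at hxy; omega
  rw [← Finset.sum_filter_add_sum_filter_not _ ok]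
  have hA : ∑ t ∈ (Finset.Icc (1 : ℤ) n).filter ok, covErr a w α n k t j ≤
      ENNReal.ofReal (w j) * (ENNReal.ofReal K + ENNReal.ofReal ((2 * |(k : ℝ)| + 2) * w (j + k))) +
      ENNReal.ofReal (w (j + k)) * (ENNReal.ofReal K + ENNReal.ofReal ((2 * |(k : ℝ)| + 2) * w j)) := by
    have e1 : ∀ t ∈ (Finset.Icc (1 : ℤ) n).filter ok, covErr a w α n k t j = _ := fun t ht => by
      rw [covErr, if_pos (Finset.mem_filter.1 ht).2]
    rw [Finset.sum_congr rfl e1, Finset.sum_add_distrib, ← Finset.mul_sum, ← Finset.mul_sum,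
      Finset.sum_add_distrib, Finset.sum_add_distrib]
    gcongr
    · exact hcoef (j + k) _ hinj1 fun t ht => ht.1
    · exact hosc _
    · exact hcoef j _ hinj2 fun t ht => ht.2
    · exact hosc _
  have hB : ∑ t ∈ (Finset.Icc (1 : ℤ) n).filter (fun t => ¬ ok t), covErr a w α n k t j ≤
      ENNReal.ofReal (2 * |(k : ℝ)| * (w (j + k) * w j)) := by
    have e1 : ∀ t ∈ (Finset.Icc (1 : ℤ) n).filter (fun t => ¬ ok t), covErr a w α n k t j =
        ENNReal.ofReal (w (j + k) * w j) := fun t ht => by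
      rw [covErr, if_neg (Finset.mem_filter.1 ht).2, ENNReal.ofReal_mul hwk]
    rw [Finset.sum_congr rfl e1, Finset.sum_const, nsmul_eq_mul, ENNReal.ofReal_mul (show (0 : ℝ) ≤ 2 * |(k : ℝ)| by positivity)]
    gcongr
    rw [← ENNReal.ofReal_natCast]
    refine ENNReal.ofReal_le_ofReal ?_
    have e2 : (((Finset.Icc (1 : ℤ) n).filter fun t => ¬ ok t).card : ℝ) ≤ (2 * k.natAbs : ℕ) := by
      exact_mod_cast card_bad_le n k
    refine e2.trans (le_of_eq ?_)
    push_cast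
    rw [Nat.cast_natAbs, Int.cast_abs]
  refine (add_le_add hA hB).trans ?_
  rw [← ENNReal.ofReal_add (by positivity) (by positivity),
    ← ENNReal.ofReal_add (by positivity) (by positivity), ← ENNReal.ofReal_mul hwj,
    ← ENNReal.ofReal_mul hwk, ← ENNReal.ofReal_add (by positivity) (by positivity),
    ← ENNReal.ofReal_add (by positivity) (by positivity)]
  refine ENNReal.ofReal_le_ofReal ?_
  have hk : |(k : ℝ)| ≤ |((j + k : ℤ) : ℝ)| + |(j : ℝ)| := by
    have := abs_sub ((j + k : ℤ) : ℝ) (j : ℝ)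
    push_cast at this ⊢
    simpa using this
  have d1 := h.w_decay j
  have d2 := h.w_decay (j + k)
  have hW := h.w_le_tsum (j + k)
  have m1 : |(k : ℝ)| * (w (j + k) * w j) ≤ K * w j + K * w (j + k) := by
    calc _ ≤ (|((j + k : ℤ) : ℝ)| + |(j : ℝ)|) * (w (j + k) * w j) := by gcongr
      _ = (|((j + k : ℤ) : ℝ)| * w (j + k)) * w j + (|(j : ℝ)| * w j) * w (j + k) := by ring
      _ ≤ _ := by gcongr
  have m2 : w (j + k) * w j ≤ (∑' i, w i) * w j := by gcongr
  have m3 : 0 ≤ (∑' i, w i) * w (j + k) := mul_nonneg h.tsum_nonneg hwk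
  nlinarith

/-- The constant in the bias bound. -/
noncomputable def biasConst (w : ℤ → ℝ) (K : ℝ) : ℝ :=
  2 * (7 * K + 4 * ∑' i, w i) * ∑' i, w i

lemma biasConst_nonneg : 0 ≤ biasConst w K := by
  have := h.tsum_nonneg
  have := h.K_pos
  unfold biasConst
  positivity

/-- The expectation of the quadratic form with symbol `β` is close to its limit. -/
lemma bias {β : ℝ → ℤ → ℝ} {R : ℝ} (hn : 0 < n) (hβ : ∀ k, Measurable fun u => β u k)
    (hR0 : 0 ≤ R) (hR : symSup β ≤ ENNReal.ofReal R) :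
    |∫ ω, quadForm X n (quadCoef n β) ω ∂P - ∑' k : ℤ, ∫ u in Ioc (0 : ℝ) 1, β u k * limCov a u k| ≤
      biasConst w K * R / n := by
  have hn' : (0 : ℝ) < n := by exact_mod_cast hn
  have hW0 := h.tsum_nonneg
  have hK := h.K_pos
  set S : ℤ → ℝ≥0∞ := fun k => ⨆ u ∈ Ioc (0 : ℝ) 1, ‖β u k‖ₑ with hS
  have hS1 : ∑' k, S k ≤ ENNReal.ofReal R := hR
  have hβS : ∀ {u : ℝ} (k : ℤ), u ∈ Ioc (0 : ℝ) 1 → ‖β u k‖ₑ ≤ S k := fun k hu =>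
    le_biSup (fun u => ‖β u k‖ₑ) hu
  have hint : ∀ k, IntegrableOn (fun u => β u k) (Ioc 0 1) :=
    integrableOn_of_symSup hβ (ne_top_of_le_ne_top ENNReal.ofReal_ne_top hR)
  have hintc : ∀ k, IntegrableOn (fun u => β u k * limCov a u k) (Ioc 0 1) := by
    intro k
    refine (hint k).mul_bdd (c := (∑' j, w j) ^ 2) (h.aemeasurable_limCov k).aestronglyMeasurable ?_
    filter_upwards [ae_restrict_mem measurableSet_Ioc] with u hu
    exact h.abs_limCov_le hu k
  set e : ℤ → ℝ := fun k => ∑ t ∈ Finset.Icc (1 : ℤ) n, ∫ u in cell n t, β u k * lagCov P X n k t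
    with he
  have he0 : ∀ k ∉ Finset.Icc (-(n : ℤ)) n, e k = 0 := by
    intro k hk
    refine Finset.sum_eq_zero fun t ht => ?_
    have : lagCov P X n k t = 0 := by
      rw [lagCov, if_neg]
      simp only [Finset.mem_Icc, mem_Icc] at *
      omega
    simp [this]
  -- In midpoint and lag coordinates the expected form becomes a sum over lags of cell integrals.
  -- Lags beyond `n` contribute zero, so extending to a series over all integers costs nothing.
  have hEQ : ∫ ω, quadForm X n (quadCoef n β) ω ∂P = ∑' k, e k := by
    rw [tsum_eq_sum he0, h.integral_quadForm, ← sum_lag_eq_sum_pairs, Finset.sum_comm]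
    refine Finset.sum_congr rfl fun t ht => ?_
    rw [Finset.sum_filter]
    refine Finset.sum_congr rfl fun k hk => ?_
    rw [integral_mul_const, lagCov]
    split_ifs with hok
    · congr 1
      rw [quadCoef]
      congr 2
      · congr 1; omega
      · ext u; congr 1; omega
    · simp
  have hdiff : ∀ k, ‖e k - ∫ u in Ioc (0 : ℝ) 1, β u k * limCov a u k‖ₑ ≤
      ENNReal.ofReal (biasConst w K / n) * S k := by
    intro k
    rw [← sum_integral_cell hn (hintc k), he, ← Finset.sum_sub_distrib]
    have h1 : ∀ t ∈ Finset.Icc (1 : ℤ) n, ‖(∫ u in cell n t, β u k * lagCov P X n k t) -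
        ∫ u in cell n t, β u k * limCov a u k‖ₑ ≤
        ENNReal.ofReal (1 / n) * S k * ∑' j, covErr a w α n k t j := by
      intro t ht
      have hsub := cell_subset hn ht
      rw [← integral_sub (((hint k).mono_set hsub).mul_const _) ((hintc k).mono_set hsub)]
      refine (enorm_integral_le_lintegral_enorm _).trans ?_
      calc _ ≤ ∫⁻ _u in cell n t, S k * ∑' j, covErr a w α n k t j := by
            refine setLIntegral_mono measurable_const fun u hu => ?_
            rw [← mul_sub, enorm_mul]
            exact mul_le_mul' (hβS k (hsub hu)) (h.enorm_lagCov_sub_le hn ht k hu)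
        _ = _ := by rw [setLIntegral_const, volume_cell]; ring
    refine (enorm_sum_le _ _).trans ((Finset.sum_le_sum h1).trans ?_)
    rw [← Finset.mul_sum, ← Summable.tsum_finsetSum fun t _ => ENNReal.summable]
    calc _ ≤ ENNReal.ofReal (1 / n) * S k *
          ∑' j, ENNReal.ofReal ((7 * K + 4 * ∑' i, w i) * (w j + w (j + k))) := by
          gcongr with j
          exact h.sum_covErr_le hn k j
      _ = ENNReal.ofReal (1 / n) * S k * ENNReal.ofReal (biasConst w K) := by
          rw [← ENNReal.ofReal_tsum_of_nonneg]
          · congr 2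
            rw [tsum_mul_left, h.summable.tsum_add (h.summable_shift k),
              show ∑' j, w (j + k) = ∑' j, w j from (Equiv.addRight k).tsum_eq w, biasConst]
            ring
          · intro j
            have := h.w_nonneg j
            have := h.w_nonneg (j + k)
            positivity
          · exact (h.summable.add (h.summable_shift k)).mul_left _
      _ = _ := by
          rw [mul_right_comm, ← ENNReal.ofReal_mul (by positivity)]
          congr 2
          ring
  have htot : ∑' k, ‖e k - ∫ u in Ioc (0 : ℝ) 1, β u k * limCov a u k‖ₑ ≤
      ENNReal.ofReal (biasConst w K * R / n) := by
    refine (ENNReal.tsum_le_tsum hdiff).trans ?_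
    rw [ENNReal.tsum_mul_left]
    calc _ ≤ ENNReal.ofReal (biasConst w K / n) * ENNReal.ofReal R := by gcongr
      _ = _ := by
        rw [← ENNReal.ofReal_mul (div_nonneg h.biasConst_nonneg hn'.le)]
        congr 1; ring
  have hsum1 : Summable fun k => e k - ∫ u in Ioc (0 : ℝ) 1, β u k * limCov a u k := by
    have h2 := ENNReal.summable_toReal (ne_top_of_le_ne_top ENNReal.ofReal_ne_top htot)
    refine Summable.of_norm ?_
    simpa using h2
  have hsum2 : Summable e := summable_of_ne_finset_zero he0
  have hsum3 : Summable fun k => ∫ u in Ioc (0 : ℝ) 1, β u k * limCov a u k := by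
    simpa using hsum2.sub hsum1
  rw [hEQ, ← hsum2.tsum_sub hsum3, ← ENNReal.ofReal_le_ofReal_iff
    (div_nonneg (mul_nonneg h.biasConst_nonneg hR0) hn'.le), ← Real.enorm_eq_ofReal_abs]
  exact enorm_tsum_le_tsum_enorm.trans htot

end LinearRows

end LocStat

/-! ### Fourier coefficients of functions on the rectangle -/

namespace LocStat

section fourier

/-- Jointly measurable functions which are bounded by `M` on the rectangle. -/
structure BoundedOnRect (φ : ℝ → ℝ → ℝ) (M : ℝ) : Prop where
  measurable : Measurable fun p : ℝ × ℝ => φ p.1 p.2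
  abs_le : ∀ u ∈ Icc (0 : ℝ) 1, ∀ x ∈ Icc (-Real.pi) Real.pi, |φ u x| ≤ M

/-- The real part of the Fourier coefficients of `φ(u, ·)`. -/
noncomputable def cosCoef (φ : ℝ → ℝ → ℝ) (u : ℝ) (k : ℤ) : ℝ :=
  ∫ x in (-Real.pi)..Real.pi, φ u x * Real.cos (k * x)

lemma neg_pi_le_pi : -Real.pi ≤ Real.pi := by linarith [Real.pi_pos]

lemma rect_eq_Ioc : rect = (volume.restrict (Ioc (0 : ℝ) 1)).prod
    (volume.restrict (Ioc (-Real.pi) Real.pi)) := by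
  rw [rect, Measure.restrict_congr_set Ioc_ae_eq_Icc, Measure.restrict_congr_set Ioc_ae_eq_Icc]

instance isFiniteMeasure_rect : IsFiniteMeasure rect := by
  unfold rect; infer_instance

lemma ae_rect_mem : ∀ᵐ p ∂rect, p.1 ∈ Ioc (0 : ℝ) 1 ∧ p.2 ∈ Ioc (-Real.pi) Real.pi := by
  rw [rect_eq_Ioc, Measure.prod_restrict]
  filter_upwards [ae_restrict_mem (measurableSet_Ioc.prod measurableSet_Ioc)] with p hp using hp

lemma exp_I_mul_re (x : ℝ) (k : ℤ) : (Complex.exp (Complex.I * x * k)).re = Real.cos (k * x) := by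
  rw [show Complex.I * x * k = ((k * x : ℝ) : ℂ) * Complex.I by push_cast; ring]
  exact Complex.exp_ofReal_mul_I_re _

/-- Parseval's identity for bounded real functions on `[-π, π]`. -/
lemma hasSum_sq_fourier {g : ℝ → ℝ} {M : ℝ} (hg : Measurable g)
    (hM : ∀ x ∈ Icc (-Real.pi) Real.pi, |g x| ≤ M) :
    HasSum (fun k : ℤ => ‖∫ x in (-Real.pi)..Real.pi, (g x : ℂ) * Complex.exp (Complex.I * x * k)‖ ^ 2)
      (2 * Real.pi * ∫ x in (-Real.pi)..Real.pi, g x ^ 2) := by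
  have hab : -Real.pi < Real.pi := by linarith [Real.pi_pos]
  have hL : MemLp (fun x => (g x : ℂ)) 2 (volume.restrict (Ioc (-Real.pi) Real.pi)) := by
    refine MemLp.of_bound (Complex.measurable_ofReal.comp hg).aestronglyMeasurable M ?_
    filter_upwards [ae_restrict_mem measurableSet_Ioc] with x hx
    simpa using hM x (Ioc_subset_Icc_self hx)
  have h1 := hasSum_sq_fourierCoeffOn hab hL
  have h2 := ((Equiv.neg ℤ).hasSum_iff.2 h1).mul_left ((2 * Real.pi) ^ 2)
  have hF : ∀ k : ℤ, ‖∫ x in (-Real.pi)..Real.pi, (g x : ℂ) * Complex.exp (Complex.I * x * k)‖ ^ 2 =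
      (2 * Real.pi) ^ 2 * ‖fourierCoeffOn hab (fun x => (g x : ℂ)) (-k)‖ ^ 2 := by
    intro k
    rw [fourierCoeffOn_eq_integral, norm_smul]
    have e1 : ‖1 / (Real.pi - -Real.pi)‖ = (2 * Real.pi)⁻¹ := by
      rw [Real.norm_of_nonneg (one_div_nonneg.2 (by linarith)), one_div]; congr 1; ring
    rw [e1, ← mul_pow, ← mul_assoc, mul_inv_cancel₀ (by have := Real.pi_pos; positivity), one_mul]
    congr 2
    refine intervalIntegral.integral_congr fun x _ => ?_
    simp only [neg_neg, smul_eq_mul]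
    rw [fourier_coe_apply, mul_comm]
    congr 2
    have : (Real.pi : ℂ) ≠ 0 := by exact_mod_cast Real.pi_ne_zero
    push_cast
    field_simp
    ring
  have hI : 2 * Real.pi * ∫ x in (-Real.pi)..Real.pi, g x ^ 2 = (2 * Real.pi) ^ 2 *
      ((Real.pi - -Real.pi)⁻¹ • ∫ x in (-Real.pi)..Real.pi, ‖(g x : ℂ)‖ ^ 2) := by
    simp only [smul_eq_mul, Complex.norm_real, Real.norm_eq_abs, sq_abs]
    have := Real.pi_pos
    field_simp
    ring
  simp_rw [hF]
  rw [hI]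
  exact h2

variable {φ ψ : ℝ → ℝ → ℝ} {M N : ℝ}

lemma BoundedOnRect.sub (hφ : BoundedOnRect φ M) (hψ : BoundedOnRect ψ N) :
    BoundedOnRect (fun u x => φ u x - ψ u x) (M + N) :=
  ⟨hφ.measurable.sub hψ.measurable, fun u hu x hx =>
    (abs_sub _ _).trans (add_le_add (hφ.abs_le u hu x hx) (hψ.abs_le u hu x hx))⟩

lemma BoundedOnRect.slice (hφ : BoundedOnRect φ M) (u : ℝ) : Measurable (φ u) :=
  hφ.measurable.comp (measurable_const.prodMk measurable_id)

lemma BoundedOnRect.intervalIntegrable (hφ : BoundedOnRect φ M) {u : ℝ} (hu : u ∈ Icc (0 : ℝ) 1) :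
    IntervalIntegrable (φ u) volume (-Real.pi) Real.pi := by
  rw [intervalIntegrable_iff_integrableOn_Ioc_of_le neg_pi_le_pi]
  refine Integrable.of_bound (hφ.slice u).aestronglyMeasurable M ?_
  filter_upwards [ae_restrict_mem measurableSet_Ioc] with x hx
  exact hφ.abs_le u hu x (Ioc_subset_Icc_self hx)

lemma BoundedOnRect.integrable (hφ : BoundedOnRect φ M) :
    Integrable (fun p : ℝ × ℝ => φ p.1 p.2) rect := by
  refine Integrable.of_bound hφ.measurable.aestronglyMeasurable M ?_
  filter_upwards [ae_rect_mem] with p hp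
  exact hφ.abs_le _ (Ioc_subset_Icc_self hp.1) _ (Ioc_subset_Icc_self hp.2)

lemma continuous_exp_I_mul (k : ℤ) : Continuous fun x : ℝ => Complex.exp (Complex.I * x * k) := by
  fun_prop

lemma BoundedOnRect.intervalIntegrable_exp (hφ : BoundedOnRect φ M) {u : ℝ} (hu : u ∈ Icc (0 : ℝ) 1)
    (k : ℤ) : IntervalIntegrable (fun x => (φ u x : ℂ) * Complex.exp (Complex.I * x * k)) volume
      (-Real.pi) Real.pi := by
  refine IntervalIntegrable.mul_continuousOn ?_ (continuous_exp_I_mul k).continuousOn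
  have := hφ.intervalIntegrable hu
  exact ⟨this.1.ofReal, this.2.ofReal⟩

lemma cosCoef_eq_re (hφ : BoundedOnRect φ M) {u : ℝ} (hu : u ∈ Icc (0 : ℝ) 1) (k : ℤ) :
    cosCoef φ u k = (fourierCoef φ u k).re := by
  have h1 := hφ.intervalIntegrable_exp hu k
  rw [intervalIntegrable_iff_integrableOn_Ioc_of_le neg_pi_le_pi] at h1
  rw [cosCoef, fourierCoef, intervalIntegral.integral_of_le neg_pi_le_pi,
    intervalIntegral.integral_of_le neg_pi_le_pi]
  have h2 := integral_re h1
  simp only [RCLike.re_eq_complex_re] at h2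
  rw [← h2]
  refine integral_congr_ae (Eventually.of_forall fun x => ?_)
  simp only
  rw [Complex.re_ofReal_mul, exp_I_mul_re]

lemma measurable_cosCoef (hφ : BoundedOnRect φ M) (k : ℤ) : Measurable fun u => cosCoef φ u k := by
  simp only [cosCoef, intervalIntegral.integral_of_le neg_pi_le_pi]
  have h1 : StronglyMeasurable (Function.uncurry fun u x : ℝ => φ u x * Real.cos (k * x)) :=
    (hφ.measurable.mul (by fun_prop)).stronglyMeasurable
  exact (StronglyMeasurable.integral_prod_right (ν := volume.restrict (Ioc (-Real.pi) Real.pi)) h1).measurable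

lemma cosCoef_sub (hφ : BoundedOnRect φ M) (hψ : BoundedOnRect ψ N) {u : ℝ} (hu : u ∈ Icc (0 : ℝ) 1)
    (k : ℤ) : cosCoef (fun u x => φ u x - ψ u x) u k = cosCoef φ u k - cosCoef ψ u k := by
  unfold cosCoef
  rw [← intervalIntegral.integral_sub]
  · simp only [sub_mul]
  · exact (hφ.intervalIntegrable hu).mul_continuousOn (by fun_prop)
  · exact (hψ.intervalIntegrable hu).mul_continuousOn (by fun_prop)

lemma symSup_cosCoef_le (hφ : BoundedOnRect φ M) : symSup (cosCoef φ) ≤ rhoInfty φ := by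
  refine ENNReal.tsum_le_tsum fun k => iSup₂_le fun u hu => ?_
  refine le_trans ?_ (le_biSup (fun u => ‖fourierCoef φ u k‖ₑ) (Ioc_subset_Icc_self hu))
  rw [cosCoef_eq_re hφ (Ioc_subset_Icc_self hu), enorm_le_iff_norm_le]
  exact Complex.abs_re_le_norm _

lemma symVar_cosCoef_le (hφ : BoundedOnRect φ M) : symVar (cosCoef φ) ≤ vSigma φ := by
  refine ENNReal.tsum_le_tsum fun k => ?_
  refine le_trans ?_ (eVariationOn.mono (fun u => fourierCoef φ u k) Ioc_subset_Icc_self)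
  have h1 : eVariationOn (fun u => cosCoef φ u k) (Ioc 0 1) =
      eVariationOn (fun u => (fourierCoef φ u k).re) (Ioc 0 1) :=
    eVariationOn.congr fun u hu => cosCoef_eq_re hφ (Ioc_subset_Icc_self hu) k
  rw [h1]
  have h2 : LipschitzOnWith 1 Complex.re univ :=
    (LipschitzWith.of_dist_le_mul fun x y => by
      rw [NNReal.coe_one, one_mul, Real.dist_eq, Complex.dist_eq, ← Complex.sub_re]
      exact Complex.abs_re_le_norm _).lipschitzOnWith
  refine (h2.comp_eVariationOn_le (g := fun u => fourierCoef φ u k) (s := Ioc 0 1)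
    (mapsTo_univ _ _)).trans ?_
  simp

lemma rho2_sq (φ ψ : ℝ → ℝ → ℝ) :
    rho2 φ ψ ^ 2 = ∫⁻ p, ENNReal.ofReal (|φ p.1 p.2 - ψ p.1 p.2| ^ 2) ∂rect := by
  rw [rho2, ← ENNReal.rpow_natCast, ← ENNReal.rpow_mul]
  norm_num

/-- Parseval's identity for every fixed `u`, integrated over `u`; taking real parts only decreases
the coefficients. -/
lemma symSq_cosCoef_le (hφ : BoundedOnRect φ M) :
    symSq (cosCoef φ) ≤ ENNReal.ofReal (2 * Real.pi) * rho2 φ 0 ^ 2 := by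
  have hpi := Real.pi_pos
  rw [symSq, ← lintegral_tsum fun k => ((measurable_cosCoef hφ k).enorm.pow_const 2).aemeasurable,
    rho2_sq, rect_eq_Ioc, lintegral_prod _ ?_]
  · rw [← lintegral_const_mul']
    · refine setLIntegral_mono' measurableSet_Ioc fun u hu => ?_
      have hu' := Ioc_subset_Icc_self hu
      have h1 := hasSum_sq_fourier (hφ.slice u) (hφ.abs_le u hu')
      calc ∑' k : ℤ, ‖cosCoef φ u k‖ₑ ^ 2 ≤ ∑' k : ℤ, ENNReal.ofReal (‖∫ x in (-Real.pi)..Real.pi,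
            (φ u x : ℂ) * Complex.exp (Complex.I * x * k)‖ ^ 2) := by
            refine ENNReal.tsum_le_tsum fun k => ?_
            rw [← ofReal_norm, ← ENNReal.ofReal_pow (norm_nonneg _), cosCoef_eq_re hφ hu']
            refine ENNReal.ofReal_le_ofReal ?_
            gcongr
            exact Complex.abs_re_le_norm _
        _ = ENNReal.ofReal (2 * Real.pi * ∫ x in (-Real.pi)..Real.pi, φ u x ^ 2) := by
            rw [← ENNReal.ofReal_tsum_of_nonneg (fun k => by positivity) h1.summable, h1.tsum_eq]
        _ = _ := by
            rw [ENNReal.ofReal_mul (by positivity), intervalIntegral.integral_of_le neg_pi_le_pi,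
              ofReal_integral_eq_lintegral_ofReal]
            · simp
            · refine Integrable.of_bound ((hφ.slice u).pow_const 2).aestronglyMeasurable (M ^ 2) ?_
              filter_upwards [ae_restrict_mem measurableSet_Ioc] with x hx
              rw [Real.norm_eq_abs, abs_pow]
              gcongr
              exact hφ.abs_le u hu' x (Ioc_subset_Icc_self hx)
            · exact Eventually.of_forall fun x => by positivity
    · exact ENNReal.ofReal_ne_top
  · have := hφ.measurable
    simp only [Pi.zero_apply, sub_zero]
    exact ((measurable_norm.comp this).pow_const 2).ennreal_ofReal.aemeasurable

end fourier

/-! ### Spectral density and local covariances -/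

section spectral

variable {Ω : Type*} [MeasurableSpace Ω] {P : Measure Ω} {X : ℕ → ℤ → Ω → ℝ} {a : ℝ → ℤ → ℝ}
  {w : ℤ → ℝ} {K : ℝ} {α : ℕ → ℤ → ℤ → ℝ}
  {φ : ℝ → ℝ → ℝ} {M : ℝ}

namespace LinearRows

variable (h : LinearRows P X a w K α)
include h

lemma summable_coef {u : ℝ} (hu : u ∈ Ioc (0 : ℝ) 1) : Summable fun j => |a u j| :=
  Summable.of_nonneg_of_le (fun _ => abs_nonneg _) (h.limit_le u hu) h.summable

/-- Expand `A(u, x)` times its conjugate as an absolutely convergent double series and collect the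
pairs of indices `(j + k, j)` by their difference `k`. -/
lemma hasSum_specDensity {u : ℝ} (hu : u ∈ Ioc (0 : ℝ) 1) (x : ℝ) :
    HasSum (fun k : ℤ => limCov a u k * Real.cos (k * x)) (2 * Real.pi * specDensity a u x) := by
  set e : ℤ → ℂ := fun j => (a u j : ℂ) * Complex.exp (-Complex.I * x * j) with he
  have hexp : ∀ j : ℤ, ‖Complex.exp (-Complex.I * x * j)‖ = 1 := fun j => by
    rw [show -Complex.I * x * j = ((-(x * j) : ℝ) : ℂ) * Complex.I by push_cast; ring]
    exact Complex.norm_exp_ofReal_mul_I _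
  have hn : Summable fun j => ‖e j‖ := by
    simpa only [he, norm_mul, hexp, mul_one, Complex.norm_real, Real.norm_eq_abs] using h.summable_coef hu
  have hc : Summable fun j => ‖starRingEnd ℂ (e j)‖ := by simpa using hn
  have h1 := (summable_mul_of_summable_norm hn hc).hasSum
  rw [← tsum_mul_tsum_of_summable_norm hn hc, ← Complex.conj_tsum] at h1
  have h2 := (Equiv.hasSum_iff (f := fun z : ℤ × ℤ => e z.1 * starRingEnd ℂ (e z.2))
    (Equiv.mk (fun p : ℤ × ℤ => (p.2 + p.1, p.2)) (fun p => (p.1 - p.2, p.2))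
      (fun p => by simp) (fun p => by simp))).2 h1
  have h3 : ∀ k j : ℤ, e (j + k) * starRingEnd ℂ (e j) =
      ((a u (j + k) * a u j : ℝ) : ℂ) * Complex.exp (Complex.I * x * (-k : ℤ)) := by
    intro k j
    simp only [he, map_mul, Complex.conj_ofReal, ← Complex.exp_conj, map_neg, Complex.conj_I, map_intCast]
    rw [mul_mul_mul_comm, ← Complex.exp_add]
    push_cast
    congr 2
    ring
  have h4 := HasSum.prod_fiberwise h2
    (g := fun k => (limCov a u k : ℂ) * Complex.exp (Complex.I * x * (-k : ℤ))) (fun k => by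
      simp only [Function.comp_apply, Equiv.coe_fn_mk, h3]
      exact (Complex.hasSum_ofReal.2 (h.summable_limCov hu k).hasSum).mul_right _)
  have h5 := Complex.hasSum_re h4
  convert h5 using 1
  · ext k
    rw [Complex.re_ofReal_mul, exp_I_mul_re]
    push_cast
    rw [neg_mul, Real.cos_neg]
  · rw [Complex.mul_conj, Complex.ofReal_re, Complex.normSq_eq_norm_sq, specDensity, transferFun]
    have := Real.pi_pos
    rw [← mul_assoc, mul_one_div_cancel (by positivity), one_mul]

lemma summable_lagBound : Summable fun k : ℤ => ∑' j, w (j + k) * w j := by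
  have h1 := summable_mul_of_summable_norm h.summable.norm h.summable.norm
  have h2 := (Equiv.summable_iff (f := fun z : ℤ × ℤ => w z.1 * w z.2)
    (Equiv.mk (fun p : ℤ × ℤ => (p.2 + p.1, p.2)) (fun p => (p.1 - p.2, p.2))
      (fun p => by simp) (fun p => by simp))).2 h1
  exact h2.prod

lemma abs_limCov_le_lagBound {u : ℝ} (hu : u ∈ Ioc (0 : ℝ) 1) (k : ℤ) :
    |limCov a u k| ≤ ∑' j, w (j + k) * w j := by
  rw [← Real.norm_eq_abs]
  refine tsum_of_norm_bounded (h.summable_mul_shift k).hasSum fun j => ?_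
  rw [Real.norm_eq_abs, abs_mul]
  exact mul_le_mul (h.limit_le u hu _) (h.limit_le u hu _) (abs_nonneg _) (h.w_nonneg _)

lemma specDensity_le {u : ℝ} (hu : u ∈ Ioc (0 : ℝ) 1) (x : ℝ) :
    specDensity a u x ≤ (∑' j, w j) ^ 2 := by
  have h1 : ‖transferFun a u x‖ ≤ ∑' j, w j := by
    refine tsum_of_norm_bounded h.summable.hasSum fun j => ?_
    rw [norm_mul, show -Complex.I * x * j = ((-(x * j) : ℝ) : ℂ) * Complex.I by push_cast; ring,
      Complex.norm_exp_ofReal_mul_I, mul_one, Complex.norm_real]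
    exact h.limit_le u hu j
  unfold specDensity
  have h2 : 1 / (2 * Real.pi) ≤ 1 := by
    rw [div_le_one (by have := Real.pi_pos; positivity)]; linarith [Real.pi_gt_three]
  calc _ ≤ 1 * (∑' j, w j) ^ 2 := by gcongr
    _ = _ := one_mul _

omit h in
lemma specDensity_nonneg (a : ℝ → ℤ → ℝ) (u x : ℝ) : 0 ≤ specDensity a u x := by
  unfold specDensity
  have := Real.pi_pos
  positivity

lemma aemeasurable_limCov_rect (k : ℤ) : AEMeasurable (fun p : ℝ × ℝ => limCov a p.1 k) rect := by
  rw [rect_eq_Ioc]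
  exact (h.aemeasurable_limCov k).comp_quasiMeasurePreserving Measure.quasiMeasurePreserving_fst

lemma aemeasurable_specDensity : AEMeasurable (fun p : ℝ × ℝ => specDensity a p.1 p.2) rect := by
  have h0 : AEMeasurable (fun p : ℝ × ℝ => 2 * Real.pi * specDensity a p.1 p.2) rect := by
    obtain ⟨v, hv⟩ := exists_seq_tendsto (atTop : Filter (Finset ℤ))
    refine aemeasurable_of_tendsto_metrizable_ae atTop
      (f := fun N p => ∑ k ∈ v N, limCov a p.1 k * Real.cos (k * p.2)) (fun N => ?_) ?_
    · refine Finset.aemeasurable_fun_sum _ fun k _ => (h.aemeasurable_limCov_rect k).mul ?_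
      exact Measurable.aemeasurable (by fun_prop)
    · filter_upwards [ae_rect_mem] with p hp
      exact (h.hasSum_specDensity hp.1 p.2).comp hv
  have := h0.const_mul (2 * Real.pi)⁻¹
  refine this.congr (Eventually.of_forall fun p => ?_)
  simp only
  rw [← mul_assoc, inv_mul_cancel₀ (by have := Real.pi_pos; positivity), one_mul]

lemma integrable_mul_specDensity (hφ : BoundedOnRect φ M) :
    Integrable (fun p : ℝ × ℝ => specDensity a p.1 p.2 * φ p.1 p.2) rect := by
  refine Integrable.bdd_mul (c := (∑' j, w j) ^ 2) hφ.integrable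
    h.aemeasurable_specDensity.aestronglyMeasurable ?_
  filter_upwards [ae_rect_mem] with p hp
  rw [Real.norm_of_nonneg (specDensity_nonneg _ _ _)]
  exact h.specDensity_le hp.1 _

/-- This identifies the limit of the expected quadratic form with the linear term of the contrast.
The lag bounds `∑ⱼ w(j+k) w(j)` are summable, which permits integrating the cosine series of `f`
term by term. -/
lemma integral_mul_specDensity (hφ : BoundedOnRect φ M) :
    2 * Real.pi * ∫ p, specDensity a p.1 p.2 * φ p.1 p.2 ∂rect =
      ∑' k : ℤ, ∫ u in Ioc (0 : ℝ) 1, cosCoef φ u k * limCov a u k := by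
  have hpi := Real.pi_pos
  set G : ℤ → ℝ × ℝ → ℝ := fun k p => φ p.1 p.2 * Real.cos (k * p.2) * limCov a p.1 k with hG
  have hGm : ∀ k, AEStronglyMeasurable (G k) rect := fun k =>
    ((hφ.measurable.mul (by fun_prop)).aemeasurable.mul (h.aemeasurable_limCov_rect k)).aestronglyMeasurable
  have hGb : ∀ k, ∀ᵐ p ∂rect, ‖G k p‖ ≤ M * ∑' j, w (j + k) * w j := by
    intro k
    filter_upwards [ae_rect_mem] with p hp
    rw [hG, norm_mul, norm_mul]
    have b1 := hφ.abs_le _ (Ioc_subset_Icc_self hp.1) _ (Ioc_subset_Icc_self hp.2)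
    refine mul_le_mul ?_ (h.abs_limCov_le_lagBound hp.1 k) (norm_nonneg _) ((abs_nonneg _).trans b1)
    exact (mul_le_of_le_one_right (norm_nonneg _) (Real.abs_cos_le_one _)).trans b1
  have hGi : ∀ k, Integrable (G k) rect := fun k => Integrable.of_bound (hGm k) _ (hGb k)
  have hsum := hasSum_integral_of_summable_integral_norm hGi (by
    refine Summable.of_nonneg_of_le (fun k => integral_nonneg fun p => norm_nonneg _) (fun k => ?_)
      ((h.summable_lagBound.mul_left M).mul_right (rect.real univ))
    have := integral_mono_ae (hGi k).norm (integrable_const _) (hGb k)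
    refine this.trans (le_of_eq ?_)
    rw [integral_const, smul_eq_mul, mul_comm])
  have e1 : ∫ p, ∑' k, G k p ∂rect = 2 * Real.pi * ∫ p, specDensity a p.1 p.2 * φ p.1 p.2 ∂rect := by
    rw [← integral_const_mul]
    refine integral_congr_ae ?_
    filter_upwards [ae_rect_mem] with p hp
    have := (h.hasSum_specDensity hp.1 p.2).mul_left (φ p.1 p.2)
    rw [← mul_assoc, mul_comm _ (φ p.1 p.2), ← this.tsum_eq]
    refine tsum_congr fun k => ?_
    simp only [hG]; ring
  rw [← e1, ← hsum.tsum_eq]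
  refine tsum_congr fun k => ?_
  rw [rect_eq_Ioc, integral_prod _ (by rw [← rect_eq_Ioc]; exact hGi k)]
  refine integral_congr_ae (Eventually.of_forall fun u => ?_)
  simp only [hG]
  rw [integral_mul_const, cosCoef, intervalIntegral.integral_of_le neg_pi_le_pi]

end LinearRows

end spectral

end LocStat

/-! ### Comparison of the empirical and the limiting contrast -/

namespace LocStat

/-- Inverse densities: jointly measurable functions with values in `[m, M]` on the rectangle whose
Fourier coefficients satisfy the norm bounds `ρ_∞ ≤ R` and `v_Σ ≤ V`. -/
structure InvDensity (φ : ℝ → ℝ → ℝ) (m M R V : ℝ) : Prop where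
  measurable : Measurable fun p : ℝ × ℝ => φ p.1 p.2
  lower : ∀ u ∈ Icc (0 : ℝ) 1, ∀ x ∈ Icc (-Real.pi) Real.pi, m ≤ φ u x
  upper : ∀ u ∈ Icc (0 : ℝ) 1, ∀ x ∈ Icc (-Real.pi) Real.pi, φ u x ≤ M
  rhoInfty_le : rhoInfty φ ≤ ENNReal.ofReal R
  vSigma_le : vSigma φ ≤ ENNReal.ofReal V

/-- The contrast as a function of the inverse density, without the factor `1 / (4π)`. -/
noncomputable def invContrast (f φ : ℝ → ℝ → ℝ) : ℝ :=
  ∫ p, (-Real.log (φ p.1 p.2) + f p.1 p.2 * φ p.1 p.2) ∂rect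

lemma sq_integral_abs_le {g : ℝ → ℝ} {M : ℝ} (hg : Measurable g)
    (hM : ∀ x ∈ Icc (-Real.pi) Real.pi, |g x| ≤ M) :
    (∫ x in (-Real.pi)..Real.pi, |g x|) ^ 2 ≤ 2 * Real.pi * ∫ x in (-Real.pi)..Real.pi, g x ^ 2 := by
  have hpi := Real.pi_pos
  set a := ∫ x in (-Real.pi)..Real.pi, |g x| with ha
  have i1 : IntervalIntegrable (fun x => |g x|) volume (-Real.pi) Real.pi := by
    rw [intervalIntegrable_iff_integrableOn_Ioc_of_le neg_pi_le_pi]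
    refine Integrable.of_bound (measurable_norm.comp hg).aestronglyMeasurable M ?_
    filter_upwards [ae_restrict_mem measurableSet_Ioc] with x hx
    simpa using hM x (Ioc_subset_Icc_self hx)
  have i2 : IntervalIntegrable (fun x => g x ^ 2) volume (-Real.pi) Real.pi := by
    rw [intervalIntegrable_iff_integrableOn_Ioc_of_le neg_pi_le_pi]
    refine Integrable.of_bound (hg.pow_const 2).aestronglyMeasurable (M ^ 2) ?_
    filter_upwards [ae_restrict_mem measurableSet_Ioc] with x hx
    rw [Real.norm_eq_abs, abs_pow]
    gcongr
    exact hM x (Ioc_subset_Icc_self hx)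
  -- Nonnegativity of the variance of `|g|` is the Cauchy–Schwarz inequality sought.
  have h0 : 0 ≤ ∫ x in (-Real.pi)..Real.pi, (|g x| - a / (2 * Real.pi)) ^ 2 :=
    intervalIntegral.integral_nonneg neg_pi_le_pi fun x _ => sq_nonneg _
  have h1 : ∫ x in (-Real.pi)..Real.pi, (|g x| - a / (2 * Real.pi)) ^ 2 =
      (∫ x in (-Real.pi)..Real.pi, g x ^ 2) - a ^ 2 / (2 * Real.pi) := by
    have e : ∀ x, (|g x| - a / (2 * Real.pi)) ^ 2 =
        g x ^ 2 - (a / Real.pi) * |g x| + (a / (2 * Real.pi)) ^ 2 := fun x => by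
      rw [sub_sq, sq_abs]; field_simp
    simp_rw [e]
    rw [intervalIntegral.integral_add (i2.sub (i1.const_mul _)) (by simp),
      intervalIntegral.integral_sub i2 (i1.const_mul _), intervalIntegral.integral_const_mul, ← ha,
      intervalIntegral.integral_const, smul_eq_mul]
    field_simp
    ring
  rw [h1, sub_nonneg, div_le_iff₀ (by positivity)] at h0
  linarith

/-- Pass from `L¹` to `L²`, use Parseval, and bound the `ℓ²` norm of the coefficients by their `ℓ¹`
norm. No convergence of the Fourier series itself is needed. -/
lemma ofReal_integral_abs_le {g : ℝ → ℝ} {M : ℝ} (hg : Measurable g)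
    (hM : ∀ x ∈ Icc (-Real.pi) Real.pi, |g x| ≤ M) :
    ENNReal.ofReal (∫ x in (-Real.pi)..Real.pi, |g x|) ≤
      ∑' k : ℤ, ‖∫ x in (-Real.pi)..Real.pi, (g x : ℂ) * Complex.exp (Complex.I * x * k)‖ₑ := by
  set c : ℤ → ℂ := fun k => ∫ x in (-Real.pi)..Real.pi, (g x : ℂ) * Complex.exp (Complex.I * x * k)
    with hc
  have h0 : 0 ≤ ∫ x in (-Real.pi)..Real.pi, |g x| :=
    intervalIntegral.integral_nonneg neg_pi_le_pi fun x _ => abs_nonneg _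
  refine (ENNReal.pow_le_pow_left_iff two_ne_zero).1 ?_
  have hP := hasSum_sq_fourier hg hM
  calc ENNReal.ofReal (∫ x in (-Real.pi)..Real.pi, |g x|) ^ 2
      ≤ ENNReal.ofReal (2 * Real.pi * ∫ x in (-Real.pi)..Real.pi, g x ^ 2) := by
        rw [← ENNReal.ofReal_pow h0]
        exact ENNReal.ofReal_le_ofReal (sq_integral_abs_le hg hM)
    _ = ∑' k, ‖c k‖ₑ ^ 2 := by
        rw [← hP.tsum_eq, ENNReal.ofReal_tsum_of_nonneg (fun k => by positivity) hP.summable]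
        refine tsum_congr fun k => ?_
        rw [ENNReal.ofReal_pow (norm_nonneg _), ofReal_norm]
    _ ≤ ∑' k, ‖c k‖ₑ * ∑' k, ‖c k‖ₑ := by
        refine ENNReal.tsum_le_tsum fun k => ?_
        rw [sq]
        gcongr
        exact ENNReal.le_tsum k
    _ = (∑' k, ‖c k‖ₑ) ^ 2 := by rw [ENNReal.tsum_mul_right, sq]

lemma abs_log_sub_le {m x y : ℝ} (hm : 0 < m) (hx : m ≤ x) (hy : m ≤ y) :
    |Real.log x - Real.log y| ≤ 1 / m * |x - y| := by
  wlog hxy : y ≤ x generalizing x y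
  · rw [abs_sub_comm, abs_sub_comm x]; exact this hy hx (le_of_not_ge hxy)
  have hy0 : 0 < y := hm.trans_le hy
  have hx0 : 0 < x := hm.trans_le hx
  rw [abs_of_nonneg (sub_nonneg.2 (Real.log_le_log hy0 hxy)), abs_of_nonneg (sub_nonneg.2 hxy),
    ← Real.log_div hx0.ne' hy0.ne']
  calc Real.log (x / y) ≤ x / y - 1 := Real.log_le_sub_one_of_pos (by positivity)
    _ = 1 / y * (x - y) := by field_simp
    _ ≤ 1 / m * (x - y) := by
        have := sub_nonneg.2 hxy
        gcongr

namespace InvDensity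

variable {φ ψ : ℝ → ℝ → ℝ} {m M R V : ℝ} (hφ : InvDensity φ m M R V)
include hφ

lemma boundedOnRect (hm : 0 < m) : BoundedOnRect φ M :=
  ⟨hφ.measurable, fun u hu x hx => by
    rw [abs_of_pos (hm.trans_le (hφ.lower u hu x hx))]; exact hφ.upper u hu x hx⟩

lemma boundedOnRect_log (hm : 0 < m) :
    BoundedOnRect (fun u x => Real.log (φ u x)) (|Real.log m| + |Real.log M|) := by
  refine ⟨hφ.measurable.log, fun u hu x hx => ?_⟩
  have h1 := hφ.lower u hu x hx
  have h2 := hφ.upper u hu x hx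
  have h3 := Real.log_le_log hm h1
  have h4 := Real.log_le_log (hm.trans_le h1) h2
  rw [abs_le]
  constructor
  · linarith [neg_abs_le (Real.log m), abs_nonneg (Real.log M)]
  · linarith [le_abs_self (Real.log M), abs_nonneg (Real.log m)]

lemma symSup_le (hm : 0 < m) : symSup (cosCoef φ) ≤ ENNReal.ofReal R :=
  (symSup_cosCoef_le (hφ.boundedOnRect hm)).trans hφ.rhoInfty_le

lemma symVar_le (hm : 0 < m) : symVar (cosCoef φ) ≤ ENNReal.ofReal V :=
  (symVar_cosCoef_le (hφ.boundedOnRect hm)).trans hφ.vSigma_le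

lemma measurable_fourierCoef (k : ℤ) : Measurable fun u => fourierCoef φ u k := by
  simp only [fourierCoef, intervalIntegral.integral_of_le neg_pi_le_pi]
  have h1 : StronglyMeasurable (Function.uncurry fun u x : ℝ =>
      (φ u x : ℂ) * Complex.exp (Complex.I * x * k)) :=
    ((Complex.measurable_ofReal.comp hφ.measurable).mul (by fun_prop)).stronglyMeasurable
  exact (StronglyMeasurable.integral_prod_right (ν := volume.restrict (Ioc (-Real.pi) Real.pi)) h1).measurable

/-- The logarithm is `1/m`-Lipschitz on the range of `φ`, and the `L¹` distance of two slices is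
controlled by the differences of their Fourier coefficients. In this way the variation of the
logarithmic term is reduced to `v_Σ`. -/
lemma enorm_integral_log_sub_le (hm : 0 < m) {u v : ℝ} (hu : u ∈ Icc (0 : ℝ) 1)
    (hv : v ∈ Icc (0 : ℝ) 1) :
    ‖(∫ x in (-Real.pi)..Real.pi, Real.log (φ v x)) - ∫ x in (-Real.pi)..Real.pi, Real.log (φ u x)‖ₑ ≤
      ENNReal.ofReal (1 / m) * ∑' k : ℤ, edist (fourierCoef φ v k) (fourierCoef φ u k) := by
  have hL := hφ.boundedOnRect_log hm
  have hB := hφ.boundedOnRect hm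
  have hgm : Measurable fun x => φ v x - φ u x := (hB.slice v).sub (hB.slice u)
  have hgM : ∀ x ∈ Icc (-Real.pi) Real.pi, |φ v x - φ u x| ≤ M + M := fun x hx =>
    (abs_sub _ _).trans (add_le_add (hB.abs_le v hv x hx) (hB.abs_le u hu x hx))
  have h1 : |(∫ x in (-Real.pi)..Real.pi, Real.log (φ v x)) -
      ∫ x in (-Real.pi)..Real.pi, Real.log (φ u x)| ≤
      1 / m * ∫ x in (-Real.pi)..Real.pi, |φ v x - φ u x| := by
    rw [← intervalIntegral.integral_sub (hL.intervalIntegrable hv) (hL.intervalIntegrable hu),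
      ← intervalIntegral.integral_const_mul]
    refine (intervalIntegral.abs_integral_le_integral_abs neg_pi_le_pi).trans ?_
    refine intervalIntegral.integral_mono_on neg_pi_le_pi
      ((hL.intervalIntegrable hv).sub (hL.intervalIntegrable hu)).abs
      ((((hB.intervalIntegrable hv).sub (hB.intervalIntegrable hu)).abs).const_mul _) fun x hx => ?_
    exact abs_log_sub_le hm (hφ.lower v hv x hx) (hφ.lower u hu x hx)
  rw [Real.enorm_eq_ofReal_abs]
  refine (ENNReal.ofReal_le_ofReal h1).trans ?_
  rw [ENNReal.ofReal_mul (by positivity)]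
  gcongr
  refine (ofReal_integral_abs_le hgm hgM).trans (le_of_eq ?_)
  refine tsum_congr fun k => ?_
  rw [edist_eq_enorm_sub, fourierCoef, fourierCoef, ← intervalIntegral.integral_sub
    (hB.intervalIntegrable_exp hv k) (hB.intervalIntegrable_exp hu k)]
  congr 1
  refine intervalIntegral.integral_congr fun x _ => ?_
  push_cast
  ring

/-- Riemann sum approximation of the logarithmic term. -/
lemma abs_sum_log_sub_le (hm : 0 < m) (hV : 0 ≤ V) {n : ℕ} (hn : 0 < n) :
    |(1 / (n : ℝ) * ∑ t ∈ Finset.Icc (1 : ℤ) n,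
      ∫ x in (-Real.pi)..Real.pi, Real.log (φ ((t : ℝ) / n) x)) - ∫ p, Real.log (φ p.1 p.2) ∂rect| ≤ V / (m * n) := by
  have hn' : (0 : ℝ) < n := by exact_mod_cast hn
  set L : ℝ → ℝ := fun u => ∫ x in (-Real.pi)..Real.pi, Real.log (φ u x) with hLdef
  have hB := hφ.boundedOnRect_log hm
  have hint := hB.integrable
  have hI : ∫ p, Real.log (φ p.1 p.2) ∂rect = ∫ u in Ioc (0 : ℝ) 1, L u := by
    rw [rect_eq_Ioc, integral_prod _ (by rwa [← rect_eq_Ioc])]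
    simp only [hLdef, intervalIntegral.integral_of_le neg_pi_le_pi]
  have hLi : IntegrableOn L (Ioc 0 1) := by
    rw [rect_eq_Ioc] at hint
    have := hint.integral_prod_left
    rw [hLdef, IntegrableOn]
    simpa only [intervalIntegral.integral_of_le neg_pi_le_pi] using this
  have hsub : ∀ t ∈ Finset.Icc (1 : ℤ) n, IntegrableOn L (cell n t) := fun t ht =>
    hLi.mono_set (cell_subset hn ht)
  have hcell : ∀ t ∈ Finset.Icc (1 : ℤ) n, ‖1 / (n : ℝ) * L ((t : ℝ) / n) - ∫ u in cell n t, L u‖ₑ ≤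
      ∫⁻ u in cell n t, ENNReal.ofReal (1 / m) *
        ∑' k : ℤ, edist (fourierCoef φ ((t : ℝ) / n) k) (fourierCoef φ u k) := by
    intro t ht
    have e1 : 1 / (n : ℝ) * L ((t : ℝ) / n) - ∫ u in cell n t, L u =
        ∫ u in cell n t, (L ((t : ℝ) / n) - L u) := by
      have i1 : IntegrableOn (fun _ => L ((t : ℝ) / n)) (cell n t) :=
        integrableOn_const (by rw [volume_cell]; exact ENNReal.ofReal_ne_top)
      rw [integral_sub i1 (hsub t ht), setIntegral_const, Measure.real, volume_cell,
        ENNReal.toReal_ofReal (by positivity), smul_eq_mul]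
    rw [e1]
    refine (enorm_integral_le_lintegral_enorm _).trans ?_
    refine setLIntegral_mono' (measurableSet_cell t) fun u hu => ?_
    exact hφ.enorm_integral_log_sub_le hm (Ioc_subset_Icc_self (cell_subset hn ht hu))
      (Ioc_subset_Icc_self (cell_subset hn ht (div_mem_cell hn t)))
  rw [hI, ← sum_integral_cell hn hLi, Finset.mul_sum, ← Finset.sum_sub_distrib,
    ← ENNReal.ofReal_le_ofReal_iff (by positivity), ← Real.enorm_eq_ofReal_abs]
  calc _ ≤ ∑ t ∈ Finset.Icc (1 : ℤ) n, ‖1 / (n : ℝ) * L ((t : ℝ) / n) - ∫ u in cell n t, L u‖ₑ :=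
        enorm_sum_le _ _
    _ ≤ ∑ t ∈ Finset.Icc (1 : ℤ) n, ∫⁻ u in cell n t, ENNReal.ofReal (1 / m) *
        ∑' k : ℤ, edist (fourierCoef φ ((t : ℝ) / n) k) (fourierCoef φ u k) := Finset.sum_le_sum hcell
    _ ≤ ∑ t ∈ Finset.Icc (1 : ℤ) n, ENNReal.ofReal (1 / m) *
        ∑' k : ℤ, ENNReal.ofReal (1 / n) * eVariationOn (fun u => fourierCoef φ u k) (cell n t) := by
        refine Finset.sum_le_sum fun t _ => ?_
        rw [lintegral_const_mul' _ _ ENNReal.ofReal_ne_top, lintegral_tsum fun k =>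
          (measurable_const.edist (hφ.measurable_fourierCoef k)).aemeasurable]
        gcongr with k
        exact lintegral_cell_edist_le hn (fun u => fourierCoef φ u k) t
    _ = ENNReal.ofReal (1 / m) * (ENNReal.ofReal (1 / n) * ∑' k : ℤ,
        ∑ t ∈ Finset.Icc (1 : ℤ) n, eVariationOn (fun u => fourierCoef φ u k) (cell n t)) := by
        rw [← Finset.mul_sum]
        simp_rw [ENNReal.tsum_mul_left]
        rw [← Finset.mul_sum, Summable.tsum_finsetSum fun t _ => ENNReal.summable]
    _ ≤ ENNReal.ofReal (1 / m) * (ENNReal.ofReal (1 / n) * vSigma φ) := by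
        gcongr
        refine ENNReal.tsum_le_tsum fun k => (sum_eVariationOn_cell_le hn _).trans ?_
        exact eVariationOn.mono _ Ioc_subset_Icc_self
    _ ≤ ENNReal.ofReal (1 / m) * (ENNReal.ofReal (1 / n) * ENNReal.ofReal V) := by
        gcongr; exact hφ.vSigma_le
    _ = _ := by
        rw [← ENNReal.ofReal_mul (by positivity), ← ENNReal.ofReal_mul (by positivity)]
        congr 1; field_simp

end InvDensity

section contrast

variable {Ω : Type*} [MeasurableSpace Ω] {P : Measure Ω} {X : ℕ → ℤ → Ω → ℝ} {a : ℝ → ℤ → ℝ}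
  {w : ℤ → ℝ} {K : ℝ} {α : ℕ → ℤ → ℤ → ℝ} {n : ℕ}
  {φ ψ g : ℝ → ℝ → ℝ} {m M R V : ℝ}

omit [MeasurableSpace Ω] in
lemma prePeriodogram_eq (t : ℤ) (x : ℝ) (ω : Ω) :
    prePeriodogram X n t x ω = 1 / (2 * Real.pi) *
      ∑ k ∈ (Finset.Icc (-(n : ℤ)) n).filter (fun k : ℤ =>
        (2 * t + 1 + k) / 2 ∈ Icc (1 : ℤ) n ∧ (2 * t + 1 - k) / 2 ∈ Icc (1 : ℤ) n),
      X n ((2 * t + 1 + k) / 2) ω * X n ((2 * t + 1 - k) / 2) ω * Real.cos (k * x) := by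
  unfold prePeriodogram
  rw [show (1 / (2 * Real.pi) : ℂ) = ((1 / (2 * Real.pi) : ℝ) : ℂ) by push_cast; rfl,
    Complex.re_ofReal_mul, Complex.re_sum]
  congr 1
  refine Finset.sum_congr rfl fun k _ => ?_
  rw [← Complex.ofReal_mul, Complex.re_ofReal_mul]
  congr 1
  rw [show -Complex.I * x * k = Complex.I * (x : ℂ) * ((-k : ℤ) : ℂ) by push_cast; ring, exp_I_mul_re]
  push_cast
  rw [neg_mul, Real.cos_neg]

-- Integrating the pre-periodogram against `1/g` replaces each cosine by a Fourier coefficient of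
-- `1/g`; reindexing midpoint and lag by pairs of times gives the form with sampled symbol.
omit [MeasurableSpace Ω] in
lemma empContrast_eq (hm : 0 < m) (hφ : InvDensity (recip g) m M R V) (hn : 0 < n) (ω : Ω) :
    4 * Real.pi * empContrast X n g ω =
      -(1 / (n : ℝ) * ∑ t ∈ Finset.Icc (1 : ℤ) n, ∫ x in (-Real.pi)..Real.pi,
        Real.log (recip g ((t : ℝ) / n) x)) +
      1 / (2 * Real.pi) * quadForm X n (fun s r =>
        1 / (n : ℝ) * cosCoef (recip g) ((((s + r) / 2 : ℤ) : ℝ) / n) (s - r)) ω := by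
  have hpi := Real.pi_pos
  have hB := hφ.boundedOnRect hm
  have hL := hφ.boundedOnRect_log hm
  have ht01 : ∀ t ∈ Finset.Icc (1 : ℤ) n, (t : ℝ) / n ∈ Icc (0 : ℝ) 1 := fun t ht =>
    Ioc_subset_Icc_self (cell_subset hn ht (div_mem_cell hn t))
  have hterm : ∀ t ∈ Finset.Icc (1 : ℤ) n, ∫ x in (-Real.pi)..Real.pi,
      (Real.log (g ((t : ℝ) / n) x) + prePeriodogram X n t x ω / g ((t : ℝ) / n) x) =
      -(∫ x in (-Real.pi)..Real.pi, Real.log (recip g ((t : ℝ) / n) x)) +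
      1 / (2 * Real.pi) * ∑ k ∈ (Finset.Icc (-(n : ℤ)) n).filter (fun k : ℤ =>
        (2 * t + 1 + k) / 2 ∈ Icc (1 : ℤ) n ∧ (2 * t + 1 - k) / 2 ∈ Icc (1 : ℤ) n),
      X n ((2 * t + 1 + k) / 2) ω * X n ((2 * t + 1 - k) / 2) ω * cosCoef (recip g) ((t : ℝ) / n) k := by
    intro t ht
    have i0 := hB.intervalIntegrable (ht01 t ht)
    have i1 : ∀ k : ℤ, IntervalIntegrable (fun x => recip g ((t : ℝ) / n) x * Real.cos (k * x)) volume
        (-Real.pi) Real.pi := fun k => i0.mul_continuousOn (by fun_prop)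
    have e1 : ∀ x, Real.log (g ((t : ℝ) / n) x) + prePeriodogram X n t x ω / g ((t : ℝ) / n) x =
        -Real.log (recip g ((t : ℝ) / n) x) + 1 / (2 * Real.pi) *
        ∑ k ∈ (Finset.Icc (-(n : ℤ)) n).filter (fun k : ℤ =>
          (2 * t + 1 + k) / 2 ∈ Icc (1 : ℤ) n ∧ (2 * t + 1 - k) / 2 ∈ Icc (1 : ℤ) n),
        X n ((2 * t + 1 + k) / 2) ω * X n ((2 * t + 1 - k) / 2) ω *
          (recip g ((t : ℝ) / n) x * Real.cos (k * x)) := by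
      intro x
      have e0 : recip g ((t : ℝ) / n) x = (g ((t : ℝ) / n) x)⁻¹ := one_div _
      rw [prePeriodogram_eq, e0, Real.log_inv, neg_neg, div_eq_mul_inv _ (g _ _),
        mul_assoc (1 / (2 * Real.pi)), Finset.sum_mul]
      congr 2
      exact Finset.sum_congr rfl fun k _ => by ring
    have i2 : ∀ k : ℤ, IntervalIntegrable (fun x => X n ((2 * t + 1 + k) / 2) ω *
        X n ((2 * t + 1 - k) / 2) ω * (recip g ((t : ℝ) / n) x * Real.cos (k * x))) volume
        (-Real.pi) Real.pi := fun k => (i1 k).const_mul _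
    have i3 := IntervalIntegrable.sum ((Finset.Icc (-(n : ℤ)) n).filter (fun k : ℤ =>
      (2 * t + 1 + k) / 2 ∈ Icc (1 : ℤ) n ∧ (2 * t + 1 - k) / 2 ∈ Icc (1 : ℤ) n)) (fun k _ => i2 k)
    simp only [Finset.sum_fn] at i3
    have i4 : IntervalIntegrable (fun x => -Real.log (recip g ((t : ℝ) / n) x)) volume
        (-Real.pi) Real.pi := (hL.intervalIntegrable (ht01 t ht)).neg
    simp_rw [e1]
    rw [intervalIntegral.integral_add i4 (i3.const_mul _),
      intervalIntegral.integral_neg, intervalIntegral.integral_const_mul,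
      intervalIntegral.integral_finsetSum fun k _ => i2 k]
    simp_rw [intervalIntegral.integral_const_mul]
    rfl
  have hreidx : quadForm X n (fun s r =>
        1 / (n : ℝ) * cosCoef (recip g) ((((s + r) / 2 : ℤ) : ℝ) / n) (s - r)) ω =
      ∑ t ∈ Finset.Icc (1 : ℤ) n, ∑ k ∈ (Finset.Icc (-(n : ℤ)) n).filter (fun k : ℤ =>
        (2 * t + 1 + k) / 2 ∈ Icc (1 : ℤ) n ∧ (2 * t + 1 - k) / 2 ∈ Icc (1 : ℤ) n),
      1 / (n : ℝ) * (X n ((2 * t + 1 + k) / 2) ω * X n ((2 * t + 1 - k) / 2) ω *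
        cosCoef (recip g) ((t : ℝ) / n) k) := by
    rw [quadForm, ← sum_lag_eq_sum_pairs]
    refine Finset.sum_congr rfl fun t _ => Finset.sum_congr rfl fun k _ => ?_
    rw [show ((2 * t + 1 + k) / 2 + (2 * t + 1 - k) / 2) / 2 = t by omega,
      show (2 * t + 1 + k) / 2 - (2 * t + 1 - k) / 2 = k by omega]
    ring
  rw [hreidx, empContrast, Finset.mul_sum, Finset.mul_sum, Finset.mul_sum, Finset.mul_sum,
    ← Finset.sum_neg_distrib, ← Finset.sum_add_distrib]
  refine Finset.sum_congr rfl fun t ht => ?_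
  rw [hterm t ht, ← Finset.mul_sum]
  field_simp

namespace LinearRows

variable (h : LinearRows P X a w K α)
include h

lemma integrable_invContrast (hm : 0 < m) (hφ : InvDensity φ m M R V) :
    Integrable (fun p : ℝ × ℝ => -Real.log (φ p.1 p.2) + specDensity a p.1 p.2 * φ p.1 p.2) rect :=
  (hφ.boundedOnRect_log hm).integrable.neg.add (h.integrable_mul_specDensity (hφ.boundedOnRect hm))

lemma contrast_eq (hm : 0 < m) (hφ : InvDensity (recip g) m M R V) :
    contrast (specDensity a) g =
      ((1 / (4 * Real.pi) * invContrast (specDensity a) (recip g) : ℝ) : EReal) := by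
  have e : (fun p : ℝ × ℝ => Real.log (g p.1 p.2) + specDensity a p.1 p.2 / g p.1 p.2) =
      fun p : ℝ × ℝ => -Real.log (recip g p.1 p.2) + specDensity a p.1 p.2 * recip g p.1 p.2 := by
    ext p
    rw [recip, one_div, Real.log_inv, neg_neg, div_eq_mul_inv]
  unfold contrast invContrast
  rw [e, if_pos (h.integrable_invContrast hm hφ)]

/-- The empirical contrast is the contrast plus a centred quadratic form, up to small errors. -/
lemma abs_empContrast_sub_le (hm : 0 < m) (hφ : InvDensity (recip g) m M R V) (hn : 0 < n)
    (hR : 0 ≤ R) (hV : 0 ≤ V) {b : ℝ} {ω : Ω} (hb : ∀ t ∈ Finset.Icc (1 : ℤ) n, X n t ω ^ 2 ≤ b)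
    (hb0 : 0 ≤ b) :
    |4 * Real.pi * empContrast X n g ω - invContrast (specDensity a) (recip g) -
      1 / (2 * Real.pi) * centredForm P X n (cosCoef (recip g)) ω| ≤
      V / (m * n) + V * b / n + biasConst w K * R / n := by
  have hpi := Real.pi_pos
  have hB := hφ.boundedOnRect hm
  have hn' : (0 : ℝ) < n := by exact_mod_cast hn
  set β := cosCoef (recip g) with hβ
  have hβm : ∀ k, Measurable fun u => β u k := measurable_cosCoef hB
  have hsup := hφ.symSup_le hm
  have h1 := hφ.abs_sum_log_sub_le hm hV hn
  have h2 : |quadForm X n (fun s r => 1 / (n : ℝ) * β ((((s + r) / 2 : ℤ) : ℝ) / n) (s - r)) ω -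
      quadForm X n (quadCoef n β) ω| ≤ V * b / n := by
    rw [← quadForm_sub]
    refine (abs_quadForm_le hb).trans ?_
    have := sum_abs_sample_sub_quadCoef_le hn hV
      (integrableOn_of_symSup hβm (ne_top_of_le_ne_top ENNReal.ofReal_ne_top hsup)) (hφ.symVar_le hm)
    calc _ ≤ V / n * b := mul_le_mul_of_nonneg_right this hb0
      _ = _ := by ring
  have h3 := h.bias hn hβm hR hsup
  rw [← h.integral_mul_specDensity hB] at h3
  have e1 : invContrast (specDensity a) (recip g) = -(∫ p, Real.log (recip g p.1 p.2) ∂rect) +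
      ∫ p, specDensity a p.1 p.2 * recip g p.1 p.2 ∂rect := by
    have i1 : Integrable (fun p : ℝ × ℝ => -Real.log (recip g p.1 p.2)) rect :=
      (hφ.boundedOnRect_log hm).integrable.neg
    rw [invContrast, integral_add i1 (h.integrable_mul_specDensity hB), integral_neg]
  rw [empContrast_eq hm hφ hn, e1, centredForm]
  set Q1 := quadForm X n (fun s r => 1 / (n : ℝ) * β ((((s + r) / 2 : ℤ) : ℝ) / n) (s - r)) ω
  set Q2 := quadForm X n (quadCoef n β) ω
  set E := ∫ ω, quadForm X n (quadCoef n β) ω ∂P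
  set I := ∫ p, specDensity a p.1 p.2 * recip g p.1 p.2 ∂rect
  -- The factor `1/(2π)` is less than one and is dropped in the error bounds.
  have h2' : |1 / (2 * Real.pi) * (Q1 - Q2)| ≤ V * b / n := by
    rw [abs_mul, abs_of_pos (by positivity)]
    refine (mul_le_of_le_one_left (abs_nonneg _) ?_).trans h2
    rw [div_le_one (by positivity)]; linarith [Real.pi_gt_three]
  have h3' : |1 / (2 * Real.pi) * (E - 2 * Real.pi * I)| ≤ biasConst w K * R / n := by
    rw [abs_mul, abs_of_pos (by positivity)]
    refine (mul_le_of_le_one_left (abs_nonneg _) ?_).trans h3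
    rw [div_le_one (by positivity)]; linarith [Real.pi_gt_three]
  have e2 : 1 / (2 * Real.pi) * (2 * Real.pi * I) = I := by field_simp
  rw [mul_sub] at h2' h3'
  rw [e2] at h3'
  rw [mul_sub]
  rw [abs_le] at *
  constructor <;> linarith [h1.1, h1.2, h2'.1, h2'.2, h3'.1, h3'.2]

/-- The basic inequality for minimisers of the empirical contrast. -/
lemma invContrast_sub_le (hm : 0 < m) {g₀ : ℝ → ℝ → ℝ} (hφ : InvDensity (recip g) m M R V)
    (hψ : InvDensity (recip g₀) m M R V) (hn : 0 < n) (hR : 0 ≤ R) (hV : 0 ≤ V) {b : ℝ} {ω : Ω}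
    (hb : ∀ t ∈ Finset.Icc (1 : ℤ) n, X n t ω ^ 2 ≤ b) (hb0 : 0 ≤ b)
    (hmin : empContrast X n g ω ≤ empContrast X n g₀ ω) :
    invContrast (specDensity a) (recip g) - invContrast (specDensity a) (recip g₀) ≤
      |centredForm P X n (fun u k => cosCoef (recip g) u k - cosCoef (recip g₀) u k) ω| +
      2 * (V / (m * n) + V * b / n + biasConst w K * R / n) := by
  have hpi := Real.pi_pos
  have h1 := h.abs_empContrast_sub_le hm hφ hn hR hV hb hb0
  have h2 := h.abs_empContrast_sub_le hm hψ hn hR hV hb hb0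
  have i1 := integrableOn_of_symSup (measurable_cosCoef (hφ.boundedOnRect hm))
    (ne_top_of_le_ne_top ENNReal.ofReal_ne_top (hφ.symSup_le hm))
  have i2 := integrableOn_of_symSup (measurable_cosCoef (hψ.boundedOnRect hm))
    (ne_top_of_le_ne_top ENNReal.ofReal_ne_top (hψ.symSup_le hm))
  rw [h.centredForm_sub hn i1 i2]
  set c1 := centredForm P X n (cosCoef (recip g)) ω
  set c2 := centredForm P X n (cosCoef (recip g₀)) ω
  have h3 : |1 / (2 * Real.pi) * (c1 - c2)| ≤ |c1 - c2| := by
    rw [abs_mul, abs_of_pos (by positivity)]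
    refine mul_le_of_le_one_left (abs_nonneg _) ?_
    rw [div_le_one (by positivity)]; linarith [Real.pi_gt_three]
  have h4 := (abs_le.1 h3).1
  have h5 := mul_le_mul_of_nonneg_left hmin (by positivity : 0 ≤ 4 * Real.pi)
  rw [mul_sub] at h4
  rw [abs_le] at h1 h2
  linarith [h1.1, h2.2]

end LinearRows

end contrast

end LocStat

/-! ### The `L₂` distance and covers -/

namespace LocStat

section distance

variable {φ ψ χ : ℝ → ℝ → ℝ} {M N : ℝ}

lemma rho2_eq_eLpNorm (φ ψ : ℝ → ℝ → ℝ) :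
    rho2 φ ψ = eLpNorm (fun p : ℝ × ℝ => φ p.1 p.2 - ψ p.1 p.2) 2 rect := by
  rw [eLpNorm_eq_lintegral_rpow_enorm_toReal (by simp) (by simp), rho2]
  simp only [ENNReal.toReal_ofNat, ENNReal.rpow_ofNat, one_div]
  congr 1
  refine lintegral_congr fun p => ?_
  rw [Real.enorm_eq_ofReal_abs, ENNReal.ofReal_pow (abs_nonneg _)]

lemma rho2_comm (φ ψ : ℝ → ℝ → ℝ) : rho2 φ ψ = rho2 ψ φ := by
  unfold rho2
  simp_rw [abs_sub_comm]

lemma rho2_triangle (hφ : Measurable fun p : ℝ × ℝ => φ p.1 p.2)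
    (hψ : Measurable fun p : ℝ × ℝ => ψ p.1 p.2) (hχ : Measurable fun p : ℝ × ℝ => χ p.1 p.2) :
    rho2 φ χ ≤ rho2 φ ψ + rho2 ψ χ := by
  simp only [rho2_eq_eLpNorm]
  refine le_trans (le_of_eq ?_) (eLpNorm_add_le (hφ.sub hψ).aestronglyMeasurable
    (hψ.sub hχ).aestronglyMeasurable (by norm_num))
  congr 1
  ext p
  simp

lemma rho2_sq_eq_integral (hφ : BoundedOnRect φ M) (hψ : BoundedOnRect ψ N) :
    rho2 φ ψ ^ 2 = ENNReal.ofReal (∫ p, (φ p.1 p.2 - ψ p.1 p.2) ^ 2 ∂rect) := by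
  have hB := hφ.sub hψ
  rw [rho2_sq, ofReal_integral_eq_lintegral_ofReal]
  · simp only [sq_abs]
  · refine Integrable.of_bound (hB.measurable.pow_const 2).aestronglyMeasurable ((M + N) ^ 2) ?_
    filter_upwards [ae_rect_mem] with p hp
    rw [Real.norm_eq_abs, abs_pow]
    gcongr
    exact hB.abs_le _ (Ioc_subset_Icc_self hp.1) _ (Ioc_subset_Icc_self hp.2)
  · exact Eventually.of_forall fun p => sq_nonneg _

lemma rho2_ne_top (hφ : BoundedOnRect φ M) (hψ : BoundedOnRect ψ N) : rho2 φ ψ ≠ ⊤ := by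
  intro h
  have := rho2_sq_eq_integral hφ hψ
  rw [h] at this
  simp at this

lemma toReal_rho2_sq (hφ : BoundedOnRect φ M) (hψ : BoundedOnRect ψ N) :
    (rho2 φ ψ).toReal ^ 2 = ∫ p, (φ p.1 p.2 - ψ p.1 p.2) ^ 2 ∂rect := by
  rw [← ENNReal.toReal_pow, rho2_sq_eq_integral hφ hψ,
    ENNReal.toReal_ofReal (integral_nonneg fun p => sq_nonneg _)]

lemma integrable_sq_sub (hφ : BoundedOnRect φ M) (hψ : BoundedOnRect ψ N) :
    Integrable (fun p : ℝ × ℝ => (φ p.1 p.2 - ψ p.1 p.2) ^ 2) rect := by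
  have hB := hφ.sub hψ
  refine Integrable.of_bound (hB.measurable.pow_const 2).aestronglyMeasurable ((M + N) ^ 2) ?_
  filter_upwards [ae_rect_mem] with p hp
  rw [Real.norm_eq_abs, abs_pow]
  gcongr
  exact hB.abs_le _ (Ioc_subset_Icc_self hp.1) _ (Ioc_subset_Icc_self hp.2)

/-- The symbol of a difference of inverse densities is controlled by their `L₂` distance. -/
lemma symSq_cosCoef_sub_le (hφ : BoundedOnRect φ M) (hψ : BoundedOnRect ψ N) {r : ℝ} (hr : 0 ≤ r)
    (h : rho2 φ ψ ≤ ENNReal.ofReal r) :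
    symSq (fun u k => cosCoef φ u k - cosCoef ψ u k) ≤ ENNReal.ofReal ((3 * r) ^ 2) := by
  have e1 : symSq (fun u k => cosCoef φ u k - cosCoef ψ u k) =
      symSq (cosCoef fun u x => φ u x - ψ u x) := by
    refine tsum_congr fun k => setLIntegral_congr_fun measurableSet_Ioc fun u hu => ?_
    rw [cosCoef_sub hφ hψ (Ioc_subset_Icc_self hu)]
  rw [e1]
  refine (symSq_cosCoef_le (hφ.sub hψ)).trans ?_
  have e2 : rho2 (fun u x => φ u x - ψ u x) 0 = rho2 φ ψ := by simp [rho2]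
  rw [e2]
  calc _ ≤ ENNReal.ofReal 9 * ENNReal.ofReal r ^ 2 := by
        gcongr
        linarith [Real.pi_lt_four]
    _ = _ := by
        rw [← ENNReal.ofReal_pow hr, ← ENNReal.ofReal_mul (by norm_num)]
        congr 1; ring

end distance

section entropy

/-- An entropy bound provides a finite cover with centres in the class. -/
lemma exists_cover_of_metricEntropy_le {Φ : Set (ℝ → ℝ → ℝ)} {η x : ℝ}
    (h : metricEntropy η Φ ≤ (x : EReal)) :
    ∃ (N : ℕ) (c : Fin N → ℝ → ℝ → ℝ), (N : ℝ) ≤ Real.exp x ∧ (∀ i, c i ∈ Φ) ∧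
      ∀ φ ∈ Φ, ∃ i, rho2 φ (c i) < ENNReal.ofReal η := by
  have htop : coveringNumber η Φ ≠ ⊤ := by
    intro ht
    rw [metricEntropy, ht] at h
    simp at h
  obtain ⟨N, hN⟩ := ENat.ne_top_iff_exists.1 htop
  -- A strict bound on the infimum produces an admissible number of centres below `N + 1`, hence at
  -- most `N`.
  have h1 : coveringNumber η Φ < ((N + 1 : ℕ) : ℕ∞) := by
    rw [← hN]; exact_mod_cast Nat.lt_succ_self N
  unfold coveringNumber at h1
  simp only [iInf_lt_iff] at h1
  obtain ⟨m, ⟨hm1, c, hc, hcov⟩, hm⟩ := h1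
  have hmN : m ≤ N := by
    have : m < N + 1 := by exact_mod_cast hm
    omega
  refine ⟨m, c, ?_, hc, hcov⟩
  rw [metricEntropy, ← hN] at h
  have hN1 : 0 < N := by omega
  have e1 : (((N : ℕ∞) : ℝ≥0∞)) = ENNReal.ofReal (N : ℝ) := by simp
  rw [e1, ENNReal.log_ofReal_of_pos (by exact_mod_cast hN1)] at h
  have h2 : Real.log N ≤ x := by exact_mod_cast h
  have h3 : (N : ℝ) ≤ Real.exp x := (Real.log_le_iff_le_exp (by exact_mod_cast hN1)).1 h2
  exact le_trans (by exact_mod_cast hmN) h3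

end entropy

/-! ### Scalar inequalities for the divergence `r - 1 - log r` -/

section scalar

/-- All terms of the series of `-log (1 - x)` at `x = 1 - r` are nonnegative; keep the first two. -/
lemma half_sq_le_sub_log {r : ℝ} (h0 : 0 < r) (h1 : r ≤ 1) : (r - 1) ^ 2 / 2 ≤ r - 1 - Real.log r := by
  have hs := Real.hasSum_pow_div_log_of_abs_lt_one (x := 1 - r) (by
    rw [abs_of_nonneg (by linarith)]; linarith)
  have h2 := sum_le_hasSum (Finset.range 2) (fun i _ => by
    have : 0 ≤ 1 - r := by linarith
    positivity) hs
  simp only [Finset.sum_range_succ, Finset.sum_range_zero] at h2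
  norm_num at h2
  nlinarith

/-- The inequality `t ≤ sinh t` at `t = log r`. -/
lemma sq_div_le_sub_log {r : ℝ} (h1 : 1 ≤ r) : (r - 1) ^ 2 / (2 * r) ≤ r - 1 - Real.log r := by
  have h0 : 0 < r := by linarith
  have h2 := Real.self_le_sinh_iff.2 (Real.log_nonneg h1)
  rw [Real.sinh_log h0] at h2
  have e : (r - 1) ^ 2 / (2 * r) = r - 1 - (r - r⁻¹) / 2 := by field_simp; ring
  rw [e]; linarith

lemma sub_log_le_sq_div {r : ℝ} (h0 : 0 < r) : r - 1 - Real.log r ≤ (r - 1) ^ 2 / r := by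
  have := Real.one_sub_inv_le_log_of_pos h0
  have e : (r - 1) ^ 2 / r = r - 1 - (1 - r⁻¹) := by field_simp
  rw [e]; linarith

/-- With `r = x/c` the left side is `c² (r - 1)²`. For `r ≤ 1` the factor `c²` is at most `M²`; for
`r ≥ 1` the weaker divergence bound loses a factor `r`, but `c² r = c x ≤ M²` as well. -/
lemma sq_sub_le_of_le_min {x c M : ℝ} (hx : 0 < x) (hxM : x ≤ M) (hc : 0 < c) (hcM : c ≤ M) :
    (x - c) ^ 2 ≤ 2 * M ^ 2 * (x / c - 1 - Real.log (x / c)) := by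
  have e : (x - c) ^ 2 = c ^ 2 * (x / c - 1) ^ 2 := by field_simp
  have hr : 0 < x / c := by positivity
  rcases le_total (x / c) 1 with h | h
  · have h1 := half_sq_le_sub_log hr h
    have h2 : c ^ 2 ≤ M ^ 2 := by gcongr
    rw [e]
    nlinarith [mul_le_mul_of_nonneg_right h2 (sq_nonneg (x / c - 1))]
  · have h1 := sq_div_le_sub_log h
    have hxc : c ≤ x := by rwa [le_div_iff₀ hc, one_mul] at h
    have h0 : 0 ≤ x / c - 1 - Real.log (x / c) := le_trans (by positivity) h1
    have h2 : c ^ 2 * (x / c) ≤ M ^ 2 := by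
      have : c ^ 2 * (x / c) = c * x := by field_simp
      rw [this, sq]
      exact mul_le_mul hcM hxM hx.le (hc.le.trans hcM)
    rw [div_le_iff₀ (by positivity)] at h1
    rw [e]
    calc c ^ 2 * (x / c - 1) ^ 2 ≤ c ^ 2 * ((x / c - 1 - Real.log (x / c)) * (2 * (x / c))) := by gcongr
      _ = 2 * (c ^ 2 * (x / c)) * (x / c - 1 - Real.log (x / c)) := by ring
      _ ≤ _ := by gcongr

/-- The Itakura–Saito type divergence dominates squared distances between truncated values. -/
lemma sq_sub_le_divergence {x y z M : ℝ} (hx : 0 < x) (hxM : x ≤ M) (hyM : y ≤ M) (hz : 0 < z) :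
    (x - y) ^ 2 ≤ 4 * M ^ 2 * (x / z - 1 - Real.log (x / z)) + 2 * (z - y) ^ 2 := by
  rcases le_total z M with h | h
  · have := sq_sub_le_of_le_min hx hxM hz h
    nlinarith [sq_nonneg (x - z - (z - y))]
  -- The value `z` stands for `1/f`, which need not be bounded by `M`. If `z > M`, replacing it by
  -- `M` decreases both the divergence from `x ≤ M` and the distance to `y ≤ M`.
  · have hM : 0 < M := hx.trans_le hxM
    have h1 := sq_sub_le_of_le_min hx hxM hM le_rfl
    have h2 : x / M - 1 - Real.log (x / M) ≤ x / z - 1 - Real.log (x / z) := by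
      rw [Real.log_div hx.ne' hM.ne', Real.log_div hx.ne' hz.ne']
      have h3 : Real.log z - Real.log M ≥ x / M - x / z := by
        have h4 : 1 - (z / M)⁻¹ ≤ Real.log (z / M) := Real.one_sub_inv_le_log_of_pos (by positivity)
        rw [Real.log_div hz.ne' hM.ne'] at h4
        have h5 : x / M - x / z ≤ 1 - (z / M)⁻¹ := by
          rw [inv_div]
          have : x / M - x / z = (x / M) * (1 - M / z) := by field_simp
          rw [this]
          refine mul_le_of_le_one_left ?_ ?_
          · rw [sub_nonneg, div_le_one hz]; exact h
          · rw [div_le_one hM]; exact hxM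
        linarith
      linarith
    have h3 : (M - y) ^ 2 ≤ (z - y) ^ 2 := by
      have : 0 ≤ M - y := by linarith
      gcongr
    nlinarith [sq_nonneg (x - M - (M - y)), mul_le_mul_of_nonneg_left h2 (by positivity : 0 ≤ 4 * M ^ 2)]

/-- Uniform convexity of `-log` on `(0, M]`. It follows from `log t ≤ t - 1` at `t = xy /
((x+y)/2)²`, for which `1 - t = (x-y)² / (x+y)²`. -/
lemma neg_log_midpoint_le {x y M : ℝ} (hx : 0 < x) (hy : 0 < y) (hxM : x ≤ M) (hyM : y ≤ M) :
    -Real.log (1 / 2 * x + 1 / 2 * y) ≤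
      1 / 2 * -Real.log x + 1 / 2 * -Real.log y - (x - y) ^ 2 / (8 * M ^ 2) := by
  have hM : 0 < M := hx.trans_le hxM
  have hs : 0 < 1 / 2 * x + 1 / 2 * y := by positivity
  have h1 : Real.log (x * y / (1 / 2 * x + 1 / 2 * y) ^ 2) ≤ x * y / (1 / 2 * x + 1 / 2 * y) ^ 2 - 1 :=
    Real.log_le_sub_one_of_pos (by positivity)
  rw [Real.log_div (by positivity) (by positivity), Real.log_mul hx.ne' hy.ne', Real.log_pow] at h1
  have h2 : x * y / (1 / 2 * x + 1 / 2 * y) ^ 2 - 1 = -((x - y) ^ 2 / (x + y) ^ 2) := by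
    field_simp; ring
  have h3 : (x - y) ^ 2 / (4 * M ^ 2) ≤ (x - y) ^ 2 / (x + y) ^ 2 := by
    gcongr
    nlinarith
  have h4 : (x - y) ^ 2 / (8 * M ^ 2) = (x - y) ^ 2 / (4 * M ^ 2) / 2 := by field_simp; ring
  rw [h2] at h1
  push_cast at h1
  rw [h4]
  linarith

end scalar

/-! ### Quadratic lower bounds for the contrast -/

section lowerBounds

variable {Ω : Type*} [MeasurableSpace Ω] {P : Measure Ω} {X : ℕ → ℤ → Ω → ℝ} {a : ℝ → ℤ → ℝ}
  {w : ℤ → ℝ} {K : ℝ} {α : ℕ → ℤ → ℤ → ℝ} {φ ψ φ₀ : ℝ → ℝ → ℝ} {m M R V : ℝ}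

namespace LinearRows

variable (h : LinearRows P X a w K α)
include h

/-- Lower bound for the contrast around the inverse of the true spectral density. -/
lemma sq_rho2_le_of_specified (hm : 0 < m) (hm1 : m ≤ 1) (hM1 : 1 ≤ M) (hφ : InvDensity φ m M R V)
    (hψ : InvDensity ψ m M R V)
    (hφ₀m : Measurable fun p : ℝ × ℝ => φ₀ p.1 p.2) (hφ₀ : ∀ᵐ p ∂rect, 0 < φ₀ p.1 p.2)
    (hf : ∀ᵐ p ∂rect, specDensity a p.1 p.2 = 1 / φ₀ p.1 p.2) {e : ℝ} (he : 0 ≤ e)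
    (hψφ : rho2 φ₀ ψ ≤ ENNReal.ofReal e) :
    (rho2 φ ψ).toReal ^ 2 ≤ 4 * M ^ 2 *
      (invContrast (specDensity a) φ - invContrast (specDensity a) ψ) +
      6 * covBound w * (M / m) ^ 2 * e ^ 2 := by
  have hBφ := hφ.boundedOnRect hm
  have hBψ := hψ.boundedOnRect hm
  set f := specDensity a with hfdef
  have hC1 : 1 ≤ covBound w := one_le_covBound w
  have hfC : ∀ᵐ p ∂rect, f p.1 p.2 ≤ covBound w := by
    filter_upwards [ae_rect_mem] with p hp
    have := h.specDensity_le hp.1 p.2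
    unfold covBound; linarith
  have hsqm : Measurable fun p : ℝ × ℝ => (φ₀ p.1 p.2 - ψ p.1 p.2) ^ 2 :=
    (hφ₀m.sub hBψ.measurable).pow_const 2
  have hl : ∫⁻ p, ENNReal.ofReal ((φ₀ p.1 p.2 - ψ p.1 p.2) ^ 2) ∂rect ≤ ENNReal.ofReal (e ^ 2) := by
    have : rho2 φ₀ ψ ^ 2 ≤ ENNReal.ofReal e ^ 2 := by gcongr
    rw [rho2_sq, ← ENNReal.ofReal_pow he] at this
    simpa only [sq_abs] using this
  -- `φ₀ = 1/f` may be unbounded; integrability comes only from its finite distance to `ψ`.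
  have hi0 : Integrable (fun p : ℝ × ℝ => (φ₀ p.1 p.2 - ψ p.1 p.2) ^ 2) rect := by
    refine ⟨hsqm.aestronglyMeasurable, ?_⟩
    rw [hasFiniteIntegral_iff_ofReal (Eventually.of_forall fun p => sq_nonneg _)]
    exact hl.trans_lt ENNReal.ofReal_lt_top
  have he2 : ∫ p, (φ₀ p.1 p.2 - ψ p.1 p.2) ^ 2 ∂rect ≤ e ^ 2 := by
    rw [integral_eq_lintegral_of_nonneg_ae (Eventually.of_forall fun p => sq_nonneg _)
      hsqm.aestronglyMeasurable]
    exact ENNReal.toReal_le_of_le_ofReal (by positivity) hl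
  set dψ : ℝ × ℝ → ℝ := fun p => ψ p.1 p.2 / φ₀ p.1 p.2 - 1 - Real.log (ψ p.1 p.2 / φ₀ p.1 p.2) with hdψ
  have hdm : Measurable dψ := ((hBψ.measurable.div hφ₀m).sub_const 1).sub (hBψ.measurable.div hφ₀m).log
  have hdle : ∀ᵐ p ∂rect, dψ p ≤ covBound w / m * (φ₀ p.1 p.2 - ψ p.1 p.2) ^ 2 := by
    filter_upwards [hfC, hf, hφ₀, ae_rect_mem] with p h1 h2 h3 hp
    have hψp := hψ.lower _ (Ioc_subset_Icc_self hp.1) _ (Ioc_subset_Icc_self hp.2)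
    have hψ0 : 0 < ψ p.1 p.2 := hm.trans_le hψp
    refine (sub_log_le_sq_div (by positivity)).trans ?_
    have e1 : (ψ p.1 p.2 / φ₀ p.1 p.2 - 1) ^ 2 / (ψ p.1 p.2 / φ₀ p.1 p.2) =
        (1 / φ₀ p.1 p.2) / ψ p.1 p.2 * (φ₀ p.1 p.2 - ψ p.1 p.2) ^ 2 := by
      field_simp; ring
    rw [e1, ← h2]
    have : 0 ≤ f p.1 p.2 := specDensity_nonneg _ _ _
    gcongr
  have hd0 : ∀ᵐ p ∂rect, 0 ≤ dψ p := by
    filter_upwards [hφ₀, ae_rect_mem] with p h3 hp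
    have hψp := hψ.lower _ (Ioc_subset_Icc_self hp.1) _ (Ioc_subset_Icc_self hp.2)
    have hψ0 : 0 < ψ p.1 p.2 := hm.trans_le hψp
    have := Real.log_le_sub_one_of_pos (show 0 < ψ p.1 p.2 / φ₀ p.1 p.2 by positivity)
    simp only [hdψ]; linarith
  have hdi : Integrable dψ rect := by
    refine (hi0.const_mul (covBound w / m)).mono' hdm.aestronglyMeasurable ?_
    filter_upwards [hdle, hd0] with p h1 h2
    rwa [Real.norm_of_nonneg h2]
  have i1 := h.integrable_invContrast hm hφ
  have i2 := h.integrable_invContrast hm hψ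
  -- Because `f = 1/φ₀`, the divergences of `φ` and of `ψ` from `φ₀` differ exactly by the
  -- difference of the two contrast integrands. The divergence of `ψ` is quadratic in `φ₀ - ψ`,
  -- since `f` is bounded.
  have key : ∀ᵐ p ∂rect, (φ p.1 p.2 - ψ p.1 p.2) ^ 2 ≤ 4 * M ^ 2 * (dψ p +
      ((-Real.log (φ p.1 p.2) + f p.1 p.2 * φ p.1 p.2) -
        (-Real.log (ψ p.1 p.2) + f p.1 p.2 * ψ p.1 p.2))) + 2 * (φ₀ p.1 p.2 - ψ p.1 p.2) ^ 2 := by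
    filter_upwards [hf, hφ₀, ae_rect_mem] with p h2 h3 hp
    have hφp := hφ.lower _ (Ioc_subset_Icc_self hp.1) _ (Ioc_subset_Icc_self hp.2)
    have hφ0 : 0 < φ p.1 p.2 := hm.trans_le hφp
    have hψp := hψ.lower _ (Ioc_subset_Icc_self hp.1) _ (Ioc_subset_Icc_self hp.2)
    have hψ0 : 0 < ψ p.1 p.2 := hm.trans_le hψp
    refine (sq_sub_le_divergence hφ0 (hφ.upper _ (Ioc_subset_Icc_self hp.1) _ (Ioc_subset_Icc_self hp.2))
      (hψ.upper _ (Ioc_subset_Icc_self hp.1) _ (Ioc_subset_Icc_self hp.2)) h3).trans (le_of_eq ?_)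
    rw [hdψ, h2]
    simp only
    rw [Real.log_div hφ0.ne' h3.ne', Real.log_div hψ0.ne' h3.ne']
    ring
  rw [toReal_rho2_sq hBφ hBψ]
  have i3 : Integrable (fun p : ℝ × ℝ => dψ p +
      ((-Real.log (φ p.1 p.2) + f p.1 p.2 * φ p.1 p.2) -
        (-Real.log (ψ p.1 p.2) + f p.1 p.2 * ψ p.1 p.2))) rect := hdi.add (i1.sub i2)
  have h5 := integral_mono_ae (integrable_sq_sub hBφ hBψ) ((i3.const_mul (4 * M ^ 2)).add
    (hi0.const_mul 2)) key
  simp only [Pi.add_apply] at h5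
  have i4 : Integrable (fun p : ℝ × ℝ => (-Real.log (φ p.1 p.2) + f p.1 p.2 * φ p.1 p.2) -
        (-Real.log (ψ p.1 p.2) + f p.1 p.2 * ψ p.1 p.2)) rect := i1.sub i2
  rw [integral_add (i3.const_mul _) (hi0.const_mul 2), integral_const_mul, integral_const_mul,
    integral_add hdi i4, integral_sub i1 i2] at h5
  have h6 : ∫ p, dψ p ∂rect ≤ covBound w / m * e ^ 2 := by
    refine (integral_mono_ae hdi (hi0.const_mul (covBound w / m)) hdle).trans ?_
    rw [integral_const_mul]
    gcongr
  have h7 : 4 * M ^ 2 * (covBound w / m * e ^ 2) + 2 * e ^ 2 ≤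
      6 * covBound w * (M / m) ^ 2 * e ^ 2 := by
    have hMm : 1 ≤ M / m := by rw [le_div_iff₀ hm]; linarith
    have a1 : M ^ 2 * (covBound w / m) ≤ covBound w * (M / m) ^ 2 := by
      rw [div_pow, mul_div_assoc', mul_div_assoc', mul_comm]
      gcongr
      nlinarith
    have a2 : 1 ≤ covBound w * (M / m) ^ 2 := by nlinarith
    nlinarith [mul_le_mul_of_nonneg_right a1 (sq_nonneg e), mul_le_mul_of_nonneg_right a2 (sq_nonneg e)]
  have h8 : 0 ≤ 4 * M ^ 2 := by positivity
  have h9 := mul_le_mul_of_nonneg_left h6 h8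
  unfold invContrast
  linarith

/-- Lower bound for the contrast around its minimiser over a convex class. -/
lemma sq_rho2_le_of_midpoint (hm : 0 < m) (hφ : InvDensity φ m M R V) (hψ : InvDensity ψ m M R V)
    (hmid : InvDensity ((1 / 2 : ℝ) • φ + (1 / 2 : ℝ) • ψ) m M R V)
    (hmin : invContrast (specDensity a) ψ ≤
      invContrast (specDensity a) ((1 / 2 : ℝ) • φ + (1 / 2 : ℝ) • ψ)) :
    (rho2 φ ψ).toReal ^ 2 ≤ 4 * M ^ 2 *
      (invContrast (specDensity a) φ - invContrast (specDensity a) ψ) := by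
  have hBφ := hφ.boundedOnRect hm
  have hBψ := hψ.boundedOnRect hm
  have i1 := h.integrable_invContrast hm hφ
  have i2 := h.integrable_invContrast hm hψ
  have i3 := h.integrable_invContrast hm hmid
  have i4 := integrable_sq_sub hBφ hBψ
  have hM : 0 < M := by
    have h0 : (0 : ℝ) ∈ Icc (0 : ℝ) 1 := by simp
    have h1 : (0 : ℝ) ∈ Icc (-Real.pi) Real.pi := by simp [Real.pi_pos.le]
    exact hm.trans_le ((hφ.lower 0 h0 0 h1).trans (hφ.upper 0 h0 0 h1))
  have key : ∀ᵐ p ∂rect, -Real.log (((1 / 2 : ℝ) • φ + (1 / 2 : ℝ) • ψ) p.1 p.2) +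
      specDensity a p.1 p.2 * ((1 / 2 : ℝ) • φ + (1 / 2 : ℝ) • ψ) p.1 p.2 ≤
      1 / 2 * (-Real.log (φ p.1 p.2) + specDensity a p.1 p.2 * φ p.1 p.2) +
      1 / 2 * (-Real.log (ψ p.1 p.2) + specDensity a p.1 p.2 * ψ p.1 p.2) -
      1 / (8 * M ^ 2) * (φ p.1 p.2 - ψ p.1 p.2) ^ 2 := by
    filter_upwards [ae_rect_mem] with p hp
    have h1 := Ioc_subset_Icc_self hp.1
    have h2 := Ioc_subset_Icc_self hp.2
    have := neg_log_midpoint_le (hm.trans_le (hφ.lower _ h1 _ h2)) (hm.trans_le (hψ.lower _ h1 _ h2))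
      (hφ.upper _ h1 _ h2) (hψ.upper _ h1 _ h2)
    simp only [Pi.add_apply, Pi.smul_apply, smul_eq_mul]
    rw [one_div_mul_eq_div (8 * M ^ 2)]
    linarith
  have h5 := integral_mono_ae i3 (((i1.const_mul (1 / 2)).add (i2.const_mul (1 / 2))).sub
    (i4.const_mul (1 / (8 * M ^ 2)))) key
  have i5 : Integrable (fun p : ℝ × ℝ =>
      1 / 2 * (-Real.log (φ p.1 p.2) + specDensity a p.1 p.2 * φ p.1 p.2) +
      1 / 2 * (-Real.log (ψ p.1 p.2) + specDensity a p.1 p.2 * ψ p.1 p.2)) rect :=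
    (i1.const_mul (1 / 2)).add (i2.const_mul (1 / 2))
  have e5 : ∀ F G H : ℝ × ℝ → ℝ, F + G - H = fun p => F p + G p - H p := fun _ _ _ => rfl
  rw [e5, integral_sub i5 (i4.const_mul _),
    integral_add (i1.const_mul _) (i2.const_mul _), integral_const_mul, integral_const_mul,
    integral_const_mul] at h5
  rw [toReal_rho2_sq hBφ hBψ]
  unfold invContrast at hmin ⊢
  -- Since `ψ` does not exceed the midpoint in contrast, half the contrast difference is at least `I
  -- / (8M²)`.
  have h6 := hmin.trans h5
  set I := ∫ p, (φ p.1 p.2 - ψ p.1 p.2) ^ 2 ∂rect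
  have h7 : I = 8 * M ^ 2 * (1 / (8 * M ^ 2) * I) := by field_simp
  rw [h7]
  have h8 : 0 ≤ 8 * M ^ 2 := by positivity
  nlinarith

end LinearRows

end lowerBounds

end LocStat

/-! ### Deviation inequality for sieve estimators -/

namespace LocStat

/-- The symbol of the difference of two inverse densities. -/
noncomputable def symbolDiff (φ ψ : ℝ → ℝ → ℝ) (u : ℝ) (k : ℤ) : ℝ := cosCoef φ u k - cosCoef ψ u k

section empirical

variable {Ω : Type*} [MeasurableSpace Ω] {P : Measure Ω} {X : ℕ → ℤ → Ω → ℝ} {a : ℝ → ℤ → ℝ}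
  {w : ℤ → ℝ} {K : ℝ} {α : ℕ → ℤ → ℤ → ℝ} {n : ℕ} {φ ψ χ : ℝ → ℝ → ℝ} {m M R V : ℝ}

namespace InvDensity

lemma integrableOn_cosCoef (hm : 0 < m) (hφ : InvDensity φ m M R V) (k : ℤ) :
    IntegrableOn (fun u => cosCoef φ u k) (Ioc 0 1) :=
  integrableOn_of_symSup (measurable_cosCoef (hφ.boundedOnRect hm))
    (ne_top_of_le_ne_top ENNReal.ofReal_ne_top (hφ.symSup_le hm)) k

lemma measurable_symbolDiff (hm : 0 < m) (hφ : InvDensity φ m M R V) (hψ : InvDensity ψ m M R V) (k : ℤ) :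
    Measurable fun u => symbolDiff φ ψ u k :=
  (measurable_cosCoef (hφ.boundedOnRect hm) k).sub (measurable_cosCoef (hψ.boundedOnRect hm) k)

lemma symSup_symbolDiff_le (hm : 0 < m) (hR : 0 ≤ R) (hφ : InvDensity φ m M R V)
    (hψ : InvDensity ψ m M R V) : symSup (symbolDiff φ ψ) ≤ ENNReal.ofReal (2 * R) := by
  refine (symSup_sub_le _ _).trans ((add_le_add (hφ.symSup_le hm) (hψ.symSup_le hm)).trans ?_)
  rw [← ENNReal.ofReal_add hR hR, two_mul]

lemma symVar_symbolDiff_le (hm : 0 < m) (hV : 0 ≤ V) (hφ : InvDensity φ m M R V)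
    (hψ : InvDensity ψ m M R V) : symVar (symbolDiff φ ψ) ≤ ENNReal.ofReal (2 * V) := by
  refine (symVar_sub_le _ _).trans ((add_le_add (hφ.symVar_le hm) (hψ.symVar_le hm)).trans ?_)
  rw [← ENNReal.ofReal_add hV hV, two_mul]

lemma symSq_symbolDiff_le (hm : 0 < m) (hφ : InvDensity φ m M R V) (hψ : InvDensity ψ m M R V) {r : ℝ}
    (hr : (rho2 φ ψ).toReal ≤ r) : symSq (symbolDiff φ ψ) ≤ ENNReal.ofReal ((3 * r) ^ 2) := by
  have hB1 := hφ.boundedOnRect hm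
  have hB2 := hψ.boundedOnRect hm
  refine symSq_cosCoef_sub_le hB1 hB2 (ENNReal.toReal_nonneg.trans hr) ?_
  rw [← ENNReal.ofReal_toReal (rho2_ne_top hB1 hB2)]
  exact ENNReal.ofReal_le_ofReal hr

lemma toReal_rho2_triangle (hm : 0 < m) (hφ : InvDensity φ m M R V) (hψ : InvDensity ψ m M R V)
    (hχ : InvDensity χ m M R V) :
    (rho2 φ χ).toReal ≤ (rho2 φ ψ).toReal + (rho2 ψ χ).toReal := by
  have h1 := rho2_ne_top (hφ.boundedOnRect hm) (hψ.boundedOnRect hm)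
  have h2 := rho2_ne_top (hψ.boundedOnRect hm) (hχ.boundedOnRect hm)
  rw [← ENNReal.toReal_add h1 h2]
  exact ENNReal.toReal_mono (by simp [h1, h2]) (rho2_triangle hφ.measurable hψ.measurable hχ.measurable)

end InvDensity

namespace LinearRows

variable (h : LinearRows P X a w K α)
include h

lemma centredForm_symbolDiff_add [IsProbabilityMeasure P] (hn : 0 < n) (hm : 0 < m) (hφ : InvDensity φ m M R V)
    (hψ : InvDensity ψ m M R V) (hχ : InvDensity χ m M R V) (ω : Ω) :
    centredForm P X n (symbolDiff φ χ) ω =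
      centredForm P X n (symbolDiff φ ψ) ω + centredForm P X n (symbolDiff ψ χ) ω := by
  unfold symbolDiff
  rw [h.centredForm_sub hn (hφ.integrableOn_cosCoef hm) (hχ.integrableOn_cosCoef hm),
    h.centredForm_sub hn (hφ.integrableOn_cosCoef hm) (hψ.integrableOn_cosCoef hm),
    h.centredForm_sub hn (hψ.integrableOn_cosCoef hm) (hχ.integrableOn_cosCoef hm)]
  ring

/-- Union bound of the Bernstein inequality over the points of a net. -/
lemma measure_net_le [IsProbabilityMeasure P]
    (hG : IsGaussianProcess (fun (t : Icc (1 : ℤ) (n : ℤ)) (ω : Ω) => X n t ω) P)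
    (hn : 0 < n) (hm : 0 < m) (hR : 0 < R) (hψ : InvDensity ψ m M R V) {N : ℕ}
    {c : Fin N → ℝ → ℝ → ℝ} (hc : ∀ i, InvDensity (c i) m M R V) {H L : ℝ} (hN : (N : ℝ) ≤ Real.exp H)
    (hL : 0 ≤ L) :
    P {ω | ∃ i, 8 * covBound w * (3 * (rho2 (c i) ψ).toReal * Real.sqrt (L / n) + 2 * R * L / n) <
      |centredForm P X n (symbolDiff (c i) ψ) ω|} ≤ ENNReal.ofReal (2 * Real.exp (H - L)) := by
  have h1 : ∀ i, P {ω | 8 * covBound w * (3 * (rho2 (c i) ψ).toReal * Real.sqrt (L / n) + 2 * R * L / n) <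
      |centredForm P X n (symbolDiff (c i) ψ) ω|} ≤ ENNReal.ofReal (2 * Real.exp (-L)) := fun i =>
    h.centredForm_tail hG hn ((hc i).measurable_symbolDiff hm hψ) ((hc i).symSq_symbolDiff_le hm hψ le_rfl)
      (by positivity) ((hc i).symSup_symbolDiff_le hm hR.le hψ) (by positivity) hL
  rw [show {ω | ∃ i, 8 * covBound w * (3 * (rho2 (c i) ψ).toReal * Real.sqrt (L / n) + 2 * R * L / n) <
      |centredForm P X n (symbolDiff (c i) ψ) ω|} = ⋃ i, {ω | 8 * covBound w *
        (3 * (rho2 (c i) ψ).toReal * Real.sqrt (L / n) + 2 * R * L / n) <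
      |centredForm P X n (symbolDiff (c i) ψ) ω|} by ext; simp]
  refine (measure_iUnion_fintype_le _ _).trans ((Finset.sum_le_sum fun i _ => h1 i).trans ?_)
  rw [Finset.sum_const, nsmul_eq_mul, Finset.card_univ, Fintype.card_fin, ← ENNReal.ofReal_natCast,
    ← ENNReal.ofReal_mul (by positivity)]
  refine ENNReal.ofReal_le_ofReal ?_
  rw [sub_eq_add_neg, Real.exp_add]
  nlinarith [Real.exp_pos (-L)]

/-- Remainder bound for inverse densities that are extremely close to each other. -/
lemma abs_centredForm_symbolDiff_le (hn : 0 < n) (hm : 0 < m) (hφ : InvDensity φ m M R V)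
    (hψ : InvDensity ψ m M R V) {r b : ℝ} (hr : (rho2 φ ψ).toReal ≤ r) {ω : Ω}
    (hb : ∀ t ∈ Finset.Icc (1 : ℤ) n, X n t ω ^ 2 ≤ b) :
    |centredForm P X n (symbolDiff φ ψ) ω| ≤ 3 * r * Real.sqrt n * (b + covBound w) := by
  have hr0 : 0 ≤ r := ENNReal.toReal_nonneg.trans hr
  exact h.abs_centredForm_le_sq hn (hφ.measurable_symbolDiff hm hψ)
    (hφ.symSq_symbolDiff_le hm hψ hr) (by positivity) hb

end LinearRows

/-- The constant in the rate for sieve estimators. -/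
noncomputable def sieveConst (A C B : ℝ) : ℝ :=
  2 * (4608 * C ^ 2 * (3 * A + 1) + 96 * C * (3 * A + 2) + 64 * C * (3 * A + 1) + 812 * C + 8 + 8 * B)

/-- Solving the basic inequality for `ρ`. Except for the cross term `ρ s` and `E`, every term is at
most a constant times `(M/m)² q`, because `c` dominates `R`, `V` and `M²`; the cross term is
absorbed into the left side, which doubles the rest. -/
lemma sieve_arith {A C B k c ρ s q η l E m M R V n : ℝ} (hA : 0 < A) (hC : 1 ≤ C) (hB : 0 ≤ B)
    (hk : 1 ≤ k) (hm : 0 < m) (hm1 : m ≤ 1) (hM : 1 ≤ M) (hR : R ≤ c) (hV : V ≤ c)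
    (hM2 : M ^ 2 ≤ c) (hR0 : 0 ≤ R) (hV0 : 0 ≤ V) (hn : 1 ≤ n) (hl : 1 ≤ l) (hq : q = c * k * l / n)
    (hs : s ^ 2 = (3 * A + 1) * k * l / n) (hη : η = 1 / n ^ 2) (hs0 : 0 ≤ s) :
    ρ ^ 2 ≤ 4 * M ^ 2 * (8 * C * (3 * (ρ + η) * s + 2 * R * ((3 * A + 1) * k * l) / n) +
      3 * η * n * (40 * C * l + C)) +
      8 * M ^ 2 * (V / (m * n) + V * (40 * C * l) / n + B * R / n) + E →
    ρ ^ 2 ≤ sieveConst A C B * ((M / m) ^ 2 * q) + 2 * E := by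
  have hn0 : 0 < n := by linarith
  have hc : 1 ≤ c := by nlinarith
  have hkl : 1 ≤ k * l := by nlinarith
  have hklk : l ≤ k * l := by nlinarith
  set T := (M / m) ^ 2 with hT
  have hM2T : M ^ 2 ≤ T := by
    rw [hT, div_pow, le_div_iff₀ (by positivity)]
    have : m ^ 2 ≤ 1 := by nlinarith
    nlinarith [sq_nonneg M]
  have hM21 : 1 ≤ M ^ 2 := by nlinarith
  have hT1 : 1 ≤ T := hM21.trans hM2T
  have hq0 : 0 ≤ q := by rw [hq]; positivity
  have q1 : ∀ {x : ℝ}, 0 ≤ x → x ≤ c → x * (k * l) / n ≤ q := by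
    intro x hx hxc
    rw [hq, mul_assoc c]
    gcongr
  have qs : M ^ 2 * s ^ 2 ≤ (3 * A + 1) * q := by
    have := q1 (by positivity) hM2
    rw [hs]
    calc M ^ 2 * ((3 * A + 1) * k * l / n) = (3 * A + 1) * (M ^ 2 * (k * l) / n) := by ring
      _ ≤ _ := by gcongr
  have up : ∀ {x : ℝ}, 0 ≤ x → x ≤ q → M ^ 2 * x ≤ T * q := fun hx hxq =>
    mul_le_mul hM2T hxq hx (by linarith)
  have t1 : M ^ 2 * (M ^ 2 * s ^ 2) ≤ (3 * A + 1) * (T * q) := by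
    calc M ^ 2 * (M ^ 2 * s ^ 2) ≤ T * ((3 * A + 1) * q) := by gcongr
      _ = _ := by ring
  have hη1 : η ^ 2 ≤ 1 / n := by
    rw [hη, div_pow, one_pow, ← pow_mul]
    gcongr
    calc n = n ^ 1 := (pow_one n).symm
      _ ≤ n ^ (2 * 2) := pow_le_pow_right₀ hn (by norm_num)
  have hinv : 1 / n ≤ q := (show 1 / n ≤ 1 * (k * l) / n by gcongr; linarith).trans (q1 zero_le_one hc)
  have hsq : s ^ 2 ≤ (3 * A + 1) * q := by
    exact le_trans (le_mul_of_one_le_left (sq_nonneg s) hM21) qs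
  have t2 : M ^ 2 * (η * s) ≤ (3 * A + 2) * (T * q) := by
    have e1 : η * s ≤ (3 * A + 2) * q := by
      have e2 := two_mul_le_add_sq η s
      have e3 : 0 ≤ (3 * A + 2) * q := by positivity
      linarith
    calc M ^ 2 * (η * s) ≤ T * ((3 * A + 2) * q) := by
          refine mul_le_mul hM2T e1 ?_ (by linarith)
          rw [hη]; positivity
      _ = _ := by ring
  have t3 : M ^ 2 * (R * ((3 * A + 1) * k * l) / n) ≤ (3 * A + 1) * (T * q) := by
    calc M ^ 2 * (R * ((3 * A + 1) * k * l) / n) = (3 * A + 1) * (M ^ 2 * (R * (k * l) / n)) := by ring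
      _ ≤ _ := mul_le_mul_of_nonneg_left (up (by positivity) (q1 hR0 hR)) (by positivity)
  have hln : l / n ≤ q := (show l / n ≤ 1 * (k * l) / n by gcongr; linarith).trans (q1 zero_le_one hc)
  have t4 : M ^ 2 * (η * n * (40 * C * l + C)) ≤ 41 * C * (T * q) := by
    have e1 : η * n = 1 / n := by rw [hη]; field_simp
    have e2 : η * n * (40 * C * l + C) ≤ 41 * C * q := by
      rw [e1]
      calc 1 / n * (40 * C * l + C) ≤ 1 / n * (41 * C * l) := by gcongr; linarith [le_mul_of_one_le_right (by linarith : 0 ≤ C) hl]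
        _ = 41 * C * (l / n) := by ring
        _ ≤ _ := by gcongr
    calc M ^ 2 * (η * n * (40 * C * l + C)) ≤ T * (41 * C * q) := by
          refine mul_le_mul hM2T e2 ?_ (by linarith)
          rw [e1]; positivity
      _ = _ := by ring
  have t5 : M ^ 2 * (V / (m * n)) ≤ T * q := by
    have e1 : M ^ 2 * (V / (m * n)) ≤ T * (V / n) := by
      rw [hT, div_pow, mul_div_assoc', div_mul_div_comm, div_le_div_iff₀ (by positivity) (by positivity)]
      have : m ^ 2 ≤ m := by rw [sq]; exact mul_le_of_le_one_left hm.le hm1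
      calc M ^ 2 * V * (m ^ 2 * n) ≤ M ^ 2 * V * (m * n) := by gcongr
        _ = _ := by ring
    refine e1.trans ?_
    gcongr
    exact (show V / n ≤ V * (k * l) / n by
      gcongr; exact le_mul_of_one_le_right hV0 hkl).trans (q1 hV0 hV)
  have t6 : M ^ 2 * (V * (40 * C * l) / n) ≤ 40 * C * (T * q) := by
    calc M ^ 2 * (V * (40 * C * l) / n) = 40 * C * (M ^ 2 * (V * l / n)) := by ring
      _ ≤ _ := mul_le_mul_of_nonneg_left
        (up (by positivity) ((show V * l / n ≤ V * (k * l) / n by gcongr).trans (q1 hV0 hV)))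
        (by positivity)
  have t7 : M ^ 2 * (B * R / n) ≤ B * (T * q) := by
    calc M ^ 2 * (B * R / n) = B * (M ^ 2 * (R / n)) := by ring
      _ ≤ _ := mul_le_mul_of_nonneg_left (up (by positivity) ((show R / n ≤ R * (k * l) / n by
          gcongr; exact le_mul_of_one_le_right hR0 hkl).trans (q1 hR0 hR))) hB
  -- Young's inequality, with `4608 = 96² / 2`. One of the two factors `M²` is used up by `M² ≤ c`,
  -- the other by `M² ≤ (M/m)²`.
  have t0 : 96 * C * M ^ 2 * (ρ * s) ≤ ρ ^ 2 / 2 + 4608 * C ^ 2 * (M ^ 2 * (M ^ 2 * s ^ 2)) := by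
    have e1 := sq_nonneg (ρ - 96 * C * M ^ 2 * s)
    have e2 : (ρ - 96 * C * M ^ 2 * s) ^ 2 = ρ ^ 2 - 2 * (96 * C * M ^ 2 * (ρ * s)) +
      9216 * C ^ 2 * (M ^ 2 * (M ^ 2 * s ^ 2)) := by ring
    linarith
  intro h
  have hC0 : 0 < C := by linarith
  have u1 := mul_le_mul_of_nonneg_left t1 (by positivity : 0 ≤ 4608 * C ^ 2)
  have u2 := mul_le_mul_of_nonneg_left t2 (by positivity : 0 ≤ 96 * C)
  have u3 := mul_le_mul_of_nonneg_left t3 (by positivity : 0 ≤ 64 * C)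
  have h' : ρ ^ 2 ≤ 96 * C * M ^ 2 * (ρ * s) + 96 * C * (M ^ 2 * (η * s)) +
      64 * C * (M ^ 2 * (R * ((3 * A + 1) * k * l) / n)) + 12 * (M ^ 2 * (η * n * (40 * C * l + C))) +
      8 * (M ^ 2 * (V / (m * n))) + 8 * (M ^ 2 * (V * (40 * C * l) / n)) + 8 * (M ^ 2 * (B * R / n)) + E :=
    h.trans (le_of_eq (by ring))
  unfold sieveConst
  linarith

namespace LinearRows

variable (h : LinearRows P X a w K α)
include h

/-- Deviation inequality for minimum contrast estimators over a class of small entropy. -/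
lemma sieve_deviation [IsProbabilityMeasure P]
    (hG : IsGaussianProcess (fun (t : Icc (1 : ℤ) (n : ℤ)) (ω : Ω) => X n t ω) P)
    (hn : 3 ≤ n) (hm : 0 < m) (hm1 : m ≤ 1) (hM : 1 ≤ M) (hR : 0 < R) (hV : 0 ≤ V)
    {Φ : Set (ℝ → ℝ → ℝ)} (hΦ : ∀ φ ∈ Φ, InvDensity φ m M R V) (hψ : ψ ∈ Φ) {A k c E : ℝ} (hA : 0 < A)
    (hk : 1 ≤ k) (hRc : R ≤ c) (hVc : V ≤ c) (hMc : M ^ 2 ≤ c)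
    (hent : metricEntropy (1 / (n : ℝ) ^ 2) Φ ≤ ((A * k * (3 * Real.log n) : ℝ) : EReal))
    {φhat : Ω → ℝ → ℝ → ℝ}
    (hest : ∀ᵐ ω ∂P, φhat ω ∈ Φ ∧ ∀ b, 0 ≤ b → (∀ t ∈ Finset.Icc (1 : ℤ) n, X n t ω ^ 2 ≤ b) →
      (rho2 (φhat ω) ψ).toReal ^ 2 ≤ 4 * M ^ 2 * |centredForm P X n (symbolDiff (φhat ω) ψ) ω| +
        8 * M ^ 2 * (V / (m * n) + V * b / n + biasConst w K * R / n) + E) :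
    P {ω | sieveConst A (covBound w) (biasConst w K) * ((M / m) ^ 2 * (c * k * Real.log n / n)) + 2 * E <
      (rho2 (φhat ω) ψ).toReal ^ 2} ≤ ENNReal.ofReal (4 / n) := by
  have hn0 : 0 < n := by omega
  have hn3 : (3 : ℝ) ≤ n := by exact_mod_cast hn
  have hn' : (0 : ℝ) < n := by linarith
  have hC := one_le_covBound w
  have hlog : 1 ≤ Real.log n := by
    rw [Real.le_log_iff_exp_le hn']
    exact (Real.exp_one_lt_d9.le.trans (by norm_num)).trans hn3
  obtain ⟨N, cs, hN, hcΦ, hcov⟩ := exists_cover_of_metricEntropy_le hent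
  -- The net of mesh `n⁻²` has entropy `A k log n³`; the excess `k log n` leaves probability at most
  -- `2/n` after the union bound.
  set L := (3 * A + 1) * k * Real.log n with hL
  have hL0 : 0 ≤ L := by positivity
  have e1 := h.measure_net_le hG hn0 hm hR (hΦ ψ hψ) (fun i => hΦ _ (hcΦ i)) hN hL0
  have e2 := h.measure_max_sq hG (n := n) (by omega)
  set B1 := {ω | ∃ i, 8 * covBound w * (3 * (rho2 (cs i) ψ).toReal * Real.sqrt (L / n) + 2 * R * L / n) <
      |centredForm P X n (symbolDiff (cs i) ψ) ω|}
  set B2 := {ω | ∃ t ∈ Finset.Icc (1 : ℤ) n, 40 * covBound w * Real.log n < X n t ω ^ 2}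
  have hprob : P (B1 ∪ B2) ≤ ENNReal.ofReal (4 / n) := by
    refine (measure_union_le _ _).trans ((add_le_add e1 e2).trans ?_)
    rw [← ENNReal.ofReal_add (by positivity) (by positivity)]
    refine ENNReal.ofReal_le_ofReal ?_
    have : Real.exp (A * k * (3 * Real.log n) - L) ≤ 1 / n := by
      rw [show A * k * (3 * Real.log n) - L = -(k * Real.log n) by rw [hL]; ring, one_div,
        ← Real.exp_log (inv_pos.2 hn'), Real.log_inv]
      exact Real.exp_le_exp.2 (by nlinarith)
    calc _ ≤ 2 * (1 / (n : ℝ)) + 2 / n := by gcongr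
      _ = _ := by ring
  refine le_trans (measure_mono_ae ?_) hprob
  filter_upwards [hest] with ω hω hlt
  by_contra hnot
  have hnot' : ω ∉ B1 ∪ B2 := hnot
  simp only [B1, B2, mem_union, mem_ofPred_eq, not_or, not_exists, not_lt, not_and] at hnot'
  obtain ⟨g1, g2⟩ := hnot'
  refine absurd hlt (not_lt.2 ?_)
  obtain ⟨hφΦ, hbas⟩ := hω
  obtain ⟨i, hi⟩ := hcov _ hφΦ
  have hφ := hΦ _ hφΦ
  have hci := hΦ _ (hcΦ i)
  have hψ' := hΦ _ hψ
  have hη : (rho2 (φhat ω) (cs i)).toReal ≤ 1 / (n : ℝ) ^ 2 :=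
    ENNReal.toReal_le_of_le_ofReal (by positivity) hi.le
  have hη' : (rho2 (cs i) (φhat ω)).toReal ≤ 1 / (n : ℝ) ^ 2 := by rwa [rho2_comm]
  have hρi := hci.toReal_rho2_triangle hm hφ hψ'
  have hbas' := hbas (40 * covBound w * Real.log n) (by positivity) g2
  have hrem := h.abs_centredForm_symbolDiff_le hn0 hm hφ hci hη g2
  have hsqrt : Real.sqrt n ≤ n := Real.sqrt_le_iff.2 ⟨hn'.le, by nlinarith⟩
  refine sieve_arith (s := Real.sqrt (L / n)) (η := 1 / (n : ℝ) ^ 2) (l := Real.log n) (n := n) (k := k)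
    (c := c) hA hC h.biasConst_nonneg hk hm hm1 hM hRc hVc hMc hR.le hV (by linarith) hlog rfl
    (by rw [Real.sq_sqrt (by positivity)]) rfl (Real.sqrt_nonneg _) (hbas'.trans ?_)
  have hsplit : |centredForm P X n (symbolDiff (φhat ω) ψ) ω| ≤
      8 * covBound w * (3 * ((rho2 (φhat ω) ψ).toReal + 1 / (n : ℝ) ^ 2) * Real.sqrt (L / n) +
        2 * R * L / n) + 3 * (1 / (n : ℝ) ^ 2) * n * (40 * covBound w * Real.log n + covBound w) := by
    rw [h.centredForm_symbolDiff_add hn0 hm hφ hci hψ']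
    refine (abs_add_le _ _).trans ?_
    rw [add_comm]
    refine add_le_add ((g1 i).trans ?_) (hrem.trans ?_)
    · gcongr
      linarith
    · gcongr
  gcongr

end LinearRows

end empirical

end LocStat

/-! ### Expansion of symbols over dyadic cells -/

namespace LocStat

section step

/-- The symbol `1_I e_k` with `I` the `t`-th of `N` equal cells. -/
noncomputable def cellAtom (N : ℕ) (t k : ℤ) (u : ℝ) (j : ℤ) : ℝ :=
  if j = k then (cell N t).indicator 1 u else 0

/-- The symbol that equals `d t k` on the `t`-th of `N` equal cells. -/
noncomputable def stepSymbol (N : ℕ) (d : ℤ → ℤ → ℝ) (u : ℝ) (k : ℤ) : ℝ :=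
  ∑ t ∈ Finset.Icc (1 : ℤ) N, d t k * (cell N t).indicator 1 u

/-- Averages of a symbol over cells. -/
noncomputable def cellMean (N : ℕ) (β : ℝ → ℤ → ℝ) (t k : ℤ) : ℝ := N * ∫ u in cell N t, β u k

variable {N : ℕ} {β γ : ℝ → ℤ → ℝ} {n : ℕ}

lemma stepSymbol_apply (hN : 0 < N) (d : ℤ → ℤ → ℝ) {t : ℤ} (ht : t ∈ Finset.Icc (1 : ℤ) N) {u : ℝ}
    (hu : u ∈ cell N t) (k : ℤ) : stepSymbol N d u k = d t k := by
  rw [stepSymbol, Finset.sum_eq_single_of_mem t ht, indicator_of_mem hu, Pi.one_apply, mul_one]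
  intro s _ hst
  rw [indicator_of_notMem, mul_zero]
  intro hs
  rw [mem_cell_iff hN] at hu hs
  exact hst (hs.symm.trans hu)

lemma measurable_cellAtom (N : ℕ) (t k j : ℤ) : Measurable fun u => cellAtom N t k u j := by
  unfold cellAtom
  split_ifs
  · exact measurable_one.indicator (measurableSet_cell t)
  · exact measurable_const

lemma integrable_indicator_cell (N : ℕ) (t : ℤ) : Integrable ((cell N t).indicator (1 : ℝ → ℝ)) :=
  (integrable_indicator_iff (measurableSet_cell t)).2
    (integrableOn_const (by rw [volume_cell]; exact ENNReal.ofReal_ne_top))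

lemma integrable_stepSymbol (N : ℕ) (d : ℤ → ℤ → ℝ) (k : ℤ) :
    Integrable fun u => stepSymbol N d u k :=
  integrable_finsetSum _ fun t _ => (integrable_indicator_cell N t).const_mul _

lemma symSq_cellAtom_le (N : ℕ) (t k : ℤ) : symSq (cellAtom N t k) ≤ ENNReal.ofReal (1 / N) := by
  rw [symSq, tsum_eq_single k fun j hj => by simp [cellAtom, hj]]
  calc ∫⁻ u in Ioc (0 : ℝ) 1, ‖cellAtom N t k u k‖ₑ ^ 2 ≤ ∫⁻ u, ‖cellAtom N t k u k‖ₑ ^ 2 :=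
        setLIntegral_le_lintegral _ _
    _ = ∫⁻ u, (cell N t).indicator 1 u := by
        refine lintegral_congr fun u => ?_
        by_cases hu : u ∈ cell N t <;> simp [cellAtom, hu]
    _ = _ := by rw [lintegral_indicator_one (measurableSet_cell t), volume_cell]

lemma quadCoef_stepSymbol (d : ℤ → ℤ → ℝ) {s r : ℤ} (hs : s ∈ Finset.Icc (1 : ℤ) n)
    (hr : r ∈ Finset.Icc (1 : ℤ) n) : quadCoef n (stepSymbol N d) s r =
      ∑ p ∈ Finset.Icc (-(n : ℤ)) n ×ˢ Finset.Icc (1 : ℤ) N,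
        d p.2 p.1 * quadCoef n (cellAtom N p.2 p.1) s r := by
  rw [Finset.sum_product, Finset.sum_eq_single_of_mem (s - r)]
  · unfold quadCoef stepSymbol
    rw [integral_finsetSum _ fun t _ => ((integrable_indicator_cell N t).const_mul _).integrableOn]
    refine Finset.sum_congr rfl fun t _ => ?_
    rw [integral_const_mul]
    simp [cellAtom]
  · simp only [Finset.mem_Icc] at *; omega
  · intro k _ hk
    refine Finset.sum_eq_zero fun t _ => ?_
    simp [quadCoef, cellAtom, Ne.symm hk]

lemma quadCoef_congr_Ioc (hn : 0 < n) (hβ : ∀ u ∈ Ioc (0 : ℝ) 1, ∀ k, β u k = γ u k) {s r : ℤ}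
    (hs : s ∈ Finset.Icc (1 : ℤ) n) (hr : r ∈ Finset.Icc (1 : ℤ) n) :
    quadCoef n β s r = quadCoef n γ s r :=
  setIntegral_congr_fun (measurableSet_cell _) fun u hu =>
    hβ u (cell_subset hn (half_sum_mem hs hr) hu) _

lemma centredForm_congr_Ioc {Ω : Type*} [MeasurableSpace Ω] {P : Measure Ω} {X : ℕ → ℤ → Ω → ℝ}
    (hn : 0 < n) (hβ : ∀ u ∈ Ioc (0 : ℝ) 1, ∀ k, β u k = γ u k) (ω : Ω) :
    centredForm P X n β ω = centredForm P X n γ ω := by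
  unfold centredForm
  rw [quadForm_congr fun s hs r hr => quadCoef_congr_Ioc hn hβ hs hr]

/-- Passing from `N` to `2N` cells: every cell is split into two. -/
lemma sum_half {M : Type*} [AddCommMonoid M] (N : ℕ) (g : ℤ → M) :
    ∑ t ∈ Finset.Icc (1 : ℤ) (2 * N : ℕ), g ((t + 1) / 2) = 2 • ∑ t ∈ Finset.Icc (1 : ℤ) N, g t := by
  induction N with
  | zero => simp
  | succ N ih =>
    have e1 : Finset.Icc (1 : ℤ) (2 * (N + 1) : ℕ) =
        insert (2 * (N : ℤ) + 2) (insert (2 * (N : ℤ) + 1) (Finset.Icc (1 : ℤ) (2 * N : ℕ))) := by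
      ext t; simp only [Finset.mem_Icc, Finset.mem_insert]; push_cast; omega
    have e2 : Finset.Icc (1 : ℤ) (N + 1 : ℕ) = insert ((N : ℤ) + 1) (Finset.Icc (1 : ℤ) N) := by
      ext t; simp only [Finset.mem_Icc, Finset.mem_insert]; push_cast; omega
    rw [e1, e2, Finset.sum_insert (by simp), Finset.sum_insert (by simp), Finset.sum_insert (by simp), ih,
      show (2 * (N : ℤ) + 2 + 1) / 2 = N + 1 by omega, show (2 * (N : ℤ) + 1 + 1) / 2 = N + 1 by omega,
      smul_add, two_nsmul (g _), add_assoc]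

lemma cell_two_mul_subset (hN : 0 < N) (t : ℤ) : cell (2 * N) t ⊆ cell N ((t + 1) / 2) := by
  intro u hu
  rw [mem_cell_iff (by omega)] at hu
  rw [mem_cell_iff hN, Int.ceil_eq_iff]
  rw [Int.ceil_eq_iff] at hu
  push_cast at hu
  have h1 : (t : ℝ) ≤ 2 * ((t + 1) / 2 : ℤ) := by exact_mod_cast (by omega : t ≤ 2 * ((t + 1) / 2))
  have h2 : 2 * (((t + 1) / 2 : ℤ) : ℝ) ≤ t + 1 := by exact_mod_cast (by omega : 2 * ((t + 1) / 2) ≤ t + 1)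
  have h3 : 2 * (N * u) = 2 * N * u := by ring
  -- the left endpoint of the parent cell is at most the left endpoint of the child
  constructor <;> linarith

/-- The cell averages vary by at most the variation over the cell. -/
lemma enorm_cellMean_sub_le (hN : 0 < N) {t k : ℤ} (hβ : IntegrableOn (fun u => β u k) (Ioc 0 1))
    (ht : t ∈ Finset.Icc (1 : ℤ) N) {v : ℝ} (hv : v ∈ cell N t) :
    ‖cellMean N β t k - β v k‖ₑ ≤ eVariationOn (fun u => β u k) (cell N t) := by
  have hN' : (0 : ℝ) < N := by exact_mod_cast hN
  have i1 : IntegrableOn (fun _ => β v k) (cell N t) :=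
    integrableOn_const (by rw [volume_cell]; exact ENNReal.ofReal_ne_top)
  have e1 : cellMean N β t k - β v k = N * ∫ u in cell N t, (β u k - β v k) := by
    rw [integral_sub (hβ.mono_set (cell_subset hN ht)) i1, setIntegral_const, Measure.real, volume_cell,
      ENNReal.toReal_ofReal (by positivity), smul_eq_mul, cellMean]
    field_simp
  rw [e1, enorm_mul]
  calc ‖(N : ℝ)‖ₑ * ‖∫ u in cell N t, (β u k - β v k)‖ₑ
      ≤ ‖(N : ℝ)‖ₑ * ∫⁻ u in cell N t, eVariationOn (fun u => β u k) (cell N t) := by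
        gcongr
        refine (enorm_integral_le_lintegral_enorm _).trans
          (setLIntegral_mono measurable_const fun u hu => ?_)
        rw [← edist_eq_enorm_sub]
        exact eVariationOn.edist_le (fun u => β u k) hu hv
    _ = _ := by
        rw [setLIntegral_const, volume_cell, mul_comm (eVariationOn _ _), ← mul_assoc,
          Real.enorm_eq_ofReal hN'.le, ← ENNReal.ofReal_mul hN'.le, mul_one_div_cancel hN'.ne',
          ENNReal.ofReal_one, one_mul]

lemma enorm_cellMean_sq_le (hN : 0 < N) (hβ : ∀ k, Measurable fun u => β u k) (t k : ℤ) :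
    ‖cellMean N β t k‖ₑ ^ 2 ≤ (N : ℝ≥0∞) * ∫⁻ u in cell N t, ‖β u k‖ₑ ^ 2 := by
  have hN' : (0 : ℝ) < N := by exact_mod_cast hN
  rw [cellMean, enorm_mul, mul_pow]
  calc ‖(N : ℝ)‖ₑ ^ 2 * ‖∫ u in cell N t, β u k‖ₑ ^ 2
      ≤ ‖(N : ℝ)‖ₑ ^ 2 * (ENNReal.ofReal (1 / N) * ∫⁻ u in cell N t, ‖β u k‖ₑ ^ 2) := by
        gcongr
        exact enorm_setIntegral_sq_le _ (hβ k) t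
    _ = _ := by
        rw [← mul_assoc, Real.enorm_eq_ofReal hN'.le, ← ENNReal.ofReal_pow hN'.le,
          ← ENNReal.ofReal_mul (by positivity), ← ENNReal.ofReal_natCast]
        congr 2
        field_simp

/-- The coefficients of the difference of the cell averages over `2N` and `N` cells. -/
noncomputable def cellDetail (N : ℕ) (β : ℝ → ℤ → ℝ) (t k : ℤ) : ℝ :=
  cellMean (2 * N) β t k - cellMean N β ((t + 1) / 2) k

lemma half_mem {t : ℤ} (ht : t ∈ Finset.Icc (1 : ℤ) (2 * N : ℕ)) :
    (t + 1) / 2 ∈ Finset.Icc (1 : ℤ) N := by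
  simp only [Finset.mem_Icc] at *; push_cast at ht; omega

lemma stepSymbol_cellDetail (hN : 0 < N) {u : ℝ} (hu : u ∈ Ioc (0 : ℝ) 1) (k : ℤ) :
    stepSymbol (2 * N) (cellDetail N β) u k =
      stepSymbol (2 * N) (cellMean (2 * N) β) u k - stepSymbol N (cellMean N β) u k := by
  have hN2 : 0 < 2 * N := by omega
  rw [← iUnion_cell hN2] at hu
  simp only [mem_iUnion, exists_prop] at hu
  obtain ⟨t, ht, hut⟩ := hu
  rw [stepSymbol_apply hN2 _ ht hut, stepSymbol_apply hN2 _ ht hut,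
    stepSymbol_apply hN _ (half_mem ht) (cell_two_mul_subset hN t hut), cellDetail]

/-- Child and parent averages are both compared with the value at the right endpoint of the child.
The variations over the children sum to the total variation once, those over the parents twice, as
each parent has two children. The bound does not depend on `N`. -/
lemma sum_enorm_cellDetail_le (hN : 0 < N) (hβ : ∀ k, IntegrableOn (fun u => β u k) (Ioc 0 1))
    (S : Finset ℤ) : ∑ p ∈ S ×ˢ Finset.Icc (1 : ℤ) (2 * N : ℕ), ‖cellDetail N β p.2 p.1‖ₑ ≤
      3 * symVar β := by
  have hN2 : 0 < 2 * N := by omega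
  rw [Finset.sum_product]
  calc ∑ k ∈ S, ∑ t ∈ Finset.Icc (1 : ℤ) (2 * N : ℕ), ‖cellDetail N β t k‖ₑ
      ≤ ∑ k ∈ S, 3 * eVariationOn (fun u => β u k) (Ioc 0 1) := by
        refine Finset.sum_le_sum fun k _ => ?_
        calc _ ≤ ∑ t ∈ Finset.Icc (1 : ℤ) (2 * N : ℕ), (eVariationOn (fun u => β u k) (cell (2 * N) t) +
              eVariationOn (fun u => β u k) (cell N ((t + 1) / 2))) := by
              refine Finset.sum_le_sum fun t ht => ?_
              have hv := div_mem_cell hN2 t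
              rw [cellDetail, ← sub_sub_sub_cancel_right _ _ (β ((t : ℝ) / (2 * N : ℕ)) k)]
              exact enorm_sub_le.trans (add_le_add (enorm_cellMean_sub_le hN2 (hβ k) ht hv)
                (enorm_cellMean_sub_le hN (hβ k) (half_mem ht) (cell_two_mul_subset hN t hv)))
          _ ≤ _ := by
              rw [Finset.sum_add_distrib, sum_half N fun t => eVariationOn (fun u => β u k) (cell N t),
                show (3 : ℝ≥0∞) = 1 + 2 by norm_num, add_mul, one_mul, nsmul_eq_mul]
              refine add_le_add (sum_eVariationOn_cell_le hN2 _) ?_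
              push_cast
              gcongr
              exact sum_eVariationOn_cell_le hN _
    _ ≤ _ := by rw [← Finset.mul_sum]; gcongr; exact ENNReal.sum_le_tsum S

/-- Jensen's inequality for the averages over `2N` and over `N` cells. Each of the two contributes
`4N`, the factor two in the second coming from the two children of a parent. -/
lemma sum_enorm_cellDetail_sq_le (hN : 0 < N) (hβ : ∀ k, Measurable fun u => β u k) (S : Finset ℤ) :
    ∑ p ∈ S ×ˢ Finset.Icc (1 : ℤ) (2 * N : ℕ), ‖cellDetail N β p.2 p.1‖ₑ ^ 2 ≤
      8 * (N : ℝ≥0∞) * symSq β := by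
  have hN2 : 0 < 2 * N := by omega
  have hsq : ∀ x y : ℝ, ‖x - y‖ₑ ^ 2 ≤ 2 * ‖x‖ₑ ^ 2 + 2 * ‖y‖ₑ ^ 2 := by
    intro x y
    simp only [Real.enorm_eq_ofReal_abs]
    rw [← ENNReal.ofReal_pow (abs_nonneg _), ← ENNReal.ofReal_pow (abs_nonneg _),
      ← ENNReal.ofReal_pow (abs_nonneg _), ← ENNReal.ofReal_ofNat 2, ← ENNReal.ofReal_mul (by norm_num),
      ← ENNReal.ofReal_mul (by norm_num), ← ENNReal.ofReal_add (by positivity) (by positivity)]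
    refine ENNReal.ofReal_le_ofReal ?_
    simp only [sq_abs]
    nlinarith [sq_nonneg (x + y)]
  rw [Finset.sum_product]
  calc ∑ k ∈ S, ∑ t ∈ Finset.Icc (1 : ℤ) (2 * N : ℕ), ‖cellDetail N β t k‖ₑ ^ 2
      ≤ ∑ k ∈ S, 8 * (N : ℝ≥0∞) * ∫⁻ u in Ioc (0 : ℝ) 1, ‖β u k‖ₑ ^ 2 := by
        refine Finset.sum_le_sum fun k _ => ?_
        calc _ ≤ ∑ t ∈ Finset.Icc (1 : ℤ) (2 * N : ℕ),
              (2 * (((2 * N : ℕ) : ℝ≥0∞) * ∫⁻ u in cell (2 * N) t, ‖β u k‖ₑ ^ 2) +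
              2 * ((N : ℝ≥0∞) * ∫⁻ u in cell N ((t + 1) / 2), ‖β u k‖ₑ ^ 2)) := by
              refine Finset.sum_le_sum fun t ht => (hsq _ _).trans ?_
              gcongr
              · exact enorm_cellMean_sq_le hN2 hβ t k
              · exact enorm_cellMean_sq_le hN hβ _ k
          _ = _ := by
              rw [Finset.sum_add_distrib, ← Finset.mul_sum, ← Finset.mul_sum, ← Finset.mul_sum,
                ← Finset.mul_sum, sum_half N fun t => ∫⁻ u in cell N t, ‖β u k‖ₑ ^ 2,
                sum_lintegral_cell hN2, sum_lintegral_cell hN, nsmul_eq_mul]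
              push_cast
              ring
    _ ≤ _ := by rw [← Finset.mul_sum]; gcongr; exact ENNReal.sum_le_tsum S

lemma tsum_lintegral_sub_stepSymbol_le (hN : 0 < N)
    (hβ : ∀ k, IntegrableOn (fun u => β u k) (Ioc 0 1)) :
    ∑' k, ∫⁻ u in Ioc (0 : ℝ) 1, ‖β u k - stepSymbol N (cellMean N β) u k‖ₑ ≤
      ENNReal.ofReal (1 / N) * symVar β := by
  rw [symVar, ← ENNReal.tsum_mul_left]
  refine ENNReal.tsum_le_tsum fun k => ?_
  rw [← sum_lintegral_cell hN]
  calc _ ≤ ∑ t ∈ Finset.Icc (1 : ℤ) N, ENNReal.ofReal (1 / N) *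
        eVariationOn (fun u => β u k) (cell N t) := by
        refine Finset.sum_le_sum fun t ht => ?_
        rw [← volume_cell t, mul_comm, ← setLIntegral_const]
        refine setLIntegral_mono measurable_const fun u hu => ?_
        rw [stepSymbol_apply hN _ ht hu, enorm_sub_rev]
        exact enorm_cellMean_sub_le hN (hβ k) ht hu
    _ ≤ _ := by rw [← Finset.mul_sum]; gcongr; exact sum_eVariationOn_cell_le hN _

lemma sum_enorm_cellMean_one_le (S : Finset ℤ) :
    ∑ p ∈ S ×ˢ Finset.Icc (1 : ℤ) (1 : ℕ), ‖cellMean 1 β p.2 p.1‖ₑ ≤ symSup β := by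
  rw [Finset.sum_product]
  refine le_trans (Finset.sum_le_sum fun k _ => ?_) (ENNReal.sum_le_tsum S)
  rw [Nat.cast_one, Finset.Icc_self, Finset.sum_singleton, cellMean, Nat.cast_one, one_mul]
  have hc : cell 1 1 = Ioc 0 1 := by simp [cell]
  rw [hc]
  calc _ ≤ ∫⁻ u in Ioc (0 : ℝ) 1, ‖β u k‖ₑ := enorm_integral_le_lintegral_enorm _
    _ ≤ ∫⁻ u in Ioc (0 : ℝ) 1, ⨆ u ∈ Ioc (0 : ℝ) 1, ‖β u k‖ₑ :=
        setLIntegral_mono measurable_const fun u hu => le_biSup (fun u => ‖β u k‖ₑ) hu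
    _ = _ := by rw [setLIntegral_const]; simp

lemma sum_enorm_cellMean_one_sq_le (hβ : ∀ k, Measurable fun u => β u k) (S : Finset ℤ) :
    ∑ p ∈ S ×ˢ Finset.Icc (1 : ℤ) (1 : ℕ), ‖cellMean 1 β p.2 p.1‖ₑ ^ 2 ≤ symSq β := by
  rw [Finset.sum_product]
  refine le_trans (Finset.sum_le_sum fun k _ => ?_) (ENNReal.sum_le_tsum S)
  rw [Nat.cast_one, Finset.Icc_self, Finset.sum_singleton]
  have hc : cell 1 1 = Ioc 0 1 := by simp [cell]
  refine (enorm_cellMean_sq_le one_pos hβ 1 k).trans (le_of_eq ?_)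
  rw [hc, Nat.cast_one, one_mul]

end step

lemma sum_range_linear_geometric_le {m c : ℝ} (hm : 0 ≤ m) (hc : 0 ≤ c) (n : ℕ) :
    ∑ q ∈ Finset.range n, (m + c * (q + 1)) * (3 / 4 : ℝ) ^ (q + 1) ≤ 4 * m + 12 * c := by
  have key : ∀ n : ℕ, ∑ q ∈ Finset.range n, (m + c * (q + 1)) * (3 / 4 : ℝ) ^ (q + 1) =
      3 * m + 12 * c - (3 * m + c * (3 * n + 12)) * (3 / 4 : ℝ) ^ n := by
    intro n
    induction n with
    | zero => simp; ring
    | succ n ih => rw [Finset.sum_range_succ, ih]; push_cast; ring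
  rw [key]
  have : 0 ≤ (3 * m + c * (3 * n + 12)) * (3 / 4 : ℝ) ^ n := by positivity
  linarith

/-! ### Uniform bound for centred forms by thresholding the dyadic atoms -/

section stochastic

variable {Ω : Type*} [MeasurableSpace Ω] {P : Measure Ω} {X : ℕ → ℤ → Ω → ℝ} {a : ℝ → ℤ → ℝ}
  {w : ℤ → ℝ} {K : ℝ} {α : ℕ → ℤ → ℤ → ℝ} {n N : ℕ} {β : ℝ → ℤ → ℝ}

/-- The sum of the squares of those forms with symbols `1_I e_k` which exceed `θ`. -/
noncomputable def largeAtoms (P : Measure Ω) (X : ℕ → ℤ → Ω → ℝ) (n N : ℕ) (θ : ℝ) (ω : Ω) : ℝ :=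
  ∑ p ∈ Finset.Icc (-(n : ℤ)) n ×ˢ Finset.Icc (1 : ℤ) N,
    if θ < |centredForm P X n (cellAtom N p.2 p.1) ω| then
      centredForm P X n (cellAtom N p.2 p.1) ω ^ 2 else 0

namespace LinearRows

variable (h : LinearRows P X a w K α)
include h

lemma centredForm_stepSymbol (d : ℤ → ℤ → ℝ) (ω : Ω) : centredForm P X n (stepSymbol N d) ω =
    ∑ p ∈ Finset.Icc (-(n : ℤ)) n ×ˢ Finset.Icc (1 : ℤ) N,
      d p.2 p.1 * centredForm P X n (cellAtom N p.2 p.1) ω := by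
  have e1 : quadForm X n (quadCoef n (stepSymbol N d)) = fun ω =>
      ∑ p ∈ Finset.Icc (-(n : ℤ)) n ×ˢ Finset.Icc (1 : ℤ) N,
        d p.2 p.1 * quadForm X n (quadCoef n (cellAtom N p.2 p.1)) ω := by
    rw [quadForm_congr fun s hs r hr => quadCoef_stepSymbol d hs hr]
    ext ω
    simp only [quadForm, Finset.sum_mul, Finset.mul_sum]
    symm
    rw [Finset.sum_comm]
    refine Finset.sum_congr rfl fun s _ => ?_
    rw [Finset.sum_comm]
    exact Finset.sum_congr rfl fun r _ => Finset.sum_congr rfl fun p _ => by ring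
  unfold centredForm
  rw [e1, integral_finsetSum _ fun p _ => (h.integrable_quadForm _).const_mul _,
    ← Finset.sum_sub_distrib]
  refine Finset.sum_congr rfl fun p _ => ?_
  rw [integral_const_mul, mul_sub]

/-- Atoms below the threshold are paired with the `ℓ¹` norm of the coefficients, the exceptional
ones by Cauchy–Schwarz with the `ℓ²` norm. -/
lemma abs_centredForm_stepSymbol_le (d : ℤ → ℤ → ℝ) {θ B₁ B₂ Z : ℝ} (hθ : 0 ≤ θ) (hB₂ : 0 ≤ B₂)
    (hZ : 0 ≤ Z)
    (h1 : ∑ p ∈ Finset.Icc (-(n : ℤ)) n ×ˢ Finset.Icc (1 : ℤ) N, ‖d p.2 p.1‖ₑ ≤ ENNReal.ofReal B₁)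
    (hB₁ : 0 ≤ B₁)
    (h2 : ∑ p ∈ Finset.Icc (-(n : ℤ)) n ×ˢ Finset.Icc (1 : ℤ) N, ‖d p.2 p.1‖ₑ ^ 2 ≤
      ENNReal.ofReal (B₂ ^ 2)) {ω : Ω} (hW : largeAtoms P X n N θ ω ≤ Z ^ 2) :
    |centredForm P X n (stepSymbol N d) ω| ≤ θ * B₁ + B₂ * Z := by
  set S := Finset.Icc (-(n : ℤ)) n ×ˢ Finset.Icc (1 : ℤ) N
  set c : ℤ × ℤ → ℝ := fun p => centredForm P X n (cellAtom N p.2 p.1) ω with hc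
  set e : ℤ × ℤ → ℝ := fun p => if θ < |c p| then |c p| else 0 with he
  have g1 : ∑ p ∈ S, |d p.2 p.1| ≤ B₁ := by
    rw [← ENNReal.ofReal_le_ofReal_iff hB₁, ENNReal.ofReal_sum_of_nonneg fun p _ => abs_nonneg _]
    simpa only [Real.enorm_eq_ofReal_abs] using h1
  have g2 : ∑ p ∈ S, |d p.2 p.1| ^ 2 ≤ B₂ ^ 2 := by
    rw [← ENNReal.ofReal_le_ofReal_iff (by positivity),
      ENNReal.ofReal_sum_of_nonneg fun p _ => by positivity]
    simpa only [Real.enorm_eq_ofReal_abs, ENNReal.ofReal_pow (abs_nonneg _)] using h2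
  have g3 : ∑ p ∈ S, e p ^ 2 ≤ Z ^ 2 := by
    refine le_trans (le_of_eq ?_) hW
    refine Finset.sum_congr rfl fun p _ => ?_
    simp only [he, hc]
    split_ifs <;> simp
  have g4 : ∑ p ∈ S, |d p.2 p.1| * e p ≤ B₂ * Z := by
    refine (Real.sum_mul_le_sqrt_mul_sqrt S _ _).trans ?_
    exact mul_le_mul (Real.sqrt_le_iff.2 ⟨hB₂, g2⟩) (Real.sqrt_le_iff.2 ⟨hZ, g3⟩)
      (Real.sqrt_nonneg _) hB₂
  rw [h.centredForm_stepSymbol]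
  calc |∑ p ∈ S, d p.2 p.1 * c p| ≤ ∑ p ∈ S, |d p.2 p.1| * |c p| := by
        refine (Finset.abs_sum_le_sum_abs _ _).trans (le_of_eq ?_)
        simp only [abs_mul]
    _ ≤ ∑ p ∈ S, (θ * |d p.2 p.1| + |d p.2 p.1| * e p) := by
        refine Finset.sum_le_sum fun p _ => ?_
        have hd := abs_nonneg (d p.2 p.1)
        simp only [he]
        split_ifs with hp
        · nlinarith [mul_nonneg hθ hd]
        · rw [mul_zero, add_zero, mul_comm]
          exact mul_le_mul_of_nonneg_right (not_lt.1 hp) hd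
    _ ≤ _ := by
        rw [Finset.sum_add_distrib, ← Finset.mul_sum]
        exact add_le_add (mul_le_mul_of_nonneg_left g1 hθ) g4

/-- An atom at level `q` has size of order `(2^q n)^{-1/2}`, and there are at most `3n 2^q` relevant
atoms, so the counts cancel. The growth `32 C q` of the threshold produces the factor `exp(-4q) ≤
16^{-q}`, which outweighs the growth of the `ℓ²` norms of the coefficients with the level. -/
lemma lintegral_largeAtoms_le [IsProbabilityMeasure P]
    (hG : IsGaussianProcess (fun (t : Icc (1 : ℤ) (n : ℤ)) (ω : Ω) => X n t ω) P) (hn : 0 < n)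
    {q : ℕ} (m : ℝ) :
    ∫⁻ ω, ENNReal.ofReal (largeAtoms P X n (2 ^ q)
      ((m + 32 * covBound w * q) / (Real.sqrt (2 ^ q) * Real.sqrt n)) ω) ∂P ≤
      ENNReal.ofReal (3072 * covBound w ^ 2 * Real.exp (-(m / (8 * covBound w))) * (1 / 16) ^ q) := by
  have hn' : (0 : ℝ) < n := by exact_mod_cast hn
  have hn1 : (1 : ℝ) ≤ n := by exact_mod_cast hn
  have hC := one_le_covBound w
  have hC0 : 0 < covBound w := by linarith
  set N : ℝ := 2 ^ q with hN
  have hN0 : 0 < N := by positivity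
  have hsN : 0 < Real.sqrt N := Real.sqrt_pos.2 hN0
  have hsn : 0 < Real.sqrt n := Real.sqrt_pos.2 hn'
  set θ := (m + 32 * covBound w * q) / (Real.sqrt N * Real.sqrt n) with hθ
  have hg : Measurable fun x : ℝ => ENNReal.ofReal (if θ < |x| then x ^ 2 else 0) :=
    (Measurable.ite (measurableSet_lt measurable_const (by fun_prop)) (by fun_prop)
      measurable_const).ennreal_ofReal
  have hcf : ∀ p : ℤ × ℤ, AEMeasurable (centredForm P X n (cellAtom (2 ^ q) p.2 p.1)) P := fun p =>
    ((h.integrable_quadForm _).sub (integrable_const _)).aemeasurable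
  have hmeas : ∀ p : ℤ × ℤ, AEMeasurable (fun ω => ENNReal.ofReal
      (if θ < |centredForm P X n (cellAtom (2 ^ q) p.2 p.1) ω|
      then centredForm P X n (cellAtom (2 ^ q) p.2 p.1) ω ^ 2 else 0)) P := fun p =>
    hg.comp_aemeasurable (hcf p)
  have hatom : ∀ p : ℤ × ℤ, ∫⁻ ω, ENNReal.ofReal (if θ < |centredForm P X n (cellAtom (2 ^ q) p.2 p.1) ω|
      then centredForm P X n (cellAtom (2 ^ q) p.2 p.1) ω ^ 2 else 0) ∂P ≤
      ENNReal.ofReal (1024 * covBound w ^ 2 / (N * n) *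
        (Real.exp (-(m / (8 * covBound w))) * (1 / 16) ^ q)) := by
    intro p
    have hD : symSq (cellAtom (2 ^ q) p.2 p.1) ≤ ENNReal.ofReal ((1 / Real.sqrt N) ^ 2) := by
      refine (symSq_cellAtom_le _ _ _).trans (le_of_eq ?_)
      rw [div_pow, Real.sq_sqrt hN0.le, one_pow, hN]
      push_cast
      rfl
    refine (h.lintegral_centredForm_sq hG hn (measurable_cellAtom _ _ _) hD (by positivity) θ).trans ?_
    refine ENNReal.ofReal_le_ofReal ?_
    have e1 : Real.sqrt n * θ / (8 * (covBound w * (1 / Real.sqrt N))) = m / (8 * covBound w) + 4 * q := by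
      rw [hθ]; field_simp; ring
    have e2 : 1024 * (covBound w * (1 / Real.sqrt N)) ^ 2 / n = 1024 * covBound w ^ 2 / (N * n) := by
      rw [mul_pow, div_pow, Real.sq_sqrt hN0.le]; field_simp
    rw [e1, e2, neg_add, Real.exp_add]
    gcongr
    rw [show -(4 * (q : ℝ)) = q * (-4 : ℝ) by ring, Real.exp_nat_mul]
    gcongr
    rw [Real.exp_neg, one_div]
    refine inv_anti₀ (by norm_num) ?_
    have := Real.add_one_le_exp (1 : ℝ)
    calc (16 : ℝ) = (1 + 1) ^ 4 := by norm_num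
      _ ≤ Real.exp 1 ^ 4 := by gcongr
      _ = Real.exp 4 := by rw [← Real.exp_nat_mul]; norm_num
  calc ∫⁻ ω, ENNReal.ofReal (largeAtoms P X n (2 ^ q) θ ω) ∂P
      = ∑ p ∈ Finset.Icc (-(n : ℤ)) n ×ˢ Finset.Icc (1 : ℤ) (2 ^ q : ℕ),
        ∫⁻ ω, ENNReal.ofReal (if θ < |centredForm P X n (cellAtom (2 ^ q) p.2 p.1) ω|
          then centredForm P X n (cellAtom (2 ^ q) p.2 p.1) ω ^ 2 else 0) ∂P := by
        rw [← lintegral_finsetSum' _ fun p _ => hmeas p]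
        refine lintegral_congr fun ω => ?_
        rw [largeAtoms, ENNReal.ofReal_sum_of_nonneg]
        intro p _
        split_ifs <;> positivity
    _ ≤ ∑ p ∈ Finset.Icc (-(n : ℤ)) n ×ˢ Finset.Icc (1 : ℤ) (2 ^ q : ℕ),
        ENNReal.ofReal (1024 * covBound w ^ 2 / (N * n) *
          (Real.exp (-(m / (8 * covBound w))) * (1 / 16) ^ q)) := Finset.sum_le_sum fun p _ => hatom p
    _ ≤ _ := by
        rw [Finset.sum_const, nsmul_eq_mul, Finset.card_product, Int.card_Icc, Int.card_Icc,
          ← ENNReal.ofReal_natCast, ← ENNReal.ofReal_mul (by positivity)]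
        refine ENNReal.ofReal_le_ofReal ?_
        have e3 : ((((n : ℤ) + 1 - -(n : ℤ)).toNat * (((2 ^ q : ℕ) : ℤ) + 1 - 1).toNat : ℕ) : ℝ) ≤
            3 * n * N := by
          have : ((n : ℤ) + 1 - -(n : ℤ)).toNat ≤ 3 * n := by omega
          have h2 : (((2 ^ q : ℕ) : ℤ) + 1 - 1).toNat = 2 ^ q := by
            rw [add_sub_cancel_right]; exact Int.toNat_natCast _
          rw [h2]
          push_cast
          rw [← hN]
          gcongr
          exact_mod_cast this
        calc _ ≤ 3 * n * N * (1024 * covBound w ^ 2 / (N * n) *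
              (Real.exp (-(m / (8 * covBound w))) * (1 / 16) ^ q)) := by gcongr
          _ = _ := by field_simp; ring

/-- Bound for a centred quadratic form on the event that few cell atoms are large. -/
lemma abs_centredForm_le_of_largeAtoms [IsProbabilityMeasure P] (hn0 : 0 < n) {m Z b R V η : ℝ}
    (hm : 0 ≤ m) (hZ : 0 ≤ Z) {ω : Ω}
    (hlarge : ∀ q : ℕ, largeAtoms P X n (2 ^ q)
      ((m + 32 * covBound w * q) / (Real.sqrt (2 ^ q) * Real.sqrt n)) ω ≤ Z ^ 2 * (1 / 8) ^ q)
    (hb : 0 ≤ b) (hmax : ∀ t ∈ Finset.Icc (1 : ℤ) n, X n t ω ^ 2 ≤ b)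
    (hβ : ∀ k, Measurable fun u => β u k) (hR0 : 0 ≤ R) (hV0 : 0 ≤ V) (hη0 : 0 ≤ η)
    (hR : symSup β ≤ ENNReal.ofReal R) (hV : symVar β ≤ ENNReal.ofReal V)
    (hη : symSq β ≤ ENNReal.ofReal (η ^ 2)) :
    |centredForm P X n β ω| ≤ (R * m + 3 * V * (4 * m + 384 * covBound w)) / Real.sqrt n +
      3 * η * Z + V * (b + covBound w) / n := by
  have hn' : (0 : ℝ) < n := by exact_mod_cast hn0
  have hsn : 0 < Real.sqrt n := Real.sqrt_pos.2 hn'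
  have hC := one_le_covBound w
  set C := covBound w with hCdef
  have hC0 : 0 < C := by linarith
  have hβi := integrableOn_of_symSup hβ (ne_top_of_le_ne_top ENNReal.ofReal_ne_top hR)
  have hlarge' : ∀ q : ℕ, largeAtoms P X n (2 ^ q)
      ((m + 32 * C * q) / (Real.sqrt (2 ^ q) * Real.sqrt n)) ω ≤ (Z * Real.sqrt ((1 / 8) ^ q)) ^ 2 := by
    intro q
    rw [mul_pow, Real.sq_sqrt (by positivity)]
    exact hlarge q
  -- The form of `β` is telescoped as level zero, `n` dyadic details, and a residual. As `2ⁿ ≥ n`,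
  -- the residual symbol has `L¹` norm at most `V/n`.
  set S : ℕ → ℝ := fun q => centredForm P X n (stepSymbol (2 ^ q) (cellMean (2 ^ q) β)) ω with hS
  have hlev0 : |S 0| ≤ R * m / Real.sqrt n + η * Z := by
    have hl0 : largeAtoms P X n 1 (m / Real.sqrt n) ω ≤ Z ^ 2 := by simpa using hlarge 0
    have hS0 : S 0 = centredForm P X n (stepSymbol 1 (cellMean 1 β)) ω := by simp only [hS, pow_zero]
    rw [hS0]
    have := h.abs_centredForm_stepSymbol_le (N := 1) (cellMean 1 β)
      (θ := m / Real.sqrt n) (by positivity) hη0 hZ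
      ((sum_enorm_cellMean_one_le _).trans hR) hR0 ((sum_enorm_cellMean_one_sq_le hβ _).trans hη) hl0
    refine this.trans (le_of_eq ?_)
    ring
  have hlev : ∀ q : ℕ, |S (q + 1) - S q| ≤
      3 * V / Real.sqrt n * ((m + 32 * C * (q + 1)) * (3 / 4) ^ (q + 1)) + η * Z * (1 / 2) ^ q := by
    intro q
    have hN : 0 < 2 ^ q := by positivity
    have e1 : S (q + 1) - S q = centredForm P X n (stepSymbol (2 ^ (q + 1)) (cellDetail (2 ^ q) β)) ω := by
      rw [hS, ← h.centredForm_sub hn0 (fun k => (integrable_stepSymbol _ _ k).integrableOn)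
        fun k => (integrable_stepSymbol _ _ k).integrableOn, pow_succ' 2 q]
      exact (centredForm_congr_Ioc hn0 (fun u hu k => stepSymbol_cellDetail hN hu k) ω).symm
    have hb1 : ∑ p ∈ Finset.Icc (-(n : ℤ)) n ×ˢ Finset.Icc (1 : ℤ) (2 ^ (q + 1) : ℕ),
        ‖cellDetail (2 ^ q) β p.2 p.1‖ₑ ≤ ENNReal.ofReal (3 * V) := by
      rw [pow_succ' 2 q]
      refine (sum_enorm_cellDetail_le hN hβi _).trans ?_
      rw [ENNReal.ofReal_mul (by norm_num), ENNReal.ofReal_ofNat]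
      gcongr
    have hb2 : ∑ p ∈ Finset.Icc (-(n : ℤ)) n ×ˢ Finset.Icc (1 : ℤ) (2 ^ (q + 1) : ℕ),
        ‖cellDetail (2 ^ q) β p.2 p.1‖ₑ ^ 2 ≤ ENNReal.ofReal ((Real.sqrt (8 * 2 ^ q) * η) ^ 2) := by
      rw [pow_succ' 2 q]
      refine (sum_enorm_cellDetail_sq_le hN hβ _).trans ?_
      rw [mul_pow, Real.sq_sqrt (by positivity), ENNReal.ofReal_mul (by positivity),
        ENNReal.ofReal_mul (by norm_num), ENNReal.ofReal_ofNat, ENNReal.ofReal_pow (by norm_num),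
        ENNReal.ofReal_ofNat]
      push_cast
      gcongr
    rw [e1]
    refine (h.abs_centredForm_stepSymbol_le (N := 2 ^ (q + 1)) (cellDetail (2 ^ q) β)
      (θ := (m + 32 * C * (q + 1 : ℕ)) / (Real.sqrt (2 ^ (q + 1)) * Real.sqrt n)) (by positivity)
      (by positivity) (by positivity) hb1 (by positivity) hb2 (hlarge' (q + 1))).trans ?_
    refine add_le_add ?_ (le_of_eq ?_)
    -- Rounding the ratio `2^{-1/2}` up to `3/4`, by `1/2 ≤ 9/16`, keeps the sum over levels
    -- explicit.
    · have e2 : 1 / Real.sqrt (2 ^ (q + 1)) ≤ (3 / 4) ^ (q + 1) := by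
        rw [one_div, ← Real.sqrt_inv]
        refine Real.sqrt_le_iff.2 ⟨by positivity, ?_⟩
        rw [← inv_pow, ← pow_mul, mul_comm, pow_mul]
        gcongr
        norm_num
      calc _ = 3 * V / Real.sqrt n * ((m + 32 * C * (q + 1)) * (1 / Real.sqrt (2 ^ (q + 1)))) := by
            push_cast; field_simp
        _ ≤ _ := by gcongr
    · have e2 : Real.sqrt (8 * 2 ^ q) * Real.sqrt ((1 / 8) ^ (q + 1)) = (1 / 2) ^ q := by
        rw [← Real.sqrt_mul (by positivity), Real.sqrt_eq_iff_mul_self_eq (by positivity) (by positivity),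
          pow_succ (1 / 8 : ℝ), ← mul_pow]
        have : 8 * (2 : ℝ) ^ q * ((1 / 8) ^ q * (1 / 8)) = (2 * (1 / 8)) ^ q := by
          rw [mul_pow]; ring
        rw [this]
        norm_num
      calc _ = (Real.sqrt (8 * 2 ^ q) * Real.sqrt ((1 / 8) ^ (q + 1))) * (η * Z) := by ring
        _ = _ := by rw [e2]; ring
  have hres : |centredForm P X n β ω - S n| ≤ V * (b + C) / n := by
    rw [hS, ← h.centredForm_sub hn0 hβi fun k => (integrable_stepSymbol _ _ k).integrableOn]
    have := h.abs_centredForm_le_abs (β := fun u k => β u k - stepSymbol (2 ^ n) (cellMean (2 ^ n) β) u k)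
      (B := V / n) (ω := ω) hn0 (by positivity) ?_ hb hmax
    · refine this.trans (le_of_eq ?_); rw [← hCdef]; ring
    · refine (tsum_lintegral_sub_stepSymbol_le (by positivity) hβi).trans ?_
      calc _ ≤ ENNReal.ofReal (1 / n) * ENNReal.ofReal V := by
            gcongr
            exact_mod_cast (Nat.lt_two_pow_self (n := n)).le
        _ = _ := by rw [← ENNReal.ofReal_mul (by positivity)]; congr 1; ring
  have hsum : |S n - S 0| ≤ 3 * V / Real.sqrt n * (4 * m + 12 * (32 * C)) + 2 * (η * Z) := by
    rw [← Finset.sum_range_sub S n]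
    refine (Finset.abs_sum_le_sum_abs _ _).trans ((Finset.sum_le_sum fun q _ => hlev q).trans ?_)
    rw [Finset.sum_add_distrib, ← Finset.mul_sum, ← Finset.mul_sum]
    refine add_le_add (mul_le_mul_of_nonneg_left
      (sum_range_linear_geometric_le hm (by positivity) n) (by positivity)) ?_
    rw [mul_comm]
    refine mul_le_mul_of_nonneg_right ?_ (by positivity)
    exact (summable_geometric_two.sum_le_tsum _ fun _ _ => by positivity).trans tsum_geometric_two.le
  have e1 : centredForm P X n β ω = S 0 + (S n - S 0) + (centredForm P X n β ω - S n) := by ring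
  rw [e1]
  refine (abs_add_three _ _ _).trans ((add_le_add (add_le_add hlev0 hsum) hres).trans (le_of_eq ?_))
  ring

/-- Uniform bound for centred quadratic forms in terms of norms of the symbol, by an expansion with
respect to dyadic cells. -/
lemma exists_uniform_bound [IsProbabilityMeasure P]
    (hG : IsGaussianProcess (fun (t : Icc (1 : ℤ) (n : ℤ)) (ω : Ω) => X n t ω) P) (hn : 2 ≤ n)
    {T m : ℝ} (hT : 0 < T) (hm : 0 ≤ m) :
    ∃ B : Set Ω, P B ≤ ENNReal.ofReal (1 / T + 2 / n) ∧ ∀ ω ∉ B,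
      (∀ t ∈ Finset.Icc (1 : ℤ) n, X n t ω ^ 2 ≤ 40 * covBound w * Real.log n) ∧
      ∀ (β : ℝ → ℤ → ℝ) (R V η : ℝ), (∀ k, Measurable fun u => β u k) → 0 ≤ R → 0 ≤ V → 0 ≤ η →
        symSup β ≤ ENNReal.ofReal R → symVar β ≤ ENNReal.ofReal V →
        symSq β ≤ ENNReal.ofReal (η ^ 2) →
        |centredForm P X n β ω| ≤ (R * m + 3 * V * (4 * m + 384 * covBound w)) / Real.sqrt n +
          3 * η * (79 * covBound w * Real.sqrt T * Real.exp (-(m / (16 * covBound w)))) +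
          V * (40 * covBound w * Real.log n + covBound w) / n := by
  have hn0 : 0 < n := by omega
  have hC := one_le_covBound w
  have hC0 : 0 < covBound w := by linarith
  -- `79² = 6241` exceeds `2 · 3072`, so Markov's inequality at level `q` with threshold `Z² 8^{-q}`
  -- gives probability at most `2^{-q} / (2T)`. These sum to `1/T`.
  obtain ⟨Z, hZ⟩ : ∃ Z, Z = 79 * covBound w * Real.sqrt T * Real.exp (-(m / (16 * covBound w))) := ⟨_, rfl⟩
  have hZ0 : 0 < Z := by rw [hZ]; positivity
  set θ : ℕ → ℝ := fun q => (m + 32 * covBound w * q) / (Real.sqrt (2 ^ q) * Real.sqrt n) with hθ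
  set B₁ : ℕ → Set Ω := fun q => {ω | Z ^ 2 * (1 / 8) ^ q < largeAtoms P X n (2 ^ q) (θ q) ω} with hB₁
  set B₂ := {ω | ∃ t ∈ Finset.Icc (1 : ℤ) n, 40 * covBound w * Real.log n < X n t ω ^ 2} with hB₂
  have hZ2 : Z ^ 2 = 6241 * covBound w ^ 2 * T * Real.exp (-(m / (8 * covBound w))) := by
    rw [hZ, mul_pow, mul_pow, mul_pow, Real.sq_sqrt hT.le, ← Real.exp_nat_mul]
    have : ((2 : ℕ) : ℝ) * -(m / (16 * covBound w)) = -(m / (8 * covBound w)) := by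
      push_cast; field_simp; ring
    rw [this]; ring
  have hB₁P : ∀ q, P (B₁ q) ≤ ENNReal.ofReal (1 / (2 * T) * (1 / 2) ^ q) := by
    intro q
    have h1 : ENNReal.ofReal (Z ^ 2 * (1 / 8) ^ q) * P (B₁ q) ≤ ENNReal.ofReal
        (3072 * covBound w ^ 2 * Real.exp (-(m / (8 * covBound w))) * (1 / 16) ^ q) := by
      refine le_trans ?_ (h.lintegral_largeAtoms_le hG hn0 (q := q) m)
      refine le_trans ?_ (mul_meas_ge_le_lintegral₀ ?_ (ENNReal.ofReal (Z ^ 2 * (1 / 8) ^ q)))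
      · gcongr
        intro ω hω
        exact ENNReal.ofReal_le_ofReal (le_of_lt hω)
      · refine AEMeasurable.ennreal_ofReal (Finset.aemeasurable_fun_sum _ fun p _ => ?_)
        have hcf : AEMeasurable (centredForm P X n (cellAtom (2 ^ q) p.2 p.1)) P :=
          ((h.integrable_quadForm _).sub (integrable_const _)).aemeasurable
        have hg : Measurable fun x : ℝ => if θ q < |x| then x ^ 2 else 0 :=
          Measurable.ite (measurableSet_lt measurable_const (by fun_prop)) (by fun_prop) measurable_const
        exact hg.comp_aemeasurable hcf
    have hpos : 0 < Z ^ 2 * (1 / 8) ^ q := by positivity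
    rw [mul_comm, ← ENNReal.le_div_iff_mul_le (Or.inl (by simpa using hpos)) (Or.inl ENNReal.ofReal_ne_top),
      ← ENNReal.ofReal_div_of_pos hpos] at h1
    refine h1.trans (ENNReal.ofReal_le_ofReal ?_)
    rw [div_le_iff₀ hpos, hZ2]
    have e3 : 1 / (2 * T) * (1 / 2) ^ q * (6241 * covBound w ^ 2 * T *
        Real.exp (-(m / (8 * covBound w))) * (1 / 8) ^ q) = 6241 / 2 * covBound w ^ 2 *
        Real.exp (-(m / (8 * covBound w))) * ((1 / 2) ^ q * (1 / 8) ^ q) := by field_simp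
    rw [e3, ← mul_pow]
    norm_num
    gcongr
    norm_num
  refine ⟨(⋃ q, B₁ q) ∪ B₂, ?_, fun ω hω => ?_⟩
  · refine (measure_union_le _ _).trans ?_
    rw [ENNReal.ofReal_add (by positivity) (by positivity)]
    refine add_le_add ((measure_iUnion_le _).trans ((ENNReal.tsum_le_tsum hB₁P).trans ?_))
      (h.measure_max_sq hG hn)
    rw [← ENNReal.ofReal_tsum_of_nonneg (fun q => by positivity)
      ((summable_geometric_two).mul_left _), tsum_mul_left, tsum_geometric_two]
    refine ENNReal.ofReal_le_ofReal (le_of_eq ?_)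
    field_simp
  simp only [mem_union, mem_iUnion, not_or, not_exists] at hω
  obtain ⟨hω1, hω2⟩ := hω
  have hmax : ∀ t ∈ Finset.Icc (1 : ℤ) n, X n t ω ^ 2 ≤ 40 * covBound w * Real.log n := by
    simpa [hB₂] using hω2
  refine ⟨hmax, fun β R V η hβ hR0 hV0 hη0 hR hV hη => ?_⟩
  have hlog : 0 ≤ Real.log n := Real.log_natCast_nonneg n
  rw [← hZ]
  exact h.abs_centredForm_le_of_largeAtoms hn0 hm hZ0.le (fun q => not_lt.1 (hω1 q)) (by positivity) hmax
    hβ hR0 hV0 hη0 hR hV hη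

end LinearRows

end stochastic

end LocStat

/-! ### Rates of convergence for entropy exponents at least one -/

namespace LocStat

section rates

lemma eventually_log_mul_rpow_le {c r s : ℝ} (hc : 0 < c) (hrs : r < s) (q : ℝ) :
    ∀ᶠ n : ℕ in atTop, Real.log n ^ q * (n : ℝ) ^ r ≤ c * (n : ℝ) ^ s := by
  have h1 := (isLittleO_log_rpow_rpow_atTop q (sub_pos.2 hrs)).bound hc
  have h2 := tendsto_natCast_atTop_atTop (R := ℝ) |>.eventually h1
  filter_upwards [h2, eventually_ge_atTop 1] with n hn hn1
  have hn0 : (0 : ℝ) < n := by exact_mod_cast hn1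
  have hle := (le_abs_self _).trans hn
  rw [Real.norm_of_nonneg (by positivity)] at hle
  calc Real.log n ^ q * (n : ℝ) ^ r ≤ c * (n : ℝ) ^ (s - r) * (n : ℝ) ^ r := by gcongr
    _ = c * (n : ℝ) ^ s := by rw [mul_assoc, ← Real.rpow_add hn0]; ring_nf

lemma globalRate_pos {γ : ℝ} {n : ℕ} (hn : 2 ≤ n) : 0 < globalRate γ n := by
  have hn0 : (0 : ℝ) < n := by exact_mod_cast (by omega : 0 < n)
  have hl : 0 < Real.log n := Real.log_pos (by exact_mod_cast (by omega : 1 < n))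
  unfold globalRate
  split_ifs <;> positivity

lemma globalRate_one (n : ℕ) : globalRate 1 n = (n : ℝ) ^ (-(1 / 4) : ℝ) := by
  rw [globalRate, if_neg (lt_irrefl _)]
  norm_num

lemma globalRate_one_sq {n : ℕ} : globalRate 1 n ^ 2 = 1 / Real.sqrt n := by
  rw [globalRate_one, ← Real.rpow_natCast, ← Real.rpow_mul (Nat.cast_nonneg n), Real.sqrt_eq_rpow,
    one_div ((n : ℝ) ^ _), ← Real.rpow_neg (Nat.cast_nonneg n)]
  norm_num

lemma globalRate_sq_of_lt_one {γ : ℝ} (h0 : 0 < γ) (hγ : γ < 1) (n : ℕ) :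
    globalRate γ n ^ 2 = (n : ℝ) ^ (-(1 / (γ + 1))) := by
  rw [globalRate, if_pos hγ, ← Real.rpow_natCast, ← Real.rpow_mul (Nat.cast_nonneg n)]
  congr 1
  push_cast
  field_simp

/-- For `γ > 1` the power of `n` in the squared rate is strictly larger than `-1/2`, which leaves
room for the missing factor `(log n)^{1/γ}`. -/
lemma log_div_sqrt_le_globalRate_sq {γ : ℝ} (h1 : 1 < γ) :
    ∀ᶠ n : ℕ in atTop, Real.log n / Real.sqrt n ≤ globalRate γ n ^ 2 := by
  have hγ : 0 < γ := by linarith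
  have hlt : -(1 / 2 : ℝ) < -((2 - γ) / (2 * γ)) := by
    rw [neg_lt_neg_iff, div_lt_div_iff₀ (by positivity) (by norm_num)]
    linarith
  filter_upwards [eventually_log_mul_rpow_le one_pos hlt (1 / γ), eventually_ge_atTop 2] with n hn hn2
  have hn0 : (0 : ℝ) < n := by exact_mod_cast (by omega : 0 < n)
  have hl : 0 < Real.log n := Real.log_pos (by exact_mod_cast (by omega : 1 < n))
  have e1 : globalRate γ n ^ 2 = (n : ℝ) ^ (-((2 - γ) / (2 * γ))) * Real.log n ^ (1 - 1 / γ) := by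
    rw [globalRate, if_neg (not_lt.2 h1.le), mul_pow, ← Real.rpow_natCast, ← Real.rpow_natCast,
      ← Real.rpow_mul hn0.le, ← Real.rpow_mul hl.le]
    congr 2 <;> · push_cast; field_simp; try ring
  have e2 : Real.log n = Real.log n ^ (1 / γ) * Real.log n ^ (1 - 1 / γ) := by
    rw [← Real.rpow_add hl, add_sub_cancel, Real.rpow_one]
  rw [e1, Real.sqrt_eq_rpow, div_eq_mul_inv, ← Real.rpow_neg hn0.le]
  nth_rewrite 1 [e2]
  rw [one_mul] at hn
  calc _ = Real.log n ^ (1 / γ) * (n : ℝ) ^ (-(1 / 2) : ℝ) * Real.log n ^ (1 - 1 / γ) := by ring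
    _ ≤ _ := by gcongr

lemma log_div_le_globalRate_sq {γ : ℝ} (hγ : 0 < γ) :
    ∀ᶠ n : ℕ in atTop, Real.log n / n ≤ globalRate γ n ^ 2 := by
  have key : ∀ {s : ℝ}, -1 < s → ∀ᶠ n : ℕ in atTop, Real.log n / n ≤ (n : ℝ) ^ s := by
    intro s hs
    filter_upwards [eventually_log_mul_rpow_le one_pos hs 1, eventually_ge_atTop 1] with n hn hn1
    rw [Real.rpow_one, one_mul, Real.rpow_neg_one] at hn
    rwa [div_eq_mul_inv]
  rcases lt_trichotomy γ 1 with h1 | rfl | h1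
  · have : -1 < -(1 / (γ + 1)) := by
      rw [neg_lt_neg_iff, div_lt_one (by linarith)]
      linarith
    simpa only [globalRate_sq_of_lt_one hγ h1] using key this
  · filter_upwards [key (s := -(1 / 2)) (by norm_num)] with n hn
    rwa [globalRate_one_sq, Real.sqrt_eq_rpow, one_div ((n : ℝ) ^ _), ← Real.rpow_neg (Nat.cast_nonneg n)]
  · filter_upwards [log_div_sqrt_le_globalRate_sq h1, eventually_ge_atTop 1] with n hn hn1
    refine le_trans ?_ hn
    have hn1' : (1 : ℝ) ≤ n := by exact_mod_cast hn1
    have hl : 0 ≤ Real.log n := Real.log_natCast_nonneg n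
    have : 0 < Real.sqrt n := Real.sqrt_pos.2 (by linarith)
    gcongr
    exact Real.sqrt_le_iff.2 ⟨by linarith, by nlinarith⟩

end rates

section empirical

variable {Ω : Type*} [MeasurableSpace Ω] {P : Measure Ω} {X : ℕ → ℤ → Ω → ℝ} {a : ℝ → ℤ → ℝ}
  {w : ℤ → ℝ} {K : ℝ} {α : ℕ → ℤ → ℤ → ℝ} {ψ : ℝ → ℝ → ℝ} {Φ : Set (ℝ → ℝ → ℝ)} {m M R V C : ℝ}
  {τ : ℕ → ℝ}

/-- With high probability, the centred empirical process indexed by `Φ`, localised at `ψ`, is of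
the order `ρ τ + τ ^ 2` uniformly over the class, and the observations are at most of the order
`√(log n)`. -/
def HasIncrementRate (P : Measure Ω) (X : ℕ → ℤ → Ω → ℝ) (C : ℝ) (Φ : Set (ℝ → ℝ → ℝ))
    (ψ : ℝ → ℝ → ℝ) (τ : ℕ → ℝ) : Prop :=
  ∀ ε : ℝ, 0 < ε → ∃ D, 0 < D ∧ ∀ᶠ n : ℕ in atTop, ∃ B : Set Ω, P B ≤ ENNReal.ofReal ε ∧ ∀ ω ∉ B,
    (∀ t ∈ Finset.Icc (1 : ℤ) n, X n t ω ^ 2 ≤ 40 * C * Real.log n) ∧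
    ∀ φ ∈ Φ, |centredForm P X n (symbolDiff φ ψ) ω| ≤ D * ((rho2 φ ψ).toReal * τ n + τ n ^ 2)

/-- If `x` were larger, then `t ≤ x` would make every term on the right a multiple of `x t`, and
dividing by `x` would give a contradiction. -/
lemma le_of_sq_le_mul_add {x t p q : ℝ} (ht : 0 ≤ t) (hp : 0 ≤ p) (hq : 0 ≤ q)
    (hx : x ^ 2 ≤ p * (x * t + t ^ 2) + q * t ^ 2) : x ≤ (2 * p + q + 1) * t := by
  by_contra! hlt
  have hxt : t ≤ x := by nlinarith [mul_nonneg (by linarith : 0 ≤ 2 * p + q) ht]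
  have hx0 : 0 < x := lt_of_le_of_lt (by positivity) hlt
  have h1 : t ^ 2 ≤ x * t := by nlinarith
  have h2 : x * ((2 * p + q + 1) * t) < x * x := mul_lt_mul_of_pos_left hlt hx0
  have h3 : 0 ≤ x * t := by positivity
  nlinarith [mul_le_mul_of_nonneg_left h1 hp, mul_le_mul_of_nonneg_left h1 hq]

/-- Convergence rate of a minimum contrast estimator from the modulus of continuity of the centred
empirical process. -/
lemma HasIncrementRate.deviation (hC : 0 ≤ C) (hτ : ∀ n, 2 ≤ n → 0 < τ n)
    (hinc : HasIncrementRate P X C Φ ψ τ)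
    (hlog : ∀ᶠ n : ℕ in atTop, Real.log n / n ≤ τ n ^ 2) (hm : 0 < m) (hV : 0 ≤ V) {B : ℝ} (hR : 0 ≤ B)
    {φhat : ℕ → Ω → ℝ → ℝ → ℝ}
    (hest : ∀ n : ℕ, 1 ≤ n → ∀ᵐ ω ∂P, φhat n ω ∈ Φ ∧
      ∀ b, 0 ≤ b → (∀ t ∈ Finset.Icc (1 : ℤ) n, X n t ω ^ 2 ≤ b) →
      (rho2 (φhat n ω) ψ).toReal ^ 2 ≤ 4 * M ^ 2 * |centredForm P X n (symbolDiff (φhat n ω) ψ) ω| +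
        8 * M ^ 2 * (V / (m * n) + V * b / n + B / n)) {ε : ℝ} (hε : 0 < ε) :
    ∃ D, 0 < D ∧ ∀ᶠ n : ℕ in atTop,
      P {ω | D * τ n < (rho2 (φhat n ω) ψ).toReal} ≤ ENNReal.ofReal ε := by
  obtain ⟨D, hD, hD'⟩ := hinc ε hε
  refine ⟨2 * (4 * M ^ 2 * D) + 8 * M ^ 2 * (V / m + V * (40 * C) + B) + 1, by positivity, ?_⟩
  filter_upwards [hD', hlog, eventually_ge_atTop 3] with n hn hl hn3
  obtain ⟨S, hS, hSω⟩ := hn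
  refine le_trans (measure_mono_ae ?_) hS
  filter_upwards [hest n (by omega)] with ω hω hlt
  by_contra hnot
  have hnot' : ω ∉ S := hnot
  obtain ⟨g1, g2⟩ := hSω ω hnot'
  obtain ⟨hφ, hb⟩ := hω
  have hn3' : (3 : ℝ) ≤ n := by exact_mod_cast hn3
  have hn0 : (0 : ℝ) < n := by linarith
  have hlog1 : 1 ≤ Real.log n := by
    rw [Real.le_log_iff_exp_le hn0]
    exact (Real.exp_one_lt_d9.le.trans (by norm_num)).trans hn3'
  have h1 : 1 / (n : ℝ) ≤ τ n ^ 2 := le_trans (by gcongr) hl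
  have h2 := hb (40 * C * Real.log n) (by positivity) g1
  refine absurd hlt (not_lt.2 (le_of_sq_le_mul_add (hτ n (by omega)).le (by positivity) (by positivity)
    (h2.trans (add_le_add ?_ ?_))))
  · rw [mul_assoc _ D]
    exact mul_le_mul_of_nonneg_left (g2 _ hφ) (by positivity)
  · rw [mul_assoc _ _ (τ n ^ 2)]
    refine mul_le_mul_of_nonneg_left ?_ (by positivity)
    calc V / (m * n) + V * (40 * C * Real.log n) / n + B / n
        = V / m * (1 / n) + V * (40 * C) * (Real.log n / n) + B * (1 / n) := by field_simp
      _ ≤ V / m * τ n ^ 2 + V * (40 * C) * τ n ^ 2 + B * τ n ^ 2 := by gcongr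
      _ = _ := by ring

lemma eventually_le_of_tendsto_zero {u : ℕ → ℝ} (hu : Tendsto u atTop (𝓝 0)) {ε : ℝ} (hε : 0 < ε) :
    ∀ᶠ n in atTop, u n ≤ ε :=
  (hu.eventually (gt_mem_nhds hε)).mono fun _ h => le_of_lt h

namespace LinearRows

variable (h : LinearRows P X a w K α)
include h

/-- Modulus of continuity when the entropy exponent exceeds one. -/
lemma hasIncrementRate_of_one_lt [IsProbabilityMeasure P]
    (hG : ∀ n : ℕ, IsGaussianProcess (fun (t : Icc (1 : ℤ) (n : ℤ)) (ω : Ω) => X n t ω) P)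
    (hm : 0 < m) (hR : 0 ≤ R) (hV : 0 ≤ V) (hΦ : ∀ φ ∈ Φ, InvDensity φ m M R V) (hψ : ψ ∈ Φ)
    {γ : ℝ} (hγ : 1 < γ) :
    HasIncrementRate P X (covBound w) Φ ψ (globalRate γ) := by
  intro ε hε
  have hC := one_le_covBound w
  set C := covBound w with hCdef
  refine ⟨32 * C * R + 6 * V * (64 * C + 384 * C) + 82 * C * V + 2133 * C + 1, by positivity, ?_⟩
  have ht : Tendsto (fun n : ℕ => (3 : ℝ) / n) atTop (𝓝 0) := tendsto_const_div_atTop_nhds_zero_nat 3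
  filter_upwards [eventually_le_of_tendsto_zero ht hε, log_div_sqrt_le_globalRate_sq hγ,
    eventually_ge_atTop 3] with n hn1 hl hn3
  have hn3' : (3 : ℝ) ≤ n := by exact_mod_cast hn3
  have hn0 : (0 : ℝ) < n := by linarith
  have hlog1 : 1 ≤ Real.log n := by
    rw [Real.le_log_iff_exp_le hn0]
    exact (Real.exp_one_lt_d9.le.trans (by norm_num)).trans hn3'
  -- With `T = n` and `m = 16 C log n` the coefficient of `ρ` is of order `√n · n⁻¹ = n^{-1/2}`, the
  -- symbol-norm terms are of order `log n / √n`, and the exceptional probability is `3/n`.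
  obtain ⟨B, hB, hBω⟩ := h.exists_uniform_bound (hG n) (n := n) (by omega) (T := n)
    (m := 16 * C * Real.log n) hn0 (by positivity)
  refine ⟨B, hB.trans (ENNReal.ofReal_le_ofReal (le_trans (le_of_eq (by ring)) hn1)), fun ω hω => ?_⟩
  obtain ⟨g1, g2⟩ := hBω ω hω
  refine ⟨g1, fun φ hφ => ?_⟩
  set ρ := (rho2 φ ψ).toReal with hρ
  have hρ0 : 0 ≤ ρ := ENNReal.toReal_nonneg
  have hb := g2 (symbolDiff φ ψ) (2 * R) (2 * V) (3 * ρ) ((hΦ φ hφ).measurable_symbolDiff hm (hΦ ψ hψ))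
    (by positivity) (by positivity) (by positivity) ((hΦ φ hφ).symSup_symbolDiff_le hm hR (hΦ ψ hψ))
    ((hΦ φ hφ).symVar_symbolDiff_le hm hV (hΦ ψ hψ)) ((hΦ φ hφ).symSq_symbolDiff_le hm (hΦ ψ hψ) le_rfl)
  rw [← hCdef] at hb
  set τ := globalRate γ n
  have hτ : 0 < τ := globalRate_pos (by omega)
  have hs : 0 < Real.sqrt n := Real.sqrt_pos.2 hn0
  have hs1 : 1 ≤ Real.sqrt n := Real.one_le_sqrt.2 (by linarith)
  have hss : Real.sqrt n * Real.sqrt n = n := Real.mul_self_sqrt hn0.le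
  have hinv : 1 / Real.sqrt n ≤ τ ^ 2 := le_trans (by gcongr) hl
  have hinv' : 1 / Real.sqrt n ≤ τ := by
    have : (1 / Real.sqrt n) ^ 2 ≤ 1 / Real.sqrt n := by
      rw [sq]; exact mul_le_of_le_one_left (by positivity) (by rw [div_le_one hs]; exact hs1)
    exact le_of_sq_le_sq (this.trans hinv) hτ.le
  have hexp : Real.sqrt n * Real.exp (-(16 * C * Real.log n / (16 * C))) = 1 / Real.sqrt n := by
    rw [mul_div_cancel_left₀ _ (by positivity), Real.exp_neg, Real.exp_log hn0]
    field_simp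
    linarith
  have hln : Real.log n / n ≤ τ ^ 2 := by
    refine le_trans ?_ hl
    gcongr
    nlinarith
  have hl0 : 0 ≤ Real.log n / Real.sqrt n := by positivity
  have h1n : 1 / (n : ℝ) ≤ τ ^ 2 := le_trans (by gcongr) hln
  refine hb.trans ?_
  calc _ = (32 * C * R + 6 * V * (64 * C)) * (Real.log n / Real.sqrt n) +
        6 * V * (384 * C) * (1 / Real.sqrt n) +
        711 * C * (ρ * (Real.sqrt n * Real.exp (-(16 * C * Real.log n / (16 * C))))) +
        80 * C * V * (Real.log n / n) + 2 * C * V * (1 / n) := by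
        field_simp; ring
    _ ≤ (32 * C * R + 6 * V * (64 * C)) * τ ^ 2 + 6 * V * (384 * C) * τ ^ 2 + 711 * C * (ρ * τ) +
        80 * C * V * τ ^ 2 + 2 * C * V * τ ^ 2 := by
        rw [hexp]; gcongr
    _ ≤ _ := by
        have k1 : 0 ≤ ρ * τ := by positivity
        have k2 : 0 ≤ τ ^ 2 := by positivity
        have k3 : 0 ≤ (32 * C * R + 6 * V * (64 * C + 384 * C) + 82 * C * V + 1422 * C + 1) * (ρ * τ) := by
          positivity
        have k4 : 0 ≤ (2133 * C + 1) * τ ^ 2 := by positivity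
        linarith

/-- Modulus of continuity when the entropy exponent is one. -/
lemma hasIncrementRate_one [IsProbabilityMeasure P]
    (hG : ∀ n : ℕ, IsGaussianProcess (fun (t : Icc (1 : ℤ) (n : ℤ)) (ω : Ω) => X n t ω) P)
    (hm : 0 < m) (hR : 0 < R) (hV : 0 ≤ V) (hΦ : ∀ φ ∈ Φ, InvDensity φ m M R V) (hψ : ψ ∈ Φ)
    {A : ℝ} (hA : 0 < A)
    (hent : ∀ η : ℝ, 0 < η → metricEntropy η Φ ≤ ((A * η ^ (-1 : ℝ) : ℝ) : EReal)) :
    HasIncrementRate P X (covBound w) Φ ψ (globalRate 1) := by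
  intro ε hε
  have hC := one_le_covBound w
  set C := covBound w with hCdef
  set q := Real.sqrt (A + 1) with hq
  set b := Real.sqrt (2 / ε) with hb
  have hq0 : 0 ≤ q := Real.sqrt_nonneg _
  have hb0 : 0 ≤ b := Real.sqrt_nonneg _
  refine ⟨48 * C * q + 16 * C * R * (A + 1) + 6 * V * (384 * C) + 711 * C * b + 82 * C * V + 1,
    by positivity, ?_⟩
  have ht : Tendsto (fun n : ℕ => (2 : ℝ) / n + 2 * Real.exp (-Real.sqrt n)) atTop (𝓝 0) := by
    have h1 : Tendsto (fun n : ℕ => (2 : ℝ) / n) atTop (𝓝 0) := tendsto_const_div_atTop_nhds_zero_nat 2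
    have h2 : Tendsto (fun n : ℕ => Real.exp (-Real.sqrt n)) atTop (𝓝 0) :=
      Real.tendsto_exp_neg_atTop_nhds_zero.comp
        (Real.tendsto_sqrt_atTop.comp tendsto_natCast_atTop_atTop)
    simpa using h1.add (h2.const_mul 2)
  filter_upwards [eventually_le_of_tendsto_zero ht (half_pos hε), log_div_le_globalRate_sq one_pos,
    eventually_ge_atTop 3] with n hn1 hl hn3
  have hn3' : (3 : ℝ) ≤ n := by exact_mod_cast hn3
  have hn0 : (0 : ℝ) < n := by linarith
  have hlog1 : 1 ≤ Real.log n := by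
    rw [Real.le_log_iff_exp_le hn0]
    exact (Real.exp_one_lt_d9.le.trans (by norm_num)).trans hn3'
  have hs : 0 < Real.sqrt n := Real.sqrt_pos.2 hn0
  have hs1 : 1 ≤ Real.sqrt n := Real.one_le_sqrt.2 (by linarith)
  have hss : Real.sqrt n * Real.sqrt n = n := Real.mul_self_sqrt hn0.le
  -- The dyadic bound is used only for differences of length at most `n^{-1/2}`. Then `m = 0` and a
  -- fixed `T` suffice, and no factor `log n` appears in the term of order `n^{-1/2}`.
  obtain ⟨B, hB, hBω⟩ := h.exists_uniform_bound (hG n) (n := n) (by omega) (T := 2 / ε)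
    (m := 0) (by positivity) le_rfl
  obtain ⟨N, cs, hN, hcΦ, hcov⟩ := exists_cover_of_metricEntropy_le (hent (1 / Real.sqrt n) (by positivity))
  have e0 : (1 / Real.sqrt n) ^ (-1 : ℝ) = Real.sqrt n := by rw [Real.rpow_neg_one]; simp
  rw [e0] at hN
  -- The net of mesh `n^{-1/2}` has entropy `A √n`. With `L = (A+1)√n` the Bernstein bound is of
  -- order `ρ n^{-1/4} + n^{-1/2}`, matching `ρ τ + τ²`.
  have hnet := h.measure_net_le (hG n) (n := n) (by omega) hm hR (hΦ ψ hψ) (fun i => hΦ _ (hcΦ i)) hN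
    (L := (A + 1) * Real.sqrt n) (by positivity)
  set B' := {ω | ∃ i, 8 * covBound w * (3 * (rho2 (cs i) ψ).toReal *
      Real.sqrt ((A + 1) * Real.sqrt n / n) + 2 * R * ((A + 1) * Real.sqrt n) / n) <
      |centredForm P X n (symbolDiff (cs i) ψ) ω|} with hB'
  refine ⟨B ∪ B', ?_, fun ω hω => ?_⟩
  · refine (measure_union_le _ _).trans ((add_le_add hB hnet).trans ?_)
    rw [← ENNReal.ofReal_add (by positivity) (by positivity)]
    refine ENNReal.ofReal_le_ofReal ?_
    have : A * Real.sqrt n - (A + 1) * Real.sqrt n = -Real.sqrt n := by ring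
    rw [this, one_div_div]
    linarith
  simp only [hB', mem_union, mem_ofPred_eq, not_or, not_exists, not_lt] at hω
  obtain ⟨g1, g2⟩ := hBω ω hω.1
  refine ⟨g1, fun φ hφ => ?_⟩
  obtain ⟨i, hi⟩ := hcov φ hφ
  have hη : (rho2 φ (cs i)).toReal ≤ 1 / Real.sqrt n :=
    ENNReal.toReal_le_of_le_ofReal (by positivity) hi.le
  have hη' : (rho2 (cs i) φ).toReal ≤ 1 / Real.sqrt n := by rwa [rho2_comm]
  have hφ' := hΦ φ hφ
  have hci := hΦ _ (hcΦ i)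
  have hψ' := hΦ ψ hψ
  have hu := g2 (symbolDiff φ (cs i)) (2 * R) (2 * V) (3 * (1 / Real.sqrt n))
    (hφ'.measurable_symbolDiff hm hci)
    (by positivity) (by positivity) (by positivity) (hφ'.symSup_symbolDiff_le hm hR.le hci)
    (hφ'.symVar_symbolDiff_le hm hV hci) (hφ'.symSq_symbolDiff_le hm hci hη)
  have hv := hω.2 i
  have hρi := hci.toReal_rho2_triangle hm hφ' hψ'
  rw [← hCdef] at hu hv
  set ρ := (rho2 φ ψ).toReal with hρ
  set ρ' := (rho2 (cs i) ψ).toReal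
  have hρ0 : 0 ≤ ρ := ENNReal.toReal_nonneg
  set τ := globalRate 1 n
  have hτ : 0 < τ := globalRate_pos (by omega)
  have hτ2 : τ ^ 2 = 1 / Real.sqrt n := globalRate_one_sq
  have hτ1 : τ ≤ 1 := by
    have : τ ^ 2 ≤ 1 ^ 2 := by rw [hτ2, one_pow, div_le_one hs]; exact hs1
    exact le_of_sq_le_sq this zero_le_one
  have h1n : 1 / (n : ℝ) ≤ τ ^ 2 := le_trans (by gcongr) hl
  have hdiv : Real.sqrt n / n = 1 / Real.sqrt n := Real.sqrt_div_self'
  have hL : Real.sqrt ((A + 1) * Real.sqrt n / n) = q * τ := by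
    rw [hq, ← Real.sqrt_sq hτ.le, ← Real.sqrt_mul (by positivity), hτ2]
    rw [mul_div_assoc, hdiv]
  have hL2 : 2 * R * ((A + 1) * Real.sqrt n) / n = 2 * R * (A + 1) * τ ^ 2 := by
    rw [hτ2, ← mul_assoc, mul_div_assoc, hdiv, mul_assoc]
  rw [hL, hL2] at hv
  rw [← hτ2] at hη'
  have hρ'2 : ρ' ≤ ρ + τ ^ 2 := by linarith
  have hu' : |centredForm P X n (symbolDiff φ (cs i)) ω| ≤
      (6 * V * (384 * C) + 711 * C * b + 82 * C * V) * τ ^ 2 := by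
    refine hu.trans ?_
    calc _ = 6 * V * (384 * C) * (1 / Real.sqrt n) + 711 * C * b * (1 / Real.sqrt n) +
          80 * C * V * (Real.log n / n) + 2 * C * V * (1 / n) := by
          rw [mul_zero, mul_zero, zero_div, neg_zero, Real.exp_zero, ← hb]; ring
      _ ≤ 6 * V * (384 * C) * τ ^ 2 + 711 * C * b * τ ^ 2 + 80 * C * V * τ ^ 2 + 2 * C * V * τ ^ 2 := by
          rw [← hτ2]; gcongr
      _ = _ := by ring
  have hv' : |centredForm P X n (symbolDiff (cs i) ψ) ω| ≤
      24 * C * q * (ρ * τ) + (24 * C * q + 16 * C * R * (A + 1)) * τ ^ 2 := by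
    refine hv.trans ?_
    have e1 : ρ' * (q * τ) ≤ q * (ρ * τ) + q * τ ^ 2 := by
      calc ρ' * (q * τ) ≤ (ρ + τ ^ 2) * (q * τ) := by gcongr
        _ = q * (ρ * τ) + q * (τ ^ 2 * τ) := by ring
        _ ≤ q * (ρ * τ) + q * (τ ^ 2 * 1) := by gcongr
        _ = _ := by ring
    have e2 := mul_le_mul_of_nonneg_left e1 (by positivity : 0 ≤ 24 * C)
    linarith
  rw [h.centredForm_symbolDiff_add (by omega) hm hφ' hci hψ']
  refine (abs_add_le _ _).trans ((add_le_add hu' hv').trans ?_)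
  have k1 : 0 ≤ (24 * C * q + 16 * C * R * (A + 1) + 6 * V * (384 * C) + 711 * C * b + 82 * C * V + 1) *
      (ρ * τ) := by positivity
  have k2 : 0 ≤ (24 * C * q + 1) * τ ^ 2 := by positivity
  linarith

end LinearRows

end empirical

end LocStat

/-! ### Chaining for entropy exponents below one -/

namespace LocStat

section empirical

variable {Ω : Type*} [MeasurableSpace Ω] {P : Measure Ω} {X : ℕ → ℤ → Ω → ℝ} {a : ℝ → ℤ → ℝ}
  {w : ℤ → ℝ} {K : ℝ} {α : ℕ → ℤ → ℤ → ℝ} {ψ : ℝ → ℝ → ℝ} {Φ : Set (ℝ → ℝ → ℝ)} {m M R V C : ℝ}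
  {n : ℕ}

lemma sum_pow_succ_le {θ : ℝ} (h0 : 0 ≤ θ) (h1 : θ < 1) (n : ℕ) :
    ∑ k ∈ Finset.range n, θ ^ (k + 1) ≤ 1 / (1 - θ) := by
  have hs := summable_geometric_of_lt_one h0 h1
  rw [one_div, ← tsum_geometric_of_lt_one h0 h1]
  refine le_trans (Finset.sum_le_sum fun k _ => ?_) (hs.sum_le_tsum _ fun _ _ => by positivity)
  exact pow_le_pow_of_le_one h0 h1.le (Nat.le_succ k)

lemma exp_neg_le_inv {x : ℝ} (hx : 0 < x) : Real.exp (-x) ≤ x⁻¹ := by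
  rw [Real.exp_neg]
  exact inv_anti₀ hx (by linarith [Real.add_one_le_exp x])

namespace LinearRows

variable (h : LinearRows P X a w K α)
include h

/-- Union bound over the links between two nets. -/
lemma measure_link_le [IsProbabilityMeasure P]
    (hG : IsGaussianProcess (fun (t : Icc (1 : ℤ) (n : ℤ)) (ω : Ω) => X n t ω) P)
    (hn : 0 < n) (hm : 0 < m) {N N' : ℕ} {c : Fin N → ℝ → ℝ → ℝ} {d : Fin N' → ℝ → ℝ → ℝ}
    (hc : ∀ i, InvDensity (c i) m M R V) (hd : ∀ j, InvDensity (d j) m M R V) {H L D : ℝ}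
    (hN : (N : ℝ) ≤ Real.exp H) (hN' : (N' : ℝ) ≤ Real.exp H) (hD : 0 < D) (hL : 1 ≤ L) :
    P {ω | ∃ i j, (rho2 (d j) (c i)).toReal ≤ D ∧ 16 * covBound w * (3 * D * L / Real.sqrt n) <
      |centredForm P X n (symbolDiff (d j) (c i)) ω|} ≤ ENNReal.ofReal (2 * Real.exp (2 * H - L)) := by
  have h1 : ∀ p : Fin N × Fin N', P {ω | (rho2 (d p.2) (c p.1)).toReal ≤ D ∧
      16 * covBound w * (3 * D * L / Real.sqrt n) <
      |centredForm P X n (symbolDiff (d p.2) (c p.1)) ω|} ≤ ENNReal.ofReal (2 * Real.exp (-L)) := by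
    intro p
    by_cases hp : (rho2 (d p.2) (c p.1)).toReal ≤ D
    · simp only [hp, true_and]
      exact h.centredForm_tail_sq hG hn ((hd p.2).measurable_symbolDiff hm (hc p.1))
        ((hd p.2).symSq_symbolDiff_le hm (hc p.1) hp) (by positivity) hL
    · simp [hp]
  rw [show {ω | ∃ i j, (rho2 (d j) (c i)).toReal ≤ D ∧ 16 * covBound w * (3 * D * L / Real.sqrt n) <
      |centredForm P X n (symbolDiff (d j) (c i)) ω|} = ⋃ p : Fin N × Fin N',
      {ω | (rho2 (d p.2) (c p.1)).toReal ≤ D ∧ 16 * covBound w * (3 * D * L / Real.sqrt n) <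
      |centredForm P X n (symbolDiff (d p.2) (c p.1)) ω|} by ext; simp]
  refine (measure_iUnion_fintype_le _ _).trans ((Finset.sum_le_sum fun i _ => h1 i).trans ?_)
  rw [Finset.sum_const, nsmul_eq_mul, Finset.card_univ, Fintype.card_prod, Fintype.card_fin,
    Fintype.card_fin, ← ENNReal.ofReal_natCast, ← ENNReal.ofReal_mul (by positivity)]
  refine ENNReal.ofReal_le_ofReal ?_
  rw [sub_eq_add_neg, Real.exp_add, two_mul H, Real.exp_add]
  push_cast
  calc (N : ℝ) * N' * (2 * Real.exp (-L)) ≤ Real.exp H * Real.exp H * (2 * Real.exp (-L)) := by gcongr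
    _ = _ := by ring

/-- Dyadic chaining below the scale `δ`, for a class with entropy exponent `γ < 1`. -/
lemma exists_chain [IsProbabilityMeasure P]
    (hG : IsGaussianProcess (fun (t : Icc (1 : ℤ) (n : ℤ)) (ω : Ω) => X n t ω) P)
    (hn : 0 < n) (hm : 0 < m) (hΦ : ∀ φ ∈ Φ, InvDensity φ m M R V) {γ A δ : ℝ} (hA : 0 < A)
    (hγ0 : 0 < γ) (hγ1 : γ < 1) (hδ : 0 < δ) (hδ1 : δ ≤ 1)
    (hent : ∀ η : ℝ, 0 < η → metricEntropy η Φ ≤ ((A * η ^ (-γ) : ℝ) : EReal)) :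
    ∃ (N : ℕ) (c : Fin N → ℝ → ℝ → ℝ) (B : Set Ω), (N : ℝ) ≤ Real.exp (A * δ ^ (-γ)) ∧
      (∀ i, c i ∈ Φ) ∧ P B ≤ ENNReal.ofReal (2 * δ ^ γ * (1 / (1 - (1 / 2) ^ γ))) ∧
      ∀ ω ∉ B, ∀ (k : ℕ), ∀ φ ∈ Φ, ∃ i, ∃ φ' ∈ Φ, (rho2 φ (c i)).toReal ≤ δ ∧
        (rho2 φ φ').toReal ≤ δ * (1 / 2) ^ k ∧ |centredForm P X n (symbolDiff φ' (c i)) ω| ≤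
          192 * covBound w * (2 * A + 1) * (δ ^ (1 - γ) / Real.sqrt n) *
            (1 / (1 - (1 / 2) ^ (1 - γ))) := by
  have hC := one_le_covBound w
  set η : ℕ → ℝ := fun k => δ * (1 / 2) ^ k with hη
  have hη0 : ∀ k, 0 < η k := fun k => by positivity
  have hη1 : ∀ k, η k ≤ 1 := fun k => by
    simp only [hη]
    exact mul_le_one₀ hδ1 (by positivity) (pow_le_one₀ (by norm_num) (by norm_num))
  have hηs : ∀ k, η k = 2 * η (k + 1) := fun k => by simp only [hη, pow_succ]; ring
  have hηpow : ∀ (k : ℕ) (s : ℝ), η k ^ s = δ ^ s * ((1 / 2) ^ s) ^ k := by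
    intro k s
    simp only [hη]
    rw [Real.mul_rpow hδ.le (by positivity), ← Real.rpow_natCast, ← Real.rpow_natCast,
      ← Real.rpow_mul (by norm_num), ← Real.rpow_mul (by norm_num), mul_comm s]
  choose N c hN hcΦ hcov using fun k => exists_cover_of_metricEntropy_le (hent (η k) (hη0 k))
  -- A link joins two nets, so the logarithm of the number of links is at most `2A η_{k+1}^{-γ}`;
  -- the excess `η_{k+1}^{-γ}` remains. By `exp(-x) ≤ 1/x` the failure probabilities are bounded by
  -- a geometric series in `(1/2)^γ`.
  set L : ℕ → ℝ := fun k => (2 * A + 1) * η (k + 1) ^ (-γ) with hL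
  have hpow1 : ∀ k, 1 ≤ η k ^ (-γ) := fun k =>
    Real.one_le_rpow_of_pos_of_le_one_of_nonpos (hη0 k) (hη1 k) (by linarith)
  have hL1 : ∀ k, 1 ≤ L k := fun k => by
    simp only [hL]
    nlinarith [hpow1 (k + 1)]
  set θ : ℝ := (1 / 2) ^ (1 - γ) with hθ
  have hθ0 : 0 ≤ θ := by positivity
  have hθ1 : θ < 1 := Real.rpow_lt_one (by norm_num) (by norm_num) (by linarith)
  set θ' : ℝ := (1 / 2) ^ γ with hθ'
  have hθ'0 : 0 ≤ θ' := by positivity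
  have hθ'1 : θ' < 1 := Real.rpow_lt_one (by norm_num) (by norm_num) hγ0
  set B : ℕ → Set Ω := fun k => {ω | ∃ i j, (rho2 (c (k + 1) j) (c k i)).toReal ≤ 2 * η k ∧
    16 * covBound w * (3 * (2 * η k) * L k / Real.sqrt n) <
      |centredForm P X n (symbolDiff (c (k + 1) j) (c k i)) ω|} with hB
  have hBP : ∀ k, P (B k) ≤ ENNReal.ofReal (2 * δ ^ γ * θ' ^ k) := by
    intro k
    have hN1 : (N k : ℝ) ≤ Real.exp (A * η (k + 1) ^ (-γ)) := by
      refine (hN k).trans (Real.exp_le_exp.2 (mul_le_mul_of_nonneg_left ?_ hA.le))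
      exact Real.rpow_le_rpow_of_nonpos (hη0 _) (by rw [hηs k]; linarith [hη0 (k + 1)]) (by linarith)
    refine (h.measure_link_le hG hn hm (fun i => hΦ _ (hcΦ k i)) (fun j => hΦ _ (hcΦ (k + 1) j)) hN1
      (hN (k + 1)) (by linarith [hη0 k]) (hL1 k)).trans (ENNReal.ofReal_le_ofReal ?_)
    have e1 : 2 * (A * η (k + 1) ^ (-γ)) - L k = -(η (k + 1) ^ (-γ)) := by simp only [hL]; ring
    rw [e1, mul_assoc]
    refine mul_le_mul_of_nonneg_left ((exp_neg_le_inv (by linarith [hpow1 (k + 1)])).trans ?_)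
      (by norm_num)
    rw [← Real.rpow_neg (hη0 _).le, neg_neg, hηpow]
    gcongr δ ^ γ * ?_
    exact pow_le_pow_of_le_one hθ'0 hθ'1.le (Nat.le_succ k)
  refine ⟨N 0, c 0, ⋃ k, B k, ?_, hcΦ 0, ?_, fun ω hω k φ hφ => ?_⟩
  · have := hN 0
    simpa only [hη, pow_zero, mul_one] using this
  · refine (measure_iUnion_le _).trans ((ENNReal.tsum_le_tsum hBP).trans ?_)
    rw [← ENNReal.ofReal_tsum_of_nonneg (fun q => by positivity)
      ((summable_geometric_of_lt_one hθ'0 hθ'1).mul_left _), tsum_mul_left,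
      tsum_geometric_of_lt_one hθ'0 hθ'1, one_div]
  choose j hj using fun k => hcov k φ hφ
  have hj' : ∀ k, (rho2 φ (c k (j k))).toReal ≤ η k := fun k =>
    ENNReal.toReal_le_of_le_ofReal (hη0 k).le (hj k).le
  refine ⟨j 0, c k (j k), hcΦ k _, ?_, hj' k, ?_⟩
  · have := hj' 0
    simpa only [hη, pow_zero, mul_one] using this
  have hlink : ∀ k, |centredForm P X n (symbolDiff (c (k + 1) (j (k + 1))) (c k (j k))) ω| ≤
      192 * covBound w * (2 * A + 1) * (δ ^ (1 - γ) / Real.sqrt n) * θ ^ (k + 1) := by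
    intro k
    have hk : ω ∉ B k := fun hk => hω (mem_iUnion.2 ⟨k, hk⟩)
    simp only [hB, mem_ofPred_eq, not_exists, not_and, not_lt] at hk
    have hd : (rho2 (c (k + 1) (j (k + 1))) (c k (j k))).toReal ≤ 2 * η k := by
      have h1 := (hΦ _ (hcΦ (k + 1) (j (k + 1)))).toReal_rho2_triangle hm (hΦ φ hφ) (hΦ _ (hcΦ k (j k)))
      have h2 := hj' (k + 1)
      rw [rho2_comm] at h2
      have h3 := hj' k
      have h4 := hηs k
      linarith [hη0 (k + 1)]
    refine (hk _ _ hd).trans (le_of_eq ?_)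
    -- The size of a link is its length times its entropy. The ratio `θ = (1/2)^{1-γ}` is below one
    -- exactly because `γ < 1`.
    have e2 : η k * η (k + 1) ^ (-γ) = 2 * (δ ^ (1 - γ) * θ ^ (k + 1)) := by
      rw [← hηpow, hηs k, mul_assoc]
      congr 1
      rw [sub_eq_add_neg, Real.rpow_add (hη0 _), Real.rpow_one]
    calc _ = 96 * covBound w * (2 * A + 1) * (η k * η (k + 1) ^ (-γ)) / Real.sqrt n := by
          simp only [hL]; ring
      _ = _ := by rw [e2]; ring
  have hchain : ∀ k, |centredForm P X n (symbolDiff (c k (j k)) (c 0 (j 0))) ω| ≤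
      192 * covBound w * (2 * A + 1) * (δ ^ (1 - γ) / Real.sqrt n) *
        ∑ i ∈ Finset.range k, θ ^ (i + 1) := by
    intro k
    induction k with
    | zero =>
      have := h.centredForm_symbolDiff_add hn hm (hΦ _ (hcΦ 0 (j 0))) (hΦ _ (hcΦ 0 (j 0)))
        (hΦ _ (hcΦ 0 (j 0))) ω
      have h0 : centredForm P X n (symbolDiff (c 0 (j 0)) (c 0 (j 0))) ω = 0 := by linarith
      simp [h0]
    | succ k ih =>
      rw [h.centredForm_symbolDiff_add hn hm (hΦ _ (hcΦ _ _)) (hΦ _ (hcΦ k (j k))) (hΦ _ (hcΦ _ _)),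
        Finset.sum_range_succ, mul_add, add_comm]
      exact (abs_add_le _ _).trans (add_le_add ih (hlink k))
  refine (hchain k).trans (mul_le_mul_of_nonneg_left (sum_pow_succ_le hθ0 hθ1 k) (by positivity))

set_option maxHeartbeats 800000 in
/-- Modulus of continuity when the entropy exponent is less than one. -/
lemma hasIncrementRate_of_lt_one [IsProbabilityMeasure P]
    (hG : ∀ n : ℕ, IsGaussianProcess (fun (t : Icc (1 : ℤ) (n : ℤ)) (ω : Ω) => X n t ω) P)
    (hm : 0 < m) (hR : 0 < R) (hΦ : ∀ φ ∈ Φ, InvDensity φ m M R V) (hψ : ψ ∈ Φ)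
    {γ A : ℝ} (hγ0 : 0 < γ) (hγ1 : γ < 1) (hA : 0 < A)
    (hent : ∀ η : ℝ, 0 < η → metricEntropy η Φ ≤ ((A * η ^ (-γ) : ℝ) : EReal)) :
    HasIncrementRate P X (covBound w) Φ ψ (globalRate γ) := by
  intro ε hε
  have hC := one_le_covBound w
  set C := covBound w with hCdef
  set q := Real.sqrt (A + 1) with hq
  have hq0 : 0 ≤ q := Real.sqrt_nonneg _
  have hθ1 : ((1 : ℝ) / 2) ^ (1 - γ) < 1 := Real.rpow_lt_one (by norm_num) (by norm_num) (by linarith)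
  set b : ℝ := 1 / (1 - (1 / 2) ^ (1 - γ)) with hb
  have hb0 : 0 ≤ b := one_div_nonneg.2 (by linarith)
  have hθ1' : ((1 : ℝ) / 2) ^ γ < 1 := Real.rpow_lt_one (by norm_num) (by norm_num) hγ0
  set b' : ℝ := 1 / (1 - (1 / 2) ^ γ) with hb'
  have hb'0 : 0 ≤ b' := one_div_nonneg.2 (by linarith)
  refine ⟨48 * C * q + 16 * C * R * (A + 1) + 192 * C * (2 * A + 1) * b + 123 * C + 1,
    by positivity, ?_⟩
  have hτt : Tendsto (globalRate γ) atTop (𝓝 0) := by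
    have h1 := (tendsto_rpow_neg_atTop (show 0 < 1 / (2 * (γ + 1)) by positivity)).comp
      (tendsto_natCast_atTop_atTop (R := ℝ))
    refine h1.congr fun n => ?_
    rw [globalRate, if_pos hγ1]
    rfl
  have ht : Tendsto (fun n : ℕ => 2 * globalRate γ n ^ γ * b' + 2 * globalRate γ n ^ γ + 2 / (n : ℝ))
      atTop (𝓝 0) := by
    have h1 : Tendsto (fun n : ℕ => (2 : ℝ) / n) atTop (𝓝 0) := tendsto_const_div_atTop_nhds_zero_nat 2
    have h2 : Tendsto (fun n => globalRate γ n ^ γ) atTop (𝓝 0) := by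
      have := hτt.rpow_const (p := γ) (Or.inr hγ0.le)
      rwa [Real.zero_rpow hγ0.ne'] at this
    simpa using (((h2.const_mul 2).mul_const b').add (h2.const_mul 2)).add h1
  filter_upwards [eventually_le_of_tendsto_zero ht hε, log_div_le_globalRate_sq hγ0,
    eventually_ge_atTop 3] with n hn1 hl hn3
  have hn3' : (3 : ℝ) ≤ n := by exact_mod_cast hn3
  have hn0 : (0 : ℝ) < n := by linarith
  have hn0' : 0 < n := by omega
  have hlog1 : 1 ≤ Real.log n := by
    rw [Real.le_log_iff_exp_le hn0]
    exact (Real.exp_one_lt_d9.le.trans (by norm_num)).trans hn3'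
  have hτdef : globalRate γ n = (n : ℝ) ^ (-(1 / (2 * (γ + 1)))) := by rw [globalRate, if_pos hγ1]
  set τ := globalRate γ n with hτd
  have hτ : 0 < τ := globalRate_pos (by omega)
  have hτ1 : τ ≤ 1 := by
    rw [hτdef]
    refine Real.rpow_le_one_of_one_le_of_nonpos (by linarith) ?_
    rw [neg_nonpos]; positivity
  have hτn : τ ^ (2 * (γ + 1)) = 1 / n := by
    rw [hτdef, ← Real.rpow_mul hn0.le, neg_mul, one_div_mul_cancel (by positivity), Real.rpow_neg_one,
      one_div]
  have hτs : τ ^ (γ + 1) = 1 / Real.sqrt n := by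
    rw [hτdef, ← Real.rpow_mul hn0.le, Real.sqrt_eq_rpow, one_div ((n : ℝ) ^ _), ← Real.rpow_neg hn0.le]
    congr 1
    field_simp
  have h1n : 1 / (n : ℝ) ≤ τ ^ 2 := le_trans (by gcongr) hl
  -- The rate balances the chaining term with `τ²`. The Bernstein term on the net is then admissible
  -- too, since `τ^{-γ}/n = τ^{γ+2} ≤ τ²`.
  have hdev : τ ^ (1 - γ) / Real.sqrt n = τ ^ 2 := by
    rw [div_eq_mul_one_div, ← hτs, ← Real.rpow_add hτ, ← Real.rpow_natCast]
    congr 1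
    push_cast
    ring
  have hLn : τ ^ (-γ) / n ≤ τ ^ 2 := by
    rw [div_eq_mul_one_div, ← hτn, ← Real.rpow_add hτ, ← Real.rpow_natCast]
    refine Real.rpow_le_rpow_of_exponent_ge hτ hτ1 ?_
    push_cast
    linarith
  have hτγ : 0 < τ ^ (-γ) := by positivity
  obtain ⟨N, cs, B, hN, hcΦ, hBP, hBω⟩ := h.exists_chain (hG n) hn0' hm hΦ hA hγ0 hγ1 hτ hτ1 hent
  have hnet := h.measure_net_le (hG n) hn0' hm hR (hΦ ψ hψ) (fun i => hΦ _ (hcΦ i)) hN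
    (L := (A + 1) * τ ^ (-γ)) (by positivity)
  have hmax := h.measure_max_sq (hG n) (n := n) (by omega)
  set B' := {ω | ∃ i, 8 * covBound w * (3 * (rho2 (cs i) ψ).toReal *
      Real.sqrt ((A + 1) * τ ^ (-γ) / n) + 2 * R * ((A + 1) * τ ^ (-γ)) / n) <
      |centredForm P X n (symbolDiff (cs i) ψ) ω|} with hB'
  set B'' := {ω | ∃ t ∈ Finset.Icc (1 : ℤ) n, 40 * covBound w * Real.log n < X n t ω ^ 2} with hB''
  refine ⟨B ∪ B' ∪ B'', ?_, fun ω hω => ?_⟩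
  · refine (measure_union_le _ _).trans ((add_le_add ((measure_union_le _ _).trans
      (add_le_add hBP hnet)) hmax).trans ?_)
    rw [← ENNReal.ofReal_add (by positivity) (by positivity),
      ← ENNReal.ofReal_add (by positivity) (by positivity)]
    refine ENNReal.ofReal_le_ofReal (le_trans ?_ hn1)
    have e1 : A * τ ^ (-γ) - (A + 1) * τ ^ (-γ) = -τ ^ (-γ) := by ring
    have e2 : (τ ^ (-γ))⁻¹ = τ ^ γ := by rw [← Real.rpow_neg hτ.le, neg_neg]
    have e3 := exp_neg_le_inv hτγ
    rw [e2] at e3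
    rw [e1]
    linarith
  simp only [hB', hB'', mem_union, mem_ofPred_eq, not_or, not_exists, not_lt, not_and] at hω
  obtain ⟨⟨hωB, hωn⟩, g1⟩ := hω
  refine ⟨g1, fun φ hφ => ?_⟩
  -- After `3n` levels the remaining distance is at most `2^{-3n} ≤ n^{-3}`, small enough for the
  -- crude bound. The chain stops there, so no continuity of the form in `φ` is needed.
  obtain ⟨i, φ', hφ'Φ, hri, hrφ, hch⟩ := hBω ω hωB (3 * n) φ hφ
  have hv := hωn i
  have hφI := hΦ φ hφ
  have hφ'I := hΦ φ' hφ'Φ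
  have hci := hΦ _ (hcΦ i)
  have hψ' := hΦ ψ hψ
  have hρi := hci.toReal_rho2_triangle hm hφI hψ'
  rw [rho2_comm (cs i) φ] at hρi
  have hpow : τ * (1 / 2) ^ (3 * n) ≤ 1 / (n : ℝ) ^ 3 := by
    have e1 : ((1 : ℝ) / 2) ^ n ≤ 1 / n := by
      rw [div_pow, one_pow]
      gcongr
      exact_mod_cast (Nat.lt_two_pow_self (n := n)).le
    calc τ * (1 / 2) ^ (3 * n) ≤ 1 * ((1 / 2) ^ n) ^ 3 := by
          rw [mul_comm 3 n, pow_mul]; gcongr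
      _ ≤ 1 * (1 / n) ^ 3 := by gcongr
      _ = _ := by rw [div_pow, one_pow, one_mul]
  have hrem := h.abs_centredForm_symbolDiff_le hn0' hm hφI hφ'I (hrφ.trans hpow) g1
  rw [← hCdef] at hv hrem hch
  set ρ := (rho2 φ ψ).toReal with hρ
  set ρ' := (rho2 (cs i) ψ).toReal
  have hρ0 : 0 ≤ ρ := ENNReal.toReal_nonneg
  have hρ'2 : ρ' ≤ ρ + τ := by linarith
  have hrem' : |centredForm P X n (symbolDiff φ φ') ω| ≤ 123 * C * τ ^ 2 := by
    refine hrem.trans ?_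
    have e1 : Real.sqrt n ≤ n := Real.sqrt_le_iff.2 ⟨hn0.le, by nlinarith⟩
    have e2 : Real.log n ≤ n := (Real.log_le_sub_one_of_pos hn0).trans (by linarith)
    calc _ ≤ 3 * (1 / (n : ℝ) ^ 3) * n * (40 * C * n + C * n) := by
          gcongr
          nlinarith
      _ = 123 * C * (1 / n) := by field_simp; ring
      _ ≤ _ := by gcongr
  have hsq : Real.sqrt ((A + 1) * τ ^ (-γ) / n) ≤ q * τ := by
    rw [mul_div_assoc, Real.sqrt_mul (by positivity), ← hq]
    gcongr
    exact Real.sqrt_le_iff.2 ⟨hτ.le, hLn⟩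
  have hv' : |centredForm P X n (symbolDiff (cs i) ψ) ω| ≤
      24 * C * q * (ρ * τ) + (24 * C * q + 16 * C * R * (A + 1)) * τ ^ 2 := by
    refine hv.trans ?_
    calc _ ≤ 8 * C * (3 * (ρ + τ) * (q * τ) + 2 * R * (A + 1) * (τ ^ (-γ) / n)) := by
          rw [show 2 * R * ((A + 1) * τ ^ (-γ)) / n = 2 * R * (A + 1) * (τ ^ (-γ) / n) by ring]
          gcongr
      _ ≤ 8 * C * (3 * (ρ + τ) * (q * τ) + 2 * R * (A + 1) * τ ^ 2) := by gcongr
      _ = _ := by ring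
  rw [hdev] at hch
  rw [h.centredForm_symbolDiff_add hn0' hm hφI hφ'I hψ', h.centredForm_symbolDiff_add hn0' hm hφ'I hci hψ']
  refine (abs_add_le _ _).trans ((add_le_add hrem' ((abs_add_le _ _).trans (add_le_add hch hv'))).trans ?_)
  have k1 : 0 ≤ (24 * C * q + 16 * C * R * (A + 1) + 192 * C * (2 * A + 1) * b + 123 * C + 1) *
      (ρ * τ) := by positivity
  have k2 : 0 ≤ (24 * C * q + 1) * τ ^ 2 := by positivity
  linarith

end LinearRows

end empirical

end LocStat

/-! ### Basic inequalities for the estimators and conclusion -/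

namespace LocStat

section deterministic

variable {φ g : ℝ → ℝ → ℝ} {m M R V : ℝ}

/-- The Fourier coefficient at frequency zero is at least `2π m`, which forces the sign of the
constant. -/
lemma InvDensity.rhoInfty_bound_pos (hm : 0 < m) (hφ : InvDensity φ m M R V) : 0 < R := by
  by_contra! hR
  have h0 : rhoInfty φ = 0 := by
    have := hφ.rhoInfty_le
    rwa [ENNReal.ofReal_of_nonpos hR, nonpos_iff_eq_zero] at this
  rw [rhoInfty, ENNReal.tsum_eq_zero] at h0
  have h1 : ‖fourierCoef φ 0 0‖ₑ = 0 := by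
    refine le_antisymm ?_ bot_le
    rw [← h0 0]
    exact le_iSup₂ (f := fun u (_ : u ∈ Icc (0 : ℝ) 1) => ‖fourierCoef φ u 0‖ₑ) 0 ⟨le_rfl, zero_le_one⟩
  have hpi := Real.pi_pos
  have h2 : fourierCoef φ 0 0 = ((∫ x in (-Real.pi)..Real.pi, φ 0 x : ℝ) : ℂ) := by
    rw [fourierCoef, ← intervalIntegral.integral_ofReal]
    simp
  have hint : IntervalIntegrable (φ 0) volume (-Real.pi) Real.pi := by
    rw [intervalIntegrable_iff_integrableOn_Icc_of_le (by linarith)]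
    refine Integrable.of_bound (C := M) (hφ.measurable.comp measurable_prodMk_left).aestronglyMeasurable ?_
    filter_upwards [ae_restrict_mem measurableSet_Icc] with x hx
    exact (hφ.boundedOnRect hm).abs_le 0 ⟨le_rfl, zero_le_one⟩ x hx
  have h3 : ∫ _ in (-Real.pi)..Real.pi, m ≤ ∫ x in (-Real.pi)..Real.pi, φ 0 x :=
    intervalIntegral.integral_mono_on (by linarith) (by simp) hint
      fun x hx => hφ.lower 0 ⟨le_rfl, zero_le_one⟩ x hx
  rw [enorm_eq_zero, h2, Complex.ofReal_eq_zero] at h1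
  rw [h1, intervalIntegral.integral_const, smul_eq_mul] at h3
  have : 0 < (Real.pi - -Real.pi) * m := by
    have : 0 < Real.pi - -Real.pi := by linarith
    positivity
  linarith

lemma measurable_recip (hg : Measurable fun p : ℝ × ℝ => g p.1 p.2) :
    Measurable fun p : ℝ × ℝ => recip g p.1 p.2 := by
  unfold recip
  exact measurable_const.div hg

lemma rho2_self (φ : ℝ → ℝ → ℝ) : rho2 φ φ = 0 := by
  simp [rho2]

end deterministic

section empirical

variable {Ω : Type*} [MeasurableSpace Ω] {P : Measure Ω} {X : ℕ → ℤ → Ω → ℝ} {a : ℝ → ℤ → ℝ}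
  {w : ℤ → ℝ} {K : ℝ} {α : ℕ → ℤ → ℤ → ℝ} {n : ℕ} {m M R V : ℝ}

namespace LinearRows

variable (h : LinearRows P X a w K α)
include h

/-- If the spectral density agrees with an element of the class whose inverse is square integrable,
then this element minimises the contrast. -/
lemma contrast_le_of_specified {g g' ψ : ℝ → ℝ → ℝ} (hgm : Measurable fun p : ℝ × ℝ => g p.1 p.2)
    (hg : ∀ u ∈ Icc (0 : ℝ) 1, ∀ x ∈ Icc (-Real.pi) Real.pi, 0 < g u x)
    (hg' : ∀ u ∈ Icc (0 : ℝ) 1, ∀ x ∈ Icc (-Real.pi) Real.pi, 0 < g' u x)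
    (hf : ∀ᵐ p ∂rect, specDensity a p.1 p.2 = g p.1 p.2) (hψ : BoundedOnRect ψ M)
    (hρ : rho2 (recip g) ψ ≠ ⊤) : contrast (specDensity a) g ≤ contrast (specDensity a) g' := by
  have hdiff : MemLp (fun p : ℝ × ℝ => recip g p.1 p.2 - ψ p.1 p.2) 2 rect :=
    ⟨((measurable_recip hgm).sub hψ.measurable).aestronglyMeasurable, by
      rw [← rho2_eq_eLpNorm]; exact lt_top_iff_ne_top.2 hρ⟩
  have hrec : Integrable (fun p : ℝ × ℝ => recip g p.1 p.2) rect := by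
    have := (hdiff.integrable (by norm_num)).add hψ.integrable
    refine this.congr (ae_of_all _ fun p => ?_)
    simp
  have hlog : Integrable (fun p : ℝ × ℝ => Real.log (g p.1 p.2)) rect := by
    -- `log g ≤ g - 1` is bounded above because `g` agrees with the bounded spectral density, and
    -- `-log g ≤ 1/g - 1` is bounded by the integrable function `1/g`.
    refine Integrable.mono' (hrec.add (integrable_const ((∑' j, w j) ^ 2)))
      hgm.log.aestronglyMeasurable ?_
    filter_upwards [hf, ae_rect_mem] with p hp hpm
    have h0 := hg _ (Ioc_subset_Icc_self hpm.1) _ (Ioc_subset_Icc_self hpm.2)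
    have h1 := h.specDensity_le hpm.1 p.2
    rw [hp] at h1
    have h2 : 0 < recip g p.1 p.2 := one_div_pos.2 h0
    have h3 := Real.log_le_sub_one_of_pos h0
    have h4 := Real.log_le_sub_one_of_pos h2
    have h5 : Real.log (recip g p.1 p.2) = -Real.log (g p.1 p.2) := by rw [recip, one_div, Real.log_inv]
    rw [h5] at h4
    have h6 : (0 : ℝ) ≤ (∑' j, w j) ^ 2 := sq_nonneg _
    rw [Real.norm_eq_abs, abs_le, Pi.add_apply]
    constructor <;> linarith
  have heq : (fun p : ℝ × ℝ => Real.log (g p.1 p.2) + 1) =ᵐ[rect]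
      fun p => Real.log (g p.1 p.2) + specDensity a p.1 p.2 / g p.1 p.2 := by
    filter_upwards [hf, ae_rect_mem] with p hp hpm
    have h0 := hg _ (Ioc_subset_Icc_self hpm.1) _ (Ioc_subset_Icc_self hpm.2)
    simp only [hp, div_self h0.ne']
  have hint := (hlog.add (integrable_const (1 : ℝ))).congr heq
  unfold contrast
  rw [if_pos hint]
  split_ifs with hint'
  · rw [EReal.coe_le_coe_iff]
    refine mul_le_mul_of_nonneg_left (integral_mono_ae hint hint' ?_) (by positivity)
    filter_upwards [hf, ae_rect_mem] with p hp hpm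
    have h0 := hg _ (Ioc_subset_Icc_self hpm.1) _ (Ioc_subset_Icc_self hpm.2)
    have h1 := hg' _ (Ioc_subset_Icc_self hpm.1) _ (Ioc_subset_Icc_self hpm.2)
    have h2 := Real.log_le_sub_one_of_pos (div_pos h0 h1)
    rw [Real.log_div h0.ne' h1.ne'] at h2
    rw [hp, div_self h0.ne']
    linarith
  · exact le_top

/-- The basic inequality for minimum contrast estimators in a correctly specified model. -/
lemma sq_rho2_le_of_estimator_specified (hm : 0 < m) (hm1 : m ≤ 1) (hM1 : 1 ≤ M) (hR : 0 ≤ R) (hV : 0 ≤ V)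
    (hn : 0 < n) {G : Set (ℝ → ℝ → ℝ)} (hG : ∀ g ∈ G, InvDensity (recip g) m M R V) {g₀ f₀ : ℝ → ℝ → ℝ}
    (hg₀ : g₀ ∈ G) (hf₀m : Measurable fun p : ℝ × ℝ => f₀ p.1 p.2)
    (hf₀ : ∀ u ∈ Icc (0 : ℝ) 1, ∀ x ∈ Icc (-Real.pi) Real.pi, 0 < f₀ u x)
    (hf : ∀ᵐ p ∂rect, specDensity a p.1 p.2 = f₀ p.1 p.2) {e : ℝ} (he : 0 ≤ e)
    (hρ : rho2 (recip f₀) (recip g₀) ≤ ENNReal.ofReal e) {fhat : Ω → ℝ → ℝ → ℝ}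
    (hest : ∀ᵐ ω ∂P, fhat ω ∈ G ∧ ∀ g ∈ G, empContrast X n (fhat ω) ω ≤ empContrast X n g ω) :
    ∀ᵐ ω ∂P, recip (fhat ω) ∈ recipClass G ∧
      ∀ b, 0 ≤ b → (∀ t ∈ Finset.Icc (1 : ℤ) n, X n t ω ^ 2 ≤ b) →
      (rho2 (recip (fhat ω)) (recip g₀)).toReal ^ 2 ≤
        4 * M ^ 2 * |centredForm P X n (symbolDiff (recip (fhat ω)) (recip g₀)) ω| +
        8 * M ^ 2 * (V / (m * n) + V * b / n + biasConst w K * R / n) +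
        6 * covBound w * (M / m) ^ 2 * e ^ 2 := by
  filter_upwards [hest] with ω hω
  refine ⟨⟨_, hω.1, rfl⟩, fun b hb0 hb => ?_⟩
  have h1 := h.invContrast_sub_le hm (hG _ hω.1) (hG _ hg₀) hn hR hV hb hb0 (hω.2 _ hg₀)
  have h2 := h.sq_rho2_le_of_specified hm hm1 hM1 (hG _ hω.1) (hG _ hg₀) (measurable_recip hf₀m)
    (by
      filter_upwards [ae_rect_mem] with p hp
      exact one_div_pos.2 (hf₀ _ (Ioc_subset_Icc_self hp.1) _ (Ioc_subset_Icc_self hp.2)))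
    (by
      filter_upwards [hf] with p hp
      rw [hp, recip, one_div_one_div]) he hρ
  have h3 := mul_le_mul_of_nonneg_left h1 (by positivity : 0 ≤ 4 * M ^ 2)
  unfold symbolDiff
  linarith

/-- The basic inequality for minimum contrast estimators over a convex class of inverse densities. -/
lemma sq_rho2_le_of_estimator_convex (hm : 0 < m) (hR : 0 ≤ R) (hV : 0 ≤ V)
    (hn : 0 < n) {G : Set (ℝ → ℝ → ℝ)} (hG : ∀ g ∈ G, InvDensity (recip g) m M R V) {g₀ : ℝ → ℝ → ℝ}
    (hconv : Convex ℝ (recipClass G)) (hg₀ : IsContrastMin (specDensity a) G g₀) {fhat : Ω → ℝ → ℝ → ℝ}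
    (hest : ∀ᵐ ω ∂P, fhat ω ∈ G ∧ ∀ g ∈ G, empContrast X n (fhat ω) ω ≤ empContrast X n g ω) :
    ∀ᵐ ω ∂P, recip (fhat ω) ∈ recipClass G ∧
      ∀ b, 0 ≤ b → (∀ t ∈ Finset.Icc (1 : ℤ) n, X n t ω ^ 2 ≤ b) →
      (rho2 (recip (fhat ω)) (recip g₀)).toReal ^ 2 ≤
        4 * M ^ 2 * |centredForm P X n (symbolDiff (recip (fhat ω)) (recip g₀)) ω| +
        8 * M ^ 2 * (V / (m * n) + V * b / n + biasConst w K * R / n) := by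
  filter_upwards [hest] with ω hω
  refine ⟨⟨_, hω.1, rfl⟩, fun b hb0 hb => ?_⟩
  have h1 := h.invContrast_sub_le hm (hG _ hω.1) (hG _ hg₀.1) hn hR hV hb hb0 (hω.2 _ hg₀.1)
  obtain ⟨g', hg', hmid⟩ := hconv ⟨_, hω.1, rfl⟩ ⟨_, hg₀.1, rfl⟩
    (by norm_num : (0 : ℝ) ≤ 1 / 2) (by norm_num : (0 : ℝ) ≤ 1 / 2) (by norm_num)
  have hmin := hg₀.2 g' hg'
  rw [h.contrast_eq hm (hG _ hg₀.1), h.contrast_eq hm (hG _ hg'), EReal.coe_le_coe_iff] at hmin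
  have hmin' := le_of_mul_le_mul_left hmin (by have := Real.pi_pos; positivity)
  have h2 := h.sq_rho2_le_of_midpoint hm (hG _ hω.1) (hG _ hg₀.1) (by rw [hmid]; exact hG _ hg')
    (by rw [hmid]; exact hmin')
  have h3 := mul_le_mul_of_nonneg_left h1 (by positivity : 0 ≤ 4 * M ^ 2)
  unfold symbolDiff
  linarith

end LinearRows

namespace ModelAssumption

variable {Fn : ℕ → Set (ℝ → ℝ → ℝ)} {F : Set (ℝ → ℝ → ℝ)} {fhat : ℕ → Ω → ℝ → ℝ → ℝ} {fF : ℝ → ℝ → ℝ}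
  {Mlo Mhi rInf vT vS : ℕ → ℝ}

/-- The constant for `v_Σ` carries no sign condition and `ENNReal.ofReal` truncates it at zero,
hence the maximum with `0`. -/
lemma invDensity {f : ℝ → ℝ → ℝ} (hF : ModelAssumption P X f Fn F fhat fF Mlo Mhi rInf vT vS)
    (hn : 1 ≤ n) {g : ℝ → ℝ → ℝ} (hg : g ∈ Fn n) :
    InvDensity (recip g) (Mlo n) (Mhi n) (rInf n) (max (vS n) 0) := by
  have hmem : recip g ∈ recipClass (Fn n) := ⟨g, hg, rfl⟩
  obtain ⟨hgm, hpos⟩ := hF.candidate_sieve n hn g hg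
  have habs : ∀ u ∈ Icc (0 : ℝ) 1, ∀ x ∈ Icc (-Real.pi) Real.pi, |recip g u x| = recip g u x :=
    fun u hu x hx => abs_of_pos (one_div_pos.2 (hpos u hu x hx))
  refine ⟨measurable_recip hgm, fun u hu x hx => ?_, fun u hu x hx => ?_, hF.bound_rhoInfty n hn _ hmem,
    (hF.bound_vSigma n hn _ hmem).trans (ENNReal.ofReal_le_ofReal (le_max_left _ _))⟩
  · rw [← habs u hu x hx]
    exact (hF.bounds n hn _ hmem u hu x hx).1
  · rw [← habs u hu x hx]
    exact (hF.bounds n hn _ hmem u hu x hx).2.le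

lemma invDensity_of_mem_recipClass {f : ℝ → ℝ → ℝ}
    (hF : ModelAssumption P X f Fn F fhat fF Mlo Mhi rInf vT vS)
    (hn : 1 ≤ n) {φ : ℝ → ℝ → ℝ} (hφ : φ ∈ recipClass (Fn n)) :
    InvDensity φ (Mlo n) (Mhi n) (rInf n) (max (vS n) 0) := by
  obtain ⟨g, hg, rfl⟩ := hφ
  exact hF.invDensity hn hg

/-- In a correctly specified model the target is the spectral density. -/
lemma specDensity_ae_eq (hF : ModelAssumption P X (specDensity a) Fn F fhat fF Mlo Mhi rInf vT vS)
    (h : LinearRows P X a w K α) (hf : BelongsTo (specDensity a) F) :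
    ∀ᵐ p ∂rect, specDensity a p.1 p.2 = fF p.1 p.2 := by
  obtain ⟨g, hg, hfg⟩ := hf
  obtain ⟨ψ, hψ, hlim⟩ := hF.approx (recip g) ⟨g, hg, rfl⟩
  -- One bounded sieve element at finite distance from `1/g` is enough: it makes `1/g` square
  -- integrable, so that `g` minimises the contrast and uniqueness applies.
  obtain ⟨n, hn1, hn⟩ := ((hlim.eventually (gt_mem_nhds zero_lt_one)).and (eventually_ge_atTop 1)).exists
  have hψb := (hF.invDensity_of_mem_recipClass hn (hψ n hn)).boundedOnRect (hF.const n hn).1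
  have hmin : IsContrastMin (specDensity a) F g := ⟨hg, fun g' hg' =>
    h.contrast_le_of_specified (hF.candidate g hg).1 (hF.candidate g hg).2 (hF.candidate g' hg').2 hfg
      hψb (ne_top_of_lt hn1)⟩
  filter_upwards [hfg, hF.target_unique g hmin] with p h1 h2
  rw [h1, h2]

/-- Common core of the two sieve statements. The hypothesis `happ` provides a reference element near
the target, within the approximation error plus `1/n`, together with the basic inequality around it.
-/
lemma sieve_isBigOP [IsProbabilityMeasure P]
    (hF : ModelAssumption P X (specDensity a) Fn F fhat fF Mlo Mhi rInf vT vS)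
    (h : LinearRows P X a w K α)
    (hG : ∀ n : ℕ, IsGaussianProcess (fun (t : Icc (1 : ℤ) (n : ℤ)) (ω : Ω) => X n t ω) P)
    {A : ℝ} {k : ℕ → ℝ} (hA : 0 < A) (hk : ∀ n, 1 ≤ n → 1 ≤ k n)
    (hent : ∀ n : ℕ, 1 ≤ n → ∀ η : ℝ, 0 < η → η ≤ 1 →
      metricEntropy η (recipClass (Fn n)) ≤ ((A * k n * Real.log (n / η) : ℝ) : EReal))
    {s : ℕ → ℝ≥0∞} (happ : ∀ n : ℕ, 1 ≤ n → s n ≠ ⊤ → ∃ g₀ ∈ Fn n, ∃ e : ℝ, 0 ≤ e ∧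
      e ≤ (s n).toReal + 1 / n ∧ rho2 (recip fF) (recip g₀) ≤ ENNReal.ofReal e ∧
      ∀ᵐ ω ∂P, recip (fhat n ω) ∈ recipClass (Fn n) ∧
      ∀ b, 0 ≤ b → (∀ t ∈ Finset.Icc (1 : ℤ) n, X n t ω ^ 2 ≤ b) →
      (rho2 (recip (fhat n ω)) (recip g₀)).toReal ^ 2 ≤
        4 * Mhi n ^ 2 * |centredForm P X n (symbolDiff (recip (fhat n ω)) (recip g₀)) ω| +
        8 * Mhi n ^ 2 * (max (vS n) 0 / (Mlo n * n) + max (vS n) 0 * b / n +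
          LinearRows.biasConst w K * rInf n / n) + 6 * covBound w * (Mhi n / Mlo n) ^ 2 * e ^ 2) :
    IsBigOP P (fun n ω => rho2 (recip (fhat n ω)) (recip fF)) (sieveRate Mlo Mhi rInf vS k s) := by
  have hC := one_le_covBound w
  obtain ⟨S, hS⟩ : ∃ S, S = sieveConst A (covBound w) (LinearRows.biasConst w K) := ⟨_, rfl⟩
  have hS0 : 0 ≤ S := by
    have := h.biasConst_nonneg
    rw [hS, sieveConst]
    positivity
  obtain ⟨D, hD⟩ : ∃ D, D = Real.sqrt S + 2 * (Real.sqrt (12 * covBound w) + 1) := ⟨_, rfl⟩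
  have hD0 : 0 < D := by rw [hD]; positivity
  intro ε hε
  refine ⟨D.toNNReal, ?_⟩
  change ∀ᶠ n in atTop, P {ω | ENNReal.ofReal D * _ < _} ≤ ε
  have ht : Tendsto (fun n : ℕ => ENNReal.ofReal (4 / n)) atTop (𝓝 0) := by
    have h1 : Tendsto (fun n : ℕ => (4 : ℝ) / n) atTop (𝓝 0) := tendsto_const_div_atTop_nhds_zero_nat 4
    simpa using ENNReal.tendsto_ofReal h1
  filter_upwards [ht.eventually (gt_mem_nhds hε), eventually_ge_atTop 3] with n hnε hn3
  refine le_trans ?_ hnε.le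
  have hn1 : 1 ≤ n := by omega
  have hn3' : (3 : ℝ) ≤ n := by exact_mod_cast hn3
  have hn0 : (0 : ℝ) < n := by linarith
  obtain ⟨hm, hm1, hM⟩ := hF.const n hn1
  have hMm : 1 ≤ Mhi n / Mlo n := by rw [le_div_iff₀ hm]; linarith
  -- If the approximation error is infinite, the rate is infinite and there is nothing to prove.
  by_cases hs : s n = ⊤
  · have : ENNReal.ofReal D * sieveRate Mlo Mhi rInf vS k s n = ⊤ := by
      rw [sieveRate, hs, max_eq_right le_top, ENNReal.mul_top (by simpa using by linarith),
        ENNReal.mul_top (by simpa using hD0)]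
    simp [this]
  obtain ⟨g₀, hg₀, e, he0, hes, hρe, hest⟩ := happ n hn1 hs
  have hlog1 : 1 ≤ Real.log n := by
    rw [Real.le_log_iff_exp_le hn0]
    exact (Real.exp_one_lt_d9.le.trans (by norm_num)).trans hn3'
  have hI₀ := hF.invDensity hn1 hg₀
  set c := max (rInf n) (max (vS n) (Mhi n ^ 2)) with hc
  have hMc : Mhi n ^ 2 ≤ c := (le_max_right _ _).trans (le_max_right _ _)
  have hc1 : 1 ≤ c := le_trans (by nlinarith) hMc
  have hVc : max (vS n) 0 ≤ c := max_le ((le_max_left _ _).trans (le_max_right _ _)) (by linarith)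
  have hkn := hk n hn1
  have hent' : metricEntropy (1 / (n : ℝ) ^ 2) (recipClass (Fn n)) ≤
      ((A * k n * (3 * Real.log n) : ℝ) : EReal) := by
    have := hent n hn1 (1 / (n : ℝ) ^ 2) (by positivity)
      (by rw [div_le_one (by positivity)]; nlinarith)
    rwa [div_div_eq_mul_div, div_one, ← pow_succ', Real.log_pow,
      show (((2 + 1 : ℕ) : ℝ)) = 3 by norm_num] at this
  have hdev := h.sieve_deviation (hG n) hn3 hm hm1 hM (hI₀.rhoInfty_bound_pos hm) (le_max_right (vS n) 0)
    (fun φ hφ => hF.invDensity_of_mem_recipClass hn1 hφ) ⟨g₀, hg₀, rfl⟩ hA hkn (le_max_left _ _) hVc hMc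
    hent' hest
  rw [← hS, ← hc] at hdev
  set q := c * k n * Real.log n / n with hq
  have hq0 : 0 ≤ q := by positivity
  set T := Mhi n / Mlo n with hT
  refine le_trans (measure_mono_ae ?_) hdev
  filter_upwards [hest] with ω hω hlt
  by_contra hnot
  have hnot' : ¬ (S * (T ^ 2 * q) + 2 * (6 * covBound w * T ^ 2 * e ^ 2) <
    (rho2 (recip (fhat n ω)) (recip g₀)).toReal ^ 2) := hnot
  rw [not_lt] at hnot'
  refine absurd hlt (not_lt.2 ?_)
  have hI := hF.invDensity_of_mem_recipClass hn1 hω.1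
  set r := (rho2 (recip (fhat n ω)) (recip g₀)).toReal with hr
  have hr0 : 0 ≤ r := ENNReal.toReal_nonneg
  have h1 : r ≤ T * (Real.sqrt S * Real.sqrt q + Real.sqrt (12 * covBound w) * e) := by
    refine le_of_sq_le_sq ?_ (by positivity)
    refine hnot'.trans ?_
    have e1 : (Real.sqrt S * Real.sqrt q + Real.sqrt (12 * covBound w) * e) ^ 2 =
        S * q + 12 * covBound w * e ^ 2 +
          2 * (Real.sqrt S * Real.sqrt q * (Real.sqrt (12 * covBound w) * e)) := by
      rw [add_sq, mul_pow, mul_pow, Real.sq_sqrt hS0, Real.sq_sqrt hq0, Real.sq_sqrt (by positivity)]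
      ring
    rw [mul_pow, e1]
    have : 0 ≤ T ^ 2 * (2 * (Real.sqrt S * Real.sqrt q * (Real.sqrt (12 * covBound w) * e))) := by
      positivity
    linarith
  set x := max (Real.sqrt q) (s n).toReal with hx
  have hqx : Real.sqrt q ≤ x := le_max_left _ _
  have hsx : (s n).toReal ≤ x := le_max_right _ _
  -- The slack `1/n` is below the stochastic part of the rate, so `e ≤ 2x`; this is the source of
  -- the factor `2` in `D`.
  have hinv : 1 / (n : ℝ) ≤ Real.sqrt q := by
    refine Real.le_sqrt_of_sq_le ?_
    have e1 : (1 / (n : ℝ)) ^ 2 ≤ 1 / n := by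
      rw [sq]; exact mul_le_of_le_one_left (by positivity) (by rw [div_le_one hn0]; linarith)
    refine e1.trans ?_
    rw [hq]
    gcongr
    have : 1 ≤ c * k n := by nlinarith
    nlinarith
  have hex : e ≤ 2 * x := by linarith
  have hx0 : 0 ≤ x := (Real.sqrt_nonneg _).trans hqx
  have htri : rho2 (recip (fhat n ω)) (recip fF) ≤ ENNReal.ofReal (r + e) := by
    refine (rho2_triangle hI.measurable hI₀.measurable
      (measurable_recip (hF.candidate _ hF.target.1).1)).trans ?_
    rw [ENNReal.ofReal_add hr0 he0, rho2_comm (recip g₀), hr, ENNReal.ofReal_toReal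
      (rho2_ne_top (hI.boundedOnRect hm) (hI₀.boundedOnRect hm))]
    gcongr
  refine htri.trans ?_
  have hrate : sieveRate Mlo Mhi rInf vS k s n = ENNReal.ofReal (T * x) := by
    rw [sieveRate, ← hc, ← hq, ← hT, ENNReal.ofReal_mul (by linarith), hx, ENNReal.ofReal_max,
      ENNReal.ofReal_toReal hs]
  rw [hrate, ← ENNReal.ofReal_mul hD0.le]
  refine ENNReal.ofReal_le_ofReal ?_
  calc r + e ≤ T * (Real.sqrt S * Real.sqrt q + Real.sqrt (12 * covBound w) * e) + T * e := by
        refine add_le_add h1 (le_mul_of_one_le_left he0 hMm)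
    _ ≤ T * (Real.sqrt S * x + Real.sqrt (12 * covBound w) * (2 * x)) + T * (2 * x) := by gcongr
    _ = _ := by rw [hD]; ring

lemma sieve_isBigOP_of_specified [IsProbabilityMeasure P]
    (hF : ModelAssumption P X (specDensity a) Fn F fhat fF Mlo Mhi rInf vT vS)
    (h : LinearRows P X a w K α)
    (hG : ∀ n : ℕ, IsGaussianProcess (fun (t : Icc (1 : ℤ) (n : ℤ)) (ω : Ω) => X n t ω) P)
    {A : ℝ} {k : ℕ → ℝ} (hA : 0 < A) (hk : ∀ n, 1 ≤ n → 1 ≤ k n)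
    (hent : ∀ n : ℕ, 1 ≤ n → ∀ η : ℝ, 0 < η → η ≤ 1 →
      metricEntropy η (recipClass (Fn n)) ≤ ((A * k n * Real.log (n / η) : ℝ) : EReal))
    (hf : BelongsTo (specDensity a) F) :
    IsBigOP P (fun n ω => rho2 (recip (fhat n ω)) (recip fF))
      (sieveRate Mlo Mhi rInf vS k fun n => ⨅ g ∈ Fn n, rho2 (recip fF) (recip g)) := by
  refine hF.sieve_isBigOP h hG hA hk hent fun n hn hs => ?_
  set s := ⨅ g ∈ Fn n, rho2 (recip fF) (recip g) with hsdef
  obtain ⟨hm, hm1, hM⟩ := hF.const n hn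
  have hn0 : (0 : ℝ) < 1 / n := by
    have : (0 : ℝ) < n := by exact_mod_cast hn
    positivity
  -- The infimum need not be attained, so an element within `1/n` of it serves as reference.
  have hlt : s < ENNReal.ofReal (s.toReal + 1 / n) := by
    rw [ENNReal.ofReal_add ENNReal.toReal_nonneg hn0.le, ENNReal.ofReal_toReal hs]
    exact ENNReal.lt_add_right hs (ENNReal.ofReal_pos.2 hn0).ne'
  obtain ⟨g₀, hg₀, hlt'⟩ := by simpa only [hsdef, iInf_lt_iff, exists_prop] using hlt
  refine ⟨g₀, hg₀, s.toReal + 1 / n, by positivity, le_rfl, hlt'.le, ?_⟩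
  have hI := hF.invDensity hn hg₀
  exact h.sq_rho2_le_of_estimator_specified hm hm1 hM (hI.rhoInfty_bound_pos hm).le (le_max_right _ _)
    hn (fun g hg => hF.invDensity hn hg) hg₀ (hF.candidate _ hF.target.1).1 (hF.candidate _ hF.target.1).2
    (hF.specDensity_ae_eq h hf) (by positivity) hlt'.le (hF.estimator n hn)

lemma sieve_isBigOP_of_convex [IsProbabilityMeasure P]
    (hF : ModelAssumption P X (specDensity a) Fn F fhat fF Mlo Mhi rInf vT vS)
    (h : LinearRows P X a w K α)
    (hG : ∀ n : ℕ, IsGaussianProcess (fun (t : Icc (1 : ℤ) (n : ℤ)) (ω : Ω) => X n t ω) P)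
    {A : ℝ} {k : ℕ → ℝ} (hA : 0 < A) (hk : ∀ n, 1 ≤ n → 1 ≤ k n)
    (hent : ∀ n : ℕ, 1 ≤ n → ∀ η : ℝ, 0 < η → η ≤ 1 →
      metricEntropy η (recipClass (Fn n)) ≤ ((A * k n * Real.log (n / η) : ℝ) : EReal))
    (hconv : ∀ n, 1 ≤ n → Convex ℝ (recipClass (Fn n))) {fFn : ℕ → ℝ → ℝ → ℝ}
    (hfFn : ∀ n, 1 ≤ n → IsContrastMin (specDensity a) (Fn n) (fFn n)) :
    IsBigOP P (fun n ω => rho2 (recip (fhat n ω)) (recip fF))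
      (sieveRate Mlo Mhi rInf vS k fun n => rho2 (recip fF) (recip (fFn n))) := by
  refine hF.sieve_isBigOP h hG hA hk hent fun n hn hs => ?_
  have hC := one_le_covBound w
  have hg₀ := (hfFn n hn).1
  obtain ⟨hm, hm1, hM⟩ := hF.const n hn
  have hI := hF.invDensity hn hg₀
  refine ⟨fFn n, hg₀, _, ENNReal.toReal_nonneg, le_add_of_nonneg_right (by positivity),
    ENNReal.le_ofReal_iff_toReal_le hs ENNReal.toReal_nonneg |>.2 le_rfl, ?_⟩
  filter_upwards [h.sq_rho2_le_of_estimator_convex hm (hI.rhoInfty_bound_pos hm).le (le_max_right (vS n) 0)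
    hn (fun g hg => hF.invDensity hn hg) (hconv n hn) (hfFn n hn) (hF.estimator n hn)] with ω hω
  exact ⟨hω.1, fun b hb0 hb => (hω.2 b hb0 hb).trans (le_add_of_nonneg_right (by positivity))⟩

lemma global_isBigOP [IsProbabilityMeasure P]
    (hF : ModelAssumption P X (specDensity a) Fn F fhat fF Mlo Mhi rInf vT vS)
    (h : LinearRows P X a w K α)
    (hG : ∀ n : ℕ, IsGaussianProcess (fun (t : Icc (1 : ℤ) (n : ℤ)) (ω : Ω) => X n t ω) P)
    (hFn : ∀ n, 1 ≤ n → Fn n = F) (hf : BelongsTo (specDensity a) F ∨ Convex ℝ (recipClass F))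
    {γ A : ℝ} (hγ : 0 < γ) (hA : 0 < A)
    (hent : ∀ η : ℝ, 0 < η → metricEntropy η (recipClass F) ≤ ((A * η ^ (-γ) : ℝ) : EReal)) :
    IsBigOP P (fun n ω => rho2 (recip (fhat n ω)) (recip fF))
      (fun n => ENNReal.ofReal (globalRate γ n)) := by
  have hC := one_le_covBound w
  obtain ⟨hm, hm1, hM⟩ := hF.const 1 le_rfl
  -- All sieves equal `F`, so the constants for `n = 1` hold for every `n`.
  have hΦ : ∀ g ∈ F, InvDensity (recip g) (Mlo 1) (Mhi 1) (rInf 1) (max (vS 1) 0) := fun g hg =>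
    hF.invDensity le_rfl (by rwa [hFn 1 le_rfl])
  have hΦ' : ∀ φ ∈ recipClass F, InvDensity φ (Mlo 1) (Mhi 1) (rInf 1) (max (vS 1) 0) := fun φ hφ =>
    hF.invDensity_of_mem_recipClass le_rfl (by rwa [hFn 1 le_rfl])
  have hψ : recip fF ∈ recipClass F := ⟨fF, hF.target.1, rfl⟩
  have hR := (hΦ' _ hψ).rhoInfty_bound_pos hm
  have hV := le_max_right (vS 1) 0
  have hmin : ∀ n : ℕ, 1 ≤ n → ∀ᵐ ω ∂P, fhat n ω ∈ F ∧
      ∀ g ∈ F, empContrast X n (fhat n ω) ω ≤ empContrast X n g ω := fun n hn => by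
    simpa only [hFn n hn] using hF.estimator n hn
  have hest : ∀ n : ℕ, 1 ≤ n → ∀ᵐ ω ∂P, recip (fhat n ω) ∈ recipClass F ∧
      ∀ b, 0 ≤ b → (∀ t ∈ Finset.Icc (1 : ℤ) n, X n t ω ^ 2 ≤ b) →
      (rho2 (recip (fhat n ω)) (recip fF)).toReal ^ 2 ≤
        4 * Mhi 1 ^ 2 * |centredForm P X n (symbolDiff (recip (fhat n ω)) (recip fF)) ω| +
        8 * Mhi 1 ^ 2 * (max (vS 1) 0 / (Mlo 1 * n) + max (vS 1) 0 * b / n +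
          LinearRows.biasConst w K * rInf 1 / n) := by
    intro n hn
    rcases hf with hf | hf
    -- The target itself lies in the class and is the reference element, so the approximation error
    -- is zero.
    · have := h.sq_rho2_le_of_estimator_specified hm hm1 hM hR.le hV hn hΦ hF.target.1
        (hF.candidate _ hF.target.1).1 (hF.candidate _ hF.target.1).2 (hF.specDensity_ae_eq h hf) le_rfl
        (by simp [rho2_self]) (hmin n hn)
      simpa using this
    · exact h.sq_rho2_le_of_estimator_convex hm hR.le hV hn hΦ hf hF.target (hmin n hn)
  have hinc : HasIncrementRate P X (covBound w) (recipClass F) (recip fF) (globalRate γ) := by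
    rcases lt_trichotomy γ 1 with h1 | rfl | h1
    · exact h.hasIncrementRate_of_lt_one hG hm hR hΦ' hψ hγ h1 hA hent
    · exact h.hasIncrementRate_one hG hm hR hV hΦ' hψ hA hent
    · exact h.hasIncrementRate_of_one_lt hG hm hR.le hV hΦ' hψ h1
  intro ε hε
  -- Capping at one makes the possibly infinite `ε` a positive real.
  have hε' : 0 < (min ε 1).toReal := ENNReal.toReal_pos (lt_min hε one_pos).ne' (by simp)
  obtain ⟨D, hD0, hD⟩ := hinc.deviation (by linarith) (fun n hn => globalRate_pos hn)
    (log_div_le_globalRate_sq hγ) hm hV (mul_nonneg h.biasConst_nonneg hR.le) hest hε'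
  refine ⟨D.toNNReal, ?_⟩
  change ∀ᶠ n in atTop, P {ω | ENNReal.ofReal D * _ < _} ≤ ε
  filter_upwards [hD, eventually_ge_atTop 1] with n hn hn1
  rw [ENNReal.ofReal_toReal (by simp)] at hn
  refine le_trans (measure_mono_ae ?_) (hn.trans (min_le_left _ _))
  filter_upwards [hest n hn1] with ω hω hlt
  have hlt' : ENNReal.ofReal D * ENNReal.ofReal (globalRate γ n) <
    rho2 (recip (fhat n ω)) (recip fF) := hlt
  rw [← ENNReal.ofReal_mul hD0.le] at hlt'
  have hfin := rho2_ne_top ((hΦ' _ hω.1).boundedOnRect hm) ((hΦ' _ hψ).boundedOnRect hm)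
  rw [← ENNReal.ofReal_toReal hfin] at hlt'
  exact (ENNReal.ofReal_lt_ofReal_iff'.1 hlt').1

end ModelAssumption

end empirical

end LocStat

theorem theorem2p6 {Ω : Type*} [MeasurableSpace Ω] (P : Measure Ω) [IsProbabilityMeasure P]
    (X : ℕ → ℤ → Ω → ℝ) (a : ℝ → ℤ → ℝ)
    (hX : LocStat.IsGaussianLocallyStationary P X a)
    (Fn : ℕ → Set (ℝ → ℝ → ℝ)) (F : Set (ℝ → ℝ → ℝ))
    (fhat : ℕ → Ω → ℝ → ℝ → ℝ) (fF : ℝ → ℝ → ℝ)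
    (Mlo Mhi rInf vT vS : ℕ → ℝ)
    (hF : LocStat.ModelAssumption P X (LocStat.specDensity a) Fn F fhat fF Mlo Mhi rInf vT vS) :
    -- sieve estimation
    (∀ (A : ℝ) (k : ℕ → ℝ), 0 < A → (∀ n, 1 ≤ n → 1 ≤ k n) →
      (∀ n : ℕ, 1 ≤ n → ∀ η : ℝ, 0 < η → η ≤ 1 →
        LocStat.metricEntropy η (LocStat.recipClass (Fn n)) ≤
          ((A * k n * Real.log (n / η) : ℝ) : EReal)) →
      -- correctly specified model
      (LocStat.BelongsTo (LocStat.specDensity a) F →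
        LocStat.IsBigOP P
          (fun n ω => LocStat.rho2 (LocStat.recip (fhat n ω)) (LocStat.recip fF))
          (LocStat.sieveRate Mlo Mhi rInf vS k
            (fun n => ⨅ g ∈ Fn n, LocStat.rho2 (LocStat.recip fF) (LocStat.recip g)))) ∧
      -- possibly misspecified model, convex sieves
      ((∀ n, 1 ≤ n → Convex ℝ (LocStat.recipClass (Fn n))) →
        ∀ fFn : ℕ → ℝ → ℝ → ℝ,
          (∀ n, 1 ≤ n → LocStat.IsContrastMin (LocStat.specDensity a) (Fn n) (fFn n)) →
          LocStat.IsBigOP P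
            (fun n ω => LocStat.rho2 (LocStat.recip (fhat n ω)) (LocStat.recip fF))
            (LocStat.sieveRate Mlo Mhi rInf vS k
              (fun n => LocStat.rho2 (LocStat.recip fF) (LocStat.recip (fFn n)))))) ∧
    -- global estimation
    ((∀ n, 1 ≤ n → Fn n = F) →
      (LocStat.BelongsTo (LocStat.specDensity a) F ∨ Convex ℝ (LocStat.recipClass F)) →
      ∀ γ A : ℝ, 0 < γ → γ < 2 → 0 < A →
        (∀ η : ℝ, 0 < η →
          LocStat.metricEntropy η (LocStat.recipClass F) ≤ ((A * η ^ (-γ) : ℝ) : EReal)) →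
        LocStat.IsBigOP P
          (fun n ω => LocStat.rho2 (LocStat.recip (fhat n ω)) (LocStat.recip fF))
          (fun n => ENNReal.ofReal (LocStat.globalRate γ n))) := by
  obtain ⟨w, K, α, h⟩ := hX.1.linearRows
  refine ⟨fun A k hA hk hent => ⟨fun hf => ?_, fun hconv fFn hfFn => ?_⟩,
    fun hFn hf γ A hγ _ hA hent => ?_⟩
  · exact hF.sieve_isBigOP_of_specified h hX.2 hA hk hent hf
  · exact hF.sieve_isBigOP_of_convex h hX.2 hA hk hent hconv hfFn
  · exact hF.global_isBigOP h hX.2 hFn hf hγ hA hent
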